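/- Let $p\ge5$ be a prime and $G_0=\mathrm{SL}_2(p)$. Let $x\in G_0$ have order $p$. An $\mathbb F_pG_0$-module is *minimally active* if $x$ acts on it with at most one nontrivial Jordan block. All modules are finite dimensional. Write $A/B$ (or $A/B/C$) for the type of a module whose successive radical layers, from top to socle, are $A,B$ (or $A,B,C$), and "unique" means up to isomorphism. Let $V_1=\mathbb F_p$ be the trivial module, $V_2$ the natural module, and $V_i=\mathrm{Sym}^{i-1}(V_2)$ for $3\le i\le p$. Then the indecomposable minimally active $\mathbb F_pG_0$-modules on which $G_0$ or $G_0/Z(G_0)$ acts faithfully are exactly the following. (a) The modules $V_i$ for $2\le i\le p$. Here $V_i$ ($1\le i\le p$) is simple of dimension $i$, and every simple $\mathbb F_pG_0$-module is isomorphic to some $V_i$ with $1\le i\le p$. (b) A unique $(p-1)$-dimensional indecomposable module $V_{j,i}$ of type $V_j/V_i$ for all $1\le i,j\le p-2$ with $i+j=p-1$. (c) A unique $p$-dimensional indecomposable module $V_{1,p-2,1}$ of type $V_1/V_{p-2}/V_1$; it is the projective cover of $V_1$. (d) A unique $(p+1)$-dimensional indecomposable module $V_{j,i}$ of type $V_j/V_i$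 for all $2\le i,j\le p-1$ with $i+j=p+1$. Let $V$ be any one of these modules, identify $G_0$ with its image in $\mathrm{GL}(V)$ (which is $\mathrm{SL}_2(p)$ or $\mathrm{PSL}_2(p)$), and let $\widehat G$ be any subgroup with $G_0\le\widehat G\le N_{\mathrm{GL}(V)}(G_0)$ such that $\widehat G/G_0$ is a subgroup of order prime to $p$ of maximal order in $N_{\mathrm{GL}(V)}(G_0)/G_0$. The composition factors of $V$ are either all even dimensional or all odd dimensional. If they are even dimensional, then $\mathrm{SL}_2(p)$ acts faithfully on $V$ and $\widehat G\cong\mathrm{GL}_2(p)$. If they are odd dimensional, then the kernel of the action of $\mathrm{SL}_2(p)$ is its center and $\widehat G\cong\mathrm{PGL}_2(p)\times C_{p-1}$. Moreover $\widehat G=N_{\mathrm{GL}(V)}(G_0)$, except when $V\cong V_{i,i}$ with $i=(p\pm1)/2$ or $V\cong V_{1,p-2,1}$, in which cases $\widehat G$ has index $p$ in $N_{\mathrm{GL}(V)}(G_0)$. Finally, let $V$ be of type $V_j/V_i$ with $i,j\ge2$ and $i+j=p+1$. Let $\mathbf U$ be a Sylow $p$-subgroup of $\widehat G$, and set $Z=C_V(\mathbf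 U)$, $Z_0=Z\cap[\mathbf U,V]$ and $\widehat G^\vee=\{g\in N_{\widehat G}(\mathbf U)\mid gz-z\in Z_0\ \forall z\in Z\}$. Then $\dim Z_0=1$. Let $\mu_V\colon\widehat G^\vee\to(\mathbb Z/p)^\times\times(\mathbb Z/p)^\times$ be the homomorphism with $\mu_V(g)=(r,s)$ when $gug^{-1}=u^r$ for all $u\in\mathbf U$ and $gz=sz$ for all $z\in Z_0$. Then $\mu_V(\widehat G^\vee)=\Delta_{i-1}=\{(r,r^{i-1})\mid r\in(\mathbb Z/p)^\times\}$. -/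

import Mathlib

open scoped MatrixGroups

universe u

noncomputable section

/-! ### General notions for modules over group algebras -/

/-- A module is indecomposable if it is nonzero and is not the direct sum of two nonzero
submodules. -/
def IsIndecomposableModule (A : Type*) [Ring A] (M : Type*) [AddCommGroup M] [Module A M] :
    Prop :=
  Nontrivial M ∧ ∀ N N' : Submodule A M, IsCompl N N' → N = ⊥ ∨ N' = ⊥

/-- A representation is minimally active (at the prime `p`) if every group element `x` of order `p`
acts with at most one nontrivial Jordan block: in a suitable basis, `x` fixes the first `a` basis
vectors and acts on the last `b` basis vectors by a single unipotent Jordan block of size `b`. -/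
def IsMinimallyActive (p : ℕ) {k G V : Type*} [Field k] [Group G] [AddCommGroup V] [Module k V]
    (ρ : Representation k G V) : Prop :=
  ∀ x : G, orderOf x = p → ∃ (a b : ℕ) (e : Module.Basis (Fin a ⊕ Fin b) k V),
    (∀ m : Fin a, ρ x (e (Sum.inl m)) = e (Sum.inl m)) ∧
    (∀ m : Fin b, m.val = 0 → ρ x (e (Sum.inr m)) = e (Sum.inr m)) ∧
    (∀ m m' : Fin b, m'.val = m.val + 1 →
      ρ x (e (Sum.inr m')) = e (Sum.inr m') + e (Sum.inr m))

/-- Every composition factor of the representation `ρ` has a dimension satisfying `P`.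
The simple subquotients of `ρ` are the `N' ⧸ N` with `N ⋖ N'` in the lattice of submodules. -/
def AllCompositionFactorDims {k G V : Type*} [Field k] [Group G] [AddCommGroup V] [Module k V]
    (ρ : Representation k G V) (P : ℕ → Prop) : Prop :=
  ∀ N N' : Submodule (MonoidAlgebra k G) ρ.asModule, N ⋖ N' →
    P (Module.finrank k (↥N' ⧸ N.submoduleOf N'))

/-! ### The modules `V_i = Sym^{i-1}(V_2)` of `SL_2(p)` -/

/-- The action of `SL_2(k)` on the polynomial ring `k[X₀, X₁]` (the symmetric algebra of the natural
module with basis `X₀, X₁`) by algebra endomorphisms, with `g • X_j = ∑ i, g i j • X_i`. -/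
def slPolyMap {k : Type*} [Field k] (g : SL(2, k)) :
    MvPolynomial (Fin 2) k →ₐ[k] MvPolynomial (Fin 2) k :=
  MvPolynomial.aeval fun j => ∑ i : Fin 2, MvPolynomial.C (g.1 i j) * MvPolynomial.X i

lemma slPolyMap_one {k : Type*} [Field k] : slPolyMap (1 : SL(2, k)) = AlgHom.id k _ := by
  apply MvPolynomial.algHom_ext
  intro j
  fin_cases j <;> simp [slPolyMap]

lemma slPolyMap_mul {k : Type*} [Field k] (g h : SL(2, k)) :
    slPolyMap (g * h) = (slPolyMap g).comp (slPolyMap h) := by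
  apply MvPolynomial.algHom_ext
  intro j
  simp [slPolyMap, Matrix.mul_apply]
  ring

lemma slPolyMap_mem {k : Type*} [Field k] (g : SL(2, k)) (n : ℕ) (f : MvPolynomial (Fin 2) k)
    (hf : f ∈ MvPolynomial.homogeneousSubmodule (Fin 2) k n) :
    slPolyMap g f ∈ MvPolynomial.homogeneousSubmodule (Fin 2) k n := by
  rw [MvPolynomial.mem_homogeneousSubmodule] at hf ⊢
  have := hf.aeval (fun j => ∑ i : Fin 2, MvPolynomial.C (g.1 i j) * MvPolynomial.X i) (n := 1)
    (fun j => MvPolynomial.IsHomogeneous.sum _ _ _ fun i _ => by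
      simpa using (MvPolynomial.isHomogeneous_C (Fin 2) (g.1 i j)).mul
        (MvPolynomial.isHomogeneous_X k i))
  simpa [slPolyMap] using this

/-- The `n`-th symmetric power of the natural module of `SL_2(k)`: homogeneous polynomials of
degree `n` in the natural basis. -/
def symPowRep (k : Type*) [Field k] (n : ℕ) :
    Representation k SL(2, k) (MvPolynomial.homogeneousSubmodule (Fin 2) k n) where
  toFun g := (slPolyMap g).toLinearMap.restrict (slPolyMap_mem g n)
  map_one' := by
    ext f : 2
    simp [slPolyMap_one]
  map_mul' g h := by
    apply LinearMap.ext
    intro f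
    apply Subtype.ext
    change slPolyMap (g * h) f.1 = slPolyMap g (slPolyMap h f.1)
    simp [slPolyMap_mul]

/-- The natural two-dimensional representation of `SL_2(k)`, on column vectors. -/
def naturalRep (k : Type*) [Field k] : Representation k SL(2, k) (Fin 2 → k) where
  toFun g := Matrix.mulVecLin g.1
  map_one' := by simp [Module.End.one_eq_id]
  map_mul' g h := by simp [Matrix.mulVecLin_mul, Module.End.mul_eq_comp]

/-- The group algebra `F_p[SL_2(p)]`. -/
abbrev GroupAlg (p : ℕ) [Fact p.Prime] : Type := MonoidAlgebra (ZMod p) SL(2, ZMod p)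

/-- The `F_p[SL_2(p)]`-module `V_i = Sym^{i-1}(V_2)`, for `i ≥ 1`. -/
abbrev VMod (p : ℕ) [Fact p.Prime] (i : ℕ) : Type := (symPowRep (ZMod p) (i - 1)).asModule

/-- `HasRadicalLayers p [i₁, …, i_r] M` says that `M` is of type `V_{i₁}/⋯/V_{i_r}`: its successive
radical layers, from the top to the bottom, are isomorphic to `V_{i₁}, …, V_{i_r}`. -/
def HasRadicalLayers (p : ℕ) [Fact p.Prime] : List ℕ →
    ∀ (M : Type u) [AddCommGroup M] [Module (GroupAlg p) M], Prop
  | [], M, _, _ => Subsingleton M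
  | i :: l, M, _, _ =>
      Nonempty ((M ⧸ Module.jacobson (GroupAlg p) M) ≃ₗ[GroupAlg p] VMod p i) ∧
        HasRadicalLayers p l (Module.jacobson (GroupAlg p) M)

/-- `ρ` is an indecomposable minimally active module for `SL_2(p)` on which `SL_2(p)` or
`SL_2(p)/Z(SL_2(p))` acts faithfully. -/
def IsMinActIndec (p : ℕ) [Fact p.Prime] {V : Type*} [AddCommGroup V] [Module (ZMod p) V]
    (ρ : Representation (ZMod p) SL(2, ZMod p) V) : Prop :=
  IsIndecomposableModule (GroupAlg p) ρ.asModule ∧ IsMinimallyActive p ρ ∧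
    (ρ.ker = ⊥ ∨ ρ.ker = Subgroup.center SL(2, ZMod p))

/-! ### The overgroup `Ĝ` -/

/-- For `G₀ ≤ Γ`, the subgroup `H` of `N_Γ(G₀)` contains `G₀`, and `H/G₀` is a `p'`-subgroup of
maximal order in `N_Γ(G₀)/G₀`. -/
def IsMaximalPrimeToExtension (p : ℕ) {Γ : Type*} [Group Γ] (G₀ H : Subgroup Γ) : Prop :=
  (G₀ ≤ H ∧ H ≤ Subgroup.normalizer (G₀ : Set Γ) ∧ ¬ p ∣ G₀.relIndex H) ∧
    ∀ K : Subgroup Γ, G₀ ≤ K → K ≤ Subgroup.normalizer (G₀ : Set Γ) → ¬ p ∣ G₀.relIndex K →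
      G₀.relIndex K ≤ G₀.relIndex H

/-- The representation on `V` of a subgroup `H` of `GL(V)`. -/
def tautRep {k V : Type*} [Field k] [AddCommGroup V] [Module k V]
    (H : Subgroup (LinearMap.GeneralLinearGroup k V)) : Representation k H V :=
  (Units.coeHom (V →ₗ[k] V)).comp H.subtype

/-! ### The group `G^∨` and the subgroups `Δ_i` -/

section Vee

variable {k G V : Type*} [Field k] [Group G] [AddCommGroup V] [Module k V]

/-- `Z = C_V(U)`. -/
def fixedSubmodule (σ : Representation k G V) (U : Subgroup G) : Submodule k V :=
  Representation.invariants (σ.comp U.subtype)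

/-- `Z₀ = C_V(U) ∩ [U, V]`, where `[U, V]` is spanned by the `u v - v` with `u ∈ U`, `v ∈ V`. -/
def zZero (σ : Representation k G V) (U : Subgroup G) : Submodule k V :=
  fixedSubmodule σ U ⊓ Representation.Coinvariants.ker (σ.comp U.subtype)

lemma zZero_stable (σ : Representation k G V) (U : Subgroup G) {a : G}
    (ha : a ∈ Subgroup.normalizer (U : Set G)) {z : V} (hz : z ∈ zZero σ U) :
    σ a z ∈ zZero σ U := by
  obtain ⟨h1, h2⟩ := hz
  refine ⟨?_, ?_⟩
  · rintro ⟨w, hw⟩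
    have hw' : a⁻¹ * w * a ∈ U := by
      have := (Subgroup.mem_normalizer_iff.1 (inv_mem ha) w).1 hw
      simpa using this
    have h3 := h1 ⟨_, hw'⟩
    simp only [MonoidHom.comp_apply, Subgroup.subtype_apply] at h3 ⊢
    conv_rhs => rw [← h3]
    rw [← Module.End.mul_apply, ← Module.End.mul_apply, ← map_mul, ← map_mul]
    congr 2
    group
  · have h4 : Representation.Coinvariants.ker (σ.comp U.subtype) ≤
        (Representation.Coinvariants.ker (σ.comp U.subtype)).comap (σ a) := by
      refine Submodule.span_le.2 ?_
      rintro _ ⟨⟨⟨w, hw⟩, v⟩, rfl⟩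
      have hw' : a * w * a⁻¹ ∈ U := (Subgroup.mem_normalizer_iff.1 ha w).1 hw
      refine Representation.Coinvariants.mem_ker_of_eq (ρ := σ.comp U.subtype) ⟨_, hw'⟩ (σ a v) _ ?_
      simp only [MonoidHom.comp_apply, Subgroup.subtype_apply, map_sub]
      rw [← Module.End.mul_apply, ← Module.End.mul_apply, ← map_mul, ← map_mul]
      congr 3
      group
    exact h4 h2

/-- `G^∨ = {α ∈ N_G(U) | [α, Z] ≤ Z₀}`. -/
def gVee (σ : Representation k G V) (U : Subgroup G) : Subgroup G where
  carrier := {a | a ∈ Subgroup.normalizer (U : Set G) ∧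
    ∀ z ∈ fixedSubmodule σ U, σ a z - z ∈ zZero σ U}
  one_mem' := ⟨one_mem _, fun z _ => by simp⟩
  mul_mem' {a b} ha hb := ⟨mul_mem ha.1 hb.1, fun z hz => by
    have h := add_mem (zZero_stable σ U ha.1 (hb.2 z hz)) (ha.2 z hz)
    rw [map_sub, sub_add_sub_cancel] at h
    simpa using h⟩
  inv_mem' {a} ha := ⟨inv_mem ha.1, fun z hz => by
    have h := neg_mem (zZero_stable σ U (inv_mem ha.1) (ha.2 z hz))
    simpa using h⟩

/-- `μ : G^∨ → Δ` is the map with `μ g = (r, s)` if and only if `g u g⁻¹ = u ^ r` for all `u ∈ U`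
and `g z = s z` for all `z ∈ Z₀`. -/
def IsMuMap {p : ℕ} [Fact p.Prime] {V : Type*} [AddCommGroup V] [Module (ZMod p) V]
    (σ : Representation (ZMod p) G V) (U : Subgroup G)
    (μ : gVee σ U →* (ZMod p)ˣ × (ZMod p)ˣ) : Prop :=
  ∀ (g : gVee σ U) (r s : (ZMod p)ˣ), μ g = (r, s) ↔
    (∀ w ∈ U, (g : G) * w * (g : G)⁻¹ = w ^ (r : ZMod p).val) ∧
    (∀ z ∈ zZero σ U, σ (g : G) z = (s : ZMod p) • z)

end Vee

/-- `Δ_i = {(r, r ^ i) | r ∈ (Z/p)ˣ}`. -/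
def DeltaSubgroup (p : ℕ) (i : ℤ) : Subgroup ((ZMod p)ˣ × (ZMod p)ˣ) :=
  ((MonoidHom.id (ZMod p)ˣ).prod (zpowGroupHom i)).range

end

universe v

set_option linter.unusedSectionVars false
set_option linter.unusedSimpArgs false

noncomputable section

attribute [-simp] ZMod.inv_coe_unit

variable {p : ℕ} [Fact p.Prime]

/-! ### Elements of `SL_2(p)` -/

/-! Let $U$ be the upper unitriangular group, $T$ the diagonal torus, and `nil` $=u-1$ for the
standard generator $u$ of $U$. A module $M$ is studied through `fixU` $=C_M(U)=\ker$ `nil` and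
through the weights, modulo $p-1$, by which $T$ acts. Minimal activity means that the kernel and
image of `nil` meet in dimension at most one (`SingleBlock`). An indecomposable $M$ falls under one
of two cases.

Suppose first that $C_M(U)$ lies in the image of `nil`. Then it is a line, $u$ is a single Jordan
block, $\dim M\le p$, and every submodule is the kernel of a power of `nil`, so the submodules form
a chain. Let $N$ be a submodule of dimension $d$ with next layer $\mathrm{Sym}^n$. A weight vector
$m$ lifting the highest weight vector of that layer satisfies: $\mathrm{nil}^d m$ spans $C_M(U)$.
Hence $n+2d$ is congruent to the weight of $C_M(U)$ (`exists_next_layer`). These congruences and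
$\dim M\le p$ leave only $V_i$, the types $V_j/V_i$ with $i+j=p-1$, and $V_1/V_{p-2}/V_1$
(`classification_of_fixU`).

Otherwise some fixed weight vector $v$ lies outside the image of `nil`, and a $U$-invariant weight
functional $\varphi$ has $\varphi(v)=1$. Frobenius reciprocity turns $v$ into a map from `homFun p
a`, the functions on row vectors homogeneous of degree $a$, to $M$, and $\varphi$ into a map back.
By the Bruhat decomposition the composite is $-1+\kappa A$, where $A$ has kernel $\det^a$
(`toFunMod_fromFun`). For $1\le a\le p-2$, $\kappa\ne0$ forces $2a=p-1$, and then $A^2=0$ because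
polynomials of low degree sum to zero over $\mathbb F_p^2$. So the composite is invertible and
$M\cong$ `homFun p a`; for trivial weight a trivial summand splits off
(`equiv_homFun_or_finrank_eq_one`). The operator with kernel $\det^{p-1-a}$ shows that `homFun p a`
is uniserial of type $V_{p-a}/V_{a+1}$ (`homFun_submodule_cases`). The same embedding into `homFun p
a` identifies the simple modules (`exists_equiv_symMod`).

Existence: type (d) is `homFun`; type (b) is the cokernel of
$X_0^p\partial_0+X_1^p\partial_1\colon\mathrm{Sym}^{m+1}\to\mathrm{Sym}^{p+m}$
(`hasRadicalLayers_frobQuot`); type (c) is a minimal summand of the group algebra containing the sum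
of all group elements (`exists_projectiveCover`). Uniqueness: in (d), a $U$-fixed vector outside the
radical gives a surjection from `homFun`; in (b), two Jordan blocks of equal size below $p$ and
equal weight are isomorphic over the Borel subgroup, and a relative trace makes the isomorphism
equivariant (`nonempty_equiv_of_fixU`); in (c), projectivity suffices.

For the overgroup, the endomorphism ring is $\mathbb F_p[\nu]$ with $\nu^2=0$, and $\nu\neq0$
exactly in the exceptional cases (`IsMinActIndec.exists_endomorphism`). Since every $M$ is
isomorphic to its twists by $\mathrm{diag}(t,1)$, the representation extends to $\mathrm{GL}_2(p)$.
The normalizer is the product of the image of $\mathrm{GL}_2(p)$, the scalars and the group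
$P=1+\mathbb F_p\nu$, and $\widehat G$ is a complement to $P$. Twisting by a power of the
determinant identifies this complement with $\mathrm{GL}_2(p)$ or $\mathrm{PGL}_2(p)\times C_{p-1}$,
according to the action of $-1$. Finally, $\mu_V$ is computed on `homFun`, where upper triangular
matrices act on the two composition factors of $C_V(U)$ by explicit scalars
(`exists_scalars_homFun`). -/

/-- The upper unitriangular matrix with entry `c`. -/
def upper (c : ZMod p) : SL(2, ZMod p) := ⟨!![1, c; 0, 1], by simp [Matrix.det_fin_two]⟩

/-- The lower unitriangular matrix with entry `c`. -/
def lower (c : ZMod p) : SL(2, ZMod p) := ⟨!![1, 0; c, 1], by simp [Matrix.det_fin_two]⟩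

/-- The diagonal matrix with entries `t`, `t⁻¹`. -/
def torus (t : (ZMod p)ˣ) : SL(2, ZMod p) :=
  ⟨!![(t : ZMod p), 0; 0, (t : ZMod p)⁻¹], by simp [Matrix.det_fin_two]⟩

/-- The antidiagonal matrix with entries `-t⁻¹`, `t`. -/
def antidiag (t : (ZMod p)ˣ) : SL(2, ZMod p) :=
  ⟨!![0, -(t : ZMod p)⁻¹; (t : ZMod p), 0], by simp [Matrix.det_fin_two]⟩

lemma upper_coe (c : ZMod p) : (upper c).1 = !![1, c; 0, 1] := rfl
lemma lower_coe (c : ZMod p) : (lower c).1 = !![1, 0; c, 1] := rfl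
lemma torus_coe (t : (ZMod p)ˣ) :
    (torus t).1 = !![(t : ZMod p), 0; 0, (t : ZMod p)⁻¹] := rfl
lemma antidiag_coe (t : (ZMod p)ˣ) :
    (antidiag t).1 = !![0, -(t : ZMod p)⁻¹; (t : ZMod p), 0] := rfl

lemma sl_ext {g h : SL(2, ZMod p)} (h00 : g.1 0 0 = h.1 0 0) (h01 : g.1 0 1 = h.1 0 1)
    (h10 : g.1 1 0 = h.1 1 0) (h11 : g.1 1 1 = h.1 1 1) : g = h := by
  apply Subtype.ext
  ext i j
  fin_cases i <;> fin_cases j <;> assumption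

lemma sl_mul_coe (g h : SL(2, ZMod p)) : (g * h).1 = g.1 * h.1 := rfl

lemma sl_det (g : SL(2, ZMod p)) : g.1 0 0 * g.1 1 1 - g.1 0 1 * g.1 1 0 = 1 := by
  rw [← Matrix.det_fin_two]; exact g.2

lemma upper_zero : upper (0 : ZMod p) = 1 := by
  apply sl_ext <;> simp [upper_coe]

lemma lower_zero : lower (0 : ZMod p) = 1 := by
  apply sl_ext <;> simp [lower_coe]

lemma upper_mul (c d : ZMod p) : upper c * upper d = upper (c + d) := by
  apply sl_ext <;> simp [upper_coe, Matrix.mul_apply, Fin.sum_univ_two, add_comm]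

lemma lower_mul (c d : ZMod p) : lower c * lower d = lower (c + d) := by
  apply sl_ext <;> simp [lower_coe, Matrix.mul_apply, Fin.sum_univ_two]

lemma upper_inv (c : ZMod p) : (upper c)⁻¹ = upper (-c) := by
  rw [inv_eq_iff_mul_eq_one, upper_mul, add_neg_cancel, upper_zero]

lemma lower_inv (c : ZMod p) : (lower c)⁻¹ = lower (-c) := by
  rw [inv_eq_iff_mul_eq_one, lower_mul, add_neg_cancel, lower_zero]

lemma torus_one : torus (1 : (ZMod p)ˣ) = 1 := by
  apply sl_ext <;> simp [torus_coe]

lemma torus_mul (s t : (ZMod p)ˣ) : torus s * torus t = torus (s * t) := by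
  apply sl_ext <;> simp [torus_coe, Matrix.mul_apply, Fin.sum_univ_two, mul_comm]

lemma torus_inv (t : (ZMod p)ˣ) : (torus t)⁻¹ = torus t⁻¹ := by
  rw [inv_eq_iff_mul_eq_one, torus_mul, mul_inv_cancel, torus_one]

lemma torus_mul_upper (t : (ZMod p)ˣ) (c : ZMod p) :
    torus t * upper c = upper ((t : ZMod p) ^ 2 * c) * torus t := by
  apply sl_ext <;> simp [torus_coe, upper_coe, Matrix.mul_apply, Fin.sum_univ_two]
  field_simp

lemma upper_pow (c : ZMod p) (n : ℕ) : upper c ^ n = upper ((n : ZMod p) * c) := by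
  induction n with
  | zero => simp [upper_zero]
  | succ n ih => rw [pow_succ, ih, upper_mul]; congr 1; push_cast; ring

lemma lower_pow (c : ZMod p) (n : ℕ) : lower c ^ n = lower ((n : ZMod p) * c) := by
  induction n with
  | zero => simp [lower_zero]
  | succ n ih => rw [pow_succ, ih, lower_mul]; congr 1; push_cast; ring

lemma upper_injective : Function.Injective (upper : ZMod p → SL(2, ZMod p)) := fun c d h => by
  simpa [upper_coe] using congrArg (fun g : SL(2, ZMod p) => g.1 0 1) h

lemma upper_ne_one {c : ZMod p} (hc : c ≠ 0) : upper c ≠ 1 := by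
  rw [← upper_zero]; exact fun h => hc (upper_injective h)

lemma orderOf_upper {c : ZMod p} (hc : c ≠ 0) : orderOf (upper c) = p :=
  orderOf_eq_prime (by simp [upper_pow, upper_zero]) (upper_ne_one hc)

/-- The elementary matrices generate `SL_2(p)`. -/
lemma sl_induction {P : SL(2, ZMod p) → Prop} (hu : ∀ c, P (upper c)) (hl : ∀ c, P (lower c))
    (hm : ∀ g h, P g → P h → P (g * h)) (g : SL(2, ZMod p)) : P g := by
  have key : ∀ g : SL(2, ZMod p), g.1 1 0 ≠ 0 → P g := by
    intro g hg
    -- The outer parameters are forced by the diagonal entries; the upper right entry then agrees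
    -- because the determinant is one.
    have h : g = upper ((g.1 0 0 - 1) / g.1 1 0) * lower (g.1 1 0) *
        upper ((g.1 1 1 - 1) / g.1 1 0) := by
      have := sl_det g
      apply sl_ext <;>
        simp [sl_mul_coe, upper_coe, lower_coe, Matrix.mul_apply, Fin.sum_univ_two] <;>
        field_simp <;> first | ring1 | linear_combination this | linear_combination (-1) * this
    rw [h]
    exact hm _ _ (hm _ _ (hu _) (hl _)) (hu _)
  by_cases hg : g.1 1 0 = 0
  · have hd := sl_det g
    have h0 : g.1 0 0 ≠ 0 := by
      intro h0; rw [h0, hg] at hd; simp at hd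
    -- Adding the first row to the second makes the lower left entry equal to the upper left one,
    -- which is nonzero here.
    have h : g = lower (-1) * (lower 1 * g) := by
      rw [← mul_assoc, lower_mul]; simp [lower_zero]
    rw [h]
    refine hm _ _ (hl _) (key _ ?_)
    simpa [sl_mul_coe, lower_coe, Matrix.mul_apply, Fin.sum_univ_two, hg] using h0
  · exact key g hg

/-- An element of order `p` is conjugate to an upper unitriangular matrix. -/
lemma exists_conj_upper {x : SL(2, ZMod p)} (hx : orderOf x = p) :
    ∃ (g : SL(2, ZMod p)) (c : ZMod p), c ≠ 0 ∧ x = g * upper c * g⁻¹ := by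
  have hxp : x.1 ^ p = 1 := by
    have := congrArg Subtype.val (hx ▸ pow_orderOf_eq_one x)
    simpa using this
  -- In characteristic $p$, $(x-1)^p=x^p-1$; so $x-1$ is nilpotent and has trace and determinant
  -- zero.
  have hnil : (x.1 - 1) ^ p = 0 := by
    rw [sub_pow_char_of_commute p (Commute.one_right _), hxp, one_pow, sub_self]
  have htr : (x.1 - 1).trace = 0 := by
    have := Matrix.isNilpotent_trace_of_isNilpotent (M := x.1 - 1) ⟨p, hnil⟩
    exact this.eq_zero
  have hdet : (x.1 - 1).det = 0 := by
    have : (x.1 - 1).det ^ p = 0 := by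
      rw [← Matrix.det_pow, hnil, Matrix.det_zero]
    exact pow_eq_zero_iff (Fact.out : p.Prime).ne_zero |>.1 this
  have hx1 : x ≠ 1 := by
    intro h; rw [h, orderOf_one] at hx; exact (Fact.out : p.Prime).one_lt.ne hx
  have hd := sl_det x
  simp [Matrix.trace_fin_two, Matrix.det_fin_two] at htr hdet
  have hD : x.1 1 1 = 2 - x.1 0 0 := by linear_combination htr
  by_cases hc : x.1 1 0 = 0
  · have ha : x.1 0 0 = 1 := by
      rw [hc, hD] at hdet
      have : (x.1 0 0 - 1) ^ 2 = 0 := by linear_combination - hdet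
      linear_combination pow_eq_zero_iff (two_ne_zero) |>.1 this
    have hxe : x = upper (x.1 0 1) := by
      apply sl_ext <;> simp [upper_coe, ha, hc, hD]; norm_num
    refine ⟨1, x.1 0 1, ?_, by simpa using hxe⟩
    intro h; rw [h, upper_zero] at hxe; exact hx1 hxe
  · set c := x.1 1 0 with hcdef
    set a := x.1 0 0 with hadef
    have hb : x.1 0 1 = - (a - 1) ^ 2 / c := by
      rw [eq_div_iff hc]; rw [hD] at hdet; linear_combination - hdet
    -- The first column spans the fixed line of $x$; the second completes it to determinant one.
    let g : SL(2, ZMod p) := ⟨!![(a - 1) / c, -1; 1, 0], by simp [Matrix.det_fin_two]⟩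
    have hg : g.1 = !![(a - 1) / c, -1; 1, 0] := rfl
    refine ⟨g, -c, neg_ne_zero.2 hc, ?_⟩
    rw [eq_mul_inv_iff_mul_eq]
    apply sl_ext <;>
      simp [sl_mul_coe, hg, upper_coe, Matrix.mul_apply, Fin.sum_univ_two, ← hcdef, ← hadef, hb,
        hD] <;> field_simp <;> ring

lemma mem_center_of_entries {g : SL(2, ZMod p)} (h01 : g.1 0 1 = 0) (h10 : g.1 1 0 = 0)
    (h : g.1 0 0 = g.1 1 1) : g ∈ Subgroup.center SL(2, ZMod p) := by
  rw [Matrix.SpecialLinearGroup.mem_center_iff]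
  have hd := sl_det g
  rw [h01, ← h] at hd
  refine ⟨g.1 0 0, ?_, ?_⟩
  · rw [Fintype.card_fin]; linear_combination hd
  · ext i j
    fin_cases i <;> fin_cases j <;> simp [h01, h10, h]

lemma mem_center_sl {g : SL(2, ZMod p)} : g ∈ Subgroup.center SL(2, ZMod p) ↔ g = 1 ∨ g = -1 := by
  constructor
  · rw [Matrix.SpecialLinearGroup.mem_center_iff]
    rintro ⟨r, hr, h⟩
    have hr2 : r = 1 ∨ r = -1 := by simpa using hr
    rcases hr2 with rfl | rfl
    · left; apply Subtype.ext; rw [← h]; simp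
    · right; apply Subtype.ext; rw [← h]; ext i j; fin_cases i <;> fin_cases j <;> simp
  · rintro (rfl | rfl)
    · exact one_mem _
    · refine mem_center_of_entries ?_ ?_ ?_ <;> simp

/-! ### Nilpotent endomorphisms with few Jordan blocks -/

section NilpotentEnd

variable {K V : Type*} [Field K] [AddCommGroup V] [Module K V] [FiniteDimensional K V]

lemma Module.End.pow_finrank_eq_zero {f : Module.End K V} (hf : IsNilpotent f) :
    f ^ Module.finrank K V = 0 := by
  obtain ⟨n, hn⟩ := hf
  have h1 : f ^ (n + Module.finrank K V) = 0 := by rw [pow_add, hn, zero_mul]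
  have h2 := Module.End.ker_pow_eq_ker_pow_finrank_of_le (f := f)
    (m := n + Module.finrank K V) (by omega)
  rw [h1, LinearMap.ker_zero] at h2
  exact LinearMap.ker_eq_top.1 h2.symm

/-- The map $f^n$ sends $\ker f^{n+1}$ into $\ker f$ with kernel inside $\ker f^n$, so each power
adds at most $\dim\ker f$. -/
lemma Module.End.finrank_ker_pow_le (f : Module.End K V) (n : ℕ) :
    Module.finrank K (LinearMap.ker (f ^ n)) ≤ n * Module.finrank K (LinearMap.ker f) := by
  induction n with
  | zero => simp [Module.End.one_eq_id, LinearMap.ker_id]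
  | succ n ih =>
    have h1 := LinearMap.finrank_range_add_finrank_ker
      ((f ^ n).domRestrict (LinearMap.ker (f ^ (n + 1))))
    have h2 : Module.finrank K
        (LinearMap.range ((f ^ n).domRestrict (LinearMap.ker (f ^ (n + 1))))) ≤
        Module.finrank K (LinearMap.ker f) := by
      refine Submodule.finrank_mono ?_
      rintro _ ⟨⟨x, hx⟩, rfl⟩
      rw [LinearMap.mem_ker, pow_succ'] at hx
      exact hx
    have h3 : Module.finrank K
        (LinearMap.ker ((f ^ n).domRestrict (LinearMap.ker (f ^ (n + 1))))) ≤
        Module.finrank K (LinearMap.ker (f ^ n)) := by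
      refine LinearMap.finrank_le_finrank_of_injective
        (f := LinearMap.codRestrict (LinearMap.ker (f ^ n))
          ((LinearMap.ker (f ^ (n + 1))).subtype ∘ₗ Submodule.subtype _) fun x => x.2) ?_
      intro x y hxy
      have := congrArg Subtype.val hxy
      exact Subtype.ext (Subtype.ext this)
    rw [add_mul, one_mul]
    omega

lemma Module.End.finrank_le_of_pow_eq_zero {f : Module.End K V} {n : ℕ} (hf : f ^ n = 0) :
    Module.finrank K V ≤ n * Module.finrank K (LinearMap.ker f) := by
  have := Module.End.finrank_ker_pow_le f n
  rwa [hf, LinearMap.ker_zero, finrank_top] at this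

/-- The invariant subspaces of a single Jordan block. -/
lemma Module.End.eq_ker_pow_finrank {f : Module.End K V} (hf : IsNilpotent f)
    (h1 : Module.finrank K (LinearMap.ker f) ≤ 1) (N : Submodule K V) (hN : ∀ x ∈ N, f x ∈ N) :
    N = LinearMap.ker (f ^ Module.finrank K N) := by
  -- A nilpotent map on $N$ is killed by its $(\dim N)$-th power, which gives one inclusion; the
  -- kernel of that power has dimension at most $\dim N$.
  apply Submodule.eq_of_le_of_finrank_le
  · intro x hx
    have hnil : IsNilpotent (f.restrict hN) := by
      obtain ⟨n, hn⟩ := hf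
      refine ⟨n, ?_⟩
      ext ⟨y, hy⟩
      rw [Module.End.pow_restrict n hN (fun x hx => by simp [hn])]
      simp [hn]
    have h2 := Module.End.pow_finrank_eq_zero hnil
    have h3 : ∀ n (y : N), (((f.restrict hN) ^ n) y : V) = (f ^ n) y := by
      intro n
      induction n with
      | zero => simp
      | succ n ih => intro y; rw [pow_succ, Module.End.mul_apply, ih, pow_succ]; simp
    rw [LinearMap.mem_ker, ← h3 _ ⟨x, hx⟩, h2]
    simp
  · refine (Module.End.finrank_ker_pow_le f _).trans ?_
    exact (Nat.mul_le_mul_left _ h1).trans (by simp)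

lemma Module.End.le_finrank_of_pow_apply_ne_zero {f : Module.End K V} (hf : IsNilpotent f) {d : ℕ}
    {q : V} (hq : (f ^ d) q ≠ 0) : d + 1 ≤ Module.finrank K V := by
  by_contra h
  apply hq
  have h2 := Module.End.pow_finrank_eq_zero hf
  rw [← Nat.sub_add_cancel (show Module.finrank K V ≤ d by omega), pow_add, h2]
  simp

/-- A nilpotent endomorphism of nilpotency index `dim V` is a single Jordan block. -/
lemma Module.End.finrank_ker_le_one {f : Module.End K V} (hf : IsNilpotent f) {d : ℕ}
    (hd : Module.finrank K V ≤ d + 1) {q : V} (hq : (f ^ d) q ≠ 0) :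
    Module.finrank K (LinearMap.ker f) ≤ 1 := by
  -- The kernels of successive powers grow strictly until they fill the space, and $f^d\ne0$
  -- guarantees $d$ strict steps after $\ker f$.
  have key : ∀ i ≤ d, i + Module.finrank K (LinearMap.ker f) ≤
      Module.finrank K (LinearMap.ker (f ^ (i + 1))) := by
    intro i
    induction i with
    | zero => intro _; rw [zero_add, zero_add, pow_one]
    | succ i ih =>
      intro hi
      have hle : LinearMap.ker (f ^ (i + 1)) ≤ LinearMap.ker (f ^ (i + 1 + 1)) := by
        rw [pow_succ' f (i + 1)]; exact LinearMap.ker_le_ker_comp _ _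
      have hlt : LinearMap.ker (f ^ (i + 1)) < LinearMap.ker (f ^ (i + 1 + 1)) := by
        refine lt_of_le_of_ne hle fun h => hq ?_
        obtain ⟨n, hn⟩ := hf
        have h2 := Module.End.ker_pow_constant h n
        rw [pow_add f _ n, hn, mul_zero, LinearMap.ker_zero] at h2
        have h3 : f ^ (i + 1) = 0 := LinearMap.ker_eq_top.1 h2
        rw [← Nat.sub_add_cancel (show i + 1 ≤ d by omega), pow_add, h3]
        simp
      have := Submodule.finrank_lt_finrank_of_lt hlt
      have := ih (by omega)
      omega
  have h1 := key d le_rfl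
  have h2 := Submodule.finrank_le (LinearMap.ker (f ^ (d + 1)))
  omega

/-- Jordan basis of a nilpotent endomorphism with at most one nontrivial Jordan block. -/
lemma Module.End.exists_jordan_basis {f : Module.End K V} (hf : IsNilpotent f)
    (h1 : Module.finrank K (LinearMap.ker f ⊓ LinearMap.range f : Submodule K V) ≤ 1) :
    ∃ (a b : ℕ) (e : Module.Basis (Fin a ⊕ Fin b) K V),
      (∀ m : Fin a, f (e (Sum.inl m)) = 0) ∧
      (∀ m : Fin b, m.val = 0 → f (e (Sum.inr m)) = 0) ∧
      (∀ m m' : Fin b, m'.val = m.val + 1 → f (e (Sum.inr m')) = e (Sum.inr m)) := by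
  classical
  by_cases hf0 : f = 0
  · refine ⟨Module.finrank K V, 0,
      (Module.finBasis K V).reindex (Equiv.sumEmpty _ _).symm, ?_, ?_, ?_⟩ <;> simp [hf0]
  -- The nilpotency index is $r+2$, which will be the size of the nontrivial block; the Jordan
  -- string is generated by a vector not killed by $f^{r+1}$.
  obtain ⟨r, hr0, hr⟩ : ∃ r, f ^ (r + 1) ≠ 0 ∧ f ^ (r + 2) = 0 := by
    have hex : ∃ n, f ^ n = 0 := hf
    have h0 : Nat.find hex ≠ 0 := by
      intro h
      have := Nat.find_spec hex
      rw [h, pow_zero] at this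
      apply hf0
      rw [← mul_one f, this, mul_zero]
    have h1 : Nat.find hex ≠ 1 := by
      intro h
      have := Nat.find_spec hex
      rw [h, pow_one] at this
      exact hf0 this
    refine ⟨Nat.find hex - 2, ?_, ?_⟩
    · exact Nat.find_min hex (by omega)
    · have := Nat.find_spec hex
      rwa [show Nat.find hex - 2 + 2 = Nat.find hex by omega]
  obtain ⟨v, hv⟩ : ∃ v, (f ^ (r + 1)) v ≠ 0 := by
    by_contra h; push Not at h; exact hr0 (LinearMap.ext h)
  have hpow : ∀ n x, f ((f ^ n) x) = (f ^ (n + 1)) x := fun n x => by rw [pow_succ']; rfl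
  have hz : (f ^ (r + 1)) v ∈ LinearMap.ker f ⊓ LinearMap.range f :=
    ⟨LinearMap.mem_ker.2 (by rw [hpow, hr]; rfl), ⟨(f ^ r) v, hpow r v⟩⟩
  have hspan : ∀ x ∈ LinearMap.ker f ⊓ LinearMap.range f, ∃ c : K, c • (f ^ (r + 1)) v = x := by
    intro x hx
    have h2 : Module.finrank K (LinearMap.ker f ⊓ LinearMap.range f : Submodule K V) = 1 := by
      refine le_antisymm h1 ?_
      rw [Nat.one_le_iff_ne_zero, Ne, Submodule.finrank_eq_zero]
      intro h
      rw [h] at hz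
      exact hv (by simpa using hz)
    obtain ⟨c, hc⟩ := (finrank_eq_one_iff_of_nonzero' (⟨_, hz⟩ :
      (LinearMap.ker f ⊓ LinearMap.range f : Submodule K V)) (by simpa using hv)).1 h2 ⟨x, hx⟩
    exact ⟨c, congrArg Subtype.val hc⟩
  -- a complement of `ker f ⊓ range f` in `ker f`
  obtain ⟨A, hA⟩ := Submodule.exists_isCompl ((LinearMap.ker f ⊓ LinearMap.range f).submoduleOf
    (LinearMap.ker f))
  set b := Module.finBasis K A
  let w : Fin (Module.finrank K A) ⊕ Fin (r + 2) → V :=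
    Sum.elim (fun i => ((b i : LinearMap.ker f) : V)) (fun m => (f ^ (r + 1 - m.val)) v)
  set Y := Submodule.span K (Set.range w) with hY
  have hYv : ∀ i, i ≤ r + 1 → (f ^ i) v ∈ Y := by
    intro i hi
    refine Submodule.subset_span ⟨Sum.inr ⟨r + 1 - i, by omega⟩, ?_⟩
    simp only [w, Sum.elim_inr]
    congr 2; omega
  have hYA : ∀ x ∈ A, (x : V) ∈ Y := by
    intro x hx
    have hx' := b.sum_repr ⟨x, hx⟩
    have hx2 := congrArg (fun y : A => ((y : LinearMap.ker f) : V)) hx'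
    simp only at hx2
    rw [← hx2]
    simp only [Submodule.coe_sum, Submodule.coe_smul]
    exact Submodule.sum_mem _ fun i _ => Submodule.smul_mem _ _
      (Submodule.subset_span ⟨Sum.inl i, rfl⟩)
  have hYker : LinearMap.ker f ≤ Y := by
    intro x hx
    have : (⟨x, hx⟩ : LinearMap.ker f) ∈ (LinearMap.ker f ⊓ LinearMap.range f).submoduleOf
        (LinearMap.ker f) ⊔ A := by rw [hA.sup_eq_top]; trivial
    obtain ⟨y, hy, z, hz', hyz⟩ := Submodule.mem_sup.1 this
    have hxe : x = (y : V) + (z : V) := by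
      have := congrArg Subtype.val hyz; simpa using this.symm
    rw [hxe]
    refine add_mem ?_ (hYA z hz')
    obtain ⟨c, hc⟩ := hspan y hy
    rw [← hc]
    exact Submodule.smul_mem _ _ (hYv _ le_rfl)
  -- Induction on the power killing $f x$: its last nonzero iterate lies on the line $\ker
  -- f\cap\operatorname{im}f$, so subtracting a multiple of a string vector from $x$ lowers the
  -- power.
  have hrange : ∀ j x, (f ^ j) (f x) = 0 → ∃ y ∈ Y, f y = f x := by
    intro j
    induction j with
    | zero => intro x hx; exact ⟨0, zero_mem _, by simpa using hx.symm⟩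
    | succ j ih =>
      intro x hx
      have h3 : (f ^ j) (f x) ∈ LinearMap.ker f ⊓ LinearMap.range f := by
        refine ⟨LinearMap.mem_ker.2 (by rw [hpow]; exact hx), ⟨(f ^ j) x, ?_⟩⟩
        rw [hpow, pow_succ]; rfl
      by_cases hj : j ≤ r
      · obtain ⟨c, hc⟩ := hspan _ h3
        obtain ⟨y, hy, hyx⟩ := ih (x - c • (f ^ (r - j)) v) (by
          rw [map_sub, map_sub, ← hc, map_smul, map_smul, hpow, ← Module.End.mul_apply,
            ← pow_add, show j + (r - j + 1) = r + 1 by omega, sub_self])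
        refine ⟨y + c • (f ^ (r - j)) v, add_mem hy
          (Submodule.smul_mem _ _ (hYv _ (by omega))), ?_⟩
        rw [map_add, hyx, map_sub, sub_add_cancel]
      · refine ih x ?_
        have : (f ^ (j + 1)) x = 0 := by
          rw [show j + 1 = (j - r - 1) + (r + 2) by omega, pow_add, hr]; simp
        rw [pow_succ] at this; exact this
  have hYtop : ⊤ ≤ Y := by
    intro x _
    obtain ⟨n, hn⟩ := hf
    obtain ⟨y, hy, hyx⟩ := hrange n x (by rw [hn]; rfl)
    have : x - y ∈ LinearMap.ker f := by rw [LinearMap.mem_ker, map_sub, hyx, sub_self]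
    simpa using add_mem (hYker this) hy
  -- Rank and nullity give one bound: the kernel has dimension $\dim A+1$ and the image contains a
  -- string of length $r+1$. Spanning gives the other.
  have hcard : Fintype.card (Fin (Module.finrank K A) ⊕ Fin (r + 2)) = Module.finrank K V := by
    refine le_antisymm ?_ ?_
    · have e1 := LinearMap.finrank_range_add_finrank_ker f
      have e2 := Submodule.finrank_add_eq_of_isCompl hA
      have e3 : Module.finrank K ((LinearMap.ker f ⊓ LinearMap.range f).submoduleOf
          (LinearMap.ker f)) ≤ 1 := by
        rw [(Submodule.submoduleOfEquivOfLe inf_le_left).finrank_eq]; exact h1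
      have e3' : 1 ≤ Module.finrank K ((LinearMap.ker f ⊓ LinearMap.range f).submoduleOf
          (LinearMap.ker f)) := by
        rw [(Submodule.submoduleOfEquivOfLe inf_le_left).finrank_eq,
          Nat.one_le_iff_ne_zero, Ne, Submodule.finrank_eq_zero]
        intro h
        rw [h] at hz
        exact hv (by simpa using hz)
      have hst : ∀ x ∈ LinearMap.range f, f x ∈ LinearMap.range f := fun x _ => ⟨x, rfl⟩
      have hnil : IsNilpotent (f.restrict hst) := by
        obtain ⟨n, hn⟩ := hf
        refine ⟨n, ?_⟩
        rw [Module.End.pow_restrict n hst (fun x hx => by simp [hn])]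
        apply LinearMap.ext; intro x; apply Subtype.ext; simp [hn]
      have e4 := Module.End.le_finrank_of_pow_apply_ne_zero hnil (d := r)
        (q := ⟨f v, v, rfl⟩) (by
          rw [Module.End.pow_restrict r hst]
          intro h
          apply hv
          have := congrArg Subtype.val h
          rw [pow_succ]; exact this)
      simp only [Fintype.card_sum, Fintype.card_fin]
      omega
    · have := finrank_range_le_card (R := K) w
      rw [Set.finrank, ← hY, top_le_iff.1 hYtop, finrank_top] at this
      exact this
  refine ⟨_, _, basisOfTopLeSpanOfCardEqFinrank w hYtop hcard, ?_, ?_, ?_⟩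
  · intro m
    simp only [coe_basisOfTopLeSpanOfCardEqFinrank, w, Sum.elim_inl]
    exact (b m : LinearMap.ker f).2
  · intro m hm
    simp only [coe_basisOfTopLeSpanOfCardEqFinrank, w, Sum.elim_inr, hm]
    rw [hpow, Nat.sub_zero, hr]; rfl
  · intro m m' hm
    have := m'.2
    simp only [coe_basisOfTopLeSpanOfCardEqFinrank, w, Sum.elim_inr, hm]
    rw [hpow]
    congr 2; omega

/-- In coordinates $f$ erases the first family and shifts the second, so a value of $f$ that is
itself killed by $f$ has only the bottom coordinate of the string. -/
lemma Module.End.finrank_ker_inf_range_le_one {f : Module.End K V} {a b : ℕ}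
    (e : Module.Basis (Fin a ⊕ Fin b) K V) (h1 : ∀ m : Fin a, f (e (Sum.inl m)) = 0)
    (h2 : ∀ m : Fin b, m.val = 0 → f (e (Sum.inr m)) = 0)
    (h3 : ∀ m m' : Fin b, m'.val = m.val + 1 → f (e (Sum.inr m')) = e (Sum.inr m)) :
    Module.finrank K (LinearMap.ker f ⊓ LinearMap.range f : Submodule K V) ≤ 1 := by
  classical
  have c1 : ∀ z (m : Fin a), e.repr (f z) (Sum.inl m) = 0 := by
    intro z m
    have : (e.coord (Sum.inl m)) ∘ₗ f = 0 := by
      refine e.ext ?_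
      rintro (m' | m')
      · simp [h1]
      · by_cases hm : m'.val = 0
        · simp [h2 _ hm]
        · simp [h3 ⟨m'.val - 1, by omega⟩ m' (by simp; omega)]
    exact LinearMap.congr_fun this z
  have c2 : ∀ z (m m' : Fin b), m'.val = m.val + 1 →
      e.repr (f z) (Sum.inr m) = e.repr z (Sum.inr m') := by
    intro z m m' hmm
    have : (e.coord (Sum.inr m)) ∘ₗ f = e.coord (Sum.inr m') := by
      refine e.ext ?_
      rintro (i | i)
      · simp [h1]
      · by_cases hm : i.val = 0
        · have : i ≠ m' := by intro h; rw [h] at hm; omega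
          simp [h2 _ hm, Finsupp.single_apply, this]
        · have h4 := h3 ⟨i.val - 1, by omega⟩ i (by simp; omega)
          have : (⟨i.val - 1, by omega⟩ : Fin b) = m ↔ i = m' := by
            rw [Fin.ext_iff, Fin.ext_iff]; simp; omega
          simp [h4, Finsupp.single_apply, this]
    exact LinearMap.congr_fun this z
  rcases Nat.eq_zero_or_pos b with hb | hb
  · have : LinearMap.ker f ⊓ LinearMap.range f = ⊥ := by
      rw [eq_bot_iff]
      rintro _ ⟨_, ⟨y, rfl⟩⟩
      rw [Submodule.mem_bot]
      apply e.repr.injective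
      ext i
      rcases i with i | i
      · simp [c1]
      · exact absurd i.2 (by omega)
    rw [this]; simp
  · have hle : LinearMap.ker f ⊓ LinearMap.range f ≤ Submodule.span K {e (Sum.inr ⟨0, hb⟩)} := by
      rintro _ ⟨hx, ⟨y, rfl⟩⟩
      rw [Submodule.mem_span_singleton]
      refine ⟨e.repr (f y) (Sum.inr ⟨0, hb⟩), ?_⟩
      apply e.repr.injective
      ext i
      rcases i with i | i
      · simp [c1]
      · by_cases hi : i.val = 0
        · have : i = ⟨0, hb⟩ := Fin.ext hi
          subst this
          simp
        · have h5 := c2 (f y) ⟨i.val - 1, by omega⟩ i (by simp; omega)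
          rw [← h5, show f (f y) = 0 from hx]
          have : (⟨0, hb⟩ : Fin b) ≠ i := by intro h; exact hi (by rw [← h])
          simp [Finsupp.single_apply, this]
    refine (Submodule.finrank_mono hle).trans ?_
    exact (finrank_span_le_card _).trans (by simp)

end NilpotentEnd

/-! ### Modules over the group algebra: unipotent elements and weights -/

/-- A group element, viewed in the group algebra. -/
def gr (g : SL(2, ZMod p)) : GroupAlg p := MonoidAlgebra.of (ZMod p) SL(2, ZMod p) g

lemma gr_one : gr (1 : SL(2, ZMod p)) = 1 := map_one _
lemma gr_mul (g h : SL(2, ZMod p)) : gr (g * h) = gr g * gr h := map_mul _ _ _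
lemma gr_pow (g : SL(2, ZMod p)) (n : ℕ) : gr (g ^ n) = gr g ^ n := map_pow _ _ _
lemma gr_inv_mul (g : SL(2, ZMod p)) : gr g⁻¹ * gr g = 1 := by
  rw [← gr_mul, inv_mul_cancel, gr_one]
lemma gr_mul_inv (g : SL(2, ZMod p)) : gr g * gr g⁻¹ = 1 := by
  rw [← gr_mul, mul_inv_cancel, gr_one]

/-- The nilpotent element `u - 1`, where `u` is the standard unipotent element. -/
def nil : GroupAlg p := gr (upper 1) - 1

lemma gr_upper_one : gr (upper (1 : ZMod p)) = 1 + nil := by simp [nil]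

lemma gr_upper_natCast (n : ℕ) : gr (upper (n : ZMod p)) = (1 + nil) ^ n := by
  rw [← gr_upper_one, ← gr_pow, upper_pow, mul_one]

lemma charP_groupAlg : CharP (GroupAlg p) p :=
  charP_of_injective_algebraMap (algebraMap (ZMod p) (GroupAlg p)).injective p

lemma nil_pow_p : (nil : GroupAlg p) ^ p = 0 := by
  have := charP_groupAlg (p := p)
  rw [nil, sub_pow_char_of_commute p (Commute.one_right _), ← gr_pow, upper_pow]
  simp [upper_zero, gr_one]

/-- Weights only see the linear term of $(1+\mathrm{nil})^c$. The remainder commutes with `nil`, so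
it disappears on vectors killed by the appropriate power. -/
lemma gr_upper_expand (c : ZMod p) :
    ∃ r : GroupAlg p, Commute nil r ∧ gr (upper c) = 1 + c • nil + nil ^ 2 * r := by
  obtain ⟨n, rfl⟩ := ZMod.natCast_zmod_surjective c
  rw [gr_upper_natCast]
  induction n with
  | zero => exact ⟨0, Commute.zero_right _, by simp⟩
  | succ n ih =>
    obtain ⟨r, hr, h⟩ := ih
    refine ⟨(n : ZMod p) • 1 + r * (1 + nil), ?_, ?_⟩
    · exact ((Commute.one_right _).smul_right _).add_right
        (hr.mul_right ((Commute.one_right _).add_right (Commute.refl _)))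
    · rw [pow_succ, h]
      push_cast
      simp only [mul_add, add_mul, one_mul, mul_one, add_smul, one_smul, smul_mul_assoc,
        mul_smul_comm, pow_two, mul_assoc]
      abel

lemma gr_upper_sub_one (c : ZMod p) :
    ∃ r : GroupAlg p, Commute nil r ∧ gr (upper c) - 1 = nil * r := by
  obtain ⟨r, hr, h⟩ := gr_upper_expand c
  refine ⟨c • 1 + nil * r, ?_, ?_⟩
  · exact ((Commute.one_right _).smul_right _).add_right ((Commute.refl _).mul_right hr)
  · rw [h, mul_add, mul_smul_comm, mul_one, pow_two, mul_assoc]; abel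

lemma gr_torus_mul_upper (t : (ZMod p)ˣ) (c : ZMod p) :
    gr (torus t) * gr (upper c) = gr (upper ((t : ZMod p) ^ 2 * c)) * gr (torus t) := by
  rw [← gr_mul, torus_mul_upper, gr_mul]

lemma gr_torus_mul_nil (t : (ZMod p)ˣ) :
    gr (torus t) * nil = (gr (upper ((t : ZMod p) ^ 2)) - 1) * gr (torus t) := by
  rw [nil, mul_sub, gr_torus_mul_upper, sub_mul]; simp

lemma exists_gr_torus_mul_nil (t : (ZMod p)ˣ) :
    ∃ r : GroupAlg p, gr (torus t) * nil = nil * r := by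
  obtain ⟨r, _, h⟩ := gr_upper_sub_one ((t : ZMod p) ^ 2)
  exact ⟨r * gr (torus t), by rw [gr_torus_mul_nil, h, mul_assoc]⟩

/-- `∑_c u^c = (u - 1)^(p - 1)`. -/
lemma sum_gr_upper : ∑ c : ZMod p, gr (upper c) = (nil : GroupAlg p) ^ (p - 1) := by
  have hp := (Fact.out : p.Prime)
  have := charP_groupAlg (p := p)
  have h1 : ∑ c : ZMod p, gr (upper c) = ∑ i ∈ Finset.range p, gr (upper (1 : ZMod p)) ^ i := by
    refine Finset.sum_bij' (fun c _ => c.val) (fun i _ => (i : ZMod p)) ?_ ?_ ?_ ?_ ?_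
    · intro c _; exact Finset.mem_range.2 (ZMod.val_lt c)
    · intro i _; exact Finset.mem_univ _
    · intro c _; simp
    · intro i hi; exact ZMod.val_cast_of_lt (Finset.mem_range.1 hi)
    · intro c _; rw [← gr_pow, upper_pow]; simp
  rw [h1, nil]
  -- Both sides become $X^p-1=(X-1)^p$ after multiplication by $X-1$.
  have key : ∑ i ∈ Finset.range p, (Polynomial.X : Polynomial (ZMod p)) ^ i =
      (Polynomial.X - 1) ^ (p - 1) := by
    have hne : (Polynomial.X - 1 : Polynomial (ZMod p)) ≠ 0 := Polynomial.X_sub_C_ne_zero 1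
    refine mul_left_cancel₀ hne ?_
    rw [mul_geom_sum, mul_pow_sub_one hp.ne_zero, sub_pow_char, one_pow]
  have := congrArg (Polynomial.aeval (gr (upper (1 : ZMod p)))) key
  simpa using this

section Modules

variable {M : Type*} [AddCommGroup M] [Module (ZMod p) M] [Module (GroupAlg p) M]
  [IsScalarTower (ZMod p) (GroupAlg p) M]
variable {N : Type*} [AddCommGroup N] [Module (ZMod p) N] [Module (GroupAlg p) N]
  [IsScalarTower (ZMod p) (GroupAlg p) N]

variable (M) in
/-- The action of the group algebra by linear endomorphisms. -/
def act : GroupAlg p →ₐ[ZMod p] Module.End (ZMod p) M := Algebra.lsmul (ZMod p) (ZMod p) M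

@[simp] lemma act_apply (a : GroupAlg p) (m : M) : act M a m = a • m := rfl

lemma gr_mul_smul (g h : SL(2, ZMod p)) (m : M) : gr (g * h) • m = gr g • gr h • m := by
  rw [gr_mul, mul_smul]

lemma gr_inv_smul_smul (g : SL(2, ZMod p)) (m : M) : gr g⁻¹ • gr g • m = m := by
  rw [smul_smul, gr_inv_mul, one_smul]

lemma gr_smul_inv_smul (g : SL(2, ZMod p)) (m : M) : gr g • gr g⁻¹ • m = m := by
  rw [smul_smul, gr_mul_inv, one_smul]

/-- An equivariant linear map is linear over the group algebra. -/
def equivariantMap (f : M →ₗ[ZMod p] N) (h : ∀ (g : SL(2, ZMod p)) m, f (gr g • m) = gr g • f m) :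
    M →ₗ[GroupAlg p] N := MonoidAlgebra.equivariantOfLinearOfComm f h

@[simp] lemma equivariantMap_apply (f : M →ₗ[ZMod p] N) (h) (m : M) :
    equivariantMap f h m = f m := rfl

/-- A stable subspace is a submodule over the group algebra. -/
def stableSubmodule (W : Submodule (ZMod p) M) (h : ∀ g : SL(2, ZMod p), ∀ m ∈ W, gr g • m ∈ W) :
    Submodule (GroupAlg p) M := MonoidAlgebra.submoduleOfSMulMem W fun g m hm => h g m hm

@[simp] lemma mem_stableSubmodule (W : Submodule (ZMod p) M) (h) (m : M) :
    m ∈ stableSubmodule W h ↔ m ∈ W := Iff.rfl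

lemma nil_smul_eq (m : M) : (nil : GroupAlg p) • m = gr (upper (1 : ZMod p)) • m - m := by
  rw [nil, sub_smul, one_smul]

lemma gr_smul_sum {ι : Type*} (g : SL(2, ZMod p)) (s : Finset ι) (c : ι → ZMod p) (f : ι → M) :
    gr g • ∑ i ∈ s, c i • f i = ∑ i ∈ s, c i • gr g • f i := by
  rw [Finset.smul_sum]
  exact Finset.sum_congr rfl fun i _ => smul_comm _ _ _

lemma isNilpotent_act_nil : IsNilpotent (act M (nil : GroupAlg p)) := ⟨p, by rw [← map_pow, nil_pow_p, map_zero]⟩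

lemma act_nil_pow_apply (n : ℕ) (m : M) : (act M (nil : GroupAlg p) ^ n) m = (nil : GroupAlg p) ^ n • m := by
  rw [← map_pow, act_apply]

variable (p M) in
/-- The vectors fixed by the standard unipotent subgroup. -/
def fixU : Submodule (ZMod p) M := LinearMap.ker (act M nil)

lemma mem_fixU {m : M} : m ∈ fixU p M ↔ (nil : GroupAlg p) • m = 0 := Iff.rfl

lemma mem_fixU_iff {m : M} : m ∈ fixU p M ↔ ∀ c : ZMod p, gr (upper c) • m = m := by
  rw [mem_fixU]
  constructor
  · intro h c
    obtain ⟨r, hr, hc⟩ := gr_upper_sub_one c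
    have : (gr (upper c) - 1) • m = 0 := by rw [hc, hr.eq, mul_smul, h, smul_zero]
    rwa [sub_smul, one_smul, sub_eq_zero] at this
  · intro h
    rw [nil, sub_smul, one_smul, h, sub_self]

lemma gr_torus_smul_mem_fixU {m : M} (h : m ∈ fixU p M) (t : (ZMod p)ˣ) :
    gr (torus t) • m ∈ fixU p M := by
  rw [mem_fixU_iff] at h ⊢
  intro c
  have h1 := gr_torus_mul_upper t (((t : ZMod p) ^ 2)⁻¹ * c)
  rw [mul_inv_cancel_left₀ (by simp)] at h1
  rw [smul_smul, ← h1, mul_smul, h]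

lemma map_mem_fixU (f : M →ₗ[GroupAlg p] N) {m : M} (h : m ∈ fixU p M) : f m ∈ fixU p N := by
  rw [mem_fixU] at h ⊢; rw [← map_smul, h, map_zero]

lemma coe_mem_fixU {S : Submodule (GroupAlg p) M} {m : S} : (m : M) ∈ fixU p M ↔ m ∈ fixU p S := by
  rw [mem_fixU, mem_fixU, ← Submodule.coe_smul, Submodule.coe_eq_zero]

lemma fixU_ne_bot [Nontrivial M] : fixU p M ≠ ⊥ := by
  intro h
  obtain ⟨m, hm⟩ := exists_ne (0 : M)
  apply hm
  have hinj : Function.Injective (act M (nil : GroupAlg p)) := LinearMap.ker_eq_bot.1 h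
  obtain ⟨n, hn⟩ := isNilpotent_act_nil (p := p) (M := M)
  have : Function.Injective (act M (nil : GroupAlg p) ^ n) := by
    rw [Module.End.coe_pow]; exact hinj.iterate n
  apply this
  rw [hn]; rfl

/-- `m` is a weight vector of weight `b`: `diag(t, t⁻¹)` acts on it by `t ^ b`. -/
def IsWt (p : ℕ) [Fact p.Prime] {M : Type*} [AddCommGroup M] [Module (ZMod p) M]
    [Module (GroupAlg p) M] (b : ℤ) (m : M) : Prop :=
  ∀ t : (ZMod p)ˣ, gr (torus t) • m = ((t ^ b : (ZMod p)ˣ) : ZMod p) • m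

lemma zpow_eq_zpow_of_dvd {a b : ℤ} (h : ((p : ℤ) - 1) ∣ a - b) (t : (ZMod p)ˣ) :
    t ^ a = t ^ b := by
  obtain ⟨c, hc⟩ := h
  have h1 : t ^ ((p : ℤ) - 1) = 1 := by
    have := ZMod.units_pow_card_sub_one_eq_one p t
    rw [← zpow_natCast, Nat.cast_sub (Fact.out : p.Prime).one_le] at this
    simpa using this
  rw [show a = b + ((p : ℤ) - 1) * c by omega, zpow_add, zpow_mul, h1, one_zpow, mul_one]

lemma dvd_of_forall_zpow_eq {a b : ℤ} (h : ∀ t : (ZMod p)ˣ, t ^ a = t ^ b) :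
    ((p : ℤ) - 1) ∣ a - b := by
  obtain ⟨g, hg⟩ := IsCyclic.exists_generator (α := (ZMod p)ˣ)
  have h1 : orderOf g = p - 1 := by
    rw [orderOf_eq_card_of_forall_mem_zpowers hg, Nat.card_eq_fintype_card, ZMod.card_units]
  have h2 : g ^ (a - b) = 1 := by rw [zpow_sub, h g, mul_inv_cancel]
  have h3 := orderOf_dvd_iff_zpow_eq_one.2 h2
  rwa [h1, Nat.cast_sub (Fact.out : p.Prime).one_le] at h3

lemma IsWt.congr {a b : ℤ} {m : M} (h : IsWt p a m) (hab : ((p : ℤ) - 1) ∣ a - b) : IsWt p b m :=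
  fun t => by rw [h t, zpow_eq_zpow_of_dvd hab]

lemma IsWt.dvd_sub {a b : ℤ} {m : M} (ha : IsWt p a m) (hb : IsWt p b m) (hm : m ≠ 0) :
    ((p : ℤ) - 1) ∣ a - b := by
  refine dvd_of_forall_zpow_eq fun t => ?_
  have h1 := (ha t).symm.trans (hb t)
  rw [← sub_eq_zero, ← sub_smul] at h1
  exact Units.ext (sub_eq_zero.1 ((smul_eq_zero.1 h1).resolve_right hm))

lemma IsWt.map {b : ℤ} {m : M} (h : IsWt p b m) (f : M →ₗ[GroupAlg p] N) : IsWt p b (f m) :=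
  fun t => by
    rw [← map_smul, h t]
    exact LinearMap.map_smul (f.restrictScalars (ZMod p)) _ _

lemma IsWt.smul {b : ℤ} {m : M} (h : IsWt p b m) (c : ZMod p) : IsWt p b (c • m) := fun t => by
  rw [smul_comm, h t, smul_comm]

lemma IsWt.coe {S : Submodule (GroupAlg p) M} {b : ℤ} {m : S} : IsWt p b (m : M) ↔ IsWt p b m := by
  refine forall_congr' fun t => ?_
  rw [← Submodule.coe_smul, ← Submodule.coe_smul_of_tower, Subtype.coe_inj]

/-- The projector onto the weight space of weight `b`. -/
def wproj (b : ℤ) : GroupAlg p :=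
  - ∑ t : (ZMod p)ˣ, ((t ^ (-b) : (ZMod p)ˣ) : ZMod p) • gr (torus t)

lemma gr_torus_mul_wproj (b : ℤ) (t : (ZMod p)ˣ) :
    gr (torus t) * wproj b = ((t ^ b : (ZMod p)ˣ) : ZMod p) • wproj b := by
  rw [wproj, mul_neg, smul_neg, Finset.mul_sum, Finset.smul_sum]
  congr 1
  refine Fintype.sum_equiv (Equiv.mulLeft t) _ _ fun s => ?_
  rw [mul_smul_comm, ← gr_mul, torus_mul, smul_smul, ← Units.val_mul, Equiv.coe_mulLeft,
    mul_zpow, ← mul_assoc, ← zpow_add]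
  simp

lemma isWt_wproj (b : ℤ) (m : M) : IsWt p b ((wproj b : GroupAlg p) • m) := fun t => by
  rw [smul_smul, gr_torus_mul_wproj, smul_assoc]

/-- The torus has order $-1$ in $\mathbb F_p$. This accounts for the sign in `wproj` and for the
signs in later sums over the torus. -/
lemma card_units_smul_neg : -(((Fintype.card (ZMod p)ˣ : ℕ) : ZMod p)) = 1 := by
  rw [ZMod.card_units, Nat.cast_sub (Fact.out : p.Prime).one_le]; simp

/-- Orthogonality of characters: for $t\ne1$ the sum of the powers of $t^{-1}$ is a vanishing
geometric series. -/
lemma sum_wproj : ∑ b ∈ Finset.range (p - 1), wproj (b : ℤ) = (1 : GroupAlg p) := by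
  have h : ∀ t : (ZMod p)ˣ, (∑ b ∈ Finset.range (p - 1), ((t ^ (-(b : ℤ)) : (ZMod p)ˣ) : ZMod p))
      = if t = 1 then -1 else 0 := by
    intro t
    have h1 : ∀ b ∈ Finset.range (p - 1), ((t ^ (-(b : ℤ)) : (ZMod p)ˣ) : ZMod p) =
        ((t⁻¹ : (ZMod p)ˣ) : ZMod p) ^ b := by
      intro b _; rw [zpow_neg, zpow_natCast, ← inv_pow]; simp
    rw [Finset.sum_congr rfl h1]
    split_ifs with ht
    · have := card_units_smul_neg (p := p)
      rw [ZMod.card_units] at this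
      subst ht; simp; linear_combination -this
    · have h2 := mul_geom_sum ((t⁻¹ : (ZMod p)ˣ) : ZMod p) (p - 1)
      rw [← Units.val_pow_eq_pow_val, ZMod.units_pow_card_sub_one_eq_one, Units.val_one,
        sub_self] at h2
      refine (mul_eq_zero.1 h2).resolve_left fun h3 => ht ?_
      rw [sub_eq_zero] at h3
      exact inv_eq_one.1 (Units.ext h3)
  simp only [wproj, Finset.sum_neg_distrib]
  rw [Finset.sum_comm]
  simp only [← Finset.sum_smul, h]
  simp [torus_one, gr_one]

lemma wproj_smul_of_isWt {b : ℤ} {m : M} (h : IsWt p b m) : (wproj b : GroupAlg p) • m = m := by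
  rw [wproj, neg_smul, Finset.sum_smul]
  have : ∀ t ∈ (Finset.univ : Finset (ZMod p)ˣ),
      (((t ^ (-b) : (ZMod p)ˣ) : ZMod p) • gr (torus t)) • m = m := by
    intro t _
    rw [smul_assoc, h t, smul_smul, ← Units.val_mul, ← zpow_add]; simp
  rw [Finset.sum_congr rfl this, Finset.sum_const, ← Nat.cast_smul_eq_nsmul (ZMod p), ← neg_smul,
    Finset.card_univ, card_units_smul_neg, one_smul]

lemma wproj_smul_mem_fixU {m : M} (h : m ∈ fixU p M) (b : ℤ) :
    (wproj b : GroupAlg p) • m ∈ fixU p M := by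
  rw [wproj, neg_smul, Finset.sum_smul]
  refine neg_mem (Submodule.sum_mem _ fun t _ => ?_)
  rw [smul_assoc]
  exact Submodule.smul_mem _ _ (gr_torus_smul_mem_fixU h t)

/-- A vector is the sum of its weight components, so they cannot all lie in $W$. No stability of $W$
is needed. -/
lemma exists_wproj_notMem (W : AddSubgroup M) {m : M} (h : m ∉ W) :
    ∃ b : ℕ, b < p - 1 ∧ (wproj (b : ℤ) : GroupAlg p) • m ∉ W := by
  by_contra hc
  push Not at hc
  apply h
  rw [← one_smul (GroupAlg p) m, ← sum_wproj, Finset.sum_smul]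
  exact sum_mem fun b hb => hc b (Finset.mem_range.1 hb)

/-- A nonzero module has a nonzero weight vector fixed by `U`. -/
lemma exists_fixU_isWt [Nontrivial M] :
    ∃ (b : ℕ) (m : M), b < p - 1 ∧ m ≠ 0 ∧ m ∈ fixU p M ∧ IsWt p (b : ℤ) m := by
  obtain ⟨m, hm, hm0⟩ := Submodule.exists_mem_ne_zero_of_ne_bot (fixU_ne_bot (p := p) (M := M))
  obtain ⟨b, hb, hb2⟩ := exists_wproj_notMem (p := p) (⊥ : AddSubgroup M) (m := m) (by simpa using hm0)
  exact ⟨b, _, hb, by simpa using hb2, wproj_smul_mem_fixU hm _, isWt_wproj (p := p) _ _⟩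

end Modules
-- Representations as modules with compatible scalar and group algebra actions.
/-- The module over the group algebra given by a representation. -/
def RepMod {V : Type*} [AddCommGroup V] [Module (ZMod p) V]
    (_ : Representation (ZMod p) SL(2, ZMod p) V) : Type _ := V

namespace RepMod

variable {V : Type*} [AddCommGroup V] [Module (ZMod p) V]
  (ρ : Representation (ZMod p) SL(2, ZMod p) V)

instance : AddCommGroup (RepMod ρ) := inferInstanceAs (AddCommGroup V)
instance : Module (ZMod p) (RepMod ρ) := inferInstanceAs (Module (ZMod p) V)

instance : Module (GroupAlg p) (RepMod ρ) where
  smul a v := ρ.asAlgebraHom a v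
  one_smul v := LinearMap.congr_fun (map_one ρ.asAlgebraHom) v
  mul_smul a b v := LinearMap.congr_fun (map_mul ρ.asAlgebraHom a b) v
  smul_zero a := map_zero (ρ.asAlgebraHom a)
  smul_add a := map_add (ρ.asAlgebraHom a)
  add_smul a b v := LinearMap.congr_fun (map_add ρ.asAlgebraHom a b) v
  zero_smul v := LinearMap.congr_fun (map_zero ρ.asAlgebraHom) v

instance : IsScalarTower (ZMod p) (GroupAlg p) (RepMod ρ) where
  smul_assoc c a v := by
    change ρ.asAlgebraHom (c • a) v = c • ρ.asAlgebraHom a v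
    rw [map_smul]; rfl

instance [h : FiniteDimensional (ZMod p) V] : FiniteDimensional (ZMod p) (RepMod ρ) := h

/-- The identity, as an equivalence with the underlying vector space. -/
def equiv : RepMod ρ ≃ₗ[ZMod p] V where
  toFun v := v
  invFun v := v
  map_add' _ _ := rfl
  map_smul' _ _ := rfl

lemma equiv_gr_smul (g : SL(2, ZMod p)) (v : RepMod ρ) : equiv ρ (gr g • v) = ρ g (equiv ρ v) := by
  change ρ.asAlgebraHom (gr g) v = ρ g v
  simp [gr]

lemma gr_smul_symm (g : SL(2, ZMod p)) (v : V) :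
    gr g • (equiv ρ).symm v = (equiv ρ).symm (ρ g v) := by
  apply (equiv ρ).injective
  rw [equiv_gr_smul]; simp

/-- The comparison with the module defined in Mathlib. -/
def asModuleEquiv : ρ.asModule ≃ₗ[GroupAlg p] RepMod ρ where
  toFun v := v
  invFun v := v
  map_add' _ _ := rfl
  map_smul' _ _ := rfl

end RepMod

/-! ### Induction from the unipotent subgroup -/

/-- The matrix in `SL_2(p)` with given entries. -/
def slMk (a b c d : ZMod p) (h : a * d - b * c = 1) : SL(2, ZMod p) :=
  ⟨!![a, b; c, d], by rw [Matrix.det_fin_two]; exact h⟩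

lemma slMk_coe (a b c d : ZMod p) (h) : (slMk a b c d h).1 = !![a, b; c, d] := rfl

/-- A matrix in `SL_2(p)` with second row `x`, when `x ≠ 0`. -/
def sec (x : Fin 2 → ZMod p) : SL(2, ZMod p) :=
  if h : x 0 ≠ 0 then slMk 0 (-(x 0)⁻¹) (x 0) (x 1) (by simp [h])
  else if h : x 1 ≠ 0 then slMk (x 1)⁻¹ 0 0 (x 1) (by simp [h])
  else 1

lemma fin2_ne_zero {x : Fin 2 → ZMod p} (hx : x ≠ 0) (h : x 0 = 0) : x 1 ≠ 0 := by
  intro h1; apply hx; ext i; fin_cases i <;> simp [h, h1]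

lemma sec_row {x : Fin 2 → ZMod p} (hx : x ≠ 0) : (sec x).1 1 = x := by
  by_cases h : x 0 = 0
  · have h1 := fin2_ne_zero hx h
    rw [sec, dif_neg (not_not.2 h), dif_pos h1, slMk_coe]
    ext i; fin_cases i <;> simp [h]
  · rw [sec, dif_pos h, slMk_coe]
    ext i; fin_cases i <;> simp

lemma units_smul_ne_zero {x : Fin 2 → ZMod p} (hx : x ≠ 0) (c : (ZMod p)ˣ) : c • x ≠ 0 := by
  intro h
  apply hx
  rw [← inv_smul_smul c x, h, smul_zero]

lemma row_mul (g h : SL(2, ZMod p)) : (g * h).1 1 = Matrix.vecMul (g.1 1) h.1 := by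
  ext j; simp [sl_mul_coe, Matrix.mul_apply, Matrix.vecMul, dotProduct]

lemma row_ne_zero (g : SL(2, ZMod p)) : g.1 1 ≠ 0 := by
  intro h
  have := sl_det g
  rw [h] at this
  simp at this

lemma row_upper_mul (c : ZMod p) (g : SL(2, ZMod p)) : (upper c * g).1 1 = g.1 1 := by
  ext j; simp [sl_mul_coe, upper_coe, Matrix.mul_apply, Fin.sum_univ_two]

/-- The second row is a complete invariant of the coset $Ug$. Hence nonzero row vectors parametrize
$U\backslash G$, with `sec` as a section. -/
lemma exists_upper_mul {g h : SL(2, ZMod p)} (hgh : g.1 1 = h.1 1) : ∃ c, g = upper c * h := by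
  have h1 : (g * h⁻¹).1 1 = (1 : SL(2, ZMod p)).1 1 := by
    rw [row_mul, hgh, ← row_mul, mul_inv_cancel]
  refine ⟨(g * h⁻¹).1 0 1, ?_⟩
  rw [← mul_inv_eq_iff_eq_mul]
  have h10 := congrFun h1 0
  have h11 := congrFun h1 1
  have hd := sl_det (g * h⁻¹)
  simp only [Matrix.SpecialLinearGroup.coe_one, ne_eq, one_ne_zero, not_false_eq_true,
    Matrix.one_apply_ne, Matrix.one_apply_eq] at h10 h11
  rw [h10, h11] at hd
  apply sl_ext
  · simp only [upper_coe]; simpa using hd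
  · simp [upper_coe]
  · rw [h10]; simp [upper_coe]
  · rw [h11]; simp [upper_coe]

lemma vecMul_ne_zero {x : Fin 2 → ZMod p} (hx : x ≠ 0) (g : SL(2, ZMod p)) :
    Matrix.vecMul x g.1 ≠ 0 := by
  rw [← sec_row hx, ← row_mul]; exact row_ne_zero _

lemma vecMul_vecMul_inv (x : Fin 2 → ZMod p) (g : SL(2, ZMod p)) :
    Matrix.vecMul (Matrix.vecMul x g.1) g⁻¹.1 = x := by
  rw [Matrix.vecMul_vecMul, ← sl_mul_coe, mul_inv_cancel]; simp

lemma vecMul_inv_vecMul (x : Fin 2 → ZMod p) (g : SL(2, ZMod p)) :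
    Matrix.vecMul (Matrix.vecMul x g⁻¹.1) g.1 = x := by
  rw [Matrix.vecMul_vecMul, ← sl_mul_coe, inv_mul_cancel]; simp

/-- The nonzero row vectors. -/
def rows (p : ℕ) [Fact p.Prime] : Finset (Fin 2 → ZMod p) := Finset.univ.erase 0

lemma mem_rows {x : Fin 2 → ZMod p} : x ∈ rows p ↔ x ≠ 0 := by simp [rows]

/-- A sum over `U \ G` may be translated. -/
lemma sum_rows_mul {W : Type*} [AddCommMonoid W] (T : SL(2, ZMod p) → W)
    (hT : ∀ c g, T (upper c * g) = T g) (h : SL(2, ZMod p)) :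
    ∑ x ∈ rows p, T (sec x * h) = ∑ x ∈ rows p, T (sec x) := by
  refine Finset.sum_bij' (fun x _ => Matrix.vecMul x h.1) (fun x _ => Matrix.vecMul x h⁻¹.1)
    ?_ ?_ ?_ ?_ ?_
  · intro x hx; rw [mem_rows] at *; exact vecMul_ne_zero hx h
  · intro x hx; rw [mem_rows] at *; exact vecMul_ne_zero hx _
  · intro x _; exact vecMul_vecMul_inv x h
  · intro x _; exact vecMul_inv_vecMul x h
  · intro x hx
    rw [mem_rows] at hx
    obtain ⟨c, hc⟩ := exists_upper_mul (g := sec x * h) (h := sec (Matrix.vecMul x h.1)) (by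
      rw [row_mul, sec_row hx, sec_row (vecMul_ne_zero hx h)])
    rw [hc, hT]

/-- The representation of `SL_2(p)` on functions of a row vector. -/
def funRep (p : ℕ) [Fact p.Prime] :
    Representation (ZMod p) SL(2, ZMod p) ((Fin 2 → ZMod p) → ZMod p) where
  toFun g := LinearMap.funLeft (ZMod p) (ZMod p) fun x => Matrix.vecMul x g.1
  map_one' := by ext f x; simp [LinearMap.funLeft_apply]
  map_mul' g h := by
    apply LinearMap.ext; intro f; funext x
    simp [LinearMap.funLeft_apply]

/-- The module of functions of a row vector. -/
abbrev FunMod (p : ℕ) [Fact p.Prime] : Type := RepMod (funRep p)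

/-- Evaluation at a row vector. -/
def ev (x : Fin 2 → ZMod p) : FunMod p →ₗ[ZMod p] ZMod p :=
  LinearMap.proj x ∘ₗ (RepMod.equiv (funRep p)).toLinearMap

/-- A function, as an element of the module `FunMod`. -/
def mkFun (f : (Fin 2 → ZMod p) → ZMod p) : FunMod p := (RepMod.equiv (funRep p)).symm f

@[simp] lemma ev_mkFun (x : Fin 2 → ZMod p) (f) : ev x (mkFun f) = f x := rfl

lemma fun_ext {f g : FunMod p} (h : ∀ x, ev x f = ev x g) : f = g := funext h

@[simp] lemma ev_gr_smul (x : Fin 2 → ZMod p) (g : SL(2, ZMod p)) (f : FunMod p) :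
    ev x (gr g • f) = ev (Matrix.vecMul x g.1) f := by
  rw [← (RepMod.equiv (funRep p)).symm_apply_apply f, RepMod.gr_smul_symm]
  rfl

/-- The functions which are homogeneous of degree `a`. -/
def homFun (p : ℕ) [Fact p.Prime] (a : ℕ) : Submodule (GroupAlg p) (FunMod p) :=
  stableSubmodule
    { carrier := {f | ∀ (c : ZMod p) (x : Fin 2 → ZMod p), ev (c • x) f = c ^ a * ev x f}
      zero_mem' := by intro c x; simp
      add_mem' := by intro f g hf hg c x; rw [map_add, map_add, hf, hg, mul_add]
      smul_mem' := by
        intro r f hf c x; rw [map_smul, map_smul, hf, smul_eq_mul, smul_eq_mul]; ring }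
    (by
      intro g f hf c x
      rw [ev_gr_smul, ev_gr_smul, Matrix.smul_vecMul, hf])

lemma mem_homFun {a : ℕ} {f : FunMod p} :
    f ∈ homFun p a ↔ ∀ (c : ZMod p) (x : Fin 2 → ZMod p), ev (c • x) f = c ^ a * ev x f := Iff.rfl

/-! ### Frobenius reciprocity, the intertwining operator and the splitting of induced summands. -/

section Modules

variable {M : Type*} [AddCommGroup M] [Module (ZMod p) M] [Module (GroupAlg p) M]
  [IsScalarTower (ZMod p) (GroupAlg p) M]

/-- The homomorphism from the induced module determined by a vector fixed by `U`. -/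
def fromFun (v : M) (hv : v ∈ fixU p M) : FunMod p →ₗ[GroupAlg p] M :=
  equivariantMap
    (∑ x ∈ rows p, (ev x).smulRight (gr (sec x)⁻¹ • v))
    (by
      intro h f
      simp only [LinearMap.sum_apply, LinearMap.smulRight_apply]
      rw [gr_smul_sum]
      have := sum_rows_mul (fun g => ev (g.1 1) f • gr (h * g⁻¹) • v) (by
        intro c g
        rw [row_upper_mul, mul_inv_rev, upper_inv, ← mul_assoc, gr_mul_smul (h * g⁻¹),
          mem_fixU_iff.1 hv]) h
      simp only [mul_inv_rev, mul_inv_cancel_left] at this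
      calc _ = ∑ x ∈ rows p, ev ((sec x * h).1 1) f • gr (sec x)⁻¹ • v := by
            refine Finset.sum_congr rfl fun x hx => ?_
            rw [ev_gr_smul, row_mul, sec_row (mem_rows.1 hx)]
        _ = _ := by
            rw [this]
            refine Finset.sum_congr rfl fun x hx => ?_
            rw [sec_row (mem_rows.1 hx), gr_mul_smul])

lemma fromFun_apply (v : M) (hv : v ∈ fixU p M) (f : FunMod p) :
    fromFun v hv f = ∑ x ∈ rows p, ev x f • gr (sec x)⁻¹ • v := by
  simp [fromFun]

/-- The homomorphism to the coinduced module determined by a `U`-invariant functional. -/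
def toFunMod (φ : M →ₗ[ZMod p] ZMod p) (hφ : ∀ (c : ZMod p) m, φ (gr (upper c) • m) = φ m) :
    M →ₗ[GroupAlg p] FunMod p :=
  equivariantMap
    { toFun := fun m => mkFun fun x => if x = 0 then 0 else φ (gr (sec x) • m)
      map_add' := by
        intro m n; apply fun_ext; intro x
        rw [map_add]; simp only [ev_mkFun, smul_add, map_add]; split_ifs <;> simp
      map_smul' := by
        intro c m; apply fun_ext; intro x
        rw [map_smul]; simp only [ev_mkFun, smul_comm _ c m, map_smul]; split_ifs <;> simp }
    (by
      intro h m
      apply fun_ext; intro x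
      simp only [LinearMap.coe_mk, AddHom.coe_mk, ev_gr_smul, ev_mkFun]
      by_cases hx : x = 0
      · simp [hx]
      · rw [if_neg hx, if_neg (vecMul_ne_zero hx h), smul_smul, ← gr_mul]
        obtain ⟨c, hc⟩ := exists_upper_mul (g := sec x * h) (h := sec (Matrix.vecMul x h.1)) (by
          rw [row_mul, sec_row hx, sec_row (vecMul_ne_zero hx h)])
        rw [hc, gr_mul_smul, hφ])

lemma ev_toFunMod (φ : M →ₗ[ZMod p] ZMod p) (hφ) (m : M) {x : Fin 2 → ZMod p} (hx : x ≠ 0) :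
    ev x (toFunMod φ hφ m) = φ (gr (sec x) • m) := by
  simp [toFunMod, hx]

lemma ev_zero_toFunMod (φ : M →ₗ[ZMod p] ZMod p) (hφ) (m : M) :
    ev 0 (toFunMod φ hφ m) = 0 := by
  simp [toFunMod]

lemma antidiag_eq (t : (ZMod p)ˣ) : antidiag t = torus t⁻¹ * antidiag 1 := by
  apply sl_ext <;> simp [antidiag_coe, torus_coe, Matrix.mul_apply, Fin.sum_univ_two]

lemma torus_mul_antidiag (t : (ZMod p)ˣ) : torus t * antidiag 1 = antidiag 1 * torus t⁻¹ := by
  apply sl_ext <;>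
    simp [antidiag_coe, torus_coe, sl_mul_coe, Matrix.mul_apply, Fin.sum_univ_two]

/-- The Bruhat decomposition. -/
lemma eq_upper_mul_torus {g : SL(2, ZMod p)} (h : g.1 1 0 = 0) (t : (ZMod p)ˣ)
    (ht : g.1 1 1 = (t : ZMod p)) : ∃ c, g = upper c * torus t⁻¹ := by
  apply exists_upper_mul
  ext i; fin_cases i <;> simp [torus_coe, h, ht]

lemma eq_upper_mul_antidiag {g : SL(2, ZMod p)} (t : (ZMod p)ˣ)
    (ht : g.1 1 0 = (t : ZMod p)) : ∃ c d, g = upper c * antidiag t * upper d := by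
  have : ∃ c, g = upper c * (antidiag t * upper (g.1 1 1 / g.1 1 0)) := by
    apply exists_upper_mul
    ext i
    fin_cases i <;>
      simp [antidiag_coe, sl_mul_coe, upper_coe, Matrix.mul_apply, Fin.sum_univ_two, ht]
    field_simp
  obtain ⟨c, hc⟩ := this
  exact ⟨c, _, by rw [mul_assoc]; exact hc⟩

/-- The determinant form on row vectors. -/
def detForm (y x : Fin 2 → ZMod p) : ZMod p := y 0 * x 1 - y 1 * x 0

/-- The lower left entry decides the Bruhat cell, so the cell of this product is read off from
whether the two rows are proportional. -/
lemma sec_mul_sec_inv_zero {x y : Fin 2 → ZMod p} (hx : x ≠ 0) (hy : y ≠ 0) :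
    (sec y * (sec x)⁻¹).1 1 0 = detForm y x := by
  have h1 : (sec y).1 1 = y := sec_row hy
  have h2 : (sec x).1 1 = x := sec_row hx
  have h3 : (sec x)⁻¹.1 = !![(sec x).1 1 1, -(sec x).1 0 1; -(sec x).1 1 0, (sec x).1 0 0] := by
    rw [Matrix.SpecialLinearGroup.coe_inv, Matrix.adjugate_fin_two]
  rw [sl_mul_coe, h3, Matrix.mul_apply, Fin.sum_univ_two, h1, h2]
  simp [detForm]; ring

lemma sec_smul_mul_sec_inv {y : Fin 2 → ZMod p} (hy : y ≠ 0) (c : (ZMod p)ˣ) :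
    (sec y * (sec (c • y))⁻¹).1 1 1 = ((c⁻¹ : (ZMod p)ˣ) : ZMod p) := by
  have hcy : c • y ≠ 0 := units_smul_ne_zero hy c
  have h1 : (sec y).1 1 = c⁻¹ • (sec (c • y)).1 1 := by
    rw [sec_row hy, sec_row hcy, inv_smul_smul]
  have h2 : (sec y * (sec (c • y))⁻¹).1 1 = c⁻¹ • (1 : SL(2, ZMod p)).1 1 := by
    rw [row_mul, h1, ← mul_inv_cancel (sec (c • y)), row_mul]
    exact Matrix.smul_vecMul _ _ _
  rw [h2]
  simp [Units.smul_def]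

/-- The invariant operator on functions with kernel `detForm ^ a`. -/
def intertwiner (a : ℕ) (f : FunMod p) : FunMod p :=
  mkFun fun y => ∑ x, ev x f * detForm y x ^ a

lemma ev_intertwiner (a : ℕ) (f : FunMod p) (y : Fin 2 → ZMod p) :
    ev y (intertwiner a f) = ∑ x, ev x f * detForm y x ^ a := rfl

lemma intertwiner_mem {a : ℕ} (f : FunMod p) : intertwiner a f ∈ homFun p a := by
  intro c y
  rw [ev_intertwiner, ev_intertwiner, Finset.mul_sum]
  refine Finset.sum_congr rfl fun x _ => ?_
  simp [detForm]
  rw [mul_left_comm, ← mul_pow]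
  ring

lemma sum_units_smul {W : Type*} [AddCommMonoid W] {y : Fin 2 → ZMod p} (hy : y ≠ 0)
    (F : (Fin 2 → ZMod p) → W) :
    ∑ x ∈ rows p with detForm y x = 0, F x = ∑ c : (ZMod p)ˣ, F (c • y) := by
  symm
  refine Finset.sum_bij (fun c _ => c • y) ?_ ?_ ?_ ?_
  · intro c _
    rw [Finset.mem_filter, mem_rows]
    refine ⟨units_smul_ne_zero hy c, ?_⟩
    simp [detForm, Units.smul_def]; ring
  · intro c _ d _ h
    obtain ⟨i, hi⟩ : ∃ i, y i ≠ 0 := by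
      by_contra hc; push Not at hc; exact hy (funext hc)
    have := congrFun h i
    simp only [Pi.smul_apply, Units.smul_def, smul_eq_mul] at this
    exact Units.ext (mul_right_cancel₀ hi this)
  · intro x hx
    rw [Finset.mem_filter, mem_rows] at hx
    obtain ⟨hx, hd⟩ := hx
    rw [detForm] at hd
    by_cases h0 : y 0 = 0
    · have h1 := fin2_ne_zero hy h0
      have hx0 : x 0 = 0 := by
        rw [h0] at hd; simpa [h1] using hd
      have hx1 := fin2_ne_zero hx hx0
      refine ⟨Units.mk0 (x 1 / y 1) (div_ne_zero hx1 h1), Finset.mem_univ _, ?_⟩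
      ext i; fin_cases i <;> simp [Units.smul_def, h0, hx0, h1]
    · have hx0 : x 0 ≠ 0 := by
        intro hx0
        rw [hx0] at hd
        have := fin2_ne_zero hx hx0
        simp [h0, this] at hd
      refine ⟨Units.mk0 (x 0 / y 0) (div_ne_zero hx0 h0), Finset.mem_univ _, ?_⟩
      ext i; fin_cases i
      · simp [Units.smul_def, h0]
      · simp [Units.smul_def]; field_simp; linear_combination -hd
  · intro c _; rfl

/-- The composite of an induced and a coinduced homomorphism. -/
lemma toFunMod_fromFun {a : ℕ} (ha : 1 ≤ a) {v : M} (hv : v ∈ fixU p M)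
    (φ : M →ₗ[ZMod p] ZMod p) (hφ : ∀ (c : ZMod p) m, φ (gr (upper c) • m) = φ m)
    (hφw : ∀ (t : (ZMod p)ˣ) m, φ (gr (torus t) • m) = ((t ^ (-(a : ℤ)) : (ZMod p)ˣ) : ZMod p) * φ m)
    (h1 : φ v = 1) {f : FunMod p} (hf : f ∈ homFun p a) :
    toFunMod (p := p) φ hφ (fromFun (p := p) v hv f) =
      -f + φ (gr (antidiag (1 : (ZMod p)ˣ)) • v) • intertwiner a f := by
  set κ := φ (gr (antidiag (1 : (ZMod p)ˣ)) • v)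
  apply fun_ext
  intro y
  by_cases hy : y = 0
  · subst hy
    have h0 := hf 0 0
    rw [zero_smul, zero_pow (by omega), zero_mul] at h0
    rw [ev_zero_toFunMod, map_add, map_neg, h0, map_smul, ev_intertwiner]
    simp [detForm, zero_pow (show a ≠ 0 by omega)]
  rw [ev_toFunMod _ _ _ hy, fromFun_apply, gr_smul_sum, map_sum, map_add, map_neg, map_smul,
    ev_intertwiner]
  have hterm : ∀ x ∈ rows p, φ (ev x f • gr (sec y) • gr (sec x)⁻¹ • v) =
      ev x f * φ (gr (sec y * (sec x)⁻¹) • v) := fun x _ => by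
    rw [map_smul, gr_mul_smul, smul_eq_mul]
  -- The sum over cosets is split along the two Bruhat cells.
  rw [Finset.sum_congr rfl hterm, ← Finset.sum_filter_add_sum_filter_not _ (fun x => detForm y x = 0)]
  congr 1
  -- Small cell: the rows are the multiples of $y$. The weight of $\varphi$ cancels the homogeneity
  -- of $f$, leaving $p-1=-1$ copies of $f(y)$.
  · rw [sum_units_smul hy fun x => ev x f * φ (gr (sec y * (sec x)⁻¹) • v)]
    have : ∀ c ∈ (Finset.univ : Finset (ZMod p)ˣ),
        ev (c • y) f * φ (gr (sec y * (sec (c • y))⁻¹) • v) = ev y f := by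
      intro c _
      have hcy : c • y ≠ 0 := units_smul_ne_zero hy c
      obtain ⟨d, hd⟩ := eq_upper_mul_torus (g := sec y * (sec (c • y))⁻¹) (by
        rw [sec_mul_sec_inv_zero hcy hy]; simp [detForm, Units.smul_def]; ring) c⁻¹
        (sec_smul_mul_sec_inv hy c)
      rw [hd, gr_mul_smul, hφ, hφw, h1, inv_inv, Units.smul_def, hf]
      rw [mul_one, mul_right_comm, ← Units.val_pow_eq_pow_val, ← Units.val_mul, ← zpow_natCast,
        ← zpow_add]
      simp
    rw [Finset.sum_congr rfl this, Finset.sum_const, nsmul_eq_mul, Finset.card_univ]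
    have := card_units_smul_neg (p := p)
    linear_combination (-ev y f) * this
  -- Big cell: the unipotent factors are absorbed by $v$ and $\varphi$, and the torus factor
  -- contributes $\det(y,x)^a$. Since $a\ge1$, the sum may be extended to all rows.
  · rw [smul_eq_mul, Finset.mul_sum]
    have hsub : (rows p).filter (fun x => ¬ detForm y x = 0) ⊆ Finset.univ := Finset.subset_univ _
    rw [← Finset.sum_subset hsub]
    · refine Finset.sum_congr rfl fun x hx => ?_
      rw [Finset.mem_filter, mem_rows] at hx
      obtain ⟨c, d, hcd⟩ := eq_upper_mul_antidiag (g := sec y * (sec x)⁻¹) (Units.mk0 _ hx.2)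
        (sec_mul_sec_inv_zero hx.1 hy)
      rw [hcd, gr_mul_smul, gr_mul_smul, mem_fixU_iff.1 hv, hφ, antidiag_eq, gr_mul_smul, hφw,
        inv_zpow', neg_neg, zpow_natCast]
      simp; ring
    · intro x _ hx
      have : detForm y x = 0 := by
        by_contra hd
        apply hx
        rw [Finset.mem_filter, mem_rows]
        refine ⟨?_, hd⟩
        rintro rfl
        exact hd (by simp [detForm])
      rw [this, zero_pow (by omega), mul_zero, mul_zero]

/-- The summand is a polynomial in the two coordinates of $y$ of degree below $2(p-1)$, and such
polynomials sum to zero over $\mathbb F_p^2$. -/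
lemma sum_detForm_pow {x z : Fin 2 → ZMod p} {a b : ℕ} (h : a + b < 2 * (p - 1)) :
    ∑ y, detForm y x ^ a * detForm z y ^ b = 0 := by
  let P : MvPolynomial (Fin 2) (ZMod p) :=
    (MvPolynomial.X 0 * MvPolynomial.C (x 1) - MvPolynomial.X 1 * MvPolynomial.C (x 0)) ^ a *
    (MvPolynomial.C (z 0) * MvPolynomial.X 1 - MvPolynomial.C (z 1) * MvPolynomial.X 0) ^ b
  have hP := MvPolynomial.sum_eval_eq_zero P (by
    have e1 : ∀ (i : Fin 2) (c : ZMod p),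
        (MvPolynomial.X i * MvPolynomial.C c : MvPolynomial (Fin 2) (ZMod p)).totalDegree ≤ 1 :=
      fun i c => (MvPolynomial.totalDegree_mul _ _).trans (by simp)
    have e2 : ∀ (i : Fin 2) (c : ZMod p),
        (MvPolynomial.C c * MvPolynomial.X i : MvPolynomial (Fin 2) (ZMod p)).totalDegree ≤ 1 :=
      fun i c => (MvPolynomial.totalDegree_mul _ _).trans (by simp)
    have e3 := (MvPolynomial.totalDegree_sub (MvPolynomial.X 0 * MvPolynomial.C (x 1))
      (MvPolynomial.X 1 * MvPolynomial.C (x 0))).trans (max_le (e1 _ _) (e1 _ _))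
    have e4 := (MvPolynomial.totalDegree_sub (MvPolynomial.C (z 0) * MvPolynomial.X 1)
      (MvPolynomial.C (z 1) * MvPolynomial.X 0)).trans (max_le (e2 _ _) (e2 _ _))
    have e5 := (MvPolynomial.totalDegree_pow _ a).trans (Nat.mul_le_mul_left a e3)
    have e6 := (MvPolynomial.totalDegree_pow _ b).trans (Nat.mul_le_mul_left b e4)
    have e7 := (MvPolynomial.totalDegree_mul _ _).trans (add_le_add e5 e6)
    rw [ZMod.card, Fintype.card_fin]
    change P.totalDegree < _
    have : P.totalDegree ≤ a * 1 + b * 1 := e7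
    omega)
  rw [← hP]
  refine Finset.sum_congr rfl fun y _ => ?_
  simp [P, detForm]

lemma intertwiner_intertwiner {a : ℕ} (h : 2 * a = p - 1) (hp : 2 < p) (f : FunMod p) :
    intertwiner a (intertwiner a f) = 0 := by
  apply fun_ext; intro z
  simp only [ev_intertwiner, Finset.sum_mul]
  rw [Finset.sum_comm, map_zero]
  refine Finset.sum_eq_zero fun x _ => ?_
  have := sum_detForm_pow (x := x) (z := z) (a := a) (b := a) (by omega)
  simp only [mul_assoc]
  rw [← Finset.mul_sum, this, mul_zero]

lemma intertwiner_add (a : ℕ) (f g : FunMod p) :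
    intertwiner a (f + g) = intertwiner a f + intertwiner a g := by
  apply fun_ext; intro z
  simp [ev_intertwiner, add_mul, Finset.sum_add_distrib]

lemma intertwiner_smul (a : ℕ) (c : ZMod p) (f : FunMod p) :
    intertwiner a (c • f) = c • intertwiner a f := by
  apply fun_ext; intro z
  simp [ev_intertwiner, mul_assoc, Finset.mul_sum]

/-- For a nontrivial weight, the induced module is a direct summand. -/
lemma exists_toFunMod_fromFun_eq {a : ℕ} (ha : 1 ≤ a) (ha' : a ≤ p - 2) (hp : 2 < p) {v : M}
    (hv : v ∈ fixU p M) (hw : IsWt p (-(a : ℤ)) v)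
    (φ : M →ₗ[ZMod p] ZMod p) (hφ : ∀ (c : ZMod p) m, φ (gr (upper c) • m) = φ m)
    (hφw : ∀ (t : (ZMod p)ˣ) m, φ (gr (torus t) • m) = ((t ^ (-(a : ℤ)) : (ZMod p)ˣ) : ZMod p) * φ m)
    (h1 : φ v = 1) {f : FunMod p} (hf : f ∈ homFun p a) :
    ∃ f' ∈ homFun p a, toFunMod (p := p) φ hφ (fromFun (p := p) v hv f') = f := by
  set κ := φ (gr (antidiag (1 : (ZMod p)ˣ)) • v) with hκ
  -- The Weyl element inverts the torus, so $\kappa\ne0$ forces $t^a=t^{-a}$ for all $t$. In the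
  -- given range this means $2a=p-1$, where the square of the operator vanishes.
  have hAA : (κ * κ) • intertwiner a (intertwiner a f) = 0 := by
    by_cases hκ0 : κ = 0
    · rw [hκ0]; simp
    · have h2 : ∀ t : (ZMod p)ˣ, t ^ (a : ℤ) = t ^ (-(a : ℤ)) := by
        intro t
        have e1 : φ (gr (torus t * antidiag 1) • v) = ((t ^ (-(a : ℤ)) : (ZMod p)ˣ) : ZMod p) * κ := by
          rw [gr_mul_smul, hφw]
        rw [torus_mul_antidiag, gr_mul_smul, hw, smul_comm, map_smul, smul_eq_mul, inv_zpow',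
          neg_neg] at e1
        exact Units.ext (mul_right_cancel₀ hκ0 e1)
      have h3 := dvd_of_forall_zpow_eq h2
      obtain ⟨c, hc⟩ := h3
      have : 2 * a = p - 1 := by
        have hc1 : c = 1 := by
          have : 0 < c := by
            by_contra hneg
            nlinarith
          have : c < 2 := by
            by_contra hneg
            nlinarith [show ((a : ℕ) : ℤ) ≤ p - 2 by omega]
          omega
        subst hc1; omega
      rw [intertwiner_intertwiner this hp, smul_zero]
  -- Since $\kappa^2A^2=0$, the operators $-1+\kappa A$ and $-1-\kappa A$ are mutually inverse.
  refine ⟨-f + (-κ) • intertwiner a f, ?_, ?_⟩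
  · exact add_mem (neg_mem hf)
      (by
        have := intertwiner_mem (a := a) ((-κ) • f)
        rwa [intertwiner_smul] at this)
  · rw [toFunMod_fromFun ha hv φ hφ hφw h1]
    · rw [intertwiner_add, intertwiner_smul, ← hκ]
      rw [← neg_one_smul (ZMod p) f, intertwiner_smul, smul_add, smul_smul, smul_smul,
        mul_neg κ κ, neg_smul (κ * κ), hAA]
      simp
    · exact add_mem (neg_mem hf)
        (by
          have := intertwiner_mem (a := a) ((-κ) • f)
          rwa [intertwiner_smul] at this)

/-- For the trivial weight, the trivial module is a direct summand. -/
lemma exists_invariant_of_trivial_weight {v : M} (hp : 2 < p)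
    (hv : v ∈ fixU p M)
    (φ : M →ₗ[ZMod p] ZMod p) (hφ : ∀ (c : ZMod p) m, φ (gr (upper c) • m) = φ m)
    (hφw : ∀ (t : (ZMod p)ˣ) m, φ (gr (torus t) • m) = φ m) (h1 : φ v = 1) :
    ∃ (v₁ : M) (ψ : M →ₗ[ZMod p] ZMod p), (∀ g : SL(2, ZMod p), gr g • v₁ = v₁) ∧
      (∀ (g : SL(2, ZMod p)) m, ψ (gr g • m) = ψ m) ∧ ψ v₁ = 1 := by
  have hpow : ∀ t : (ZMod p)ˣ, t ^ (-((p - 1 : ℕ) : ℤ)) = 1 := by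
    intro t
    rw [zpow_neg, zpow_natCast, ZMod.units_pow_card_sub_one_eq_one, inv_one]
  -- The indicator of the nonzero rows is invariant, and homogeneous of degree $p-1$ by Fermat.
  set one : FunMod p := mkFun fun x => if x = 0 then 0 else 1 with hone
  have hmem : one ∈ homFun p (p - 1) := by
    intro c x
    by_cases hc : c = 0
    · rw [hc, zero_smul, zero_pow (by omega), zero_mul]; simp [one]
    · simp only [one, ev_mkFun, smul_eq_zero, hc, false_or, ZMod.pow_card_sub_one_eq_one hc, one_mul]
  have hfix : ∀ g : SL(2, ZMod p), gr g • one = one := by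
    intro g
    apply fun_ext; intro x
    rw [ev_gr_smul]
    simp only [one, ev_mkFun]
    by_cases hx : x = 0
    · simp [hx]
    · rw [if_neg hx, if_neg (vecMul_ne_zero hx g)]
  -- The value at $0$ may be changed to $1$ because the kernel vanishes there; what remains is a
  -- polynomial sum of degree $p-1<2(p-1)$.
  have hint : intertwiner (p - 1) one = 0 := by
    apply fun_ext; intro y
    rw [ev_intertwiner, map_zero]
    have := sum_detForm_pow (x := 0) (z := y) (a := 0) (b := p - 1) (by omega)
    simp only [pow_zero, one_mul] at this
    rw [← this]
    refine Finset.sum_congr rfl fun x _ => ?_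
    by_cases hx : x = 0
    · subst hx; simp [detForm, one, zero_pow (show p - 1 ≠ 0 by omega)]
    · simp [one, hx]
  have hmain := toFunMod_fromFun (a := p - 1) (by omega) hv φ hφ (fun t m => by rw [hφw, hpow]; simp) h1 hmem
  rw [hint, smul_zero, add_zero] at hmain
  have hcard : ((rows p).card : ZMod p) = -1 := by
    rw [rows, Finset.card_erase_of_mem (Finset.mem_univ _), Finset.card_univ]
    rw [Fintype.card_fun, ZMod.card, Fintype.card_fin, Nat.cast_sub (Nat.one_le_pow _ _ (by omega))]
    simp
  -- The pairing is $-\sum_{x\ne0}1=-(p^2-1)=1$, since the composite sends the indicator to its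
  -- negative.
  refine ⟨fromFun v hv one, (∑ x ∈ rows p, ev x) ∘ₗ
    (toFunMod φ hφ).restrictScalars (ZMod p), ?_, ?_, ?_⟩
  · intro g; rw [← map_smul, hfix]
  · intro g m
    simp only [LinearMap.comp_apply, LinearMap.restrictScalars_apply, map_smul,
      LinearMap.sum_apply, ev_gr_smul]
    have := sum_rows_mul (fun h => ev (h.1 1) (toFunMod φ hφ m)) (fun c h => by
      rw [row_upper_mul]) g
    calc _ = ∑ x ∈ rows p, ev ((sec x * g).1 1) (toFunMod φ hφ m) := by
          refine Finset.sum_congr rfl fun x hx => ?_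
          rw [row_mul, sec_row (mem_rows.1 hx)]
      _ = _ := by
          rw [this]
          refine Finset.sum_congr rfl fun x hx => ?_
          rw [sec_row (mem_rows.1 hx)]
  · rw [LinearMap.comp_apply, LinearMap.restrictScalars_apply, hmain, map_neg,
      LinearMap.sum_apply]
    have : ∀ x ∈ rows p, ev x one = 1 := by
      intro x hx
      rw [mem_rows] at hx
      simp [one, hx]
    rw [Finset.sum_congr rfl this, Finset.sum_const, nsmul_eq_mul, hcard]
    simp

end Modules

/-! ### The symmetric powers of the natural module -/

/-- The `n`-th symmetric power of the natural module, as a module over the group algebra. -/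
abbrev SymMod (p : ℕ) [Fact p.Prime] (n : ℕ) : Type := RepMod (symPowRep (ZMod p) n)

/-- The polynomial underlying an element of a symmetric power. -/
def symVal (n : ℕ) : SymMod p n →ₗ[ZMod p] MvPolynomial (Fin 2) (ZMod p) :=
  Submodule.subtype _ ∘ₗ (RepMod.equiv (symPowRep (ZMod p) n)).toLinearMap

/-- A homogeneous polynomial, as an element of a symmetric power. -/
def symMk {n : ℕ} (f : MvPolynomial (Fin 2) (ZMod p))
    (hf : f ∈ MvPolynomial.homogeneousSubmodule (Fin 2) (ZMod p) n) : SymMod p n :=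
  (RepMod.equiv (symPowRep (ZMod p) n)).symm ⟨f, hf⟩

@[simp] lemma symVal_symMk {n : ℕ} (f : MvPolynomial (Fin 2) (ZMod p)) (hf) :
    symVal n (symMk f hf) = f := rfl

lemma symVal_injective (n : ℕ) : Function.Injective (symVal (p := p) n) := fun _ _ h =>
  Subtype.ext h

lemma symVal_mem {n : ℕ} (f : SymMod p n) :
    symVal n f ∈ MvPolynomial.homogeneousSubmodule (Fin 2) (ZMod p) n :=
  ((RepMod.equiv (symPowRep (ZMod p) n)) f).2

lemma symVal_gr_smul {n : ℕ} (g : SL(2, ZMod p)) (f : SymMod p n) :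
    symVal n (gr g • f) = slPolyMap g (symVal n f) := by
  rw [← (RepMod.equiv (symPowRep (ZMod p) n)).symm_apply_apply f, RepMod.gr_smul_symm]
  rfl

lemma monomial_mem (n s : ℕ) (hs : s ≤ n) :
    (MvPolynomial.X 0 ^ (n - s) * MvPolynomial.X 1 ^ s : MvPolynomial (Fin 2) (ZMod p)) ∈
      MvPolynomial.homogeneousSubmodule (Fin 2) (ZMod p) n := by
  rw [MvPolynomial.mem_homogeneousSubmodule]
  have := (MvPolynomial.isHomogeneous_X_pow (R := ZMod p) (0 : Fin 2) (n - s)).mul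
    (MvPolynomial.isHomogeneous_X_pow (R := ZMod p) (1 : Fin 2) s)
  rwa [Nat.sub_add_cancel hs] at this

/-- The monomial `X₀ ^ (n - s) X₁ ^ s`. -/
def symMono (n : ℕ) (s : Fin (n + 1)) : SymMod p n :=
  symMk (MvPolynomial.X 0 ^ (n - s.val) * MvPolynomial.X 1 ^ s.val)
    (monomial_mem n s.val (by omega))

lemma symVal_symMono (n : ℕ) (s : Fin (n + 1)) : symVal n (symMono (p := p) n s) =
    MvPolynomial.X 0 ^ (n - s.val) * MvPolynomial.X 1 ^ s.val := rfl

lemma span_symMono (n : ℕ) :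
    Submodule.span (ZMod p) (Set.range (symMono (p := p) n)) = ⊤ := by
  rw [eq_top_iff]
  intro f _
  have hmap : symVal n f ∈
      (Submodule.span (ZMod p) (Set.range (symMono (p := p) n))).map (symVal n) := by
    have hf := symVal_mem f
    rw [MvPolynomial.mem_homogeneousSubmodule] at hf
    rw [(symVal n f).as_sum]
    refine Submodule.sum_mem _ fun d hd => ?_
    have hdeg := hf (MvPolynomial.mem_support_iff.1 hd)
    have hd2 : d 0 + d 1 = n := by
      rw [← hdeg, Finsupp.weight_apply, Finsupp.sum_fintype _ _ (by simp), Fin.sum_univ_two]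
      simp
    have hmon : MvPolynomial.monomial d (MvPolynomial.coeff d (symVal n f)) =
        MvPolynomial.coeff d (symVal n f) • symVal n (symMono n ⟨d 1, by omega⟩) := by
      rw [symVal_symMono, MvPolynomial.smul_eq_C_mul, MvPolynomial.monomial_eq]
      congr 1
      rw [Finsupp.prod_fintype _ _ (by simp), Fin.prod_univ_two]
      simp only [show n - d 1 = d 0 by omega]
    rw [hmon, ← map_smul]
    exact Submodule.mem_map_of_mem (Submodule.smul_mem _ _ (Submodule.subset_span ⟨_, rfl⟩))
  obtain ⟨g, hg, hgf⟩ := hmap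
  rwa [← symVal_injective n hgf]

lemma symMod_linear_ext {n : ℕ} {W : Type*} [AddCommGroup W] [Module (ZMod p) W]
    {f g : SymMod p n →ₗ[ZMod p] W} (h : ∀ s, f (symMono n s) = g (symMono n s)) : f = g :=
  LinearMap.ext_on_range (span_symMono n) h

instance (n : ℕ) : FiniteDimensional (ZMod p) (SymMod p n) :=
  ⟨⟨(Set.finite_range (symMono (p := p) n)).toFinset, by simpa using span_symMono n⟩⟩

lemma finrank_symMod_le (n : ℕ) : Module.finrank (ZMod p) (SymMod p n) ≤ n + 1 := by
  have := finrank_range_le_card (R := ZMod p) (symMono (p := p) n)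
  rw [Set.finrank, span_symMono, finrank_top, Fintype.card_fin] at this
  exact this

/-! ### Dehomogenization -/

/-- The difference operator on polynomials in one variable. -/
def polyDiff (p : ℕ) : Module.End (ZMod p) (Polynomial (ZMod p)) :=
  Polynomial.taylor 1 - LinearMap.id

lemma polyDiff_apply (f : Polynomial (ZMod p)) :
    polyDiff p f = Polynomial.taylor 1 f - f := rfl

lemma taylor_one_coeff {f : Polynomial (ZMod p)} {s : ℕ} (hf : f.natDegree ≤ s + 1) (n : ℕ) :
    (Polynomial.taylor 1 f).coeff n =
      ∑ i ∈ Finset.range (s + 2), ((i.choose n : ℕ) : ZMod p) * f.coeff i := by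
  rw [Polynomial.taylor_coeff, Polynomial.hasseDeriv_apply,
    Polynomial.sum_over_range' f (by simp) (s + 2) (by omega), Polynomial.eval_finsetSum]
  simp

lemma polyDiff_natDegree {f : Polynomial (ZMod p)} {s : ℕ} (hf : f.natDegree ≤ s + 1) :
    (polyDiff p f).natDegree ≤ s ∧
      (polyDiff p f).coeff s = ((s + 1 : ℕ) : ZMod p) * f.coeff (s + 1) := by
  have key : ∀ n, s ≤ n → (polyDiff p f).coeff n =
      if n = s then ((s + 1 : ℕ) : ZMod p) * f.coeff (s + 1) else 0 := by
    intro n hn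
    rw [polyDiff_apply, Polynomial.coeff_sub, taylor_one_coeff hf, Finset.sum_range_succ,
      Finset.sum_range_succ, Finset.sum_eq_zero]
    · split_ifs with h
      · subst h; simp
      · rw [Nat.choose_eq_zero_of_lt (show s < n by omega)]
        by_cases h2 : n = s + 1
        · subst h2; simp
        · rw [Nat.choose_eq_zero_of_lt (show s + 1 < n by omega),
            Polynomial.coeff_eq_zero_of_natDegree_lt (show f.natDegree < n by omega)]
          simp
    · intro i hi
      rw [Finset.mem_range] at hi
      rw [Nat.choose_eq_zero_of_lt (show i < n by omega)]; simp
  refine ⟨?_, by rw [key s le_rfl, if_pos rfl]⟩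
  rw [Polynomial.natDegree_le_iff_coeff_eq_zero]
  intro n hn
  rw [key n hn.le, if_neg (by omega)]

/-- Each difference lowers the degree bound by one and multiplies the top coefficient by the old
bound, so a falling factorial accumulates. -/
lemma polyDiff_pow_coeff {f : Polynomial (ZMod p)} {s : ℕ} (hf : f.natDegree ≤ s) (r : ℕ)
    (hr : r ≤ s) : ((polyDiff p ^ r) f).natDegree ≤ s - r ∧
      ((polyDiff p ^ r) f).coeff (s - r) = ((s.descFactorial r : ℕ) : ZMod p) * f.coeff s := by
  induction r with
  | zero => simpa using hf
  | succ r ih =>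
    obtain ⟨h1, h2⟩ := ih (by omega)
    have e : s - r = s - (r + 1) + 1 := by omega
    rw [e] at h1
    obtain ⟨h3, h4⟩ := polyDiff_natDegree h1
    rw [pow_succ', Module.End.mul_apply]
    refine ⟨h3, ?_⟩
    rw [h4, ← e, h2, Nat.descFactorial_succ, ← mul_assoc]; push_cast; ring

/-- Dehomogenization: `X₀ ↦ 1`, `X₁ ↦ X`. -/
def dehom (p : ℕ) : MvPolynomial (Fin 2) (ZMod p) →ₐ[ZMod p] Polynomial (ZMod p) :=
  MvPolynomial.aeval ![1, Polynomial.X]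

lemma dehom_slPolyMap_upper (f : MvPolynomial (Fin 2) (ZMod p)) :
    dehom p (slPolyMap (k := ZMod p) (upper 1) f) = Polynomial.taylor 1 (dehom p f) := by
  have : (dehom p).comp (slPolyMap (k := ZMod p) (upper 1)) =
      (Polynomial.taylorAlgHom (1 : ZMod p)).comp (dehom p) := by
    apply MvPolynomial.algHom_ext
    intro i
    have h0 : dehom p (MvPolynomial.X 0) = 1 := by simp [dehom]
    have h1 : dehom p (MvPolynomial.X 1) = Polynomial.X := by simp [dehom]
    have hC : ∀ c : ZMod p, dehom p (MvPolynomial.C c) = Polynomial.C c := fun c => by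
      simp [dehom]
    have hs : ∀ j : Fin 2, slPolyMap (k := ZMod p) (upper 1) (MvPolynomial.X j) =
        MvPolynomial.C ((upper (1 : ZMod p)).1 0 j) * MvPolynomial.X 0 +
          MvPolynomial.C ((upper (1 : ZMod p)).1 1 j) * MvPolynomial.X 1 := fun j => by
      rw [slPolyMap, MvPolynomial.aeval_X, Fin.sum_univ_two]
    rw [AlgHom.comp_apply, AlgHom.comp_apply, hs, map_add, map_mul, map_mul, hC, hC, h0, h1]
    revert i
    rw [Fin.forall_fin_two, h0, h1]
    simp [upper_coe, add_comm]
  exact DFunLike.congr_fun this f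

/-- Dehomogenization on a symmetric power. -/
def symDehom (n : ℕ) : SymMod p n →ₗ[ZMod p] Polynomial (ZMod p) :=
  (dehom p).toLinearMap ∘ₗ symVal n

lemma symDehom_symMono (n : ℕ) (s : Fin (n + 1)) :
    symDehom n (symMono (p := p) n s) = Polynomial.X ^ s.val := by
  simp [symDehom, symVal_symMono, dehom]

lemma symDehom_nil_smul {n : ℕ} (f : SymMod p n) :
    symDehom n ((nil : GroupAlg p) • f) = polyDiff p (symDehom n f) := by
  have h : symDehom n (gr (upper (1 : ZMod p)) • f) = Polynomial.taylor 1 (symDehom n f) := by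
    rw [symDehom, LinearMap.comp_apply, LinearMap.comp_apply, symVal_gr_smul]
    exact dehom_slPolyMap_upper _
  have e := congrArg (symDehom n) (nil_smul_eq (p := p) f)
  rw [map_sub, h] at e
  rw [polyDiff_apply]
  exact e

lemma symDehom_nil_pow_smul {n : ℕ} (r : ℕ) (f : SymMod p n) :
    symDehom n ((nil : GroupAlg p) ^ r • f) = (polyDiff p ^ r) (symDehom n f) := by
  induction r with
  | zero => simp
  | succ r ih => rw [pow_succ', pow_succ', mul_smul, symDehom_nil_smul, ih]; rfl

lemma descFactorial_ne_zero {s r : ℕ} (hs : s < p) (hr : r ≤ s) :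
    ((s.descFactorial r : ℕ) : ZMod p) ≠ 0 := by
  rw [Ne, ZMod.natCast_eq_zero_iff]
  intro h
  have h2 := h.trans (Dvd.intro_left _ (Nat.factorial_mul_descFactorial hr))
  exact absurd (((Fact.out : p.Prime).dvd_factorial).1 h2) (by omega)

/-- After dehomogenization `nil` is the difference operator, and the $n$-th difference of $X^n$ is
$n!\ne0$. Thus $\mathrm{Sym}^n$ is one Jordan block generated by $X_1^n$. -/
lemma nil_pow_symMono_last {n : ℕ} (hn : n < p) :
    (act (SymMod p n) (nil : GroupAlg p) ^ n) (symMono n (Fin.last n)) ≠ 0 := by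
  intro h
  rw [act_nil_pow_apply] at h
  have h1 := symDehom_nil_pow_smul n (symMono (p := p) n (Fin.last n))
  rw [h, map_zero, symDehom_symMono] at h1
  have h2 := (polyDiff_pow_coeff (p := p) (f := Polynomial.X ^ n) (s := n) (by simp) n le_rfl).2
  rw [Fin.val_last] at h1
  rw [← h1] at h2
  simp at h2
  exact descFactorial_ne_zero hn le_rfl (by simpa using h2.symm)

lemma finrank_symMod {n : ℕ} (hn : n < p) : Module.finrank (ZMod p) (SymMod p n) = n + 1 :=
  le_antisymm (finrank_symMod_le n)
    (Module.End.le_finrank_of_pow_apply_ne_zero isNilpotent_act_nil (nil_pow_symMono_last hn))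

lemma finrank_fixU_symMod_le {n : ℕ} (hn : n < p) :
    Module.finrank (ZMod p) (fixU p (SymMod p n)) ≤ 1 :=
  Module.End.finrank_ker_le_one (f := act (SymMod p n) nil) isNilpotent_act_nil
    (finrank_symMod_le n) (nil_pow_symMono_last hn)

lemma symMono_zero_mem_fixU (n : ℕ) : symMono n 0 ∈ fixU p (SymMod p n) := by
  rw [mem_fixU_iff]
  intro c
  apply symVal_injective
  rw [symVal_gr_smul, symVal_symMono]
  simp [slPolyMap, upper_coe, Fin.sum_univ_two]

lemma isWt_symMono (n : ℕ) (s : Fin (n + 1)) :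
    IsWt p ((n : ℤ) - 2 * s.val) (symMono (p := p) n s) := by
  intro t
  apply symVal_injective
  rw [symVal_gr_smul, map_smul, symVal_symMono, MvPolynomial.smul_eq_C_mul]
  have e : t ^ ((n : ℤ) - 2 * s.val) = t ^ (n - s.val) * (t⁻¹) ^ s.val := by
    rw [← zpow_natCast, ← zpow_natCast, inv_zpow', ← zpow_add, Nat.cast_sub (by omega)]
    congr 1; ring
  rw [e]
  simp only [slPolyMap, torus_coe, map_mul, map_pow, MvPolynomial.aeval_X, Fin.sum_univ_two]
  simp [mul_pow]
  rw [← inv_pow, MvPolynomial.C.map_pow]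
  ring

lemma symMono_zero_ne_zero (n : ℕ) : symMono (p := p) n 0 ≠ 0 := by
  intro h
  have := symDehom_symMono (p := p) n 0
  rw [h, map_zero] at this
  simp at this

lemma mem_span_of_finrank_le_one {K V : Type*} [Field K] [AddCommGroup V] [Module K V]
    [FiniteDimensional K V] {W : Submodule K V} (h : Module.finrank K W ≤ 1) {x y : V}
    (hx : x ∈ W) (hx0 : x ≠ 0) (hy : y ∈ W) : ∃ c : K, y = c • x := by
  obtain ⟨v, hv⟩ := finrank_le_one_iff.1 h
  obtain ⟨a, ha⟩ := hv ⟨x, hx⟩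
  obtain ⟨b, hb⟩ := hv ⟨y, hy⟩
  have ha0 : a ≠ 0 := by
    rintro rfl; rw [zero_smul] at ha; exact hx0 (congrArg Subtype.val ha.symm)
  refine ⟨b * a⁻¹, ?_⟩
  have e1 := congrArg Subtype.val ha
  have e2 := congrArg Subtype.val hb
  simp only [Submodule.coe_smul] at e1 e2
  rw [← e1, ← e2, smul_smul, mul_assoc, inv_mul_cancel₀ ha0, mul_one]

/-- The Weyl element carries the $U$-fixed vector to the generator of the Jordan block; this is what
makes $\mathrm{Sym}^n$ simple. -/
lemma antidiag_smul_symMono_zero (n : ℕ) :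
    gr (antidiag (1 : (ZMod p)ˣ)) • symMono (p := p) n 0 = symMono n (Fin.last n) := by
  apply symVal_injective
  rw [symVal_gr_smul, symVal_symMono, symVal_symMono]
  simp [slPolyMap, antidiag_coe, Fin.sum_univ_two]

/-! ### Submodules when $U$ fixes only a line. -/

section Modules

variable {M : Type*} [AddCommGroup M] [Module (ZMod p) M] [Module (GroupAlg p) M]
  [IsScalarTower (ZMod p) (GroupAlg p) M]

lemma exists_mem_fixU_of_ne_bot {N : Submodule (GroupAlg p) M} (hN : N ≠ ⊥) :
    ∃ (b : ℕ) (m : M), b < p - 1 ∧ m ∈ N ∧ m ≠ 0 ∧ m ∈ fixU p M ∧ IsWt p (b : ℤ) m := by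
  have := Submodule.nontrivial_iff_ne_bot.2 hN
  obtain ⟨b, m, hb, hm0, hm, hw⟩ := exists_fixU_isWt (p := p) (M := N)
  exact ⟨b, m, hb, m.2, by simpa using hm0, coe_mem_fixU.2 hm, IsWt.coe.2 hw⟩

/-- If the fixed points of `U` are a line, then it is contained in all nonzero submodules. -/
lemma fixU_mem_of_ne_bot [FiniteDimensional (ZMod p) M]
    (h : Module.finrank (ZMod p) (fixU p M) ≤ 1) {N : Submodule (GroupAlg p) M}
    (hN : N ≠ ⊥) {m : M} (hm : m ∈ fixU p M) : m ∈ N := by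
  obtain ⟨b, n, _, hnN, hn0, hn, _⟩ := exists_mem_fixU_of_ne_bot hN
  obtain ⟨c, rfl⟩ := mem_span_of_finrank_le_one h hn hn0 hm
  exact N.smul_of_tower_mem c hnN

lemma eq_ker_nil_pow [FiniteDimensional (ZMod p) M]
    (h : Module.finrank (ZMod p) (fixU p M) ≤ 1) (N : Submodule (GroupAlg p) M) :
    N.restrictScalars (ZMod p) =
      LinearMap.ker (act M (nil : GroupAlg p) ^ Module.finrank (ZMod p) N) :=
  Module.End.eq_ker_pow_finrank isNilpotent_act_nil h (N.restrictScalars (ZMod p))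
    fun _ hx => N.smul_mem _ hx

/-- A submodule containing a generator of the Jordan block is everything. -/
lemma eq_top_of_mem [FiniteDimensional (ZMod p) M]
    (h : Module.finrank (ZMod p) (fixU p M) ≤ 1) {d : ℕ} (hd : Module.finrank (ZMod p) M ≤ d + 1)
    {q : M} (hq : (act M (nil : GroupAlg p) ^ d) q ≠ 0) {N : Submodule (GroupAlg p) M}
    (hqN : q ∈ N) : N = ⊤ := by
  have h1 := eq_ker_nil_pow h N
  have h2 : q ∈ LinearMap.ker (act M (nil : GroupAlg p) ^ Module.finrank (ZMod p) N) := by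
    rw [← h1]; exact hqN
  have h3 : d < Module.finrank (ZMod p) N := by
    by_contra hlt
    apply hq
    rw [← Nat.sub_add_cancel (not_lt.1 hlt), pow_add, Module.End.mul_apply, h2, map_zero]
  have h4 : N.restrictScalars (ZMod p) = ⊤ := by
    apply Submodule.eq_top_of_finrank_eq
    refine le_antisymm (Submodule.finrank_le _) ?_
    change _ ≤ Module.finrank (ZMod p) N
    omega
  rw [eq_top_iff]
  intro x _
  have : x ∈ N.restrictScalars (ZMod p) := by rw [h4]; trivial
  exact this

end Modules

instance nontrivial_symMod (n : ℕ) : Nontrivial (SymMod p n) :=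
  ⟨⟨_, _, symMono_zero_ne_zero n⟩⟩

/-- A nonzero submodule contains the $U$-fixed line of $X_0^n$, hence the Weyl translate $X_1^n$,
which generates everything under `nil`. -/
lemma isSimpleModule_symMod {n : ℕ} (hn : n < p) : IsSimpleModule (GroupAlg p) (SymMod p n) := by
  rw [isSimpleModule_iff]
  refine { exists_pair_ne := exists_pair_ne _, eq_bot_or_eq_top := fun N => ?_ }
  by_cases hN : N = ⊥
  · exact Or.inl hN
  · right
    have h1 := finrank_fixU_symMod_le hn
    refine eq_top_of_mem h1 (finrank_symMod_le n) (nil_pow_symMono_last hn) ?_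
    rw [← antidiag_smul_symMono_zero]
    exact N.smul_mem _ (fixU_mem_of_ne_bot h1 hN (symMono_zero_mem_fixU n))

/-- Evaluation of polynomials, as a homomorphism to the module of functions. -/
def evalMap (n : ℕ) : SymMod p n →ₗ[GroupAlg p] FunMod p :=
  equivariantMap
    { toFun := fun f => mkFun fun x => MvPolynomial.eval x (symVal n f)
      map_add' := by intro f g; apply fun_ext; intro x; simp
      map_smul' := by intro c f; apply fun_ext; intro x; simp [MvPolynomial.smul_eval] }
    (by
      intro g f
      apply fun_ext; intro x
      simp only [LinearMap.coe_mk, AddHom.coe_mk, ev_mkFun, ev_gr_smul, symVal_gr_smul]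
      have : (MvPolynomial.aeval x).comp (slPolyMap g) =
          (MvPolynomial.aeval (Matrix.vecMul x g.1) :
            MvPolynomial (Fin 2) (ZMod p) →ₐ[ZMod p] ZMod p) := by
        apply MvPolynomial.algHom_ext
        intro i
        simp [slPolyMap, Fin.sum_univ_two, Matrix.vecMul, dotProduct]; ring
      have h := DFunLike.congr_fun this (symVal n f)
      simpa [MvPolynomial.aeval_eq_eval] using h)

lemma ev_evalMap {n : ℕ} (f : SymMod p n) (x : Fin 2 → ZMod p) :
    ev x (evalMap n f) = MvPolynomial.eval x (symVal n f) := rfl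

lemma ev_evalMap_symMono_zero (n : ℕ) (x : Fin 2 → ZMod p) :
    ev x (evalMap n (symMono n 0)) = x 0 ^ n := by
  rw [ev_evalMap, symVal_symMono]; simp

/-! ### The induced modules `homFun p a` -/

section Modules

variable {M : Type*} [AddCommGroup M] [Module (ZMod p) M] [Module (GroupAlg p) M]
  [IsScalarTower (ZMod p) (GroupAlg p) M]

/-- The lower unitriangular group is conjugate to $U$, so it acts trivially too, and the two
generate. -/
lemma gr_smul_of_fixU_eq_top (h : fixU p M = ⊤) (g : SL(2, ZMod p)) (m : M) : gr g • m = m := by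
  have hu : ∀ (c : ZMod p) (m : M), gr (upper c) • m = m := fun c m =>
    mem_fixU_iff.1 (h ▸ Submodule.mem_top) c
  have hl : ∀ (c : ZMod p) (m : M), gr (lower c) • m = m := by
    intro c m
    have e : lower c = antidiag 1 * upper (-c) * (antidiag (1 : (ZMod p)ˣ))⁻¹ := by
      rw [eq_mul_inv_iff_mul_eq]
      apply sl_ext <;> simp [lower_coe, upper_coe, antidiag_coe, Matrix.mul_apply, Fin.sum_univ_two]
    rw [e, gr_mul_smul, gr_mul_smul, hu, gr_smul_inv_smul]
  have key : ∀ g : SL(2, ZMod p), ∀ m : M, gr g • m = m := by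
    intro g
    refine sl_induction (P := fun g => ∀ m : M, gr g • m = m) hu hl ?_ g
    intro g h hg hh m
    rw [gr_mul_smul, hh, hg]
  exact key g m

/-- A weight vector outside the image of `nil` is detected by a `U`-invariant weight functional. -/
lemma exists_wt_functional {b : ℤ} {v : M} (hw : IsWt p b v)
    (hv : v ∉ LinearMap.range (act M (nil : GroupAlg p))) :
    ∃ φ : M →ₗ[ZMod p] ZMod p, (∀ (c : ZMod p) m, φ (gr (upper c) • m) = φ m) ∧
      (∀ (t : (ZMod p)ˣ) m, φ (gr (torus t) • m) = ((t ^ b : (ZMod p)ˣ) : ZMod p) * φ m) ∧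
      φ v = 1 := by
  -- Any functional vanishing on the image of `nil` is $U$-invariant. Composing with the weight
  -- projector keeps this property, because the torus preserves that image.
  obtain ⟨φ, hφ, hk⟩ := Submodule.exists_le_ker_of_notMem hv
  have h0 : ∀ m : M, φ ((nil : GroupAlg p) • m) = 0 := fun m => hk ⟨m, rfl⟩
  have h1 : ∀ m : M, φ ((wproj b : GroupAlg p) • (nil : GroupAlg p) • m) = 0 := by
    intro m
    rw [wproj, neg_smul, map_neg, Finset.sum_smul, map_sum, Finset.sum_eq_zero, neg_zero]
    intro t _
    obtain ⟨r, hr⟩ := exists_gr_torus_mul_nil t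
    rw [smul_assoc, map_smul, smul_smul, hr, mul_smul, h0, smul_zero]
  have hcomm : ∀ t : (ZMod p)ˣ, wproj b * gr (torus t) =
      ((t ^ b : (ZMod p)ˣ) : ZMod p) • wproj b := by
    intro t
    rw [← gr_torus_mul_wproj, wproj, mul_neg, neg_mul, Finset.mul_sum, Finset.sum_mul]
    congr 1
    refine Finset.sum_congr rfl fun s _ => ?_
    rw [smul_mul_assoc, mul_smul_comm, ← gr_mul, ← gr_mul, torus_mul, torus_mul, mul_comm]
  refine ⟨(φ v)⁻¹ • φ ∘ₗ act M (wproj b), ?_, ?_, ?_⟩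
  · intro c m
    obtain ⟨r, _, hr⟩ := gr_upper_sub_one c
    have e : gr (upper c) • m = m + (nil : GroupAlg p) • r • m := by
      rw [← mul_smul, ← hr, sub_smul, one_smul]; abel
    rw [e]
    simp [smul_add, h1]
  · intro t m
    simp only [LinearMap.smul_apply, LinearMap.comp_apply, act_apply, smul_smul, hcomm, smul_assoc,
      map_smul, smul_eq_mul]
    ring
  · simp [wproj_smul_of_isWt hw, hφ]

lemma toFunMod_mem_homFun {a : ℕ} (ha : 1 ≤ a) (φ : M →ₗ[ZMod p] ZMod p)
    (hφ : ∀ (c : ZMod p) m, φ (gr (upper c) • m) = φ m)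
    (hφw : ∀ (t : (ZMod p)ˣ) m,
      φ (gr (torus t) • m) = ((t ^ (-(a : ℤ)) : (ZMod p)ˣ) : ZMod p) * φ m) (m : M) :
    toFunMod (p := p) φ hφ m ∈ homFun p a := by
  rw [mem_homFun]
  intro c x
  by_cases hx : x = 0
  · subst hx; rw [smul_zero, ev_zero_toFunMod, mul_zero]
  by_cases hc : c = 0
  · subst hc; rw [zero_smul, ev_zero_toFunMod, zero_pow (by omega), zero_mul]
  obtain ⟨t, rfl⟩ : ∃ t : (ZMod p)ˣ, (t : ZMod p) = c := ⟨Units.mk0 c hc, rfl⟩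
  have hcx : (t : ZMod p) • x ≠ 0 := units_smul_ne_zero hx t
  rw [ev_toFunMod _ _ _ hcx, ev_toFunMod _ _ _ hx]
  obtain ⟨d, hd⟩ : ∃ d, sec ((t : ZMod p) • x) = upper d * (torus t⁻¹ * sec x) := by
    apply exists_upper_mul
    rw [sec_row hcx, row_mul, ← sec_row hx]
    simp only [sec_row hx]
    ext i; fin_cases i <;> simp [torus_coe, Matrix.vecMul, dotProduct, Fin.sum_univ_two, Matrix.mul_apply, sec_row hx]
  rw [hd, gr_mul_smul, gr_mul_smul, hφ, hφw]
  simp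

/-- The function supported on the multiples of $(0,1)$ is sent to $p-1=-1$ copies of $v$; its
negative is the preimage. -/
lemma exists_fromFun_eq {a : ℕ} (ha : 1 ≤ a) {v : M} (hv : v ∈ fixU p M)
    (hw : IsWt p (-(a : ℤ)) v) : ∃ f ∈ homFun p a, fromFun (p := p) v hv f = v := by
  refine ⟨-mkFun fun x => if x 0 = 0 then x 1 ^ a else 0, ?_, ?_⟩
  · refine neg_mem ?_
    rw [mem_homFun]
    intro c x
    simp only [ev_mkFun, Pi.smul_apply, smul_eq_mul]
    by_cases hc : c = 0
    · simp [hc, zero_pow (show a ≠ 0 by omega)]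
    · by_cases hx : x 0 = 0 <;> simp [hc, hx, mul_pow]
  · rw [map_neg, fromFun_apply]
    have h1 : ∑ x ∈ rows p, ev x (mkFun fun x => if x 0 = 0 then x 1 ^ a else 0) •
          gr (sec x)⁻¹ • v =
        ∑ x ∈ rows p with detForm ![0, 1] x = 0, x 1 ^ a • gr (sec x)⁻¹ • v := by
      rw [Finset.sum_filter]
      refine Finset.sum_congr rfl fun x _ => ?_
      have : detForm ![0, 1] x = 0 ↔ x 0 = 0 := by simp [detForm]
      simp only [ev_mkFun, this]
      split_ifs <;> simp
    rw [h1, sum_units_smul (y := ![0, 1]) (by intro h; simpa using congrFun h 1)]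
    have h2 : ∀ c : (ZMod p)ˣ, ((c • ![0, 1] : Fin 2 → ZMod p) 1) ^ a •
        gr (sec (c • ![0, 1] : Fin 2 → ZMod p))⁻¹ • v = v := by
      intro c
      have e : sec (c • ![0, 1] : Fin 2 → ZMod p) = torus c⁻¹ := by
        have hne : (c • ![0, 1] : Fin 2 → ZMod p) ≠ 0 :=
          units_smul_ne_zero (by intro h; simpa using congrFun h 1) c
        rw [sec, dif_neg (by simp), dif_pos (by simp [Units.smul_def])]
        apply sl_ext <;> simp [slMk_coe, torus_coe, Units.smul_def]
      rw [e, torus_inv, inv_inv, hw c, smul_smul]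
      have : ((c • ![0, 1] : Fin 2 → ZMod p) 1) = (c : ZMod p) := by simp [Units.smul_def]
      rw [this, zpow_neg, zpow_natCast, ← Units.val_pow_eq_pow_val, ← Units.val_mul,
        mul_inv_cancel, Units.val_one, one_smul]
    rw [Finset.sum_congr rfl fun c _ => h2 c, Finset.sum_const, Finset.card_univ,
      ← Nat.cast_smul_eq_nsmul (ZMod p), ← neg_smul, card_units_smul_neg, one_smul]

end Modules

/-! ### Dimension and `U`-fixed functions -/

lemma ev_upper_smul (c : ZMod p) (f : FunMod p) (x : Fin 2 → ZMod p) :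
    ev x (gr (upper c) • f) = ev ![x 0, c * x 0 + x 1] f := by
  rw [ev_gr_smul]
  congr 2
  ext i; fin_cases i <;> simp [upper_coe, Matrix.vecMul, dotProduct, Fin.sum_univ_two, mul_comm]

lemma ev_eq_pow_mul {a : ℕ} {f : FunMod p} (hf : f ∈ homFun p a) {x : Fin 2 → ZMod p}
    (hx : x 0 ≠ 0) : ev x f = x 0 ^ a * ev ![1, (x 0)⁻¹ * x 1] f := by
  rw [← mem_homFun.1 hf]
  congr 2
  ext i; fin_cases i <;> simp [hx]

lemma ev_eq_pow_mul' {a : ℕ} {f : FunMod p} (hf : f ∈ homFun p a) {x : Fin 2 → ZMod p}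
    (hx : x 0 = 0) : ev x f = x 1 ^ a * ev ![0, 1] f := by
  rw [← mem_homFun.1 hf]
  congr 2
  ext i; fin_cases i <;> simp [hx]

/-- A homogeneous function of positive degree vanishes at $0$ and is determined by arbitrary values
at the representatives $(1,c)$ and $(0,1)$ of the $p+1$ points of the projective line. -/
lemma finrank_homFun {a : ℕ} (ha : 1 ≤ a) :
    Module.finrank (ZMod p) (homFun p a) = p + 1 := by
  let L : homFun p a →ₗ[ZMod p] (ZMod p → ZMod p) × ZMod p :=
    (LinearMap.prod (LinearMap.pi fun c => ev ![1, c]) (ev ![0, 1])) ∘ₗ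
      (homFun p a).subtype.restrictScalars (ZMod p)
  have hL : Function.Bijective L := by
    constructor
    · rw [← LinearMap.ker_eq_bot, LinearMap.ker_eq_bot']
      intro f hf
      have h1 : ∀ c, ev ![1, c] f.1 = 0 := fun c => congrFun (congrArg Prod.fst hf) c
      have h2 : ev ![0, 1] f.1 = 0 := congrArg Prod.snd hf
      apply Subtype.ext
      apply fun_ext
      intro x
      rw [ZeroMemClass.coe_zero, map_zero]
      by_cases hx : x 0 = 0
      · rw [ev_eq_pow_mul' f.2 hx, h2, mul_zero]
      · rw [ev_eq_pow_mul f.2 hx, h1, mul_zero]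
    · rintro ⟨g, c⟩
      refine ⟨⟨mkFun fun x => if x 0 = 0 then x 1 ^ a * c else x 0 ^ a * g ((x 0)⁻¹ * x 1), ?_⟩, ?_⟩
      · rw [mem_homFun]
        intro d x
        simp only [ev_mkFun, Pi.smul_apply, smul_eq_mul]
        by_cases hd : d = 0
        · simp [hd, zero_pow (show a ≠ 0 by omega)]
        · by_cases hx : x 0 = 0
          · simp [hd, hx, mul_pow, mul_assoc]
          · have : (d * x 0)⁻¹ * (d * x 1) = (x 0)⁻¹ * x 1 := by field_simp
            simp [hd, hx, mul_pow, mul_assoc, this]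
      · ext d
        · simp [L]
        · simp [L]
  rw [(LinearEquiv.ofBijective L hL).finrank_eq]
  simp [Module.finrank_prod, Module.finrank_pi, ZMod.card]

instance : FiniteDimensional (ZMod p) (FunMod p) :=
  inferInstanceAs (FiniteDimensional (ZMod p) ((Fin 2 → ZMod p) → ZMod p))

lemma evalMap_mem_homFun {a : ℕ} (f : SymMod p a) : evalMap a f ∈ homFun p a := by
  rw [mem_homFun]
  intro c x
  have h : ev (c • x) ∘ₗ (evalMap a).restrictScalars (ZMod p) =
      c ^ a • ev x ∘ₗ (evalMap (p := p) a).restrictScalars (ZMod p) := by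
    apply symMod_linear_ext
    intro s
    have e : c ^ a = c ^ (a - s.val) * c ^ s.val := by rw [← pow_add]; congr 1; omega
    simp [ev_evalMap, symVal_symMono, e, mul_pow]
    ring
  exact LinearMap.congr_fun h f

lemma evalMap_injective {a : ℕ} (ha : a < p) : Function.Injective (evalMap (p := p) a) := by
  have := isSimpleModule_symMod ha
  refine (LinearMap.injective_or_eq_zero (R := GroupAlg p) (M := SymMod p a) (N := FunMod p) (evalMap a)).resolve_right fun h => ?_
  have h1 := ev_evalMap_symMono_zero (p := p) a ![1, 0]
  rw [h] at h1
  simp at h1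

lemma finrank_range_evalMap {a : ℕ} (ha : a < p) :
    Module.finrank (ZMod p) (LinearMap.range (evalMap (p := p) a)) = a + 1 := by
  rw [← finrank_symMod ha]
  exact (((LinearEquiv.ofInjective _ (evalMap_injective ha)).restrictScalars (ZMod p)).finrank_eq).symm

/-- A `U`-fixed homogeneous function vanishing at `(0, 1)` is a monomial. -/
lemma eq_smul_evalMap {a : ℕ} {f : FunMod p} (hf : f ∈ homFun p a) (hU : f ∈ fixU p (FunMod p))
    (h : ev ![0, 1] f = 0) : f = ev ![1, 0] f • evalMap a (symMono a 0) := by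
  apply fun_ext
  intro x
  rw [map_smul, ev_evalMap_symMono_zero, smul_eq_mul]
  by_cases hx : x 0 = 0
  · rw [ev_eq_pow_mul' hf hx, h, mul_zero, hx]
    by_cases ha : a = 0
    · subst ha
      have h1 := mem_homFun.1 hf 0 ![0, 1]
      have h2 := mem_homFun.1 hf 0 ![1, 0]
      simp at h1 h2
      rw [← h2, h1, h]; simp
    · rw [zero_pow ha, mul_zero]
  · rw [ev_eq_pow_mul hf hx, mul_comm]
    congr 1
    have h1 := ev_upper_smul ((x 0)⁻¹ * x 1) f ![1, 0]
    rw [mem_fixU_iff.1 hU] at h1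
    simpa using h1.symm

/-- Evaluation at $(0,1)$ transforms under the torus by $t^{-a}$, so a nonzero value fixes the
weight. -/
lemma homFun_wt {a : ℕ} {b : ℤ} {f : FunMod p} (hf : f ∈ homFun p a) (hw : IsWt p b f)
    (h : ev ![0, 1] f ≠ 0) : ((p : ℤ) - 1) ∣ b - (-(a : ℤ)) := by
  refine dvd_of_forall_zpow_eq fun t => ?_
  have h1 := congrArg (ev ![0, 1]) (hw t)
  rw [ev_gr_smul, map_smul, smul_eq_mul] at h1
  have h2 : Matrix.vecMul ![0, 1] (torus t).1 = ((t⁻¹ : (ZMod p)ˣ) : ZMod p) • ![0, 1] := by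
    ext i; fin_cases i <;> simp [torus_coe, Matrix.vecMul, dotProduct, Fin.sum_univ_two]
  rw [h2, mem_homFun.1 hf] at h1
  have h3 := mul_right_cancel₀ h h1
  ext
  rw [← h3]
  simp

/-- A submodule containing a `U`-fixed weight function which does not vanish at `(0, 1)`. -/
lemma homFun_le_of_mem {a : ℕ} (ha : 1 ≤ a) (ha' : a ≤ p - 2) (hp : 2 < p)
    {N : Submodule (GroupAlg p) (FunMod p)} (hN : N ≤ homFun p a) {b : ℤ} {f : FunMod p}
    (hf : f ∈ N) (hU : f ∈ fixU p (FunMod p)) (hw : IsWt p b f) (h : ev ![0, 1] f ≠ 0) :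
    homFun p a ≤ N := by
  have hw' := hw.congr (homFun_wt (hN hf) hw h)
  intro g hg
  let M := homFun p a
  -- The splitting is applied to `homFun p a` itself, with $v$ the normalized function and $\varphi$
  -- the evaluation at $(0,1)$.
  let v : M := (ev ![0, 1] f)⁻¹ • ⟨f, hN hf⟩
  have hv : v ∈ fixU p M := Submodule.smul_mem _ _ (coe_mem_fixU.1 hU)
  have hwv : IsWt p (-(a : ℤ)) v := (IsWt.coe.1 hw').smul _
  let φ : M →ₗ[ZMod p] ZMod p := ev ![0, 1] ∘ₗ (homFun p a).subtype.restrictScalars (ZMod p)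
  have hφv : ∀ m : M, φ m = ev ![0, 1] (m : FunMod p) := fun _ => rfl
  have hφ : ∀ (c : ZMod p) m, φ (gr (upper c) • m) = φ m := by
    intro c m
    rw [hφv, hφv, Submodule.coe_smul, ev_upper_smul]; simp
  have hφw : ∀ (t : (ZMod p)ˣ) m,
      φ (gr (torus t) • m) = ((t ^ (-(a : ℤ)) : (ZMod p)ˣ) : ZMod p) * φ m := by
    intro t m
    have h2 : Matrix.vecMul ![0, 1] (torus t).1 = ((t⁻¹ : (ZMod p)ˣ) : ZMod p) • ![0, 1] := by
      ext i; fin_cases i <;> simp [torus_coe, Matrix.vecMul, dotProduct, Fin.sum_univ_two]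
    rw [hφv, hφv, Submodule.coe_smul, ev_gr_smul, h2, mem_homFun.1 m.2]
    simp
  have h1 : φ v = 1 := by
    rw [hφv]
    change ev ![0, 1] ((ev ![0, 1] f)⁻¹ • f) = 1
    rw [map_smul, smul_eq_mul, inv_mul_cancel₀ h]
  obtain ⟨f', hf', e⟩ := exists_toFunMod_fromFun_eq ha ha' hp hv hwv φ hφ hφw h1 hg
  -- For this functional the coinduced map is the inclusion, so surjectivity of the composite says
  -- that the translates of $v$ span.
  have key : ∀ m : M, toFunMod φ hφ m = (m : FunMod p) := by
    intro m
    apply fun_ext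
    intro x
    by_cases hx : x = 0
    · subst hx
      rw [ev_zero_toFunMod]
      have := mem_homFun.1 m.2 0 0
      rw [zero_pow (by omega), zero_mul, zero_smul] at this
      exact this.symm
    · rw [ev_toFunMod _ _ _ hx, hφv, Submodule.coe_smul, ev_gr_smul]
      congr 2
      conv_rhs => rw [← sec_row hx]
      ext i; simp [Matrix.vecMul, dotProduct, Fin.sum_univ_two]
  rw [key, fromFun_apply] at e
  rw [← e]
  have hvN : (v : FunMod p) ∈ N := N.smul_of_tower_mem _ hf
  rw [AddSubmonoidClass.coe_finsetSum]
  refine N.sum_mem fun x _ => ?_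
  exact N.smul_of_tower_mem _ (N.smul_mem _ hvN)

/-! ### Submodules of the induced modules, and the simple modules -/

lemma detForm_vecMul (y x : Fin 2 → ZMod p) (g : SL(2, ZMod p)) :
    detForm (Matrix.vecMul y g.1) (Matrix.vecMul x g.1) = detForm y x := by
  have := sl_det g
  simp only [detForm, Matrix.vecMul, dotProduct, Fin.sum_univ_two]
  linear_combination (y 0 * x 1 - y 1 * x 0) * this

lemma finrank_add_finrank_le_of_inf_eq_bot {M : Type*} [AddCommGroup M] [Module (ZMod p) M]
    [Module (GroupAlg p) M] [IsScalarTower (ZMod p) (GroupAlg p) M] [FiniteDimensional (ZMod p) M]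
    {N N' P : Submodule (GroupAlg p) M} (h : N ≤ P) (h' : N' ≤ P) (hi : N ⊓ N' = ⊥) :
    Module.finrank (ZMod p) N + Module.finrank (ZMod p) N' ≤ Module.finrank (ZMod p) P := by
  have h1 := Submodule.finrank_sup_add_finrank_inf_eq (N.restrictScalars (ZMod p))
    (N'.restrictScalars (ZMod p))
  have h2 : N.restrictScalars (ZMod p) ⊓ N'.restrictScalars (ZMod p) = ⊥ := by
    ext x
    exact (SetLike.ext_iff.1 hi x)
  rw [h2, finrank_bot, add_zero] at h1
  have h3 := Submodule.finrank_mono (sup_le (show N.restrictScalars (ZMod p) ≤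
    P.restrictScalars (ZMod p) from h) (show N'.restrictScalars (ZMod p) ≤ _ from h'))
  rw [h1] at h3
  exact h3

/-- The intertwining operator, as a homomorphism. -/
def intertwinerMap (p : ℕ) [Fact p.Prime] (b : ℕ) : FunMod p →ₗ[GroupAlg p] FunMod p :=
  equivariantMap
    { toFun := intertwiner b
      map_add' := intertwiner_add b
      map_smul' := intertwiner_smul b }
    (by
      intro g f
      apply fun_ext
      intro y
      simp only [LinearMap.coe_mk, AddHom.coe_mk, ev_gr_smul, ev_intertwiner]
      refine Fintype.sum_bijective (fun x => Matrix.vecMul x g.1) ?_ _ _ fun x => ?_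
      · exact Function.bijective_iff_has_inverse.2 ⟨fun x => Matrix.vecMul x g⁻¹.1,
          fun x => vecMul_vecMul_inv x g, fun x => vecMul_inv_vecMul x g⟩
      · rw [detForm_vecMul])

lemma ev_intertwinerMap (b : ℕ) (f : FunMod p) (y : Fin 2 → ZMod p) :
    ev y (intertwinerMap p b f) = ∑ x, ev x f * detForm y x ^ b := rfl

/-- For fixed $x$ the kernel $\det(y,x)^b$ is a homogeneous polynomial of degree $b$ in $y$. -/
lemma range_intertwinerMap_le (b : ℕ) :
    LinearMap.range (intertwinerMap p b) ≤ LinearMap.range (evalMap (p := p) b) := by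
  rintro _ ⟨f, rfl⟩
  let L : (Fin 2 → ZMod p) → MvPolynomial (Fin 2) (ZMod p) := fun x =>
    MvPolynomial.C (x 1) * MvPolynomial.X 0 - MvPolynomial.C (x 0) * MvPolynomial.X 1
  have hL : ∀ x, (L x).IsHomogeneous 1 := fun x =>
    (MvPolynomial.isHomogeneous_C_mul_X _ _).sub (MvPolynomial.isHomogeneous_C_mul_X _ _)
  have hP : ∑ x, ev x f • L x ^ b ∈ MvPolynomial.homogeneousSubmodule (Fin 2) (ZMod p) b := by
    refine Submodule.sum_mem _ fun x _ => Submodule.smul_mem _ _ ?_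
    rw [MvPolynomial.mem_homogeneousSubmodule]
    simpa using (hL x).pow b
  refine ⟨symMk _ hP, ?_⟩
  apply fun_ext
  intro y
  rw [ev_evalMap, symVal_symMk, ev_intertwinerMap, map_sum]
  refine Finset.sum_congr rfl fun x _ => ?_
  rw [MvPolynomial.smul_eval, map_pow]
  simp [L, detForm, mul_comm]

/-- The function $x_0^a$ is itself a power of the determinant form with $(0,1)$, so this is a
vanishing convolution of two such powers. -/
lemma intertwinerMap_evalMap {a b : ℕ} (h : a + b < 2 * (p - 1)) :
    intertwinerMap p b (evalMap a (symMono a 0)) = 0 := by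
  apply fun_ext
  intro z
  rw [ev_intertwinerMap, map_zero, ← sum_detForm_pow (x := ![0, 1]) (z := z) h]
  refine Finset.sum_congr rfl fun x _ => ?_
  rw [ev_evalMap_symMono_zero]
  simp [detForm]

/-- The homogeneous function supported on the multiples of `(0, 1)`. -/
def deltaFun (p : ℕ) [Fact p.Prime] (a : ℕ) : FunMod p :=
  mkFun fun x => if x 0 = 0 then x 1 ^ a else 0

lemma deltaFun_mem {a : ℕ} (ha : 1 ≤ a) : deltaFun p a ∈ homFun p a := by
  rw [mem_homFun]
  intro c x
  simp only [deltaFun, ev_mkFun, Pi.smul_apply, smul_eq_mul]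
  by_cases hc : c = 0
  · simp [hc, zero_pow (show a ≠ 0 by omega)]
  · by_cases hx : x 0 = 0 <;> simp [hc, hx, mul_pow]

/-- The value at $(1,0)$ is $\sum_c c^{a+b}=\sum_c c^{p-1}=-1$, where the hypothesis on $a+b$
enters. -/
lemma intertwinerMap_deltaFun_ne_zero {a b : ℕ} (ha : 1 ≤ a) (h : a + b = p - 1) :
    intertwinerMap p b (deltaFun p a) ≠ 0 := by
  intro h0
  have h1 := congrArg (ev ![1, 0]) h0
  rw [ev_intertwinerMap, map_zero] at h1
  have h2 : ∑ x, ev x (deltaFun p a) * detForm ![1, 0] x ^ b =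
      ∑ x ∈ rows p with detForm ![0, 1] x = 0, x 1 ^ (p - 1) := by
    rw [Finset.sum_filter, rows, ← Finset.add_sum_erase _ _ (Finset.mem_univ 0)]
    have h3 : ev 0 (deltaFun p a) = 0 := by
      simp [deltaFun, zero_pow (show a ≠ 0 by omega)]
    rw [h3, zero_mul, zero_add]
    refine Finset.sum_congr rfl fun x _ => ?_
    have : detForm ![0, 1] x = 0 ↔ x 0 = 0 := by simp [detForm]
    simp only [this, deltaFun, ev_mkFun]
    split_ifs
    · simp [detForm, ← pow_add, h]
    · simp
  rw [h2, sum_units_smul (y := ![0, 1]) (by intro h; simpa using congrFun h 1)] at h1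
  have h4 : ∀ c : (ZMod p)ˣ, ((c • ![0, 1] : Fin 2 → ZMod p) 1) ^ (p - 1) = 1 := by
    intro c
    have : ((c • ![0, 1] : Fin 2 → ZMod p) 1) = (c : ZMod p) := by simp [Units.smul_def]
    rw [this, ZMod.pow_card_sub_one_eq_one c.ne_zero]
  rw [Finset.sum_congr rfl fun c _ => h4 c, Finset.sum_const, Finset.card_univ, nsmul_eq_mul,
    mul_one] at h1
  have := card_units_smul_neg (p := p)
  rw [h1] at this
  simp at this

lemma range_evalMap_le (a : ℕ) : LinearMap.range (evalMap (p := p) a) ≤ homFun p a := by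
  rintro _ ⟨f, rfl⟩; exact evalMap_mem_homFun f

lemma isSimpleModule_range {R M N : Type*} [Ring R] [AddCommGroup M] [Module R M]
    [AddCommGroup N] [Module R N] [IsSimpleModule R M] {f : M →ₗ[R] N}
    (hf : Function.Injective f) : IsSimpleModule R (LinearMap.range f) :=
  IsSimpleModule.congr (LinearEquiv.ofInjective f hf).symm

lemma isSimpleModule_range_evalMap {a : ℕ} (ha : a < p) :
    IsSimpleModule (GroupAlg p) (LinearMap.range (evalMap (p := p) a)) := by
  have := isSimpleModule_symMod ha
  exact isSimpleModule_range (M := SymMod p a) (N := FunMod p) (evalMap_injective ha)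

lemma le_of_inf_ne_bot {R M : Type*} [Ring R] [AddCommGroup M] [Module R M] {S N : Submodule R M}
    [hS : IsSimpleModule R S] (h : S ⊓ N ≠ ⊥) : S ≤ N := by
  have := isSimpleModule_iff_isAtom.1 hS
  rcases this.le_iff.1 (inf_le_left : S ⊓ N ≤ S) with h1 | h1
  · exact absurd h1 h
  · exact inf_eq_left.1 h1

lemma finrank_mono_submodule {M : Type*} [AddCommGroup M] [Module (ZMod p) M]
    [Module (GroupAlg p) M] [IsScalarTower (ZMod p) (GroupAlg p) M] [FiniteDimensional (ZMod p) M]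
    {N N' : Submodule (GroupAlg p) M} (h : N ≤ N') :
    Module.finrank (ZMod p) N ≤ Module.finrank (ZMod p) N' :=
  Submodule.finrank_mono (s := N.restrictScalars (ZMod p)) (t := N'.restrictScalars (ZMod p)) h

lemma eq_of_le_of_finrank_submodule {M : Type*} [AddCommGroup M] [Module (ZMod p) M]
    [Module (GroupAlg p) M] [IsScalarTower (ZMod p) (GroupAlg p) M] [FiniteDimensional (ZMod p) M]
    {N N' : Submodule (GroupAlg p) M} (h : N ≤ N')
    (h2 : Module.finrank (ZMod p) N' ≤ Module.finrank (ZMod p) N) : N = N' := by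
  have := Submodule.eq_of_le_of_finrank_le (S₁ := N.restrictScalars (ZMod p))
    (S₂ := N'.restrictScalars (ZMod p)) h h2
  exact SetLike.coe_injective (congrArg (fun W : Submodule (ZMod p) M => (W : Set M)) this)

lemma finrank_map_add_finrank_inf_ker {M N : Type*} [AddCommGroup M] [Module (ZMod p) M]
    [Module (GroupAlg p) M] [IsScalarTower (ZMod p) (GroupAlg p) M] [FiniteDimensional (ZMod p) M]
    [AddCommGroup N] [Module (ZMod p) N] [Module (GroupAlg p) N]
    [IsScalarTower (ZMod p) (GroupAlg p) N] (P : Submodule (GroupAlg p) M)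
    (f : M →ₗ[GroupAlg p] N) :
    Module.finrank (ZMod p) (P.map f) +
      Module.finrank (ZMod p) (P ⊓ LinearMap.ker f : Submodule (GroupAlg p) M) =
      Module.finrank (ZMod p) P := by
  let g : P →ₗ[GroupAlg p] N := f.domRestrict P
  have : FiniteDimensional (ZMod p) P :=
    inferInstanceAs (FiniteDimensional (ZMod p) (P.restrictScalars (ZMod p)))
  have h1 := (g.restrictScalars (ZMod p)).finrank_range_add_finrank_ker
  rw [← h1]
  congr 1
  · change _ = Module.finrank (ZMod p) (LinearMap.range g)
    rw [LinearMap.range_domRestrict]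
  · change _ = Module.finrank (ZMod p) (LinearMap.ker g)
    have e : LinearMap.ker g = (P ⊓ LinearMap.ker f).submoduleOf P := by
      ext x; simp [g, Submodule.submoduleOf]
    rw [e]
    exact (((Submodule.submoduleOfEquivOfLe (inf_le_left : P ⊓ LinearMap.ker f ≤ P)).restrictScalars
      (ZMod p)).finrank_eq).symm

lemma map_intertwinerMap_homFun {a b : ℕ} (ha : 1 ≤ a) (h : a + b = p - 1) :
    (homFun p a).map (intertwinerMap p b) = LinearMap.range (evalMap (p := p) b) := by
  have := isSimpleModule_range_evalMap (p := p) (a := b) (by omega)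
  refine le_antisymm (LinearMap.map_le_range.trans (range_intertwinerMap_le b)) ?_
  apply le_of_inf_ne_bot
  rw [inf_eq_right.2 (LinearMap.map_le_range.trans (range_intertwinerMap_le b))]
  intro h0
  have : intertwinerMap p b (deltaFun p a) ∈ (homFun p a).map (intertwinerMap p b) :=
    Submodule.mem_map_of_mem (deltaFun_mem ha)
  rw [h0] at this
  exact intertwinerMap_deltaFun_ne_zero ha h this

/-- The simple submodule $\mathrm{Sym}^a$ contains a nonzero vector of the kernel, hence lies in it;
equality follows from $p+1=(a+1)+(b+1)$. -/
lemma ker_intertwinerMap_homFun {a b : ℕ} (ha : 1 ≤ a) (h : a + b = p - 1) :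
    homFun p a ⊓ LinearMap.ker (intertwinerMap p b) = LinearMap.range (evalMap (p := p) a) := by
  have hp := (Fact.out : p.Prime).two_le
  have := isSimpleModule_range_evalMap (p := p) (a := a) (by omega)
  symm
  apply eq_of_le_of_finrank_submodule
  · refine le_inf (range_evalMap_le a) (le_of_inf_ne_bot ?_)
    rw [Submodule.ne_bot_iff]
    refine ⟨evalMap a (symMono a 0), ⟨⟨_, rfl⟩, intertwinerMap_evalMap (by omega)⟩, ?_⟩
    intro h0
    exact symMono_zero_ne_zero (p := p) a
      (evalMap_injective (by omega) (h0.trans (map_zero (evalMap a)).symm))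
  · rw [finrank_range_evalMap (by omega)]
    have h1 := finrank_map_add_finrank_inf_ker (M := FunMod p) (N := FunMod p) (homFun p a)
      (intertwinerMap p b)
    rw [map_intertwinerMap_homFun ha h, finrank_range_evalMap (by omega), finrank_homFun ha] at h1
    omega

/-- The submodules of the induced modules. -/
lemma homFun_submodule_cases {a : ℕ} (ha : 1 ≤ a) (ha' : a ≤ p - 2)
    {N : Submodule (GroupAlg p) (FunMod p)} (hN : N ≤ homFun p a) :
    N = ⊥ ∨ N = LinearMap.range (evalMap (p := p) a) ∨ N = homFun p a := by
  have hp := (Fact.out : p.Prime).two_le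
  by_cases h0 : N = ⊥
  · exact Or.inl h0
  right
  obtain ⟨b, n, hb, hnN, hn0, hn, hw⟩ := exists_mem_fixU_of_ne_bot h0
  -- A $U$-fixed weight vector not vanishing at $(0,1)$ generates everything. One that vanishes
  -- there is a multiple of $x_0^a$ and puts $\mathrm{Sym}^a$ inside $N$.
  by_cases h1 : ev ![0, 1] n = 0
  · have h2 := eq_smul_evalMap (hN hnN) hn h1
    have := isSimpleModule_range_evalMap (p := p) (a := a) (by omega)
    have hS : LinearMap.range (evalMap (p := p) a) ≤ N := by
      apply le_of_inf_ne_bot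
      rw [Submodule.ne_bot_iff]
      refine ⟨n, ⟨?_, hnN⟩, hn0⟩
      rw [h2]
      exact Submodule.smul_of_tower_mem _ _ ⟨_, rfl⟩
    obtain ⟨c, hc⟩ : ∃ c, a + c = p - 1 := ⟨p - 1 - a, by omega⟩
    have := isSimpleModule_range_evalMap (p := p) (a := c) (by omega)
    -- With $\mathrm{Sym}^a\le N$, only the image of $N$ in the simple quotient $\mathrm{Sym}^c$
    -- remains to be decided.
    by_cases h3 : N.map (intertwinerMap p c) = ⊥
    · left
      refine le_antisymm ?_ hS
      rw [← ker_intertwinerMap_homFun ha hc]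
      exact le_inf hN (LinearMap.le_ker_iff_map.2 h3)
    · right
      refine le_antisymm hN ?_
      have h4 : LinearMap.range (evalMap (p := p) c) ≤ N.map (intertwinerMap p c) := by
        apply le_of_inf_ne_bot
        rwa [inf_eq_right.2 (LinearMap.map_le_range.trans (range_intertwinerMap_le c))]
      rw [← map_intertwinerMap_homFun ha hc] at h4
      intro f hf
      obtain ⟨n, hn, e⟩ := h4 (Submodule.mem_map_of_mem hf)
      have h5 : f - n ∈ N := by
        apply hS
        rw [← ker_intertwinerMap_homFun ha hc]
        exact ⟨sub_mem hf (hN hn), (map_sub (intertwinerMap p c) f n).trans (by rw [e, sub_self])⟩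
      simpa using add_mem h5 hn
  · right
    exact le_antisymm hN (homFun_le_of_mem ha ha' (by omega) hN hnN hn hw h1)

lemma sec_e1 : sec (![0, 1] : Fin 2 → ZMod p) = 1 := by
  rw [sec, dif_neg (by simp), dif_pos (by simp)]
  apply sl_ext <;> simp [slMk_coe]

/-! ### Classification of the simple modules. -/

section Modules

variable {M : Type*} [AddCommGroup M] [Module (ZMod p) M] [Module (GroupAlg p) M]
  [IsScalarTower (ZMod p) (GroupAlg p) M]

lemma nil_range_ne_top [Nontrivial M] : LinearMap.range (act M (nil : GroupAlg p)) ≠ ⊤ := by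
  intro h
  obtain ⟨n, hn⟩ := isNilpotent_act_nil (p := p) (M := M)
  have h1 := LinearMap.range_eq_top.1 h
  have h2 : Function.Surjective (act M (nil : GroupAlg p) ^ n) := by
    rw [Module.End.coe_pow]; exact h1.iterate n
  rw [hn] at h2
  obtain ⟨m, hm⟩ := exists_ne (0 : M)
  obtain ⟨x, hx⟩ := h2 m
  exact hm hx.symm

lemma exists_isWt_notMem_range {v : M} (hv : v ∉ LinearMap.range (act M (nil : GroupAlg p))) :
    ∃ b : ℕ, b < p - 1 ∧
      (wproj (b : ℤ) : GroupAlg p) • v ∉ LinearMap.range (act M (nil : GroupAlg p)) :=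
  exists_wproj_notMem (LinearMap.range (act M (nil : GroupAlg p))).toAddSubgroup hv

/-- Weights are rewritten as $-a$ with $a=p-1-b$, so that $b<p-1$ gives the positive degree $a$
required by `homFun p a`; in particular $b=0$ becomes $a=p-1$, not $0$. -/
lemma IsWt.neg_of_nat {b : ℕ} {v : M} (hw : IsWt p (b : ℤ) v) (hb : b ≤ p - 1) :
    IsWt p (-((p - 1 - b : ℕ) : ℤ)) v := by
  have hp := (Fact.out : p.Prime).one_le
  refine hw.congr ⟨1, ?_⟩
  rw [Nat.cast_sub hb, Nat.cast_sub hp]; push_cast; ring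

lemma ev_toFunMod_e1 (φ : M →ₗ[ZMod p] ZMod p) (hφ : ∀ (c : ZMod p) m, φ (gr (upper c) • m) = φ m)
    (m : M) : ev ![0, 1] (toFunMod (p := p) φ hφ m) = φ m := by
  rw [ev_toFunMod _ _ _ (by intro h; simpa using congrFun h 1), sec_e1, gr_one, one_smul]

lemma gr_smul_of_finrank_le_one [FiniteDimensional (ZMod p) M]
    (h : Module.finrank (ZMod p) M ≤ 1) (g : SL(2, ZMod p)) (m : M) : gr g • m = m := by
  rcases subsingleton_or_nontrivial M with _ | _
  · exact Subsingleton.elim _ _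
  · refine gr_smul_of_fixU_eq_top ?_ g m
    apply Submodule.eq_top_of_finrank_eq
    have h1 := Submodule.finrank_le (fixU p M)
    have h2 : Module.finrank (ZMod p) (fixU p M) ≠ 0 := by
      rw [Ne, Submodule.finrank_eq_zero]; exact fixU_ne_bot
    omega

lemma nonempty_equiv_of_finrank_eq_one {N : Type*} [AddCommGroup N] [Module (ZMod p) N]
    [Module (GroupAlg p) N] [IsScalarTower (ZMod p) (GroupAlg p) N]
    (h : Module.finrank (ZMod p) M = 1) (h2 : Module.finrank (ZMod p) N = 1) :
    Nonempty (M ≃ₗ[GroupAlg p] N) := by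
  have : FiniteDimensional (ZMod p) M := FiniteDimensional.of_finrank_pos (by omega)
  have : FiniteDimensional (ZMod p) N := FiniteDimensional.of_finrank_pos (by omega)
  let e := LinearEquiv.ofFinrankEq M N (h.trans h2.symm)
  refine ⟨LinearEquiv.ofBijective (equivariantMap e.toLinearMap fun g m => ?_) e.bijective⟩
  rw [gr_smul_of_finrank_le_one h.le]
  exact (gr_smul_of_finrank_le_one h2.le g _).symm

lemma nonempty_equiv_symMod_zero (h : Module.finrank (ZMod p) M = 1) :
    Nonempty (M ≃ₗ[GroupAlg p] SymMod p 0) :=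
  nonempty_equiv_of_finrank_eq_one (M := M) (N := SymMod p 0) h
    (finrank_symMod (Fact.out : p.Prime).pos)

lemma finiteDimensional_of_isSimpleModule [IsSimpleModule (GroupAlg p) M] :
    FiniteDimensional (ZMod p) M := by
  have : Module.Finite (GroupAlg p) M := inferInstance
  have : Module.Finite (ZMod p) (GroupAlg p) := inferInstance
  exact Module.Finite.trans (GroupAlg p) M

/-- Every simple module is a symmetric power of the natural module. -/
theorem exists_equiv_symMod [IsSimpleModule (GroupAlg p) M] :
    ∃ n < p, Nonempty (M ≃ₗ[GroupAlg p] SymMod p n) := by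
  have hp := (Fact.out : p.Prime).two_le
  have : FiniteDimensional (ZMod p) M := finiteDimensional_of_isSimpleModule (p := p)
  have : Nontrivial M := IsSimpleModule.nontrivial (GroupAlg p) M
  obtain ⟨v₀, hv₀⟩ : ∃ v, v ∉ LinearMap.range (act M (nil : GroupAlg p)) := by
    by_contra! h
    exact nil_range_ne_top (p := p) (M := M) (eq_top_iff.2 fun x _ => h x)
  obtain ⟨b, hb, hv⟩ := exists_isWt_notMem_range hv₀
  have hw := (isWt_wproj (p := p) (b : ℤ) v₀).neg_of_nat hb.le
  obtain ⟨φ, hφ, hφw, h1⟩ := exists_wt_functional hw hv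
  obtain ⟨a, ha, ha1⟩ : ∃ a, a = p - 1 - b ∧ 1 ≤ a := ⟨_, rfl, by omega⟩
  rw [← ha] at hφw
  have hne : toFunMod (p := p) φ hφ ≠ 0 := by
    intro h0
    have := ev_toFunMod_e1 φ hφ ((wproj (b : ℤ) : GroupAlg p) • v₀)
    rw [h0, h1] at this
    simp at this
  have hinj := (LinearMap.injective_or_eq_zero (R := GroupAlg p) (M := M) (N := FunMod p)
    (toFunMod φ hφ)).resolve_right hne
  have hle : LinearMap.range (toFunMod (p := p) φ hφ) ≤ homFun p a := by
    rintro _ ⟨m, rfl⟩; exact toFunMod_mem_homFun ha1 φ hφ hφw m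
  let e := LinearEquiv.ofInjective (R := GroupAlg p) (M := M) (M₂ := FunMod p) _ hinj
  have hN : IsSimpleModule (GroupAlg p) (LinearMap.range (toFunMod (p := p) φ hφ)) :=
    IsSimpleModule.congr e.symm
  have hS := isSimpleModule_range_evalMap (p := p) (a := a) (by omega)
  -- Two simple submodules either coincide or meet trivially. The latter is excluded for $a\le p-2$
  -- by the list of submodules; for $a=p-1$ it leaves room only for a one-dimensional module.
  by_cases h : LinearMap.range (evalMap (p := p) a) ⊓ LinearMap.range (toFunMod (p := p) φ hφ) = ⊥
  · have h4 : Module.finrank (ZMod p) M = Module.finrank (ZMod p)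
        (LinearMap.range (toFunMod (p := p) φ hφ)) := (e.restrictScalars (ZMod p)).finrank_eq
    rcases Nat.lt_or_ge (p - 2) a with h5 | h5
    · refine ⟨0, by omega, nonempty_equiv_symMod_zero ?_⟩
      have h6 := finrank_add_finrank_le_of_inf_eq_bot (M := FunMod p) (range_evalMap_le a) hle h
      rw [finrank_range_evalMap (by omega), finrank_homFun ha1] at h6
      have h7 : 0 < Module.finrank (ZMod p) M := Module.finrank_pos
      omega
    · rcases homFun_submodule_cases ha1 h5 hle with h6 | h6 | h6
      · exact absurd (LinearMap.range_eq_bot.1 h6) hne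
      · rw [h6, inf_idem] at h
        exact absurd h (isSimpleModule_iff_isAtom.1 hS).1
      · rw [h6, inf_eq_left.2 (range_evalMap_le a)] at h
        exact absurd h (isSimpleModule_iff_isAtom.1 hS).1
  · have h2 := le_of_inf_ne_bot h
    rw [inf_comm] at h
    have h3 := le_antisymm (le_of_inf_ne_bot h) h2
    exact ⟨a, by omega, ⟨e.trans ((LinearEquiv.ofEq _ _ h3).trans
      (LinearEquiv.ofInjective _ (evalMap_injective (by omega))).symm)⟩⟩

end Modules

/-! ### Radical layers -/

section Jacobson

variable {R : Type*} [Ring R]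

lemma jacobson_eq_of_forall_isCoatom {M : Type*} [AddCommGroup M] [Module R M] {N : Submodule R M}
    (hN : IsCoatom N) (h : ∀ N' : Submodule R M, IsCoatom N' → N' = N) :
    Module.jacobson R M = N :=
  le_antisymm (sInf_le hN) (le_sInf fun N' hN' => (h N' hN').ge)

/-- If the submodules form a chain, then the radical is the maximal submodule. -/
lemma jacobson_eq_of_total {M : Type*} [AddCommGroup M] [Module R M] {N : Submodule R M}
    [IsSimpleModule R (M ⧸ N)] (h : ∀ N N' : Submodule R M, N ≤ N' ∨ N' ≤ N) :
    Module.jacobson R M = N := by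
  have hN : IsCoatom N := isSimpleModule_iff_isCoatom.1 inferInstance
  refine jacobson_eq_of_forall_isCoatom hN fun N' hN' => ?_
  rcases h N N' with h1 | h1
  · exact (hN.le_iff.1 h1).resolve_left hN'.1
  · exact ((hN'.le_iff.1 h1).resolve_left hN.1).symm

lemma map_jacobson_equiv {M N : Type*} [AddCommGroup M] [Module R M] [AddCommGroup N] [Module R N]
    (e : M ≃ₗ[R] N) : (Module.jacobson R M).map e.toLinearMap = Module.jacobson R N :=
  Module.map_jacobson_of_bijective (f := e.toLinearMap) e.bijective

end Jacobson

lemma HasRadicalLayers.cons {i : ℕ} {l : List ℕ} {M : Type u} [AddCommGroup M]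
    [Module (GroupAlg p) M] {N : Submodule (GroupAlg p) M}
    (hN : Module.jacobson (GroupAlg p) M = N) (e : (M ⧸ N) ≃ₗ[GroupAlg p] VMod p i)
    (h : HasRadicalLayers p l N) : HasRadicalLayers p (i :: l) M := by
  subst hN; exact ⟨⟨e⟩, h⟩

lemma HasRadicalLayers.congr {l : List ℕ} : ∀ {M : Type u} [AddCommGroup M]
    [Module (GroupAlg p) M] {N : Type v} [AddCommGroup N] [Module (GroupAlg p) N]
    (_ : M ≃ₗ[GroupAlg p] N), HasRadicalLayers p l M → HasRadicalLayers p l N := by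
  induction l with
  | nil =>
    intro M _ _ N _ _ e h
    have h' : Subsingleton M := h
    exact e.symm.injective.subsingleton
  | cons i l ih =>
    intro M _ _ N _ _ e h
    obtain ⟨⟨e1⟩, h2⟩ := h
    have hJ := map_jacobson_equiv e
    refine ⟨⟨(Submodule.Quotient.equiv _ _ e hJ).symm.trans e1⟩, ?_⟩
    exact ih ((e.submoduleMap _).trans (LinearEquiv.ofEq _ _ hJ)) h2

/-! ### Successive layers, and the two cases of the classification. -/

section Modules

variable {M : Type u} [AddCommGroup M] [Module (ZMod p) M] [Module (GroupAlg p) M]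
  [IsScalarTower (ZMod p) (GroupAlg p) M]

lemma le_total_of_fixU [FiniteDimensional (ZMod p) M]
    (h : Module.finrank (ZMod p) (fixU p M) ≤ 1) (N N' : Submodule (GroupAlg p) M) :
    N ≤ N' ∨ N' ≤ N := by
  have h1 := eq_ker_nil_pow h N
  have h2 := eq_ker_nil_pow h N'
  have h3 : ∀ {a b : ℕ} (_ : a ≤ b), LinearMap.ker (act M (nil : GroupAlg p) ^ a) ≤
      LinearMap.ker (act M (nil : GroupAlg p) ^ b) := by
    intro a b hab x hx
    rw [LinearMap.mem_ker] at hx ⊢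
    rw [← Nat.sub_add_cancel hab, pow_add, Module.End.mul_apply, hx, map_zero]
  rcases le_total (Module.finrank (ZMod p) N) (Module.finrank (ZMod p) N') with h4 | h4
  · left
    have := h3 h4
    rw [← h1, ← h2] at this
    exact this
  · right
    have := h3 h4
    rw [← h1, ← h2] at this
    exact this

instance [FiniteDimensional (ZMod p) M] (N : Submodule (GroupAlg p) M) :
    FiniteDimensional (ZMod p) N :=
  inferInstanceAs (FiniteDimensional (ZMod p) (N.restrictScalars (ZMod p)))

instance [FiniteDimensional (ZMod p) M] (N : Submodule (GroupAlg p) M) :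
    FiniteDimensional (ZMod p) (M ⧸ N) :=
  Module.Finite.of_surjective (N.mkQ.restrictScalars (ZMod p)) N.mkQ_surjective

lemma finrank_quotient_add [FiniteDimensional (ZMod p) M] (N : Submodule (GroupAlg p) M) :
    Module.finrank (ZMod p) (M ⧸ N) + Module.finrank (ZMod p) N = Module.finrank (ZMod p) M := by
  have h := (N.mkQ.restrictScalars (ZMod p)).finrank_range_add_finrank_ker
  have h1 : LinearMap.range (N.mkQ.restrictScalars (ZMod p)) = ⊤ :=
    LinearMap.range_eq_top.2 N.mkQ_surjective
  have h2 : LinearMap.ker (N.mkQ.restrictScalars (ZMod p)) = N.restrictScalars (ZMod p) := by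
    ext x; simp
  rw [h1, h2, finrank_top] at h
  exact h

lemma finrank_fixU_submodule_le [FiniteDimensional (ZMod p) M] (N : Submodule (GroupAlg p) M) :
    Module.finrank (ZMod p) (fixU p N) ≤ Module.finrank (ZMod p) (fixU p M) := by
  let f : fixU p N →ₗ[ZMod p] fixU p M :=
    (N.subtype.restrictScalars (ZMod p)).restrict fun x hx => coe_mem_fixU.2 hx
  refine LinearMap.finrank_le_finrank_of_injective (f := f) ?_
  intro x y hxy
  exact Subtype.ext (Subtype.ext (congrArg (fun z : fixU p M => (z : M)) hxy))

/-- Submodules form a chain, so a submodule with simple quotient is the radical. The radical series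
can therefore be built upward from the socle. -/
lemma HasRadicalLayers.step [FiniteDimensional (ZMod p) M]
    (h : Module.finrank (ZMod p) (fixU p M) ≤ 1) {N N' : Submodule (GroupAlg p) M} (hN : N ≤ N')
    {n i : ℕ} (hn : n < p) (hi : i - 1 = n)
    (e : (N' ⧸ N.submoduleOf N') ≃ₗ[GroupAlg p] SymMod p n) {l : List ℕ}
    (hl : HasRadicalLayers p l N) : HasRadicalLayers p (i :: l) N' := by
  subst hi
  have := isSimpleModule_symMod hn
  have hs : IsSimpleModule (GroupAlg p) (N' ⧸ N.submoduleOf N') :=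
    IsSimpleModule.congr (N := SymMod p (i - 1)) e
  refine HasRadicalLayers.cons (N := N.submoduleOf N') ?_ e
    (hl.congr (Submodule.submoduleOfEquivOfLe hN).symm)
  exact jacobson_eq_of_total (le_total_of_fixU ((finrank_fixU_submodule_le N').trans h))

lemma exists_unit_add_nil_mul_pow (c : ZMod p) {s : GroupAlg p} (hs : Commute nil s) (n : ℕ) :
    ∃ r, Commute nil r ∧ (c • 1 + nil * s) ^ n = c ^ n • 1 + nil * r := by
  induction n with
  | zero => exact ⟨0, Commute.zero_right _, by simp⟩
  | succ n ih =>
    obtain ⟨r, hr, e⟩ := ih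
    refine ⟨c ^ n • s + c • r + r * nil * s, ?_, ?_⟩
    · exact ((hs.smul_right _).add_right (hr.smul_right _)).add_right
        ((hr.mul_right (Commute.refl _)).mul_right hs)
    · rw [pow_succ, e]
      simp only [add_mul, mul_add, smul_mul_assoc, mul_smul_comm, one_mul, mul_one, smul_smul,
        mul_assoc, pow_succ, smul_add]
      rw [mul_comm c]
      abel

/-- To leading order, conjugation by the torus scales `nil` by $t^2$; the error is pushed into the
next power of `nil`. -/
lemma gr_torus_mul_nil_pow (t : (ZMod p)ˣ) (n : ℕ) : ∃ r : GroupAlg p, Commute nil r ∧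
    gr (torus t) * nil ^ n = (((t : ZMod p) ^ 2) ^ n • nil ^ n + nil ^ (n + 1) * r) *
      gr (torus t) := by
  obtain ⟨s, hs, h⟩ := gr_upper_expand ((t : ZMod p) ^ 2)
  obtain ⟨r, hr, e⟩ := exists_unit_add_nil_mul_pow ((t : ZMod p) ^ 2) hs n
  refine ⟨r, hr, ?_⟩
  have h1 : gr (torus t) * nil = nil * (((t : ZMod p) ^ 2) • 1 + nil * s) * gr (torus t) := by
    rw [gr_torus_mul_nil, h, mul_add, mul_smul_comm, mul_one, ← mul_assoc, pow_two nil]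
    congr 1; abel
  have hc : Commute nil (((t : ZMod p) ^ 2) • 1 + nil * s) :=
    ((Commute.one_right _).smul_right _).add_right ((Commute.refl _).mul_right hs)
  have h2 : gr (torus t) * nil ^ n = (nil * (((t : ZMod p) ^ 2) • 1 + nil * s)) ^ n *
      gr (torus t) := by
    generalize nil * (((t : ZMod p) ^ 2) • 1 + nil * s) = y at h1
    have h1' : SemiconjBy (gr (torus t)) nil y := h1
    exact h1'.pow_right n
  rw [h2, hc.mul_pow, e, mul_add, mul_smul_comm, mul_one, pow_succ nil, mul_assoc (nil ^ n)]

/-- The weight of the last vector of a `nil`-string. -/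
lemma isWt_nil_pow {b : ℤ} {m : M} (hw : IsWt p b m) {n : ℕ}
    (h : (nil : GroupAlg p) ^ (n + 1) • m = 0) :
    IsWt p (b + 2 * n) ((nil : GroupAlg p) ^ n • m) := by
  intro t
  obtain ⟨r, hr, e⟩ := gr_torus_mul_nil_pow t n
  have h1 : (nil : GroupAlg p) ^ (n + 1) • r • m = 0 := by
    rw [← mul_smul, (hr.pow_left (n + 1)).eq, mul_smul, h, smul_zero]
  rw [← mul_smul, e, mul_smul, hw t, smul_comm, add_smul, mul_smul, h1, add_zero, smul_assoc,
    smul_smul]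
  congr 1
  rw [zpow_add, zpow_mul, zpow_natCast]
  push_cast
  norm_cast

/-- The next layer of the socle series, when the `U`-fixed points are a line. -/
lemma exists_next_layer [FiniteDimensional (ZMod p) M]
    (h : Module.finrank (ZMod p) (fixU p M) ≤ 1) {s : M} (hs : s ∈ fixU p M) (hs0 : s ≠ 0)
    {c : ℤ} (hw : IsWt p c s) {N : Submodule (GroupAlg p) M} (hN : N ≠ ⊤) :
    ∃ (N' : Submodule (GroupAlg p) M) (n : ℕ), N ≤ N' ∧ n < p ∧
      Nonempty ((N' ⧸ N.submoduleOf N') ≃ₗ[GroupAlg p] SymMod p n) ∧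
      Module.finrank (ZMod p) N' = Module.finrank (ZMod p) N + n + 1 ∧
      ((p : ℤ) - 1) ∣ n + 2 * Module.finrank (ZMod p) N - c := by
  have hnt : Nontrivial (M ⧸ N) := Submodule.Quotient.nontrivial_iff.2 hN
  have : IsArtinian (ZMod p) (M ⧸ N) := inferInstance
  have : IsArtinian (GroupAlg p) (M ⧸ N) := isArtinian_of_tower (ZMod p) this
  obtain ⟨T, hT⟩ := IsAtomic.exists_atom (Submodule (GroupAlg p) (M ⧸ N))
  have hTs : IsSimpleModule (GroupAlg p) T := isSimpleModule_iff_isAtom.2 hT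
  obtain ⟨n, hn, ⟨e⟩⟩ := exists_equiv_symMod (p := p) (M := T)
  let N' := T.comap N.mkQ
  have hle : N ≤ N' := by
    intro x hx
    change N.mkQ x ∈ T
    rw [show N.mkQ x = 0 by simpa using hx]; exact zero_mem _
  let g : N' →ₗ[GroupAlg p] T := N.mkQ.restrict fun x hx => hx
  have hg : Function.Surjective g := by
    rintro ⟨y, hy⟩
    obtain ⟨x, rfl⟩ := N.mkQ_surjective y
    exact ⟨⟨x, hy⟩, rfl⟩
  have hk : LinearMap.ker g = N.submoduleOf N' := by
    ext x
    rw [LinearMap.mem_ker, ← Subtype.coe_inj]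
    change N.mkQ x = 0 ↔ (x : M) ∈ N
    simp
  let e2 : (N' ⧸ N.submoduleOf N') ≃ₗ[GroupAlg p] SymMod p n :=
    (Submodule.quotEquivOfEq _ _ hk.symm).trans ((g.quotKerEquivOfSurjective hg).trans e)
  refine ⟨N', n, hle, hn, ⟨e2⟩, ?_, ?_⟩
  · have h1 := finrank_quotient_add (N.submoduleOf N')
    have h2 := (e2.restrictScalars (ZMod p)).finrank_eq
    have h3 := ((Submodule.submoduleOfEquivOfLe hle).restrictScalars (ZMod p)).finrank_eq
    rw [finrank_symMod hn] at h2
    omega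
  -- The layer's highest weight vector, of weight $n$, lifts to a weight vector $m\notin
  -- N=\ker\mathrm{nil}^d$ with `nil` $m\in N$. So $\mathrm{nil}^d m$ is a nonzero fixed vector of
  -- weight $n+2d$, to be compared with $c$.
  · set d := Module.finrank (ZMod p) N with hd
    have ht := map_mem_fixU (M := SymMod p n) (N := T) e.symm.toLinearMap (symMono_zero_mem_fixU n)
    have htw := IsWt.map (M := SymMod p n) (N := T) (isWt_symMono (p := p) n 0) e.symm.toLinearMap
    set t0 : T := e.symm.toLinearMap (symMono n 0) with ht0
    have ht00 : t0 ≠ 0 := fun h0 => symMono_zero_ne_zero (p := p) n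
      (e.symm.injective (h0.trans (map_zero e.symm).symm))
    obtain ⟨m0, hm0⟩ := N.mkQ_surjective (t0 : M ⧸ N)
    have hw1 : IsWt p (n : ℤ) (t0 : M ⧸ N) := IsWt.coe.2 (by simpa using htw)
    have hU1 : (t0 : M ⧸ N) ∈ fixU p (M ⧸ N) := coe_mem_fixU.2 ht
    set m : M := (wproj (n : ℤ) : GroupAlg p) • m0 with hm
    have hmw : IsWt p (n : ℤ) m := isWt_wproj _ _
    have hmQ : N.mkQ m = t0 := by rw [hm, map_smul, hm0, wproj_smul_of_isWt hw1]
    have hmN : m ∉ N := by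
      intro h0
      have : N.mkQ m = 0 := by simpa using h0
      rw [hmQ] at this
      exact ht00 (Subtype.ext this)
    have hnN : (nil : GroupAlg p) • m ∈ N := by
      rw [← Submodule.ker_mkQ N, LinearMap.mem_ker, map_smul, hmQ]; exact hU1
    have hker := eq_ker_nil_pow h N
    rw [← hd] at hker
    have h1 : (nil : GroupAlg p) ^ (d + 1) • m = 0 := by
      have : (nil : GroupAlg p) • m ∈ LinearMap.ker (act M (nil : GroupAlg p) ^ d) := by
        rw [← hker]; exact hnN
      rw [LinearMap.mem_ker, act_nil_pow_apply, ← mul_smul, ← pow_succ] at this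
      exact this
    have h2 : (nil : GroupAlg p) ^ d • m ≠ 0 := by
      intro h0
      have : m ∈ LinearMap.ker (act M (nil : GroupAlg p) ^ d) := by
        rw [LinearMap.mem_ker, act_nil_pow_apply]; exact h0
      rw [← hker] at this
      exact hmN this
    have h3 : (nil : GroupAlg p) ^ d • m ∈ fixU p M := by
      rw [mem_fixU, ← mul_smul, ← pow_succ']; exact h1
    obtain ⟨x, hx⟩ := mem_span_of_finrank_le_one h hs hs0 h3
    have h4 := isWt_nil_pow hmw h1
    have h5 : IsWt p c ((nil : GroupAlg p) ^ d • m) := by rw [hx]; exact hw.smul x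
    exact h4.dvd_sub h5 h2

lemma finrank_le_of_fixU [FiniteDimensional (ZMod p) M]
    (h : Module.finrank (ZMod p) (fixU p M) ≤ 1) : Module.finrank (ZMod p) M ≤ p := by
  have h1 : act M (nil : GroupAlg p) ^ p = 0 := by rw [← map_pow, nil_pow_p, map_zero]
  have h2 := Module.End.finrank_le_of_pow_eq_zero h1
  change _ ≤ p * Module.finrank (ZMod p) (fixU p M) at h2
  calc _ ≤ _ := h2
    _ ≤ p * 1 := Nat.mul_le_mul_left p h
    _ = p := mul_one p

/-- The modules on which `U` fixes only a line. -/
theorem classification_of_fixU (hp : 5 ≤ p) [FiniteDimensional (ZMod p) M]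
    (h : Module.finrank (ZMod p) (fixU p M) ≤ 1) {s : M} (hs : s ∈ fixU p M) (hs0 : s ≠ 0)
    {c : ℤ} (hw : IsWt p c s) :
    (∃ n < p, Nonempty (M ≃ₗ[GroupAlg p] SymMod p n) ∧ ((p : ℤ) - 1) ∣ (n : ℤ) - c) ∨
    (∃ i, 1 ≤ i ∧ i ≤ p - 2 ∧ HasRadicalLayers p [p - 1 - i, i] M ∧
      Module.finrank (ZMod p) M = p - 1 ∧ ((p : ℤ) - 1) ∣ ((i : ℤ) - 1) - c) ∨
    (HasRadicalLayers p [1, p - 2, 1] M ∧ Module.finrank (ZMod p) M = p) := by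
  have hM := finrank_le_of_fixU h
  have : Nontrivial M := ⟨⟨s, 0, hs0⟩⟩
  have hfin : ∀ N : Submodule (GroupAlg p) M,
      Module.finrank (ZMod p) N ≤ Module.finrank (ZMod p) M := fun N =>
    Submodule.finrank_le (N.restrictScalars (ZMod p))
  have htop : Module.finrank (ZMod p) (⊤ : Submodule (GroupAlg p) M) =
      Module.finrank (ZMod p) M := finrank_top (ZMod p) M
  have hq0 : Module.finrank (ZMod p) (⊥ : Submodule (GroupAlg p) M) = 0 := finrank_bot (ZMod p) M
  have hl0 : HasRadicalLayers p [] (⊥ : Submodule (GroupAlg p) M) :=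
    inferInstanceAs (Subsingleton (⊥ : Submodule (GroupAlg p) M))
  obtain ⟨N1, n1, hle1, hn1, ⟨e1⟩, hf1, hd1⟩ := exists_next_layer h hs hs0 hw
    (N := (⊥ : Submodule (GroupAlg p) M)) bot_ne_top
  rw [hq0] at hf1 hd1
  have hl1 := HasRadicalLayers.step h hle1 hn1 (i := n1 + 1) rfl e1 hl0
  by_cases ht1 : N1 = ⊤
  · left
    have h1 : (⊥ : Submodule (GroupAlg p) M).submoduleOf N1 = ⊥ := by
      rw [Submodule.submoduleOf, Submodule.comap_bot, Submodule.ker_subtype]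
    refine ⟨n1, hn1, ⟨?_⟩, by simpa using hd1⟩
    exact Submodule.topEquiv.symm.trans ((LinearEquiv.ofEq _ _ ht1.symm).trans
      ((Submodule.quotEquivOfEqBot _ h1).symm.trans e1))
  obtain ⟨N2, n2, hle2, hn2, ⟨e2⟩, hf2, hd2⟩ := exists_next_layer h hs hs0 hw ht1
  have h12 := hfin N2
  rw [hf1] at hd2 hf2
  -- Subtracting the two weight congruences makes this sum divisible by $p-1$; it is the dimension
  -- of `N2`, which lies between $2$ and $p<2(p-1)$.
  have hsum : n1 + n2 + 2 = p - 1 := by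
    have h1 : ((p : ℤ) - 1) ∣ ((n1 + n2 + 2 : ℕ) : ℤ) := by
      have := dvd_sub hd2 hd1
      push_cast at this ⊢
      ring_nf at this ⊢
      exact this
    have h2 : ((p : ℤ) - 1) = ((p - 1 : ℕ) : ℤ) := by rw [Nat.cast_sub (by omega)]; simp
    rw [h2, Int.natCast_dvd_natCast] at h1
    obtain ⟨k, hk⟩ := h1
    have hk1 : k = 1 := by
      have : k < 2 := by
        by_contra! h3
        have := Nat.mul_le_mul_left (p - 1) h3
        omega
      have : k ≠ 0 := by rintro rfl; omega
      omega
    rw [hk1] at hk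
    omega
  have hl2 := HasRadicalLayers.step h hle2 hn2 (i := n2 + 1) rfl e2 hl1
  by_cases ht2 : N2 = ⊤
  · right; left
    refine ⟨n1 + 1, by omega, by omega, ?_, ?_, ?_⟩
    · have : p - 1 - (n1 + 1) = n2 + 1 := by omega
      rw [this]
      exact hl2.congr ((LinearEquiv.ofEq _ _ ht2).trans Submodule.topEquiv)
    · rw [ht2, htop] at hf2; omega
    · push_cast
      simpa using hd1
  right; right
  obtain ⟨N3, n3, hle3, hn3, ⟨e3⟩, hf3, hd3⟩ := exists_next_layer h hs hs0 hw ht2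
  have h13 := hfin N3
  -- Only one dimension is left above the first two layers, since $\dim M\le p$.
  have hn3' : n3 = 0 := by omega
  -- A third layer of dimension one sits above dimension $p-1$, so its congruence gives $c\equiv0$;
  -- hence $n_1\equiv0$ with $n_1<p-1$.
  have hn1' : n1 = 0 := by
    have h2 : ((p : ℤ) - 1) = ((p - 1 : ℕ) : ℤ) := by rw [Nat.cast_sub (by omega)]; simp
    have h3 : Module.finrank (ZMod p) N2 = p - 1 := by omega
    rw [h3, hn3', ← h2] at hd3
    have h1 : ((p : ℤ) - 1) ∣ (n1 : ℤ) := by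
      have := dvd_sub hd1 hd3
      have h4 := dvd_add this (dvd_mul_left ((p : ℤ) - 1) 2)
      simpa using h4
    rw [h2, Int.natCast_dvd_natCast] at h1
    exact Nat.eq_zero_of_dvd_of_lt h1 (by omega)
  subst hn3' hn1'
  have hl3 := HasRadicalLayers.step h hle3 hn3 (i := 1) rfl e3 hl2
  have ht3 : N3 = ⊤ := eq_of_le_of_finrank_submodule le_top (by rw [htop]; omega)
  refine ⟨?_, by rw [ht3, htop] at hf3; omega⟩
  have : p - 2 = n2 + 1 := by omega
  rw [this]
  exact hl3.congr ((LinearEquiv.ofEq _ _ ht3).trans Submodule.topEquiv)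

lemma isCompl_range_ker {R M N : Type*} [Ring R] [AddCommGroup M] [Module R M] [AddCommGroup N]
    [Module R N] {f : N →ₗ[R] M} {g : M →ₗ[R] N} (h : Function.Bijective (g ∘ₗ f)) :
    IsCompl (LinearMap.range f) (LinearMap.ker g) := by
  constructor
  · rw [Submodule.disjoint_def]
    rintro _ ⟨x, rfl⟩ hx
    have : x = 0 := h.1 (by rw [map_zero]; exact hx)
    rw [this, map_zero]
  · rw [codisjoint_iff, eq_top_iff]
    intro m _
    obtain ⟨y, hy⟩ := h.2 (g m)
    rw [← add_sub_cancel (f y) m]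
    refine Submodule.add_mem_sup ⟨y, rfl⟩ ?_
    rw [LinearMap.mem_ker, map_sub, ← hy]
    simp

/-- Indecomposable modules with a `U`-fixed vector outside the image of `nil`. -/
theorem equiv_homFun_or_finrank_eq_one (hp : 2 < p) [FiniteDimensional (ZMod p) M]
    (hM : IsIndecomposableModule (GroupAlg p) M) {v₀ : M} (hv₀ : v₀ ∈ fixU p M)
    (hv₀' : v₀ ∉ LinearMap.range (act M (nil : GroupAlg p))) :
    (∃ a, 1 ≤ a ∧ a ≤ p - 2 ∧ Nonempty (homFun p a ≃ₗ[GroupAlg p] M)) ∨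
      Module.finrank (ZMod p) M = 1 := by
  obtain ⟨b, hb, hv'⟩ := exists_isWt_notMem_range hv₀'
  have hw := isWt_wproj (p := p) (b : ℤ) v₀
  have hv := wproj_smul_mem_fixU hv₀ (b : ℤ)
  set v := (wproj (b : ℤ) : GroupAlg p) • v₀ with hvdef
  -- Weight zero corresponds to $a=p-1$, outside the range where the composite is shown invertible.
  -- There an invariant line splits off, with the kernel of an invariant functional as complement.
  by_cases hb0 : b = 0
  · right
    subst hb0
    obtain ⟨φ, hφ, hφw, h1⟩ := exists_wt_functional hw hv'
    obtain ⟨v₁, ψ, hv₁, hψ, h2⟩ := exists_invariant_of_trivial_weight hp hv φ hφ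
      (fun t m => by rw [hφw]; simp) h1
    let N : Submodule (GroupAlg p) M := stableSubmodule (Submodule.span (ZMod p) {v₁}) (by
      intro g m hm
      obtain ⟨c, rfl⟩ := Submodule.mem_span_singleton.1 hm
      rw [smul_comm, hv₁]; exact hm)
    let N' : Submodule (GroupAlg p) M := stableSubmodule (LinearMap.ker ψ) (by
      intro g m hm
      rw [LinearMap.mem_ker] at hm ⊢; rw [hψ, hm])
    have hc : IsCompl N N' := by
      constructor
      · rw [Submodule.disjoint_def]
        intro x hx hx'
        obtain ⟨c, rfl⟩ := Submodule.mem_span_singleton.1 hx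
        have : ψ (c • v₁) = 0 := hx'
        rw [map_smul, h2, smul_eq_mul, mul_one] at this
        rw [this, zero_smul]
      · rw [codisjoint_iff, eq_top_iff]
        intro m _
        rw [← add_sub_cancel (ψ m • v₁) m]
        refine Submodule.add_mem_sup (Submodule.smul_mem _ _ (Submodule.mem_span_singleton_self v₁)) ?_
        change ψ (m - ψ m • v₁) = 0
        simp [h2]
    have hv1 : v₁ ≠ 0 := by rintro rfl; simp at h2
    rcases hM.2 N N' hc with h3 | h3
    · exfalso
      have : v₁ ∈ N := Submodule.mem_span_singleton_self v₁
      rw [h3] at this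
      exact hv1 this
    · have h4 : N = ⊤ := by simpa [h3] using hc.sup_eq_top
      have h5 : Submodule.span (ZMod p) {v₁} = ⊤ := by
        ext x
        exact SetLike.ext_iff.1 h4 x
      rw [← finrank_top (ZMod p) M, ← h5, finrank_span_singleton hv1]
  · left
    have hw := hw.neg_of_nat hb.le
    obtain ⟨φ, hφ, hφw, h1⟩ := exists_wt_functional hw hv'
    obtain ⟨a, ha, ha1⟩ : ∃ a, a = p - 1 - b ∧ 1 ≤ a := ⟨_, rfl, by omega⟩
    rw [← ha] at hφw hw
    refine ⟨a, ha1, by omega, ?_⟩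
    let f : homFun p a →ₗ[GroupAlg p] M := (fromFun v hv).domRestrict (homFun p a)
    let g : M →ₗ[GroupAlg p] homFun p a := LinearMap.codRestrict _ (toFunMod (p := p) φ hφ)
      (toFunMod_mem_homFun ha1 φ hφ hφw)
    -- Once the composite is bijective, the image of `f` is a nonzero direct summand, hence all of
    -- the indecomposable module.
    have hs : Function.Surjective (g ∘ₗ f) := by
      rintro ⟨x, hx⟩
      obtain ⟨x', hx', e⟩ := exists_toFunMod_fromFun_eq ha1 (by omega) hp hv hw φ hφ hφw h1 hx
      exact ⟨⟨x', hx'⟩, Subtype.ext e⟩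
    have hi : Function.Injective (g ∘ₗ f) :=
      (LinearMap.injective_iff_surjective (f := (g ∘ₗ f).restrictScalars (ZMod p))).2 hs
    have hc := isCompl_range_ker (R := GroupAlg p) (M := M) (N := homFun p a) (f := f) (g := g) ⟨hi, hs⟩
    have hne : LinearMap.range f ≠ ⊥ := by
      intro h0
      have h3 : f = 0 := LinearMap.range_eq_bot.1 h0
      have h4 : deltaFun p a ≠ 0 := by
        intro h5
        have := congrArg (ev ![0, 1]) h5
        simp [deltaFun] at this
      apply h4
      have : (⟨deltaFun p a, deltaFun_mem ha1⟩ : homFun p a) = 0 := hi (by simp [h3])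
      exact congrArg Subtype.val this
    have hk := (hM.2 _ _ hc).resolve_left hne
    have h5 : LinearMap.range f = ⊤ := by simpa [hk] using hc.sup_eq_top
    have hfi : Function.Injective f := by
      rw [LinearMap.coe_comp] at hi; exact hi.of_comp
    exact ⟨LinearEquiv.ofBijective f ⟨hfi, LinearMap.range_eq_top.1 h5⟩⟩

end Modules

/-! ### Consequences of the shape of the radical series -/

/-- The comparison of the two models for symmetric powers. -/
def vmodEquiv (p : ℕ) [Fact p.Prime] (i : ℕ) : VMod p i ≃ₗ[GroupAlg p] SymMod p (i - 1) :=
  RepMod.asModuleEquiv _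

lemma HasRadicalLayers.of_isSimpleModule {i : ℕ} {M : Type u} [AddCommGroup M]
    [Module (GroupAlg p) M] (hi : i - 1 < p) (e : M ≃ₗ[GroupAlg p] VMod p i) :
    HasRadicalLayers p [i] M := by
  have hs := isSimpleModule_symMod hi
  have : IsSimpleModule (GroupAlg p) M := IsSimpleModule.congr (e.trans (vmodEquiv p i))
  have hJ : Module.jacobson (GroupAlg p) M = ⊥ := IsSimpleModule.jacobson_eq_bot ..
  refine HasRadicalLayers.cons hJ ((Submodule.quotEquivOfEqBot _ rfl).trans e) ?_
  exact inferInstanceAs (Subsingleton (⊥ : Submodule (GroupAlg p) M))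

/-- The top of the induced module. -/
def homFunTop {a b : ℕ} (ha : 1 ≤ a) (h : a + b = p - 1) :
    (homFun p a ⧸ (LinearMap.range (evalMap (p := p) a)).submoduleOf (homFun p a))
      ≃ₗ[GroupAlg p] SymMod p b :=
  have hb : b < p := by have := (Fact.out : p.Prime).pos; omega
  let g : homFun p a →ₗ[GroupAlg p] LinearMap.range (evalMap (p := p) b) :=
    LinearMap.codRestrict _ ((intertwinerMap p b).domRestrict (homFun p a))
      fun x => range_intertwinerMap_le b ⟨x.1, rfl⟩
  have hg : Function.Surjective g := by
    rintro ⟨y, hy⟩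
    rw [← map_intertwinerMap_homFun ha h] at hy
    obtain ⟨x, hx, e⟩ := hy
    exact ⟨⟨x, hx⟩, Subtype.ext e⟩
  have hk : LinearMap.ker g = (LinearMap.range (evalMap (p := p) a)).submoduleOf (homFun p a) := by
    rw [← ker_intertwinerMap_homFun ha h]
    ext x
    rw [LinearMap.mem_ker, ← Subtype.coe_inj]
    change intertwinerMap p b x.1 = 0 ↔ x.1 ∈ homFun p a ∧ intertwinerMap p b x.1 = 0
    exact ⟨fun h => ⟨x.2, h⟩, fun h => h.2⟩
  (Submodule.quotEquivOfEq _ _ hk.symm).trans ((g.quotKerEquivOfSurjective hg).trans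
    (LinearEquiv.ofInjective _ (evalMap_injective hb)).symm)

lemma isSimpleModule_homFunTop {a : ℕ} (ha : 1 ≤ a) (ha' : a ≤ p - 2) :
    IsSimpleModule (GroupAlg p)
      (homFun p a ⧸ (LinearMap.range (evalMap (p := p) a)).submoduleOf (homFun p a)) := by
  have hp := (Fact.out : p.Prime).two_le
  have := isSimpleModule_symMod (p := p) (n := p - 1 - a) (by omega)
  exact IsSimpleModule.congr (N := SymMod p (p - 1 - a)) (homFunTop ha (by omega))

/-- By the list of submodules, every proper submodule lies in $\mathrm{Sym}^a$, so this is the only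
maximal one. -/
lemma jacobson_homFun {a : ℕ} (ha : 1 ≤ a) (ha' : a ≤ p - 2) :
    Module.jacobson (GroupAlg p) (homFun p a) =
      (LinearMap.range (evalMap (p := p) a)).submoduleOf (homFun p a) := by
  have hs := isSimpleModule_homFunTop ha ha'
  have hc := isSimpleModule_iff_isCoatom.1 hs
  refine jacobson_eq_of_forall_isCoatom hc fun N' hN' => ?_
  have hle : N' ≤ (LinearMap.range (evalMap (p := p) a)).submoduleOf (homFun p a) := by
    have h1 : ∀ x : homFun p a, x ∈ N' ↔ (x : FunMod p) ∈ N'.map (homFun p a).subtype := by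
      intro x
      constructor
      · intro hx; exact ⟨x, hx, rfl⟩
      · rintro ⟨y, hy, e⟩
        rwa [← Subtype.ext e]
    rcases homFun_submodule_cases ha ha' (Submodule.map_subtype_le (homFun p a) N') with h | h | h
    · intro x hx
      rw [h1, h] at hx
      have : (x : FunMod p) = 0 := hx
      change (x : FunMod p) ∈ LinearMap.range (evalMap (p := p) a)
      rw [this]; exact zero_mem _
    · intro x hx
      rw [h1, h] at hx
      exact hx
    · exfalso
      apply hN'.1
      rw [eq_top_iff]
      intro x _
      rw [h1, h]
      exact x.2
  exact ((hN'.le_iff.1 hle).resolve_left hc.1).symm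

/-- These are the modules of dimension $p+1$: socle $\mathrm{Sym}^a$, and top $\mathrm{Sym}^{p-1-a}$
through the intertwining operator. -/
theorem hasRadicalLayers_homFun {a : ℕ} (ha : 1 ≤ a) (ha' : a ≤ p - 2) :
    HasRadicalLayers p [p - a, a + 1] (homFun p a) := by
  have hp := (Fact.out : p.Prime).two_le
  refine HasRadicalLayers.cons (jacobson_homFun ha ha') ?_ ?_
  · exact (homFunTop ha (b := p - a - 1) (by omega)).trans (vmodEquiv p (p - a)).symm
  · refine HasRadicalLayers.of_isSimpleModule (by simp; omega) ?_
    exact (Submodule.submoduleOfEquivOfLe (range_evalMap_le a)).trans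
      ((LinearEquiv.ofInjective _ (evalMap_injective (by omega))).symm.trans
        (vmodEquiv p (a + 1)).symm)

/-- The row $(0,1)$ is fixed by $U$, so values of `nil` vanish there, and fixed homogeneous
functions vanishing there are multiples of $x_0^a$. This is minimal activity of `homFun p a`. -/
lemma finrank_fixU_inf_range_homFun (a : ℕ) :
    Module.finrank (ZMod p) (fixU p (homFun p a) ⊓
      LinearMap.range (act (homFun p a) (nil : GroupAlg p)) : Submodule (ZMod p) _) ≤ 1 := by
  let x : homFun p a := ⟨evalMap a (symMono a 0), evalMap_mem_homFun _⟩
  have : fixU p (homFun p a) ⊓ LinearMap.range (act (homFun p a) (nil : GroupAlg p)) ≤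
      Submodule.span (ZMod p) {x} := by
    rintro y ⟨hy, z, hz⟩
    have h1 : ev ![0, 1] (y : FunMod p) = 0 := by
      rw [← hz, act_apply, Submodule.coe_smul]
      have := congrArg (ev ![0, 1]) (nil_smul_eq (p := p) (z : FunMod p))
      rw [map_sub, ev_upper_smul] at this
      refine this.trans ?_
      simp
    have h2 := eq_smul_evalMap y.2 (coe_mem_fixU.2 hy) h1
    rw [Submodule.mem_span_singleton]
    exact ⟨_, Subtype.ext h2.symm⟩
  refine (Submodule.finrank_mono this).trans ?_
  have := finrank_span_le_card (R := ZMod p) ({x} : Set (homFun p a))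
  simpa using this

/-- For $a\le p-2$ the possible dimensions are $0$, $a+1$ and $p+1$. For $a=p-1$ a submodule
contains $\mathrm{Sym}^{p-1}$ or has dimension at most one. -/
lemma finrank_ne_two_of_le_homFun {a : ℕ} (ha : 2 ≤ a) (ha' : a ≤ p - 1)
    {K : Submodule (GroupAlg p) (FunMod p)} (hK : K ≤ homFun p a) :
    Module.finrank (ZMod p) K ≠ 2 := by
  have hp := (Fact.out : p.Prime).two_le
  intro h
  rcases Nat.lt_or_ge (p - 2) a with h1 | h1
  · have hS := isSimpleModule_range_evalMap (p := p) (a := a) (by omega)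
    by_cases h2 : LinearMap.range (evalMap (p := p) a) ⊓ K = ⊥
    · have h3 := finrank_add_finrank_le_of_inf_eq_bot (M := FunMod p) (range_evalMap_le a) hK h2
      rw [finrank_range_evalMap (by omega), finrank_homFun (by omega)] at h3
      omega
    · have h3 := finrank_mono_submodule (M := FunMod p) (le_of_inf_ne_bot h2)
      rw [finrank_range_evalMap (by omega)] at h3
      omega
  · rcases homFun_submodule_cases (by omega) h1 hK with h2 | h2 | h2
    · subst h2
      have : Module.finrank (ZMod p) (⊥ : Submodule (GroupAlg p) (FunMod p)) = 0 :=
        finrank_bot (ZMod p) (FunMod p)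
      omega
    · rw [h2, finrank_range_evalMap (by omega)] at h; omega
    · rw [h2, finrank_homFun (by omega)] at h; omega

/-! ### Dimension, indecomposability and generation from the radical layers. -/

section Modules

variable {M : Type u} [AddCommGroup M] [Module (ZMod p) M] [Module (GroupAlg p) M]
  [IsScalarTower (ZMod p) (GroupAlg p) M]

lemma HasRadicalLayers.finrank_eq {l : List ℕ} : ∀ {M : Type u} [AddCommGroup M] [Module (ZMod p) M]
    [Module (GroupAlg p) M] [IsScalarTower (ZMod p) (GroupAlg p) M] (_ : ∀ i ∈ l, 1 ≤ i ∧ i ≤ p)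
    (_ : HasRadicalLayers p l M),
    FiniteDimensional (ZMod p) M ∧ Module.finrank (ZMod p) M = l.sum := by
  induction l with
  | nil =>
    intro M _ _ _ _ _ h
    have : Subsingleton M := h
    exact ⟨inferInstance, by simpa using Module.finrank_zero_of_subsingleton⟩
  | cons i l ih =>
    intro M _ _ _ _ hl h
    obtain ⟨⟨e⟩, h2⟩ := h
    obtain ⟨h3, h4⟩ := ih (fun j hj => hl j (List.mem_cons_of_mem _ hj)) h2
    obtain ⟨hi1, hi2⟩ := hl i (by simp)
    have e' := (e.trans (vmodEquiv p i)).restrictScalars (ZMod p)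
    have h5 : FiniteDimensional (ZMod p) (M ⧸ Module.jacobson (GroupAlg p) M) :=
      Module.Finite.of_injective (M := M ⧸ Module.jacobson (GroupAlg p) M)
        (N := SymMod p (i - 1)) e'.toLinearMap e'.injective
    let J := (Module.jacobson (GroupAlg p) M).restrictScalars (ZMod p)
    have h6 : FiniteDimensional (ZMod p) (M ⧸ J) := h5
    have h7 : FiniteDimensional (ZMod p) J := h3
    have h8 : FiniteDimensional (ZMod p) M := Module.Finite.of_submodule_quotient J
    refine ⟨h8, ?_⟩
    rw [← finrank_quotient_add (Module.jacobson (GroupAlg p) M), h4]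
    have h9 : Module.finrank (ZMod p) (M ⧸ Module.jacobson (GroupAlg p) M) = i - 1 + 1 := by
      rw [← finrank_symMod (p := p) (n := i - 1) (by omega)]
      exact e'.finrank_eq
    rw [h9, List.sum_cons]; omega

lemma HasRadicalLayers.isSimpleModule_top {i : ℕ} {l : List ℕ} (hi : i - 1 < p)
    (h : HasRadicalLayers p (i :: l) M) :
    IsSimpleModule (GroupAlg p) (M ⧸ Module.jacobson (GroupAlg p) M) := by
  obtain ⟨⟨e⟩, _⟩ := h
  have := isSimpleModule_symMod hi
  exact IsSimpleModule.congr (e.trans (vmodEquiv p i))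

/-- A simple top makes the radical the unique maximal submodule, and every proper submodule lies in
a maximal one. -/
lemma HasRadicalLayers.eq_top {i : ℕ} {l : List ℕ} (hi : i - 1 < p)
    (h : HasRadicalLayers p (i :: l) M) [FiniteDimensional (ZMod p) M]
    {N : Submodule (GroupAlg p) M} (hN : ¬ N ≤ Module.jacobson (GroupAlg p) M) : N = ⊤ := by
  have hc := isSimpleModule_iff_isCoatom.1 (h.isSimpleModule_top hi)
  have : IsNoetherian (ZMod p) M := inferInstance
  have : IsNoetherian (GroupAlg p) M := isNoetherian_of_tower (ZMod p) this
  rcases eq_top_or_exists_le_coatom N with h1 | ⟨N', hN', hle⟩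
  · exact h1
  · exfalso
    apply hN
    have h2 : Module.jacobson (GroupAlg p) M ≤ N' := sInf_le hN'
    rw [(hc.le_iff.1 h2).resolve_left hN'.1] at hle
    exact hle

/-- Two proper complements would both lie in the radical, which is proper. -/
lemma HasRadicalLayers.isIndecomposableModule {i : ℕ} {l : List ℕ} (hi : i - 1 < p)
    (h : HasRadicalLayers p (i :: l) M) [FiniteDimensional (ZMod p) M] :
    IsIndecomposableModule (GroupAlg p) M := by
  have hc := isSimpleModule_iff_isCoatom.1 (h.isSimpleModule_top hi)
  refine ⟨?_, fun N N' hN => ?_⟩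
  · by_contra hM
    rw [not_nontrivial_iff_subsingleton] at hM
    exact hc.1 (Subsingleton.elim _ _)
  · by_cases h1 : N ≤ Module.jacobson (GroupAlg p) M
    · by_cases h2 : N' ≤ Module.jacobson (GroupAlg p) M
      · exact absurd (eq_top_iff.2 (hN.sup_eq_top.ge.trans (sup_le h1 h2))) hc.1
      · left
        have := hN.inf_eq_bot
        rwa [h.eq_top hi h2, inf_top_eq] at this
    · right
      have := hN.inf_eq_bot
      rwa [h.eq_top hi h1, top_inf_eq] at this

/-- Trivial action passes to every layer. A layer of dimension at least two thus bounds the kernel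
of the representation. -/
lemma HasRadicalLayers.trivial_of_mem {l : List ℕ} {i : ℕ} (hi : i ∈ l) (g : SL(2, ZMod p)) :
    ∀ {M : Type u} [AddCommGroup M] [Module (GroupAlg p) M] (_ : HasRadicalLayers p l M)
    (_ : ∀ m : M, gr g • m = m) (v : VMod p i), gr g • v = v := by
  induction l with
  | nil => simp at hi
  | cons j l ih =>
    intro M _ _ h hg
    obtain ⟨⟨e⟩, h2⟩ := h
    rcases List.mem_cons.1 hi with rfl | hi'
    · intro v
      obtain ⟨x, rfl⟩ := e.surjective v
      obtain ⟨m, rfl⟩ := Submodule.Quotient.mk_surjective _ x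
      rw [← map_smul, ← Submodule.Quotient.mk_smul, hg]
    · exact ih hi' h2 fun m => Subtype.ext (hg m)

/-- A `U`-fixed weight vector which generates the module. -/
lemma HasRadicalLayers.exists_generator {i j : ℕ} (hi : 1 ≤ i) (hi' : i ≤ p) (hj : 1 ≤ j)
    (hj' : j ≤ p) (h : HasRadicalLayers p [j, i] M) [FiniteDimensional (ZMod p) M]
    (hU : 1 < Module.finrank (ZMod p) (fixU p M)) :
    ∃ y ∈ fixU p M, IsWt p ((j : ℤ) - 1) y ∧ y ∉ Module.jacobson (GroupAlg p) M := by
  obtain ⟨⟨e⟩, ⟨⟨e2⟩, h3⟩⟩ := h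
  have h3' : Subsingleton (Module.jacobson (GroupAlg p) (Module.jacobson (GroupAlg p) M)) := h3
  have e3 : Module.jacobson (GroupAlg p) M ≃ₗ[GroupAlg p] SymMod p (i - 1) :=
    ((Submodule.quotEquivOfEqBot _ (Submodule.subsingleton_iff_eq_bot.1 h3')).symm.trans e2).trans
      (vmodEquiv p i)
  have hJU : Module.finrank (ZMod p) (fixU p (Module.jacobson (GroupAlg p) M)) ≤ 1 := by
    let f : fixU p (Module.jacobson (GroupAlg p) M) →ₗ[ZMod p] fixU p (SymMod p (i - 1)) :=
      (e3.toLinearMap.restrictScalars (ZMod p)).restrict fun x hx =>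
        map_mem_fixU (M := Module.jacobson (GroupAlg p) M) (N := SymMod p (i - 1)) e3.toLinearMap hx
    refine (LinearMap.finrank_le_finrank_of_injective (f := f) ?_).trans
      (finrank_fixU_symMod_le (by omega))
    intro x y hxy
    exact Subtype.ext (e3.injective
      (congrArg (fun z : fixU p (SymMod p (i - 1)) => (z : SymMod p (i - 1))) hxy))
  -- The radical is simple, so $U$ fixes only a line in it; a second fixed direction must lie
  -- outside.
  obtain ⟨y₀, hy₀, hyJ⟩ : ∃ y ∈ fixU p M, y ∉ Module.jacobson (GroupAlg p) M := by
    by_contra! hc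
    have : Module.finrank (ZMod p) (fixU p M) ≤
        Module.finrank (ZMod p) (fixU p (Module.jacobson (GroupAlg p) M)) := by
      let f : fixU p M →ₗ[ZMod p] fixU p (Module.jacobson (GroupAlg p) M) :=
        { toFun := fun x => ⟨⟨x, hc x x.2⟩, coe_mem_fixU.1 x.2⟩
          map_add' := fun x y => rfl
          map_smul' := fun c x => rfl }
      refine LinearMap.finrank_le_finrank_of_injective (f := f) ?_
      intro x y hxy
      exact Subtype.ext (congrArg
        (fun z : fixU p (Module.jacobson (GroupAlg p) M) => (z.1 : M)) hxy)
    omega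
  obtain ⟨b, hb, hy⟩ := exists_wproj_notMem (p := p) (Module.jacobson (GroupAlg p) M).toAddSubgroup hyJ
  have hw := isWt_wproj (p := p) (b : ℤ) y₀
  have hyU := wproj_smul_mem_fixU hy₀ (b : ℤ)
  refine ⟨_, hyU, hw.congr ?_, hy⟩
  set y := (wproj (b : ℤ) : GroupAlg p) • y₀
  let q : M →ₗ[GroupAlg p] SymMod p (j - 1) :=
    (e.trans (vmodEquiv p j)).toLinearMap ∘ₗ (Module.jacobson (GroupAlg p) M).mkQ
  have hq0 : q y ≠ 0 := by
    intro h0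
    apply hy
    have h1 : (Module.jacobson (GroupAlg p) M).mkQ y = 0 :=
      (e.trans (vmodEquiv p j)).injective (h0.trans (map_zero _).symm)
    have h2 : y ∈ LinearMap.ker (Module.jacobson (GroupAlg p) M).mkQ := h1
    rw [Submodule.ker_mkQ] at h2
    exact h2
  have hq1 := map_mem_fixU (M := M) (N := SymMod p (j - 1)) q hyU
  have hq2 := IsWt.map (M := M) (N := SymMod p (j - 1)) hw q
  obtain ⟨c, hc⟩ := mem_span_of_finrank_le_one (V := SymMod p (j - 1)) (finrank_fixU_symMod_le (by omega))
    hq1 hq0 (symMono_zero_mem_fixU (p := p) (j - 1))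
  have hq3 : IsWt p (b : ℤ) (symMono (p := p) (j - 1) 0) := by
    rw [hc]; exact IsWt.smul (M := SymMod p (j - 1)) hq2 c
  have hq4 := IsWt.dvd_sub (M := SymMod p (j - 1)) hq3 (isWt_symMono (j - 1) 0)
    (symMono_zero_ne_zero _)
  rw [Nat.cast_sub hj] at hq4
  simpa using hq4

/-- The fixed vector outside the radical has weight $j-1\equiv-(p-j)$, so it lies in an image of
`homFun p (p - j)`, and it generates because the top is simple. -/
lemma HasRadicalLayers.exists_surjective {i j : ℕ} (hi : 1 ≤ i) (hi' : i ≤ p) (hj : 1 ≤ j)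
    (hj' : j ≤ p - 1) (h : HasRadicalLayers p [j, i] M) [FiniteDimensional (ZMod p) M]
    (hU : 1 < Module.finrank (ZMod p) (fixU p M)) :
    ∃ f : FunMod p →ₗ[GroupAlg p] M, (homFun p (p - j)).map f = ⊤ := by
  have hp := (Fact.out : p.Prime).two_le
  obtain ⟨y, hy, hw, hyJ⟩ := h.exists_generator hi hi' hj (by omega) hU
  have hw' : IsWt p (-((p - j : ℕ) : ℤ)) y := hw.congr ⟨1, by rw [Nat.cast_sub (by omega)]; ring⟩
  obtain ⟨f, hf, e⟩ := exists_fromFun_eq (by omega) hy hw'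
  refine ⟨fromFun y hy, h.eq_top (by omega) fun hle => hyJ (hle ⟨f, hf, e⟩)⟩

/-- Dimension $p+1$ exceeds the size of any Jordan block of $u$, so $U$ fixes more than a line; the
resulting surjection from `homFun` is between spaces of equal dimension. -/
theorem HasRadicalLayers.nonempty_equiv_homFun {i j : ℕ} (hi : 2 ≤ i) (hj : 2 ≤ j)
    (hij : i + j = p + 1) (h : HasRadicalLayers p [j, i] M) :
    Nonempty (homFun p (p - j) ≃ₗ[GroupAlg p] M) := by
  obtain ⟨hfd, hfr⟩ := h.finrank_eq (by simp; omega)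
  simp only [List.sum_cons, List.sum_nil] at hfr
  have hU : 1 < Module.finrank (ZMod p) (fixU p M) := by
    by_contra! hc
    have := finrank_le_of_fixU hc
    omega
  obtain ⟨f, hf⟩ := h.exists_surjective (by omega) (by omega) (by omega) (by omega) hU
  let g := f.domRestrict (homFun p (p - j))
  have hg : Function.Surjective g := by
    rw [← LinearMap.range_eq_top, LinearMap.range_domRestrict]; exact hf
  have hgi : Function.Injective g := by
    refine (LinearMap.injective_iff_surjective_of_finrank_eq_finrank
      (f := g.restrictScalars (ZMod p)) ?_).2 hg
    rw [finrank_homFun (by omega)]; omega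
  exact ⟨LinearEquiv.ofBijective g ⟨hgi, hg⟩⟩

/-- Otherwise the module of dimension $p-1$ would be a quotient of `homFun p (p - j)` by a submodule
of dimension two, and there is none. -/
lemma HasRadicalLayers.finrank_fixU_le {i j : ℕ} (hi : 1 ≤ i) (hj : 1 ≤ j)
    (hij : i + j = p - 1) (h : HasRadicalLayers p [j, i] M) :
    Module.finrank (ZMod p) (fixU p M) ≤ 1 := by
  obtain ⟨hfd, hfr⟩ := h.finrank_eq (by simp; omega)
  simp only [List.sum_cons, List.sum_nil] at hfr
  by_contra! hU
  obtain ⟨f, hf⟩ := h.exists_surjective (by omega) (by omega) (by omega) (by omega) hU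
  have h1 := finrank_map_add_finrank_inf_ker (M := FunMod p) (N := M) (homFun p (p - j)) f
  have h2 : Module.finrank (ZMod p) (⊤ : Submodule (GroupAlg p) M) = Module.finrank (ZMod p) M :=
    finrank_top (ZMod p) M
  rw [hf, h2, finrank_homFun (by omega)] at h1
  exact finrank_ne_two_of_le_homFun (p := p) (a := p - j) (K := homFun p (p - j) ⊓ LinearMap.ker f)
    (by omega) (by omega) inf_le_left (by omega)

end Modules

/-! ### Modules which are a single Jordan block of size less than `p` -/

section Modules

variable {M : Type u} [AddCommGroup M] [Module (ZMod p) M] [Module (GroupAlg p) M]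
  [IsScalarTower (ZMod p) (GroupAlg p) M]
variable {N : Type v} [AddCommGroup N] [Module (ZMod p) N] [Module (GroupAlg p) N]
  [IsScalarTower (ZMod p) (GroupAlg p) N]

/-- A weight vector generating the Jordan block. -/
lemma exists_isWt_top [FiniteDimensional (ZMod p) M]
    (h : Module.finrank (ZMod p) (fixU p M) ≤ 1) {s : M} (hs : s ∈ fixU p M) (hs0 : s ≠ 0)
    {c : ℤ} (hw : IsWt p c s) {d : ℕ} (hd : Module.finrank (ZMod p) M = d + 1) :
    ∃ v : M, IsWt p (c - 2 * d) v ∧ (nil : GroupAlg p) ^ d • v ≠ 0 := by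
  have : Nontrivial M := ⟨⟨s, 0, hs0⟩⟩
  have hnil : act M (nil : GroupAlg p) ^ (d + 1) = 0 := by
    rw [← hd]; exact Module.End.pow_finrank_eq_zero isNilpotent_act_nil
  obtain ⟨v₀, hv₀⟩ : ∃ v, v ∉ LinearMap.range (act M (nil : GroupAlg p)) := by
    by_contra! h
    exact nil_range_ne_top (p := p) (M := M) (eq_top_iff.2 fun x _ => h x)
  obtain ⟨b, hb, hv⟩ := exists_isWt_notMem_range hv₀
  have hwv := isWt_wproj (p := p) (b : ℤ) v₀
  set v := (wproj (b : ℤ) : GroupAlg p) • v₀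
  -- In a Jordan block of size $d+1$ a weight vector outside the image survives $\mathrm{nil}^d$.
  -- This raises its weight by $2d$ and lands on the line of $s$, so its weight is $c-2d$.
  have hrk : LinearMap.range (act M (nil : GroupAlg p)) =
      LinearMap.ker (act M (nil : GroupAlg p) ^ d) := by
    apply Submodule.eq_of_le_of_finrank_le
    · rintro _ ⟨x, rfl⟩
      rw [LinearMap.mem_ker, ← Module.End.mul_apply, ← pow_succ, hnil, LinearMap.zero_apply]
    · have h1 := Module.End.finrank_ker_pow_le (act M (nil : GroupAlg p)) d
      have h2 := (act M (nil : GroupAlg p)).finrank_range_add_finrank_ker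
      have h3 : Module.finrank (ZMod p) (LinearMap.ker (act M (nil : GroupAlg p))) ≤ 1 := h
      have h4 := Nat.mul_le_mul_left d h3
      omega
  have hne : (nil : GroupAlg p) ^ d • v ≠ 0 := by
    intro h0
    apply hv
    rw [hrk, LinearMap.mem_ker, act_nil_pow_apply, h0]
  have h0 : (nil : GroupAlg p) ^ (d + 1) • v = 0 := by
    rw [← act_nil_pow_apply, hnil, LinearMap.zero_apply]
  have h3 : (nil : GroupAlg p) ^ d • v ∈ fixU p M := by
    rw [mem_fixU, ← mul_smul, ← pow_succ', h0]
  obtain ⟨x, hx⟩ := mem_span_of_finrank_le_one h hs hs0 h3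
  have h4 := isWt_nil_pow hwv h0
  have h5 : IsWt p c ((nil : GroupAlg p) ^ d • v) := by rw [hx]; exact hw.smul x
  have h6 := h4.dvd_sub h5 hne
  exact ⟨v, hwv.congr (by rw [show (b : ℤ) - (c - 2 * d) = b + 2 * d - c by ring]; exact h6), hne⟩

/-- The basis of a Jordan block. -/
lemma bijective_string [FiniteDimensional (ZMod p) M] {d : ℕ}
    (hd : Module.finrank (ZMod p) M = d + 1) {v : M} (hv : (nil : GroupAlg p) ^ d • v ≠ 0) :
    Function.Bijective
      (Fintype.linearCombination (ZMod p) fun s : Fin (d + 1) => (nil : GroupAlg p) ^ s.val • v) := by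
  have hnil : act M (nil : GroupAlg p) ^ (d + 1) = 0 := by
    rw [← hd]; exact Module.End.pow_finrank_eq_zero isNilpotent_act_nil
  have h0 : ∀ n, d < n → (nil : GroupAlg p) ^ n • v = 0 := by
    intro n hn
    rw [← act_nil_pow_apply, ← Nat.sub_add_cancel (show d + 1 ≤ n from hn), pow_add, hnil,
      mul_zero, LinearMap.zero_apply]
  have hi : LinearIndependent (ZMod p) fun s : Fin (d + 1) => (nil : GroupAlg p) ^ s.val • v := by
    rw [Fintype.linearIndependent_iff]
    intro g hg
    by_contra! hc
    obtain ⟨s, hs, hmin⟩ : ∃ s, g s ≠ 0 ∧ ∀ s' < s, g s' = 0 := by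
      obtain ⟨i, hi⟩ := hc
      have hne : (Finset.univ.filter fun s => g s ≠ 0).Nonempty := ⟨i, by simpa using hi⟩
      refine ⟨_, by simpa using Finset.min'_mem _ hne, fun s' hs' => ?_⟩
      by_contra h
      exact absurd (Finset.min'_le _ s' (by simpa using h)) (not_le.2 hs')
    have h1 := congrArg (fun m => (nil : GroupAlg p) ^ (d - s.val) • m) hg
    simp only [smul_zero, Finset.smul_sum] at h1
    rw [Finset.sum_eq_single s] at h1
    · rw [smul_comm, ← mul_smul, ← pow_add, Nat.sub_add_cancel (by omega)] at h1
      exact (smul_ne_zero hs hv) h1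
    · intro s' _ hne
      rcases lt_or_gt_of_ne hne with h2 | h2
      · rw [hmin s' h2, zero_smul, smul_zero]
      · rw [smul_comm, ← mul_smul, ← pow_add, h0 _ (by have := Fin.lt_def.1 h2; omega), smul_zero]
    · simp
  have hinj : Function.Injective (Fintype.linearCombination (ZMod p)
      fun s : Fin (d + 1) => (nil : GroupAlg p) ^ s.val • v) :=
    hi.fintypeLinearCombination_injective
  exact ⟨hinj, (LinearMap.injective_iff_surjective_of_finrank_eq_finrank (by simp [hd])).1 hinj⟩

/-- The isomorphism of two Jordan blocks, over the Borel subgroup. -/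
lemma exists_borel_equiv [FiniteDimensional (ZMod p) M] [FiniteDimensional (ZMod p) N] {d : ℕ}
    (hM : Module.finrank (ZMod p) M = d + 1) (hN : Module.finrank (ZMod p) N = d + 1)
    {b : ℤ} {v : M} (hv : (nil : GroupAlg p) ^ d • v ≠ 0) (hvw : IsWt p b v)
    {w : N} (hw : (nil : GroupAlg p) ^ d • w ≠ 0) (hww : IsWt p b w) :
    ∃ θ : M ≃ₗ[ZMod p] N, (∀ c m, θ (gr (upper (c : ZMod p)) • m) = gr (upper c) • θ m) ∧
      ∀ (t : (ZMod p)ˣ) m, θ (gr (torus t) • m) = gr (torus t) • θ m := by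
  let eM := LinearEquiv.ofBijective _ (bijective_string hM hv)
  let eN := LinearEquiv.ofBijective _ (bijective_string hN hw)
  let θ := eM.symm.trans eN
  have hMnil : act M (nil : GroupAlg p) ^ (d + 1) = 0 := by
    rw [← hM]; exact Module.End.pow_finrank_eq_zero isNilpotent_act_nil
  have hNnil : act N (nil : GroupAlg p) ^ (d + 1) = 0 := by
    rw [← hN]; exact Module.End.pow_finrank_eq_zero isNilpotent_act_nil
  have h1 : ∀ s, θ ((nil : GroupAlg p) ^ s • v) = (nil : GroupAlg p) ^ s • w := by
    intro s
    by_cases hs : s < d + 1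
    · have e1 : eM (Pi.single ⟨s, hs⟩ 1) = (nil : GroupAlg p) ^ s • v := by
        simp [eM, Fintype.linearCombination_apply_single]
      have e2 : eN (Pi.single ⟨s, hs⟩ 1) = (nil : GroupAlg p) ^ s • w := by
        simp [eN, Fintype.linearCombination_apply_single]
      rw [← e1, ← e2]
      simp [θ]
    · have e1 : (nil : GroupAlg p) ^ s • v = 0 := by
        rw [← act_nil_pow_apply, ← Nat.sub_add_cancel (not_lt.1 hs), pow_add, hMnil, mul_zero,
          LinearMap.zero_apply]
      have e2 : (nil : GroupAlg p) ^ s • w = 0 := by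
        rw [← act_nil_pow_apply, ← Nat.sub_add_cancel (not_lt.1 hs), pow_add, hNnil, mul_zero,
          LinearMap.zero_apply]
      rw [e1, e2, map_zero]
  have ext : ∀ f g : M →ₗ[ZMod p] N, (∀ s : ℕ, f ((nil : GroupAlg p) ^ s • v) =
      g ((nil : GroupAlg p) ^ s • v)) → ∀ m, f m = g m := by
    intro f g hfg m
    obtain ⟨x, rfl⟩ := eM.surjective m
    simp [eM, Fintype.linearCombination_apply, map_sum, map_smul, hfg]
  have h2 : ∀ m, θ ((nil : GroupAlg p) • m) = (nil : GroupAlg p) • θ m := by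
    refine ext (θ.toLinearMap ∘ₗ act M nil) (act N nil ∘ₗ θ.toLinearMap) fun s => ?_
    simp only [LinearMap.comp_apply, act_apply, LinearEquiv.coe_coe, h1, ← mul_smul, ← pow_succ']
  have h3 : ∀ (n : ℕ) m, θ ((1 + nil : GroupAlg p) ^ n • m) = (1 + nil : GroupAlg p) ^ n • θ m := by
    intro n
    induction n with
    | zero => simp
    | succ n ih => intro m; rw [pow_succ, mul_smul, mul_smul, ih, add_smul, add_smul, map_add, h2]; simp
  have h4 : ∀ (c : ZMod p) m, θ (gr (upper c) • m) = gr (upper c) • θ m := by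
    intro c m
    obtain ⟨n, rfl⟩ := ZMod.natCast_zmod_surjective c
    rw [gr_upper_natCast, h3]
  have h5 : ∀ (c : ZMod p) (s : ℕ) m, θ ((gr (upper c) - 1) ^ s • m) =
      (gr (upper c) - 1) ^ s • θ m := by
    intro c s
    induction s with
    | zero => simp
    | succ s ih => intro m; rw [pow_succ, mul_smul, mul_smul, ih, sub_smul, sub_smul, map_sub, h4]; simp
  refine ⟨θ, h4, fun t => ?_⟩
  refine ext (θ.toLinearMap ∘ₗ act M (gr (torus t))) (act N (gr (torus t)) ∘ₗ θ.toLinearMap)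
    fun s => ?_
  -- Moving the torus past `nil` produces only elements of the group algebra of $U$, with which
  -- $\theta$ already commutes; equality of the two weights does the rest.
  have h6 : gr (torus t) * nil ^ s = (gr (upper ((t : ZMod p) ^ 2)) - 1) ^ s * gr (torus t) := by
    have : SemiconjBy (gr (torus t)) nil (gr (upper ((t : ZMod p) ^ 2)) - 1) := gr_torus_mul_nil t
    exact this.pow_right s
  simp only [LinearMap.comp_apply, act_apply, LinearEquiv.coe_coe, h1, ← mul_smul, h6]
  rw [mul_smul, mul_smul, hvw t, hww t, h5, map_smul]
  congr 2
  simpa using h1 0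

/-- The sum over `U \ G` of the conjugates of a `U`-linear map. -/
def relTrace (θ : M →ₗ[ZMod p] N)
    (hθ : ∀ (c : ZMod p) m, θ (gr (upper c) • m) = gr (upper c) • θ m) : M →ₗ[GroupAlg p] N :=
  equivariantMap (∑ x ∈ rows p, act N (gr (sec x)⁻¹) ∘ₗ θ ∘ₗ act M (gr (sec x))) (by
    intro g m
    have h := sum_rows_mul (fun h => gr h⁻¹ • θ (gr h • m)) (fun c h => by
      rw [mul_inv_rev, gr_mul_smul, gr_mul_smul, hθ, gr_inv_smul_smul]) g
    simp only [LinearMap.sum_apply, LinearMap.comp_apply, act_apply, ← h, Finset.smul_sum]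
    refine Finset.sum_congr rfl fun x _ => ?_
    rw [mul_inv_rev, gr_mul_smul g⁻¹, gr_smul_inv_smul, gr_mul_smul])

lemma relTrace_apply (θ : M →ₗ[ZMod p] N) (hθ) (m : M) :
    relTrace θ hθ m = ∑ x ∈ rows p, gr (sec x)⁻¹ • θ (gr (sec x) • m) := by
  simp [relTrace]

/-- The small Bruhat cell gives $p-1=-1$ copies of $\theta m$. On the big cell, for each $t$, the
sum over $U$ is an application of $\mathrm{nil}^{p-1}$, which kills $N$. -/
lemma relTrace_of_mem_fixU (θ : M →ₗ[ZMod p] N) (hθ)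
    (ht : ∀ (t : (ZMod p)ˣ) m, θ (gr (torus t) • m) = gr (torus t) • θ m)
    (hN : ∀ n : N, (nil : GroupAlg p) ^ (p - 1) • n = 0) {m : M} (hm : m ∈ fixU p M) :
    relTrace (p := p) θ hθ m = - θ m := by
  let T : SL(2, ZMod p) → N := fun h => gr h⁻¹ • θ (gr h • m)
  have hT : ∀ (c : ZMod p) h, T (upper c * h) = T h := by
    intro c h
    simp only [T]
    rw [mul_inv_rev, gr_mul_smul, gr_mul_smul, hθ, gr_inv_smul_smul]
  rw [relTrace_apply, ← Finset.sum_filter_add_sum_filter_not _ (fun x => detForm ![0, 1] x = 0),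
    sum_units_smul (y := ![0, 1]) (by intro h; simpa using congrFun h 1) (fun x => T (sec x))]
  have h1 : ∀ c : (ZMod p)ˣ, T (sec (c • ![0, 1] : Fin 2 → ZMod p)) = θ m := by
    intro c
    have hne : (c • ![0, 1] : Fin 2 → ZMod p) ≠ 0 :=
      units_smul_ne_zero (by intro h; simpa using congrFun h 1) c
    have e : sec (c • ![0, 1] : Fin 2 → ZMod p) = torus c⁻¹ := by
      rw [sec, dif_neg (by simp), dif_pos (by simp [Units.smul_def])]
      apply sl_ext <;> simp [slMk_coe, torus_coe, Units.smul_def]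
    simp only [T]
    rw [e, ht, gr_inv_smul_smul]
  have h2 : ∑ x ∈ rows p with ¬ detForm ![0, 1] x = 0, T (sec x) =
      ∑ y : (ZMod p)ˣ × ZMod p, T (antidiag y.1 * upper y.2) := by
    have hrow : ∀ y : (ZMod p)ˣ × ZMod p, (antidiag y.1 * upper y.2).1 1 =
        ![(y.1 : ZMod p), (y.1 : ZMod p) * y.2] := by
      intro y
      ext i
      fin_cases i <;> simp [sl_mul_coe, antidiag_coe, upper_coe, Matrix.mul_apply, Fin.sum_univ_two]
    symm
    refine Finset.sum_bij (fun y _ => ![(y.1 : ZMod p), (y.1 : ZMod p) * y.2]) ?_ ?_ ?_ ?_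
    · intro y _
      rw [Finset.mem_filter, mem_rows]
      refine ⟨fun h => y.1.ne_zero (by simpa using congrFun h 0), ?_⟩
      simp [detForm]
    · intro y _ y' _ h
      have h3 := congrFun h 0
      have h4 := congrFun h 1
      simp only [Matrix.cons_val_zero, Matrix.cons_val_one] at h3 h4
      have h5 : y.1 = y'.1 := Units.ext h3
      rw [h5] at h4
      exact Prod.ext h5 (mul_left_cancel₀ y'.1.ne_zero h4)
    · intro x hx
      rw [Finset.mem_filter] at hx
      have hx0 : x 0 ≠ 0 := by intro h; exact hx.2 (by simp [detForm, h])
      refine ⟨(Units.mk0 _ hx0, (x 0)⁻¹ * x 1), Finset.mem_univ _, ?_⟩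
      ext i; fin_cases i <;> simp [hx0]
    · intro y _
      have hne : ![(y.1 : ZMod p), (y.1 : ZMod p) * y.2] ≠ 0 :=
        fun h => y.1.ne_zero (by simpa using congrFun h 0)
      obtain ⟨c, hc⟩ := exists_upper_mul (g := antidiag y.1 * upper y.2)
        (h := sec ![(y.1 : ZMod p), (y.1 : ZMod p) * y.2]) (by rw [hrow, sec_row hne])
      rw [hc, hT]
  have h3 : ∀ t : (ZMod p)ˣ, ∑ d : ZMod p, T (antidiag t * upper d) = 0 := by
    intro t
    have : ∀ d : ZMod p, T (antidiag t * upper d) = gr (upper (-d)) • T (antidiag t) := by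
      intro d
      simp only [T]
      rw [mul_inv_rev, gr_mul_smul, gr_mul_smul, mem_fixU_iff.1 hm, upper_inv]
    rw [Finset.sum_congr rfl fun d _ => this d, ← Finset.sum_smul,
      Fintype.sum_equiv (Equiv.neg (ZMod p)) (fun d => gr (upper (-d))) (fun d => gr (upper d))
        (fun d => rfl), sum_gr_upper, hN]
  rw [Finset.sum_congr rfl fun c _ => h1 c, h2, Fintype.sum_prod_type,
    Finset.sum_eq_zero fun t _ => h3 t, add_zero, Finset.sum_const, Finset.card_univ,
      ← Nat.cast_smul_eq_nsmul (ZMod p)]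
  have := card_units_smul_neg (p := p)
  rw [neg_eq_iff_eq_neg] at this
  rw [this, neg_smul, one_smul]

/-- Jordan blocks of size less than `p` are determined by dimension and weight. -/
theorem nonempty_equiv_of_fixU [FiniteDimensional (ZMod p) M] [FiniteDimensional (ZMod p) N]
    (hM : Module.finrank (ZMod p) (fixU p M) ≤ 1) (hN : Module.finrank (ZMod p) (fixU p N) ≤ 1)
    (hMN : Module.finrank (ZMod p) M = Module.finrank (ZMod p) N)
    (hlt : Module.finrank (ZMod p) M < p) {s : M} (hs : s ∈ fixU p M) (hs0 : s ≠ 0)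
    {c : ℤ} (hw : IsWt p c s) {s' : N} (hs' : s' ∈ fixU p N) (hs0' : s' ≠ 0) (hw' : IsWt p c s') :
    Nonempty (M ≃ₗ[GroupAlg p] N) := by
  have : Nontrivial M := ⟨⟨s, 0, hs0⟩⟩
  obtain ⟨d, hd⟩ : ∃ d, Module.finrank (ZMod p) M = d + 1 :=
    Nat.exists_eq_succ_of_ne_zero Module.finrank_pos.ne'
  have hd' := hMN.symm.trans hd
  obtain ⟨v, hvw, hv⟩ := exists_isWt_top hM hs hs0 hw hd
  obtain ⟨v', hvw', hv'⟩ := exists_isWt_top hN hs' hs0' hw' hd'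
  obtain ⟨θ, h1, h2⟩ := exists_borel_equiv hd hd' hv hvw hv' hvw'
  have hNnil : ∀ n : N, (nil : GroupAlg p) ^ (p - 1) • n = 0 := by
    intro n
    have := Module.End.pow_finrank_eq_zero (K := ZMod p) (isNilpotent_act_nil (p := p) (M := N))
    rw [← act_nil_pow_apply, ← Nat.sub_add_cancel (show Module.finrank (ZMod p) N ≤ p - 1 by omega),
      pow_add, this, mul_zero, LinearMap.zero_apply]
  -- This equivariant map is $-\theta$ on the fixed line, and every nonzero submodule, in particular
  -- a nonzero kernel, would contain that line.
  let F := relTrace θ.toLinearMap h1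
  have hF : F s ≠ 0 := by
    rw [relTrace_of_mem_fixU θ.toLinearMap h1 h2 hNnil hs]
    simpa using hs0
  have hinj : Function.Injective F := by
    rw [← LinearMap.ker_eq_bot]
    by_contra h
    exact hF (fixU_mem_of_ne_bot hM h hs)
  exact ⟨LinearEquiv.ofBijective F ⟨hinj,
    (LinearMap.injective_iff_surjective_of_finrank_eq_finrank (f := F.restrictScalars (ZMod p))
      hMN).1 hinj⟩⟩

lemma HasRadicalLayers.exists_socle_wt {i : ℕ} {l : List ℕ} (hi : 1 ≤ i) :
    ∀ {M : Type u} [AddCommGroup M] [Module (ZMod p) M] [Module (GroupAlg p) M]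
    [IsScalarTower (ZMod p) (GroupAlg p) M] (_ : HasRadicalLayers p (l ++ [i]) M),
    ∃ s ∈ fixU p M, s ≠ 0 ∧ IsWt p ((i : ℤ) - 1) s := by
  induction l with
  | nil =>
    intro M _ _ _ _ h
    obtain ⟨⟨e⟩, h3⟩ := h
    have h3' : Subsingleton (Module.jacobson (GroupAlg p) M) := h3
    let e3 : SymMod p (i - 1) ≃ₗ[GroupAlg p] M :=
      (((Submodule.quotEquivOfEqBot _ (Submodule.subsingleton_iff_eq_bot.1 h3')).symm.trans e).trans
        (vmodEquiv p i)).symm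
    refine ⟨e3.toLinearMap (symMono (i - 1) 0), map_mem_fixU _ (symMono_zero_mem_fixU _), ?_, ?_⟩
    · exact fun h0 => symMono_zero_ne_zero (p := p) (i - 1) (e3.injective (h0.trans (map_zero _).symm))
    · have := (isWt_symMono (p := p) (i - 1) 0).map e3.toLinearMap
      rw [Nat.cast_sub hi] at this
      simpa using this
  | cons j l ih =>
    intro M _ _ _ _ h
    obtain ⟨s, hs, hs0, hw⟩ := ih h.2
    exact ⟨s, coe_mem_fixU.2 hs, by simpa using hs0, IsWt.coe.2 hw⟩

/-- Uniqueness of the modules of dimension `p - 1`. -/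
theorem HasRadicalLayers.nonempty_equiv_of_add_eq {i j : ℕ} (hi : 1 ≤ i) (hj : 1 ≤ j)
    (hij : i + j = p - 1) (h : HasRadicalLayers p [j, i] M) (h' : HasRadicalLayers p [j, i] N) :
    Nonempty (M ≃ₗ[GroupAlg p] N) := by
  obtain ⟨hfd, hfr⟩ := h.finrank_eq (by simp; omega)
  obtain ⟨hfd', hfr'⟩ := h'.finrank_eq (by simp; omega)
  have h1 := h.finrank_fixU_le hi hj hij
  have h2 := h'.finrank_fixU_le hi hj hij
  obtain ⟨s, hs, hs0, hw⟩ := HasRadicalLayers.exists_socle_wt (l := [j]) hi h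
  obtain ⟨s', hs', hs0', hw'⟩ := HasRadicalLayers.exists_socle_wt (l := [j]) hi h'
  refine nonempty_equiv_of_fixU h1 h2 (hfr.trans hfr'.symm) ?_ hs hs0 hw hs' hs0' hw'
  simp only [List.sum_cons, List.sum_nil] at hfr
  omega

end Modules

/-! ### Existence of the modules of dimension `p - 1` -/

open MvPolynomial in
/-- The derivation `X₀ ^ p ∂₀ + X₁ ^ p ∂₁`. -/
def frobDerivation (p : ℕ) [Fact p.Prime] :
    Derivation (ZMod p) (MvPolynomial (Fin 2) (ZMod p)) (MvPolynomial (Fin 2) (ZMod p)) :=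
  (X 0 ^ p : MvPolynomial (Fin 2) (ZMod p)) • pderiv 0 +
    (X 1 ^ p : MvPolynomial (Fin 2) (ZMod p)) • pderiv 1

lemma frobDerivation_apply (f : MvPolynomial (Fin 2) (ZMod p)) : frobDerivation p f =
    MvPolynomial.X 0 ^ p * MvPolynomial.pderiv 0 f +
      MvPolynomial.X 1 ^ p * MvPolynomial.pderiv 1 f := by
  simp [frobDerivation]

lemma frobDerivation_X (i : Fin 2) :
    frobDerivation p (MvPolynomial.X i) = MvPolynomial.X i ^ p := by
  fin_cases i <;> simp [frobDerivation_apply, MvPolynomial.pderiv_X]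

lemma frobDerivation_mem {n : ℕ} {f : MvPolynomial (Fin 2) (ZMod p)}
    (hf : f ∈ MvPolynomial.homogeneousSubmodule (Fin 2) (ZMod p) (n + 1)) :
    frobDerivation p f ∈ MvPolynomial.homogeneousSubmodule (Fin 2) (ZMod p) (p + n) := by
  rw [MvPolynomial.mem_homogeneousSubmodule] at hf ⊢
  rw [frobDerivation_apply]
  exact ((MvPolynomial.isHomogeneous_X_pow 0 p).mul (hf.pderiv (i := 0))).add
    ((MvPolynomial.isHomogeneous_X_pow 1 p).mul (hf.pderiv (i := 1)))

/-- Matrix entries in $\mathbb F_p$ are fixed by Frobenius, so the $p$-th power map commutes with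
the action on linear forms; the derivation rule extends this to all polynomials. -/
lemma slPolyMap_frobDerivation (g : SL(2, ZMod p)) (f : MvPolynomial (Fin 2) (ZMod p)) :
    slPolyMap g (frobDerivation p f) = frobDerivation p (slPolyMap g f) := by
  have hX : ∀ j, slPolyMap g (MvPolynomial.X j) ^ p =
      frobDerivation p (slPolyMap g (MvPolynomial.X j)) := by
    intro j
    rw [slPolyMap, MvPolynomial.aeval_X, Fin.sum_univ_two, map_add, add_pow_char]
    simp only [Derivation.leibniz, frobDerivation_X, mul_pow, ← map_pow, ZMod.pow_card,
      smul_eq_mul, MvPolynomial.derivation_C, mul_zero, add_zero]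
  induction f using MvPolynomial.induction_on with
  | C a => simp [slPolyMap]
  | add f h hf hh => simp only [map_add, hf, hh]
  | mul_X f j hf =>
    simp only [Derivation.leibniz, map_mul, map_add, smul_eq_mul, hf, frobDerivation_X, map_pow, hX]

/-- The homomorphism of symmetric powers given by `frobDerivation`. -/
def symFrob (p : ℕ) [Fact p.Prime] (m : ℕ) : SymMod p (m + 1) →ₗ[GroupAlg p] SymMod p (p + m) :=
  equivariantMap
    { toFun := fun f => symMk (frobDerivation p (symVal (m + 1) f))
        (frobDerivation_mem (symVal_mem f))
      map_add' := by intro f g; apply symVal_injective; simp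
      map_smul' := by intro c f; apply symVal_injective; simp }
    (by
      intro g f
      apply symVal_injective
      simp only [LinearMap.coe_mk, AddHom.coe_mk, symVal_symMk, symVal_gr_smul,
        slPolyMap_frobDerivation])

lemma symVal_symFrob (m : ℕ) (f : SymMod p (m + 1)) :
    symVal (p + m) (symFrob p m f) = frobDerivation p (symVal (m + 1) f) := rfl

lemma symDehom_symFrob (m : ℕ) (s : Fin (m + 2)) :
    symDehom (p + m) (symFrob p m (symMono (m + 1) s)) =
      Polynomial.C (((m + 1 - s.val : ℕ) : ZMod p)) * Polynomial.X ^ s.val +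
        Polynomial.C (((s.val : ℕ) : ZMod p)) * Polynomial.X ^ (p + (s.val - 1)) := by
  have h0 : dehom p (MvPolynomial.X 0) = 1 := by simp [dehom]
  have h1 : dehom p (MvPolynomial.X 1) = Polynomial.X := by simp [dehom]
  rw [symDehom, LinearMap.comp_apply, symVal_symFrob, symVal_symMono]
  simp only [Derivation.leibniz, Derivation.leibniz_pow, frobDerivation_X, AlgHom.toLinearMap_apply,
    map_add, smul_eq_mul, map_mul, map_pow, h0, h1, map_nsmul, one_pow, mul_one, one_mul,
    nsmul_eq_mul, map_natCast]
  rw [pow_add]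
  ring

/-- The source is simple, and $X_0^{m+1}$ goes to $(m+1)X_0^{p+m}\ne0$. -/
lemma symFrob_injective {m : ℕ} (hm : m + 1 < p) : Function.Injective (symFrob p m) := by
  have := isSimpleModule_symMod hm
  refine (LinearMap.injective_or_eq_zero (symFrob p m)).resolve_right fun h => ?_
  have h1 := symDehom_symFrob (p := p) m 0
  rw [h] at h1
  have h2 := congrArg (fun f => Polynomial.coeff f 0) h1
  simp [(Fact.out : p.Prime).ne_zero] at h2
  have h3 : ((m + 1 : ℕ) : ZMod p) = 0 := by push_cast; exact h2.symm
  rw [ZMod.natCast_eq_zero_iff] at h3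
  exact absurd (Nat.le_of_dvd (by omega) h3) (by omega)

/-- A functional vanishing on the image of `symFrob`. -/
def frobFunctional (p : ℕ) [Fact p.Prime] (m : ℕ) : SymMod p (p + m) →ₗ[ZMod p] ZMod p :=
  (Polynomial.lcoeff (ZMod p) 1 - (m : ZMod p) • Polynomial.lcoeff (ZMod p) p) ∘ₗ symDehom (p + m)

lemma frobFunctional_apply (m : ℕ) (f : SymMod p (p + m)) : frobFunctional p m f =
    (symDehom (p + m) f).coeff 1 - m * (symDehom (p + m) f).coeff p := by
  simp [frobFunctional]

/-- Only the monomial $X_0^mX_1$ matters: its image has coefficient $m$ at $X$ and $1$ at $X^p$, and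
the weight $m$ in the functional cancels them. -/
lemma frobFunctional_symFrob {m : ℕ} (hm : m + 1 < p) (f : SymMod p (m + 1)) :
    frobFunctional p m (symFrob p m f) = 0 := by
  have hp := (Fact.out : p.Prime).two_le
  have : frobFunctional p m ∘ₗ (symFrob p m).restrictScalars (ZMod p) = 0 := by
    apply symMod_linear_ext
    intro s
    have hs := s.2
    rw [LinearMap.comp_apply, LinearMap.restrictScalars_apply, frobFunctional_apply,
      symDehom_symFrob, LinearMap.zero_apply]
    simp only [Polynomial.coeff_add, Polynomial.coeff_C_mul, Polynomial.coeff_X_pow]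
    rw [if_neg (show ¬ (1 = p + (s.val - 1)) by omega), if_neg (show ¬ (p = s.val) by omega)]
    by_cases h1 : s.val = 1
    · simp [h1]
    · rw [if_neg (Ne.symm h1)]
      by_cases h0 : s.val = 0
      · simp [h0]
      · rw [if_neg (show ¬ (p = p + (s.val - 1)) by omega)]; simp
  exact LinearMap.congr_fun this f

/-- The module of dimension `p - 1` with socle of dimension `m`. -/
abbrev FrobQuot (p : ℕ) [Fact p.Prime] (m : ℕ) : Type :=
  SymMod p (p + m) ⧸ LinearMap.range (symFrob p m)

lemma finrank_frobQuot_le {m : ℕ} (hm : m + 1 < p) :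
    Module.finrank (ZMod p) (FrobQuot p m) ≤ p - 1 := by
  have h1 : Module.finrank (ZMod p) (FrobQuot p m) +
      Module.finrank (ZMod p) (LinearMap.range (symFrob p m)) =
      Module.finrank (ZMod p) (SymMod p (p + m)) := finrank_quotient_add _
  have h2 := finrank_symMod_le (p := p) (p + m)
  have h3 : Module.finrank (ZMod p) (LinearMap.range (symFrob p m)) = m + 1 + 1 := by
    rw [← finrank_symMod hm]
    exact (((LinearEquiv.ofInjective _ (symFrob_injective hm)).restrictScalars
      (ZMod p)).finrank_eq).symm
  omega

/-- The quotient is one Jordan block of size $p-1$ whose fixed line has weight $m-1$; the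
classification of such modules determines its layers. -/
theorem hasRadicalLayers_frobQuot (hp : 5 ≤ p) {m : ℕ} (hm1 : 1 ≤ m) (hm : m ≤ p - 2) :
    HasRadicalLayers p [p - 1 - m, m] (FrobQuot p m) := by
  -- This is $X_0^{m+1}X_1^{p-1}$. Its $(p-2)$-nd difference has degree at most one and linear
  -- coefficient $(p-1)!$, which the functional detects.
  let q0 : SymMod p (p + m) := symMono (p + m) ⟨p - 1, by omega⟩
  let q : FrobQuot p m := (LinearMap.range (symFrob p m)).mkQ q0
  have hq : (nil : GroupAlg p) ^ (p - 2) • q ≠ 0 := by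
    intro h0
    have h1 : (nil : GroupAlg p) ^ (p - 2) • q0 ∈ LinearMap.range (symFrob p m) := by
      rw [← Submodule.ker_mkQ (LinearMap.range (symFrob p m)), LinearMap.mem_ker, map_smul]
      exact h0
    obtain ⟨f, hf⟩ := h1
    have h2 := frobFunctional_symFrob (by omega) f
    rw [hf, frobFunctional_apply, symDehom_nil_pow_smul, symDehom_symMono] at h2
    obtain ⟨h3, h4⟩ := polyDiff_pow_coeff (p := p) (f := Polynomial.X ^ (p - 1)) (s := p - 1)
      (by simp) (p - 2) (by omega)
    rw [show p - 1 - (p - 2) = 1 by omega] at h3 h4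
    change ((polyDiff p ^ (p - 2)) (Polynomial.X ^ (p - 1))).coeff 1 - (m : ZMod p) *
      ((polyDiff p ^ (p - 2)) (Polynomial.X ^ (p - 1))).coeff p = 0 at h2
    rw [h4, Polynomial.coeff_eq_zero_of_natDegree_lt (n := p) (h3.trans_lt (by omega)), mul_zero, sub_zero,
      Polynomial.coeff_X_pow, if_pos rfl, mul_one] at h2
    exact descFactorial_ne_zero (by omega) (by omega) h2
  have hfr : Module.finrank (ZMod p) (FrobQuot p m) = p - 2 + 1 := by
    refine le_antisymm ((finrank_frobQuot_le (by omega)).trans (by omega)) ?_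
    refine Module.End.le_finrank_of_pow_apply_ne_zero (f := act (FrobQuot p m) nil)
      isNilpotent_act_nil (q := q) ?_
    rwa [act_nil_pow_apply]
  have hU : Module.finrank (ZMod p) (fixU p (FrobQuot p m)) ≤ 1 :=
    Module.End.finrank_ker_le_one (f := act (FrobQuot p m) nil) isNilpotent_act_nil hfr.le
      (q := q) (by rwa [act_nil_pow_apply])
  have hz : (nil : GroupAlg p) ^ (p - 2 + 1) • q = 0 := by
    rw [← act_nil_pow_apply, ← hfr, Module.End.pow_finrank_eq_zero isNilpotent_act_nil,
      LinearMap.zero_apply]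
  have hqw : IsWt p (((p + m : ℕ) : ℤ) - 2 * ((p - 1 : ℕ) : ℤ)) q :=
    (isWt_symMono (p + m) _).map _
  -- The weight is $p+m-2(p-1)+2(p-2)=(m-1)+(p-1)$.
  have hw := (isWt_nil_pow hqw hz).congr (b := (m : ℤ) - 1) ⟨1, by
    rw [Nat.cast_sub (by omega), Nat.cast_sub (by omega)]; push_cast; ring⟩
  have hs : (nil : GroupAlg p) ^ (p - 2) • q ∈ fixU p (FrobQuot p m) := by
    rw [mem_fixU, ← mul_smul, ← pow_succ', hz]
  rcases classification_of_fixU hp hU hs hq hw with ⟨n, hn, ⟨e⟩, hd⟩ | ⟨i, hi1, hi, h, _, hd⟩ | ⟨_, h⟩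
  -- A simple module of dimension $p-1$ has fixed weight $p-2\equiv-1$; this would force $p-1\mid
  -- m$.
  · exfalso
    have h1 := (e.restrictScalars (ZMod p)).finrank_eq
    rw [hfr, finrank_symMod hn] at h1
    have h2 : ((p - 1 : ℕ) : ℤ) ∣ ((m : ℕ) : ℤ) := by
      have h3 : n = p - 2 := by omega
      rw [h3, Nat.cast_sub (by omega)] at hd
      rw [Nat.cast_sub (by omega)]
      have := dvd_sub (dvd_refl ((p : ℤ) - 1)) hd
      push_cast at this ⊢
      ring_nf at this ⊢
      exact this
    rw [Int.natCast_dvd_natCast] at h2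
    exact absurd (Nat.le_of_dvd (by omega) h2) (by omega)
  · have h1 : i = m := by
      have h2 : ((p : ℤ) - 1) ∣ (i : ℤ) - m := by convert hd using 1; ring
      have h3 := Int.eq_zero_of_abs_lt_dvd h2 (by rw [abs_lt]; omega)
      omega
    rwa [h1] at h
  · omega

/-! ### The projective cover of the trivial module -/

section Modules

variable {M : Type u} [AddCommGroup M] [Module (ZMod p) M] [Module (GroupAlg p) M]
  [IsScalarTower (ZMod p) (GroupAlg p) M]

/-- The span of an invariant vector. -/
def invariantLine {e : M} (he : ∀ g : SL(2, ZMod p), gr g • e = e) : Submodule (GroupAlg p) M :=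
  stableSubmodule (Submodule.span (ZMod p) {e}) (by
    intro g m hm
    obtain ⟨c, rfl⟩ := Submodule.mem_span_singleton.1 hm
    rw [smul_comm, he]; exact hm)

lemma mem_invariantLine {e : M} (he : ∀ g : SL(2, ZMod p), gr g • e = e) {x : M} :
    x ∈ invariantLine he ↔ ∃ c : ZMod p, c • e = x := Submodule.mem_span_singleton

lemma finrank_invariantLine_le {e : M} (he : ∀ g : SL(2, ZMod p), gr g • e = e) :
    Module.finrank (ZMod p) (invariantLine he) ≤ 1 := by
  have h : Module.finrank (ZMod p) (Submodule.span (ZMod p) {e}) ≤ 1 := by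
    have := finrank_span_le_card (R := ZMod p) ({e} : Set M)
    simpa using this
  exact h

lemma coe_finrank_bot : Module.finrank (ZMod p) (⊥ : Submodule (GroupAlg p) M) = 0 :=
  finrank_bot (ZMod p) M

/-- If every nonzero submodule contains a given invariant vector, then the `U`-fixed points are
spanned by it. -/
lemma finrank_fixU_le_of_invariant [FiniteDimensional (ZMod p) M] {e : M}
    (he : ∀ g : SL(2, ZMod p), gr g • e = e) (he0 : e ≠ 0)
    (hmem : ∀ N : Submodule (GroupAlg p) M, N ≠ ⊥ → e ∈ N) :
    Module.finrank (ZMod p) (fixU p M) ≤ 1 := by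
  have hp := (Fact.out : p.Prime).two_le
  have heL : e ∈ invariantLine he := (mem_invariantLine he).2 ⟨1, one_smul _ _⟩
  have key : ∀ (b : ℕ) (y : M), b < p - 1 → y ∈ fixU p M → IsWt p (b : ℤ) y →
      y ∈ invariantLine he := by
    intro b y hb hy hw
    by_cases hy0 : y = 0
    · rw [hy0]; exact zero_mem _
    have hw' := hw.neg_of_nat hb.le
    obtain ⟨a, ha, ha1⟩ : ∃ a, a = p - 1 - b ∧ 1 ≤ a := ⟨_, rfl, by omega⟩
    rw [← ha] at hw'
    obtain ⟨f, hf, hfy⟩ := exists_fromFun_eq ha1 hy hw'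
    let ψ := fromFun (p := p) y hy
    have hpre : ∀ T : Submodule (GroupAlg p) (FunMod p), ¬ T ≤ LinearMap.ker ψ →
        ∃ z ∈ T, ψ z = e := by
      intro T hT
      have h3 : T.map ψ ≠ ⊥ := fun h => hT (LinearMap.le_ker_iff_map.2 h)
      exact hmem _ h3
    have hpre' : ∀ T : Submodule (GroupAlg p) (FunMod p), ¬ T ≤ LinearMap.ker ψ →
        T ⊓ (invariantLine he).comap ψ ≠ ⊥ := by
      intro T hT h
      obtain ⟨z, hz, hze⟩ := hpre T hT
      have h5 : z ∈ T ⊓ (invariantLine he).comap ψ := ⟨hz, by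
        change ψ z ∈ invariantLine he
        rw [hze]; exact heL⟩
      rw [h, Submodule.mem_bot] at h5
      rw [h5, map_zero] at hze
      exact he0 hze.symm
    have hmono : ∀ T : Submodule (GroupAlg p) (FunMod p), T ≤ (invariantLine he).comap ψ →
        Module.finrank (ZMod p) (T.map ψ) ≤ 1 := fun T hT =>
      (finrank_mono_submodule (Submodule.map_le_iff_le_comap.2 hT)).trans
        (finrank_invariantLine_le he)
    let S := LinearMap.range (evalMap (p := p) a)
    have hS : IsSimpleModule (GroupAlg p) S := isSimpleModule_range_evalMap (by omega)
    have hrS : Module.finrank (ZMod p) S = a + 1 := finrank_range_evalMap (by omega)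
    -- If $\mathrm{Sym}^a$ were not killed it would embed, and being simple it would lie in the
    -- preimage of the invariant line, although its dimension is $a+1\ge2$.
    have hSk : S ≤ LinearMap.ker ψ := by
      by_contra hc
      have h1 : S ⊓ LinearMap.ker ψ = ⊥ := by
        by_contra h; exact hc (le_of_inf_ne_bot h)
      have h2 := finrank_map_add_finrank_inf_ker S ψ
      rw [h1, coe_finrank_bot, hrS] at h2
      have h3 := hmono S (le_of_inf_ne_bot (hpre' S hc))
      omega
    have h1 := finrank_map_add_finrank_inf_ker (homFun p a) ψ
    rw [finrank_homFun ha1] at h1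
    have hy1 : y ∈ (homFun p a).map ψ := ⟨f, hf, hfy⟩
    have hnk : ¬ homFun p a ≤ LinearMap.ker ψ := by
      intro h
      rw [LinearMap.le_ker_iff_map.1 h] at hy1
      exact hy0 hy1
    suffices h : Module.finrank (ZMod p) ((homFun p a).map ψ) ≤ 1 by
      obtain ⟨z, hz, hze⟩ := hpre _ hnk
      have h3 : e ∈ (homFun p a).map ψ := ⟨z, hz, hze⟩
      obtain ⟨c, rfl⟩ := mem_span_of_finrank_le_one
        (W := ((homFun p a).map ψ).restrictScalars (ZMod p)) h h3 he0 hy1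
      exact Submodule.smul_of_tower_mem _ _ heL
    have hSle := finrank_mono_submodule (le_inf (range_evalMap_le a) hSk)
    change Module.finrank (ZMod p) S ≤ _ at hSle
    -- For $a=p-1$ the quotient by $\mathrm{Sym}^a$ already has dimension one. Otherwise the
    -- preimage of the invariant line is strictly larger than $\mathrm{Sym}^a$, hence everything.
    rcases Nat.lt_or_ge (p - 2) a with h4 | h4
    · omega
    · rcases homFun_submodule_cases ha1 h4
        (inf_le_left : homFun p a ⊓ (invariantLine he).comap ψ ≤ homFun p a) with h5 | h5 | h5
      · exact absurd h5 (hpre' _ hnk)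
      · exfalso
        obtain ⟨z, hz, hze⟩ := hpre _ hnk
        have h6 : z ∈ homFun p a ⊓ (invariantLine he).comap ψ := ⟨hz, by
          change ψ z ∈ invariantLine he
          rw [hze]; exact heL⟩
        rw [h5] at h6
        exact he0 (hze.symm.trans (hSk h6))
      · exact hmono _ (inf_eq_left.1 h5)
  have hle : fixU p M ≤ (invariantLine he).restrictScalars (ZMod p) := by
    intro y hy
    have h1 : ∑ b ∈ Finset.range (p - 1), (wproj (b : ℤ) : GroupAlg p) • y = y := by
      rw [← Finset.sum_smul, sum_wproj, one_smul]
    rw [← h1]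
    exact Submodule.sum_mem _ fun b hb => key b _ (Finset.mem_range.1 hb)
      (wproj_smul_mem_fixU hy _) (isWt_wproj _ _)
  exact (Submodule.finrank_mono hle).trans (finrank_invariantLine_le he)

end Modules

/-! ### The norm element and the projective cover of the trivial module. -/

/-- The sum of all group elements. -/
def normElt (p : ℕ) [Fact p.Prime] : GroupAlg p := ∑ g : SL(2, ZMod p), gr g

lemma gr_mul_normElt (g : SL(2, ZMod p)) : gr g * normElt p = normElt p := by
  rw [normElt, Finset.mul_sum]
  exact Fintype.sum_equiv (Equiv.mulLeft g) _ _ fun h => (gr_mul g h).symm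

lemma normElt_ne_zero : normElt p ≠ 0 := by
  intro h
  have h1 := congrArg (fun f : GroupAlg p => MonoidAlgebra.coeff f 1) h
  simp [normElt, gr, MonoidAlgebra.coeff_sum, Finsupp.single_apply] at h1

/-- The homomorphism from the regular module to itself determined by a functional. -/
def regularMap (φ : GroupAlg p →ₗ[ZMod p] ZMod p) : GroupAlg p →ₗ[GroupAlg p] GroupAlg p :=
  equivariantMap (∑ g : SL(2, ZMod p), (φ ∘ₗ act (GroupAlg p) (gr g⁻¹)).smulRight (gr g)) (by
    intro g x
    simp only [LinearMap.sum_apply, LinearMap.smulRight_apply, LinearMap.comp_apply, act_apply]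
    rw [Finset.smul_sum]
    symm
    refine Fintype.sum_equiv (Equiv.mulLeft g) _ _ fun h => ?_
    rw [Equiv.coe_mulLeft, mul_inv_rev, gr_mul_smul h⁻¹, gr_inv_smul_smul, gr_mul, smul_comm]
    rfl)

lemma regularMap_apply (φ : GroupAlg p →ₗ[ZMod p] ZMod p) (x : GroupAlg p) :
    regularMap φ x = ∑ g : SL(2, ZMod p), φ (gr g⁻¹ * x) • gr g := by
  simp [regularMap]

lemma regularMap_normElt (φ : GroupAlg p →ₗ[ZMod p] ZMod p) :
    regularMap φ (normElt p) = φ (normElt p) • normElt p := by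
  rw [regularMap_apply]
  simp only [gr_mul_normElt]
  rw [← Finset.smul_sum, normElt]

/-- The sum over $G$ is the sum over $U$ times the sum over representatives of $U\backslash G$, and
the former is $\mathrm{nil}^{p-1}$. -/
lemma exists_normElt_eq : ∃ r : GroupAlg p, normElt p = nil ^ (p - 1) * r := by
  refine ⟨∑ x ∈ rows p, gr (sec x), ?_⟩
  rw [← sum_gr_upper, Finset.sum_mul_sum, normElt, ← Finset.sum_product']
  symm
  refine Finset.sum_bij (fun y _ => upper y.1 * sec y.2) (fun _ _ => Finset.mem_univ _) ?_ ?_ ?_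
  · rintro ⟨c, x⟩ hx ⟨d, y⟩ hy h
    simp only [Finset.mem_product, mem_rows] at hx hy h
    have h1 : x = y := by
      have := congrArg (fun g : SL(2, ZMod p) => g.1 1) h
      simp only [row_upper_mul, sec_row hx.2, sec_row hy.2] at this
      exact this
    subst h1
    rw [upper_injective (mul_right_cancel h)]
  · intro g _
    obtain ⟨c, hc⟩ := exists_upper_mul (g := g) (h := sec (g.1 1)) (by rw [sec_row (row_ne_zero g)])
    exact ⟨(c, g.1 1), by simp [mem_rows, row_ne_zero], hc.symm⟩
  · intro y _
    rw [gr_mul]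

/-- There is a minimal direct summand of the regular module containing `normElt`. -/
lemma exists_minimal_summand : ∃ (P : Submodule (GroupAlg p) (GroupAlg p))
    (r : GroupAlg p →ₗ[GroupAlg p] P), (∀ x : P, r x = x) ∧ normElt p ∈ P ∧
    ∀ φ : P →ₗ[GroupAlg p] P, φ (r (normElt p)) = r (normElt p) → Function.Injective φ := by
  classical
  let S : ℕ → Prop := fun n => ∃ (P : Submodule (GroupAlg p) (GroupAlg p))
    (r : GroupAlg p →ₗ[GroupAlg p] P), (∀ x : P, r x = x) ∧ normElt p ∈ P ∧
      Module.finrank (ZMod p) P = n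
  have hS : ∃ n, S n := ⟨_, ⊤, Submodule.topEquiv.symm.toLinearMap, fun x => rfl, trivial, rfl⟩
  obtain ⟨P, r, hr, hm, hf⟩ := Nat.find_spec hS
  refine ⟨P, r, hr, hm, fun φ hφ => ?_⟩
  have : IsNoetherian (GroupAlg p) P := isNoetherian_of_tower (ZMod p) inferInstance
  have : IsArtinian (GroupAlg p) P := isArtinian_of_tower (ZMod p) inferInstance
  -- Fitting's lemma: the eventual image of $\varphi$ is a summand still containing the norm
  -- element, so by minimality of dimension it is everything and $\varphi$ is injective.
  obtain ⟨n, hn1, hc⟩ := ((Filter.eventually_ge_atTop 1).and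
    (LinearMap.eventually_isCompl_ker_pow_range_pow (R := GroupAlg p) (M := P) φ)).exists
  have hpow : ∀ k : ℕ, (φ ^ k) (r (normElt p)) = r (normElt p) := fun k => by
    induction k with
    | zero => rfl
    | succ k ih => rw [pow_succ, Module.End.mul_apply, hφ, ih]
  have hφn := hpow n
  let R := LinearMap.range (φ ^ n)
  let q : P →ₗ[GroupAlg p] R := R.projectionOnto _ hc.symm
  let j := R.equivMapOfInjective P.subtype P.injective_subtype
  have hmin : Nat.find hS ≤ Module.finrank (ZMod p) (R.map P.subtype) := by
    refine Nat.find_min' hS ⟨R.map P.subtype, j.toLinearMap ∘ₗ q ∘ₗ r, ?_, ?_, rfl⟩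
    · rintro ⟨_, ⟨y, hy, rfl⟩⟩
      have h1 : r (P.subtype y) = y := hr y
      have h2 : q y = ⟨y, hy⟩ := Submodule.projectionOnto_apply_left hc.symm ⟨y, hy⟩
      simp only [LinearMap.comp_apply, h1, h2]
      rfl
    · refine ⟨r (normElt p), ⟨_, hφn⟩, ?_⟩
      exact congrArg Subtype.val (hr ⟨_, hm⟩)
  rw [← hf] at hmin
  have h3 : Module.finrank (ZMod p) R = Module.finrank (ZMod p) (R.map P.subtype) :=
    (j.restrictScalars (ZMod p)).finrank_eq
  have h4 : R = ⊤ := by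
    apply eq_of_le_of_finrank_submodule le_top
    have : Module.finrank (ZMod p) (⊤ : Submodule (GroupAlg p) P) = Module.finrank (ZMod p) P :=
      finrank_top (ZMod p) P
    omega
  have h5 : LinearMap.ker (φ ^ n) = ⊥ := by simpa [R, h4] using hc.inf_eq_bot
  rw [← LinearMap.ker_eq_bot, eq_bot_iff, ← h5]
  intro x hx
  rw [LinearMap.mem_ker] at hx ⊢
  rw [← Nat.sub_add_cancel hn1, pow_succ, Module.End.mul_apply, hx, map_zero]

/-- Existence of the projective cover of the trivial module. -/
theorem exists_projectiveCover (hp : 5 ≤ p) : ∃ P : Submodule (GroupAlg p) (GroupAlg p),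
    Module.Projective (GroupAlg p) P ∧ HasRadicalLayers p [1, p - 2, 1] P ∧
    Module.finrank (ZMod p) (fixU p P) ≤ 1 := by
  obtain ⟨P, r, hr, hm, hinj⟩ := exists_minimal_summand (p := p)
  let e : P := ⟨normElt p, hm⟩
  have hre : r (normElt p) = e := hr e
  have he : ∀ g : SL(2, ZMod p), gr g • e = e := fun g => Subtype.ext (gr_mul_normElt g)
  have he0 : e ≠ 0 := fun h => normElt_ne_zero (congrArg Subtype.val h)
  -- A functional vanishing on $N$ but not on the norm extends to an endomorphism of $P$ that kills
  -- $N$ and fixes $e$. Minimality makes it injective, so $N=0$.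
  have hmem : ∀ N : Submodule (GroupAlg p) P, N ≠ ⊥ → e ∈ N := by
    intro N hN
    by_contra hc
    obtain ⟨φ, hφ, hk⟩ := Submodule.exists_le_ker_of_notMem
      (p := (N.map P.subtype).restrictScalars (ZMod p)) (v := normElt p) (by
        rintro ⟨x, hx, hxe⟩
        exact hc (by rwa [← show x = e from Subtype.ext hxe]))
    let F : P →ₗ[GroupAlg p] P := r ∘ₗ regularMap ((φ (normElt p))⁻¹ • φ) ∘ₗ P.subtype
    have hF : F (r (normElt p)) = r (normElt p) := by
      rw [hre]
      change r (regularMap ((φ (normElt p))⁻¹ • φ) (normElt p)) = e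
      rw [regularMap_normElt, LinearMap.smul_apply, smul_eq_mul, inv_mul_cancel₀ hφ, one_smul, hre]
    obtain ⟨x, hxN, hx0⟩ := Submodule.exists_mem_ne_zero_of_ne_bot hN
    apply hx0
    apply hinj F hF
    rw [map_zero]
    change r (regularMap ((φ (normElt p))⁻¹ • φ) x) = 0
    have : regularMap ((φ (normElt p))⁻¹ • φ) (x : GroupAlg p) = 0 := by
      rw [regularMap_apply]
      refine Finset.sum_eq_zero fun g _ => ?_
      have : φ (gr g⁻¹ * (x : GroupAlg p)) = 0 := hk ⟨gr g⁻¹ • x, N.smul_mem _ hxN, rfl⟩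
      rw [LinearMap.smul_apply, this, smul_zero, zero_smul]
    rw [this, map_zero]
  have hU := finrank_fixU_le_of_invariant (p := p) (M := P) he he0 hmem
  refine ⟨P, Module.Projective.of_split P.subtype r (LinearMap.ext hr), ?_, hU⟩
  obtain ⟨r0, hr0⟩ := exists_normElt_eq (p := p)
  -- The norm element has the form $\mathrm{nil}^{p-1}r$, so $P$ contains a Jordan block of full
  -- size.
  have hfr : p - 1 + 1 ≤ Module.finrank (ZMod p) P := by
    refine Module.End.le_finrank_of_pow_apply_ne_zero (f := act P nil)
      isNilpotent_act_nil (q := r r0) ?_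
    rw [act_nil_pow_apply, ← map_smul, smul_eq_mul, ← hr0, hre]
    exact he0
  have heU : e ∈ fixU p P := mem_fixU_iff.2 fun c => he _
  have hew : IsWt p 0 e := fun t => by rw [he]; simp
  rcases classification_of_fixU hp hU heU he0 hew with ⟨n, hn, ⟨f⟩, hd⟩ | ⟨i, hi1, hi, h, h', hd⟩ | ⟨h, _⟩
  · exfalso
    have := isSimpleModule_symMod hn
    have hs : IsSimpleModule (GroupAlg p) P := IsSimpleModule.congr f
    have h1 : invariantLine (p := p) (M := P) he = ⊤ := by
      refine (eq_bot_or_eq_top _).resolve_left fun h => he0 ?_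
      have : e ∈ invariantLine (p := p) (M := P) he :=
        (mem_invariantLine (p := p) (M := P) he).2 ⟨1, one_smul _ _⟩
      rwa [h] at this
    have h2 := finrank_invariantLine_le (p := p) (M := P) he
    have h3 : Module.finrank (ZMod p) (⊤ : Submodule (GroupAlg p) P) = Module.finrank (ZMod p) P :=
      finrank_top (ZMod p) P
    rw [h1] at h2
    omega
  · omega
  · exact h

/-- Uniqueness of the projective cover of the trivial module. -/
theorem HasRadicalLayers.nonempty_equiv_of_projective (hp : 5 ≤ p)
    {P : Type v} [AddCommGroup P] [Module (ZMod p) P] [Module (GroupAlg p) P]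
    [IsScalarTower (ZMod p) (GroupAlg p) P]
    {M : Type u} [AddCommGroup M] [Module (ZMod p) M] [Module (GroupAlg p) M]
    [IsScalarTower (ZMod p) (GroupAlg p) M] [Module.Projective (GroupAlg p) P]
    (hP : HasRadicalLayers p [1, p - 2, 1] P) (hM : HasRadicalLayers p [1, p - 2, 1] M) :
    Nonempty (M ≃ₗ[GroupAlg p] P) := by
  obtain ⟨hfd, hfr⟩ := hP.finrank_eq (by simp; omega)
  obtain ⟨hfd', hfr'⟩ := hM.finrank_eq (by simp; omega)
  obtain ⟨⟨e1⟩, _⟩ := id hP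
  obtain ⟨⟨e2⟩, _⟩ := id hM
  let π : P →ₗ[GroupAlg p] M ⧸ Module.jacobson (GroupAlg p) M :=
    (e1.trans e2.symm).toLinearMap ∘ₗ (Module.jacobson (GroupAlg p) P).mkQ
  obtain ⟨f, hf⟩ := Module.projective_lifting_property (Module.jacobson (GroupAlg p) M).mkQ π
    (Submodule.mkQ_surjective _)
  have hπ : Function.Surjective π :=
    (e1.trans e2.symm).surjective.comp (Submodule.mkQ_surjective _)
  -- The lift is surjective onto the nonzero top, so its range is not in the radical, and a simple
  -- top leaves no other proper room.
  have htop : LinearMap.range f = ⊤ := by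
    refine hM.eq_top (by omega) fun hle => ?_
    have hs := hM.isSimpleModule_top (by omega)
    have : Nontrivial (M ⧸ Module.jacobson (GroupAlg p) M) :=
      IsSimpleModule.nontrivial (GroupAlg p) _
    obtain ⟨z, hz⟩ := exists_ne (0 : M ⧸ Module.jacobson (GroupAlg p) M)
    obtain ⟨x, rfl⟩ := hπ z
    apply hz
    rw [← hf, LinearMap.comp_apply]
    have : f x ∈ LinearMap.ker (Module.jacobson (GroupAlg p) M).mkQ := by
      rw [Submodule.ker_mkQ]; exact hle ⟨x, rfl⟩
    exact this
  have hsurj := LinearMap.range_eq_top.1 htop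
  have hinj : Function.Injective f :=
    (LinearMap.injective_iff_surjective_of_finrank_eq_finrank (f := f.restrictScalars (ZMod p))
      (hfr.trans hfr'.symm)).2 hsurj
  exact ⟨(LinearEquiv.ofBijective f ⟨hinj, hsurj⟩).symm⟩

/-! ### Kernels and minimal activity of representations -/

section Modules

variable {M : Type u} [AddCommGroup M] [Module (ZMod p) M] [Module (GroupAlg p) M]
  [IsScalarTower (ZMod p) (GroupAlg p) M]

lemma gr_upper_smul_natCast_mul {c : ZMod p} {m : M} (h : gr (upper c) • m = m) (n : ℕ) :
    gr (upper ((n : ZMod p) * c)) • m = m := by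
  rw [← upper_pow]
  induction n with
  | zero => simp [gr_one]
  | succ n ih => rw [pow_succ, gr_mul_smul, h, ih]

variable (p M) in
/-- The group generator acts with at most one nontrivial Jordan block. -/
def SingleBlock : Prop :=
  Module.finrank (ZMod p) (fixU p M ⊓ LinearMap.range (act M (nil : GroupAlg p)) :
    Submodule (ZMod p) M) ≤ 1

lemma singleBlock_of_fixU [FiniteDimensional (ZMod p) M]
    (h : Module.finrank (ZMod p) (fixU p M) ≤ 1) : SingleBlock p M :=
  (Submodule.finrank_mono inf_le_left).trans h

lemma SingleBlock.congr {N : Type v} [AddCommGroup N] [Module (ZMod p) N] [Module (GroupAlg p) N]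
    [IsScalarTower (ZMod p) (GroupAlg p) N] [FiniteDimensional (ZMod p) M]
    (h : SingleBlock p M) (e : M ≃ₗ[GroupAlg p] N) : SingleBlock p N := by
  let e' : M ≃ₗ[ZMod p] N := e.restrictScalars (ZMod p)
  have hle : (fixU p N ⊓ LinearMap.range (act N (nil : GroupAlg p)) : Submodule (ZMod p) N) ≤
      (fixU p M ⊓ LinearMap.range (act M (nil : GroupAlg p)) : Submodule (ZMod p) M).map
        e'.toLinearMap := by
    rintro x ⟨hx, y, hy⟩
    refine ⟨e.symm x, ⟨map_mem_fixU e.symm.toLinearMap hx, e.symm y, ?_⟩, e.apply_symm_apply x⟩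
    rw [act_apply, ← map_smul, ← hy, act_apply]
  exact (Submodule.finrank_mono hle).trans ((Submodule.finrank_map_le _ _).trans h)

lemma range_act_upper_sub_one_le (c : ZMod p) :
    LinearMap.range (act M (gr (upper c) - 1)) ≤ LinearMap.range (act M (nil : GroupAlg p)) := by
  obtain ⟨r, hr, hc⟩ := gr_upper_sub_one c
  rintro _ ⟨m, rfl⟩
  exact ⟨r • m, by rw [hc, act_apply, act_apply, mul_smul]⟩

lemma ker_act_upper_sub_one_le {c : ZMod p} (hc : c ≠ 0) :
    LinearMap.ker (act M (gr (upper c) - 1)) ≤ fixU p M := by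
  intro m hm
  rw [LinearMap.mem_ker, act_apply, sub_smul, one_smul, sub_eq_zero] at hm
  rw [mem_fixU, nil, sub_smul, one_smul, sub_eq_zero]
  have := gr_upper_smul_natCast_mul hm (c⁻¹).val
  rwa [ZMod.natCast_zmod_val, inv_mul_cancel₀ hc] at this

lemma isNilpotent_act_upper_sub_one (c : ZMod p) : IsNilpotent (act M (gr (upper c) - 1)) := by
  obtain ⟨r, hr, hc⟩ := gr_upper_sub_one c
  exact ⟨p, by rw [← map_pow, hc, hr.mul_pow, nil_pow_p, zero_mul, map_zero]⟩

end Modules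

section Representations

variable {V : Type u} [AddCommGroup V] [Module (ZMod p) V]
  (ρ : Representation (ZMod p) SL(2, ZMod p) V)

/-- Every element of order $p$ is conjugate to some nontrivial $u^c$, whose kernel and image lie in
those for `nil`; the Jordan basis is transported by the conjugating element. -/
lemma isMinimallyActive_of_singleBlock [FiniteDimensional (ZMod p) V]
    (h : SingleBlock p (RepMod ρ)) : IsMinimallyActive p ρ := by
  intro x hx
  obtain ⟨g, c, hc, rfl⟩ := exists_conj_upper hx
  obtain ⟨a, b, e, h1, h2, h3⟩ := Module.End.exists_jordan_basis
    (isNilpotent_act_upper_sub_one (M := RepMod ρ) c)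
    ((Submodule.finrank_mono (inf_le_inf (ker_act_upper_sub_one_le hc)
      (range_act_upper_sub_one_le c))).trans h)
  let γ : V ≃ₗ[ZMod p] V := LinearEquiv.ofLinearMap (ρ g) (ρ g⁻¹)
    (by rw [← Module.End.mul_eq_comp, ← map_mul, mul_inv_cancel, map_one]; rfl)
    (by rw [← Module.End.mul_eq_comp, ← map_mul, inv_mul_cancel, map_one]; rfl)
  have key : ∀ m : RepMod ρ, ρ (g * upper c * g⁻¹) (γ (RepMod.equiv ρ m)) =
      γ (RepMod.equiv ρ m) + γ (RepMod.equiv ρ (act (RepMod ρ) (gr (upper c) - 1) m)) := by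
    intro m
    rw [← map_add, ← map_add, act_apply, sub_smul, one_smul, add_sub_cancel,
      RepMod.equiv_gr_smul]
    change ρ (g * upper c * g⁻¹) (ρ g _) = ρ g _
    rw [← Module.End.mul_apply, ← Module.End.mul_apply, ← map_mul, ← map_mul]
    congr 2
    group
  refine ⟨a, b, e.map (RepMod.equiv ρ ≪≫ₗ γ), fun m => ?_, fun m hm => ?_, fun m m' hm => ?_⟩
  · rw [Module.Basis.map_apply, LinearEquiv.trans_apply, key, h1]; simp
  · rw [Module.Basis.map_apply, LinearEquiv.trans_apply, key, h2 m hm]; simp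
  · rw [Module.Basis.map_apply, LinearEquiv.trans_apply, key, h3 m m' hm]; simp

lemma IsMinimallyActive.singleBlock [FiniteDimensional (ZMod p) V]
    {ρ : Representation (ZMod p) SL(2, ZMod p) V}
    (h : IsMinimallyActive p ρ) : SingleBlock p (RepMod ρ) := by
  obtain ⟨a, b, e, h1, h2, h3⟩ := h (upper 1) (orderOf_upper one_ne_zero)
  have key : ∀ v : V, act (RepMod ρ) (nil : GroupAlg p) ((RepMod.equiv ρ).symm v) =
      (RepMod.equiv ρ).symm (ρ (upper 1) v - v) := by
    intro v
    rw [act_apply, nil_smul_eq, RepMod.gr_smul_symm, map_sub]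
  refine Module.End.finrank_ker_inf_range_le_one (e.map (RepMod.equiv ρ).symm)
    (fun m => ?_) (fun m hm => ?_) (fun m m' hm => ?_)
  · rw [Module.Basis.map_apply, key, h1, sub_self, map_zero]
  · rw [Module.Basis.map_apply, key, h2 m hm, sub_self, map_zero]
  · rw [Module.Basis.map_apply, key, h3 m m' hm, add_sub_cancel_left, Module.Basis.map_apply]

variable {ρ}

lemma RepMod.gr_smul_eq_iff {g : SL(2, ZMod p)} :
    (∀ m : RepMod ρ, gr g • m = m) ↔ g ∈ ρ.ker := by
  rw [MonoidHom.mem_ker]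
  refine ⟨fun h => LinearMap.ext fun v => ?_, fun h m => ?_⟩
  · have := h ((RepMod.equiv ρ).symm v)
    rw [RepMod.gr_smul_symm] at this
    exact (RepMod.equiv ρ).symm.injective this
  · apply (RepMod.equiv ρ).injective
    rw [RepMod.equiv_gr_smul, h]; rfl

lemma neg_one_mem_center : (-1 : SL(2, ZMod p)) ∈ Subgroup.center SL(2, ZMod p) :=
  mem_center_sl.2 (Or.inr rfl)

lemma neg_one_ne_one (hp : 2 < p) : (-1 : SL(2, ZMod p)) ≠ 1 := by
  intro h
  have h1 := congrArg (fun g : SL(2, ZMod p) => g.1 0 0) h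
  have : Fact (2 < p) := ⟨hp⟩
  simp only [Matrix.SpecialLinearGroup.coe_neg] at h1
  exact ZMod.neg_one_ne_one (by simpa using h1)

lemma eq_bot_or_eq_center {K : Subgroup SL(2, ZMod p)} (h : K ≤ Subgroup.center SL(2, ZMod p)) :
    K = ⊥ ∨ K = Subgroup.center SL(2, ZMod p) := by
  by_cases h1 : (-1 : SL(2, ZMod p)) ∈ K
  · right
    refine le_antisymm h fun g hg => ?_
    rcases mem_center_sl.1 hg with rfl | rfl
    · exact one_mem _
    · exact h1
  · left
    rw [eq_bot_iff]
    intro g hg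
    rcases mem_center_sl.1 (h hg) with rfl | rfl
    · exact one_mem _
    · exact absurd hg h1

end Representations

/-- Evaluating $X_0^n$ and $X_1^n$ at coordinate rows kills the off-diagonal entries; $X_0^n$ and
$X_0^{n-1}X_1$ at $(1,1)$ equate the diagonal ones. -/
lemma mem_center_of_symMod {n : ℕ} (hn1 : 1 ≤ n) {g : SL(2, ZMod p)}
    (h : ∀ f : SymMod p n, gr g • f = f) : g ∈ Subgroup.center SL(2, ZMod p) := by
  have key : ∀ (s : Fin (n + 1)) (x : Fin 2 → ZMod p),
      (Matrix.vecMul x g.1) 0 ^ (n - s.val) * (Matrix.vecMul x g.1) 1 ^ s.val =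
        x 0 ^ (n - s.val) * x 1 ^ s.val := by
    intro s x
    have h1 := congrArg (fun f => ev x (evalMap n f)) (h (symMono n s))
    simp only [map_smul, ev_gr_smul, ev_evalMap, symVal_symMono] at h1
    simpa using h1
  have h10 : g.1 1 0 = 0 := by
    have := key 0 ![0, 1]
    simp [Matrix.vecMul, dotProduct, Fin.sum_univ_two, show n ≠ 0 by omega] at this
    exact this
  have h01 : g.1 0 1 = 0 := by
    have := key (Fin.last n) ![1, 0]
    simp [Matrix.vecMul, dotProduct, Fin.sum_univ_two, show n ≠ 0 by omega] at this
    exact this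
  have h0 := key 0 ![1, 1]
  have h1 := key ⟨1, by omega⟩ ![1, 1]
  simp [Matrix.vecMul, dotProduct, Fin.sum_univ_two, h10, h01] at h0 h1
  refine mem_center_of_entries h01 h10 ?_
  have hne : g.1 0 0 ≠ 0 := fun h => by
    rw [h, zero_pow (by omega)] at h0; exact zero_ne_one h0
  rw [← Nat.sub_add_cancel hn1, pow_succ] at h0
  exact mul_left_cancel₀ (pow_ne_zero _ hne) (h0.trans h1.symm)

lemma vecMul_neg_one (x : Fin 2 → ZMod p) :
    Matrix.vecMul x (-1 : SL(2, ZMod p)).1 = (-1 : ZMod p) • x := by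
  rw [Matrix.SpecialLinearGroup.coe_neg]
  simp [Matrix.vecMul_neg]

lemma gr_neg_one_smul_homFun {a : ℕ} {f : FunMod p} (hf : f ∈ homFun p a) :
    gr (-1 : SL(2, ZMod p)) • f = (-1 : ZMod p) ^ a • f := by
  apply fun_ext
  intro x
  rw [ev_gr_smul, vecMul_neg_one, mem_homFun.1 hf, map_smul, smul_eq_mul]

lemma gr_neg_one_smul_symMod {n : ℕ} (hn : n < p) (f : SymMod p n) :
    gr (-1 : SL(2, ZMod p)) • f = (-1 : ZMod p) ^ n • f := by
  apply evalMap_injective hn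
  rw [map_smul, gr_neg_one_smul_homFun (evalMap_mem_homFun f)]
  exact (LinearMap.map_smul ((evalMap n).restrictScalars (ZMod p)) _ _).symm

/-! ### Modules as representations -/

/-- The representation on a module over the group algebra. -/
def modRep (M : Type u) [AddCommGroup M] [Module (ZMod p) M] [Module (GroupAlg p) M]
    [IsScalarTower (ZMod p) (GroupAlg p) M] : Representation (ZMod p) SL(2, ZMod p) M where
  toFun g := act M (gr g)
  map_one' := by rw [gr_one, map_one]
  map_mul' g h := by rw [gr_mul, map_mul]

/-- The module of the representation on a module. -/
def modRepEquiv (M : Type u) [AddCommGroup M] [Module (ZMod p) M] [Module (GroupAlg p) M]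
    [IsScalarTower (ZMod p) (GroupAlg p) M] : RepMod (modRep (p := p) M) ≃ₗ[GroupAlg p] M :=
  LinearEquiv.ofBijective (equivariantMap (RepMod.equiv (modRep (p := p) M)).toLinearMap fun g m => by
    rw [LinearEquiv.coe_coe, RepMod.equiv_gr_smul]; rfl) (RepMod.equiv (modRep (p := p) M)).bijective

lemma IsIndecomposableModule.congr {R M N : Type*} [Ring R] [AddCommGroup M] [Module R M]
    [AddCommGroup N] [Module R N] (h : IsIndecomposableModule R M) (e : M ≃ₗ[R] N) :
    IsIndecomposableModule R N := by
  obtain ⟨h1, h2⟩ := h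
  refine ⟨e.injective.nontrivial, fun P Q hPQ => ?_⟩
  let o := Submodule.orderIsoMapComap e.symm
  rcases h2 (o P) (o Q) (o.isCompl_iff.1 hPQ) with h | h
  · exact Or.inl (by simpa using h)
  · exact Or.inr (by simpa using h)

section Representations

variable {V : Type u} [AddCommGroup V] [Module (ZMod p) V]
  {ρ : Representation (ZMod p) SL(2, ZMod p) V}

lemma isMinActIndec_of_indecomposable [FiniteDimensional (ZMod p) V]
    (h1 : IsIndecomposableModule (GroupAlg p) (RepMod ρ)) (h2 : SingleBlock p (RepMod ρ))
    (h3 : ρ.ker ≤ Subgroup.center SL(2, ZMod p)) : IsMinActIndec p ρ :=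
  ⟨h1.congr (RepMod.asModuleEquiv ρ).symm, isMinimallyActive_of_singleBlock ρ h2,
    eq_bot_or_eq_center h3⟩

lemma isMinActIndec_of_hasRadicalLayers {i j : ℕ} {l : List ℕ} (hi : i - 1 < p)
    (h : HasRadicalLayers p (i :: l) (RepMod ρ)) [FiniteDimensional (ZMod p) V]
    (hj : j ∈ i :: l) (hj2 : 2 ≤ j) (h2 : SingleBlock p (RepMod ρ)) : IsMinActIndec p ρ := by
  refine isMinActIndec_of_indecomposable (h.isIndecomposableModule hi) h2 fun g hg => ?_
  refine mem_center_of_symMod (n := j - 1) (by omega) fun f => ?_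
  apply (vmodEquiv p j).symm.injective
  rw [map_smul]
  exact h.trivial_of_mem hj g (RepMod.gr_smul_eq_iff.2 hg) _

end Representations

/-- A module with given radical layers yields a representation in any universe. -/
theorem exists_isMinActIndec {M : Type} [AddCommGroup M] [Module (ZMod p) M] [Module (GroupAlg p) M]
    [IsScalarTower (ZMod p) (GroupAlg p) M] {i j : ℕ} {l : List ℕ}
    (hl : ∀ m ∈ i :: l, 1 ≤ m ∧ m ≤ p) (h : HasRadicalLayers p (i :: l) M)
    (hj : j ∈ i :: l) (hj2 : 2 ≤ j) (h2 : SingleBlock p M) :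
    ∃ (W : Type u) (_ : AddCommGroup W) (_ : Module (ZMod p) W)
      (σ : Representation (ZMod p) SL(2, ZMod p) W),
      IsMinActIndec p σ ∧ Module.finrank (ZMod p) W = (i :: l).sum ∧
      HasRadicalLayers p (i :: l) σ.asModule ∧ Nonempty (σ.asModule ≃ₗ[GroupAlg p] M) := by
  obtain ⟨hfd, hfr⟩ := h.finrank_eq hl
  let e : RepMod (modRep (p := p) (ULift.{u} M)) ≃ₗ[GroupAlg p] M :=
    (modRepEquiv (p := p) (ULift.{u} M)).trans ULift.moduleEquiv
  have h' := h.congr e.symm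
  refine ⟨ULift.{u} M, inferInstance, inferInstance, modRep (p := p) (ULift.{u} M), ?_, ?_,
    h'.congr (RepMod.asModuleEquiv _).symm, ⟨(RepMod.asModuleEquiv _).trans e⟩⟩
  · have : FiniteDimensional (ZMod p) (ULift.{u} M) :=
      Module.Finite.equiv (ULift.moduleEquiv (R := ZMod p)).symm
    exact isMinActIndec_of_hasRadicalLayers (by have := hl i (by simp); omega) h' hj hj2
      (h2.congr e.symm)
  · rw [← hfr]; exact (ULift.moduleEquiv (R := ZMod p)).finrank_eq

/-! ### The simple modules -/

lemma nonempty_vmod_one_equiv : Nonempty (VMod p 1 ≃ₗ[GroupAlg p]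
    (Representation.trivial (ZMod p) SL(2, ZMod p) (ZMod p)).asModule) := by
  obtain ⟨e⟩ := nonempty_equiv_symMod_zero (p := p)
    (M := RepMod (Representation.trivial (ZMod p) SL(2, ZMod p) (ZMod p)))
    ((RepMod.equiv _).finrank_eq.trans (Module.finrank_self _))
  exact ⟨(vmodEquiv p 1).trans (e.symm.trans (RepMod.asModuleEquiv _).symm)⟩

/-- Linear forms as elements of the first symmetric power. -/
def linearForm (p : ℕ) [Fact p.Prime] : RepMod (naturalRep (ZMod p)) →ₗ[GroupAlg p] SymMod p 1 :=
  equivariantMap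
    { toFun := fun v => symMk (∑ i : Fin 2, RepMod.equiv (naturalRep (ZMod p)) v i •
          (MvPolynomial.X i : MvPolynomial (Fin 2) (ZMod p)))
        (Submodule.sum_mem _ fun i _ => Submodule.smul_mem _ _ (MvPolynomial.isHomogeneous_X _ i))
      map_add' := fun v w => by
        apply symVal_injective
        simp only [map_add, symVal_symMk, Pi.add_apply, add_smul, Finset.sum_add_distrib]
      map_smul' := fun c v => by
        apply symVal_injective
        simp only [map_smul, symVal_symMk, Pi.smul_apply, smul_assoc, Finset.smul_sum,
          RingHom.id_apply] } (by
    intro g v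
    apply symVal_injective
    simp only [LinearMap.coe_mk, AddHom.coe_mk, symVal_gr_smul, symVal_symMk, map_sum, map_smul,
      RepMod.equiv_gr_smul]
    simp [slPolyMap, naturalRep, Matrix.mulVec, dotProduct, Fin.sum_univ_two, MvPolynomial.smul_eq_C_mul]
    ring)

lemma linearForm_injective : Function.Injective (linearForm p) := by
  rw [← LinearMap.ker_eq_bot, LinearMap.ker_eq_bot']
  intro v hv
  have h1 := congrArg (symVal 1) hv
  simp only [linearForm, equivariantMap_apply, LinearMap.coe_mk, AddHom.coe_mk, symVal_symMk,
    map_zero, Fin.sum_univ_two] at h1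
  apply (RepMod.equiv (naturalRep (ZMod p))).injective
  rw [map_zero]
  funext i
  have h2 := congrArg (MvPolynomial.eval (Pi.single i 1)) h1
  fin_cases i <;> simpa using h2

lemma nonempty_vmod_two_equiv : Nonempty (VMod p 2 ≃ₗ[GroupAlg p]
    (naturalRep (ZMod p)).asModule) := by
  have h : Module.finrank (ZMod p) (RepMod (naturalRep (ZMod p))) =
      Module.finrank (ZMod p) (SymMod p 1) := by
    rw [finrank_symMod (Fact.out : p.Prime).one_lt, (RepMod.equiv _).finrank_eq]; simp
  have hb : Function.Bijective (linearForm p) := ⟨linearForm_injective,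
    (LinearMap.injective_iff_surjective_of_finrank_eq_finrank
      (f := (linearForm p).restrictScalars (ZMod p)) h).1 linearForm_injective⟩
  exact ⟨(vmodEquiv p 2).trans ((LinearEquiv.ofBijective _ hb).symm.trans
    (RepMod.asModuleEquiv _).symm)⟩

lemma isSimpleModule_vmod {i : ℕ} (hi : i - 1 < p) : IsSimpleModule (GroupAlg p) (VMod p i) := by
  have := isSimpleModule_symMod hi
  exact IsSimpleModule.congr (vmodEquiv p i)

lemma finrank_vmod {i : ℕ} (hi : 1 ≤ i) (hip : i ≤ p) : Module.finrank (ZMod p) (VMod p i) = i := by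
  have h : Module.finrank (ZMod p) (SymMod p (i - 1)) = i := by
    rw [finrank_symMod (by omega)]; omega
  exact h

lemma isMinActIndec_symPowRep {i : ℕ} (hi : 2 ≤ i) (hip : i ≤ p) :
    IsMinActIndec p (symPowRep (ZMod p) (i - 1)) := by
  have h1 : HasRadicalLayers p [i] (SymMod p (i - 1)) :=
    HasRadicalLayers.of_isSimpleModule (by omega) (vmodEquiv p i).symm
  have : FiniteDimensional (ZMod p) (MvPolynomial.homogeneousSubmodule (Fin 2) (ZMod p) (i - 1)) :=
    inferInstanceAs (FiniteDimensional (ZMod p) (SymMod p (i - 1)))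
  exact isMinActIndec_of_hasRadicalLayers (by omega) h1 (by simp) hi
    (singleBlock_of_fixU (finrank_fixU_symMod_le (by omega)))

section Representations

variable {V : Type u} [AddCommGroup V] [Module (ZMod p) V]
  {ρ : Representation (ZMod p) SL(2, ZMod p) V}

lemma exists_equiv_vmod (h : IsSimpleModule (GroupAlg p) ρ.asModule) :
    ∃ i : ℕ, 1 ≤ i ∧ i ≤ p ∧ Nonempty (ρ.asModule ≃ₗ[GroupAlg p] VMod p i) := by
  have : IsSimpleModule (GroupAlg p) (RepMod ρ) := IsSimpleModule.congr (RepMod.asModuleEquiv ρ).symm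
  obtain ⟨n, hn, ⟨e⟩⟩ := exists_equiv_symMod (p := p) (M := RepMod ρ)
  exact ⟨n + 1, by omega, by omega,
    ⟨(RepMod.asModuleEquiv ρ).trans (e.trans (vmodEquiv p (n + 1)).symm)⟩⟩

lemma IsMinActIndec.indecomposable (h : IsMinActIndec p ρ) :
    IsIndecomposableModule (GroupAlg p) (RepMod ρ) := h.1.congr (RepMod.asModuleEquiv ρ)

lemma IsMinActIndec.exists_gr_smul_ne (h : IsMinActIndec p ρ) :
    ∃ (g : SL(2, ZMod p)) (m : RepMod ρ), gr g • m ≠ m := by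
  by_contra hc
  push Not at hc
  have h1 : upper (1 : ZMod p) ∈ ρ.ker := RepMod.gr_smul_eq_iff.1 (hc _)
  rcases h.2.2 with h2 | h2
  · rw [h2, Subgroup.mem_bot] at h1
    exact upper_ne_one one_ne_zero h1
  · rw [h2, mem_center_sl] at h1
    rcases h1 with h1 | h1
    · exact upper_ne_one one_ne_zero h1
    · have := congrArg (fun g : SL(2, ZMod p) => g.1 0 1) h1
      simp [upper_coe, Matrix.SpecialLinearGroup.coe_neg] at this

/-- The classification of the indecomposable minimally active modules. -/
theorem IsMinActIndec.classification [FiniteDimensional (ZMod p) V] (hp : 5 ≤ p)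
    (h : IsMinActIndec p ρ) :
    (∃ i : ℕ, 2 ≤ i ∧ i ≤ p ∧ Nonempty (RepMod ρ ≃ₗ[GroupAlg p] VMod p i)) ∨
    (∃ i j : ℕ, 1 ≤ i ∧ 1 ≤ j ∧ i + j = p - 1 ∧ HasRadicalLayers p [j, i] (RepMod ρ)) ∨
    HasRadicalLayers p [1, p - 2, 1] (RepMod ρ) ∨
    (∃ i j : ℕ, 2 ≤ i ∧ 2 ≤ j ∧ i + j = p + 1 ∧ HasRadicalLayers p [j, i] (RepMod ρ)) := by
  obtain ⟨g, m, hgm⟩ := h.exists_gr_smul_ne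
  have hM := h.indecomposable
  have : Nontrivial (RepMod ρ) := hM.1
  have hone : Module.finrank (ZMod p) (RepMod ρ) ≠ 1 := fun h1 =>
    hgm (gr_smul_of_finrank_le_one h1.le g m)
  -- In the first case minimal activity makes the fixed space a line; in the second a fixed vector
  -- outside the image splits off an induced or trivial summand.
  by_cases hU : fixU p (RepMod ρ) ≤ LinearMap.range (act (RepMod ρ) (nil : GroupAlg p))
  · have h1 : Module.finrank (ZMod p) (fixU p (RepMod ρ)) ≤ 1 := by
      have := h.2.1.singleBlock
      rwa [SingleBlock, inf_eq_left.2 hU] at this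
    obtain ⟨b, s, -, hs0, hs, hw⟩ := exists_fixU_isWt (p := p) (M := RepMod ρ)
    rcases classification_of_fixU hp h1 hs hs0 hw with ⟨n, hn, ⟨e⟩, -⟩ | ⟨i, hi1, hi, hl, -, -⟩ | ⟨hl, -⟩
    · refine Or.inl ⟨n + 1, ?_, by omega, ⟨e.trans (vmodEquiv p (n + 1)).symm⟩⟩
      by_contra hc
      apply hone
      rw [(e.restrictScalars (ZMod p)).finrank_eq, finrank_symMod hn]
      omega
    · exact Or.inr (Or.inl ⟨i, p - 1 - i, hi1, by omega, by omega, hl⟩)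
    · exact Or.inr (Or.inr (Or.inl hl))
  · obtain ⟨v, hv, hv'⟩ := SetLike.not_le_iff_exists.1 hU
    rcases equiv_homFun_or_finrank_eq_one (by omega) hM hv hv' with ⟨a, ha, ha', ⟨e⟩⟩ | h1
    · exact Or.inr (Or.inr (Or.inr ⟨a + 1, p - a, by omega, by omega, by omega,
        (hasRadicalLayers_homFun ha ha').congr e⟩))
    · exact absurd h1 hone

end Representations

/-! ### Parity of composition factors -/

lemma commute_gr_neg_one (g : SL(2, ZMod p)) :
    Commute (gr (-1 : SL(2, ZMod p)) : GroupAlg p) (gr g) := by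
  rw [Commute, SemiconjBy, ← gr_mul, ← gr_mul, neg_one_mul, mul_neg_one]

section Modules

variable {M : Type u} [AddCommGroup M] [Module (ZMod p) M] [Module (GroupAlg p) M]
  [IsScalarTower (ZMod p) (GroupAlg p) M]

/-- The eigenspaces of the central involution. -/
def centralEigen (M : Type u) [AddCommGroup M] [Module (ZMod p) M] [Module (GroupAlg p) M]
    [IsScalarTower (ZMod p) (GroupAlg p) M] (c : ZMod p) : Submodule (GroupAlg p) M :=
  stableSubmodule (LinearMap.ker (act M (gr (-1 : SL(2, ZMod p))) - c • 1)) (by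
    intro g m hm
    simp only [LinearMap.mem_ker, LinearMap.sub_apply, act_apply, LinearMap.smul_apply,
      Module.End.one_apply, sub_eq_zero] at hm ⊢
    rw [smul_smul, (commute_gr_neg_one g).eq, mul_smul, hm, smul_comm])

lemma mem_centralEigen {c : ZMod p} {m : M} :
    m ∈ centralEigen M c ↔ gr (-1 : SL(2, ZMod p)) • m = c • m := by
  simp [centralEigen, sub_eq_zero]

/-- The element $-1$ is a central involution and $2$ is invertible, so its eigenspaces are
complementary submodules and one of them is zero. -/
lemma IsIndecomposableModule.central (hp : 2 < p) (h : IsIndecomposableModule (GroupAlg p) M) :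
    ∃ c : ZMod p, (c = 1 ∨ c = -1) ∧ ∀ m : M, gr (-1 : SL(2, ZMod p)) • m = c • m := by
  have h2 : (2 : ZMod p) ≠ 0 := by
    intro h
    have h' : ((2 : ℕ) : ZMod p) = 0 := by exact_mod_cast h
    rw [ZMod.natCast_eq_zero_iff] at h'
    exact absurd (Nat.le_of_dvd (by norm_num) h') (by omega)
  have hz : ∀ m : M, gr (-1 : SL(2, ZMod p)) • gr (-1 : SL(2, ZMod p)) • m = m := fun m => by
    rw [← gr_mul_smul, neg_one_mul, neg_neg, gr_one, one_smul]
  have hc : IsCompl (centralEigen (p := p) M 1) (centralEigen M (-1)) := by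
    refine IsCompl.of_eq (eq_bot_iff.2 ?_) (eq_top_iff.2 ?_)
    · rintro x ⟨hx1, hx2⟩
      rw [SetLike.mem_coe, mem_centralEigen] at hx1 hx2
      rw [hx1, ← sub_eq_zero, ← sub_smul, sub_neg_eq_add, one_add_one_eq_two] at hx2
      exact (smul_eq_zero.1 hx2).resolve_left h2
    · intro x _
      rw [show x = (2 : ZMod p)⁻¹ • (x + gr (-1 : SL(2, ZMod p)) • x) +
        (2 : ZMod p)⁻¹ • (x - gr (-1 : SL(2, ZMod p)) • x) by
          rw [← smul_add, add_add_sub_cancel, ← two_smul (ZMod p), smul_smul, inv_mul_cancel₀ h2,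
            one_smul]]
      refine Submodule.add_mem_sup ?_ ?_
      · rw [mem_centralEigen, smul_comm, smul_add, hz, one_smul, add_comm]
      · rw [mem_centralEigen, smul_comm, smul_sub, hz, neg_one_smul, ← smul_neg, neg_sub]
  rcases h.2 _ _ hc with h1 | h1
  · refine ⟨-1, Or.inr rfl, fun m => mem_centralEigen.1 ?_⟩
    have := hc.sup_eq_top
    rw [h1, bot_sup_eq] at this
    rw [this]; trivial
  · refine ⟨1, Or.inl rfl, fun m => mem_centralEigen.1 ?_⟩
    have := hc.sup_eq_top
    rw [h1, sup_bot_eq] at this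
    rw [this]; trivial

/-- The parity of the dimension of a simple subquotient is determined by the central involution. -/
lemma neg_one_pow_finrank_of_covBy {c : ZMod p}
    (h : ∀ m : M, gr (-1 : SL(2, ZMod p)) • m = c • m) {N N' : Submodule (GroupAlg p) M}
    (hN : N ⋖ N') : (-1) ^ (Module.finrank (ZMod p) (N' ⧸ N.submoduleOf N')) = -c := by
  have hs : IsSimpleModule (GroupAlg p) (N' ⧸ N.submoduleOf N') :=
    (covBy_iff_quot_is_simple hN.le).1 hN
  obtain ⟨n, hn, ⟨e⟩⟩ := exists_equiv_symMod (p := p) (M := N' ⧸ N.submoduleOf N')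
  rw [(e.restrictScalars (ZMod p)).finrank_eq, finrank_symMod hn]
  have h1 : gr (-1 : SL(2, ZMod p)) • symMono (p := p) n 0 = c • symMono n 0 := by
    obtain ⟨y, hy⟩ := e.surjective (symMono n 0)
    obtain ⟨x, rfl⟩ := Submodule.mkQ_surjective _ y
    rw [← hy, ← map_smul, ← map_smul]
    have : gr (-1 : SL(2, ZMod p)) • x = c • x := Subtype.ext (h x)
    rw [this]
    exact LinearMap.map_smul ((e.toLinearMap ∘ₗ (N.submoduleOf N').mkQ).restrictScalars (ZMod p))
      _ _
  rw [gr_neg_one_smul_symMod hn] at h1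
  have h2 := smul_left_injective _ (symMono_zero_ne_zero (p := p) n) h1
  rw [pow_succ, h2, mul_neg_one]

lemma exists_covBy [Nontrivial M] [FiniteDimensional (ZMod p) M] :
    ∃ N N' : Submodule (GroupAlg p) M, N ⋖ N' := by
  have : IsArtinian (GroupAlg p) M := isArtinian_of_tower (ZMod p) inferInstance
  obtain ⟨S, hS⟩ := IsAtomic.exists_atom (Submodule (GroupAlg p) M)
  exact ⟨⊥, S, bot_covBy_iff.2 hS⟩

end Modules

section Representations

variable {V : Type u} [AddCommGroup V] [Module (ZMod p) V]
  {ρ : Representation (ZMod p) SL(2, ZMod p) V}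

lemma allCompositionFactorDims_iff {P : ℕ → Prop} : AllCompositionFactorDims ρ P ↔
    ∀ N N' : Submodule (GroupAlg p) (RepMod ρ), N ⋖ N' →
      P (Module.finrank (ZMod p) (↥N' ⧸ N.submoduleOf N')) := Iff.rfl

lemma neg_one_zmod_ne_one (hp : 2 < p) : (-1 : ZMod p) ≠ 1 := by
  have : Fact (2 < p) := ⟨hp⟩
  exact ZMod.neg_one_ne_one

lemma neg_one_pow_eq_one_iff (hp : 2 < p) (n : ℕ) : (-1 : ZMod p) ^ n = 1 ↔ Even n := by
  rcases Nat.even_or_odd n with h | h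
  · simp [h.neg_one_pow, h]
  · simp [h.neg_one_pow, neg_one_zmod_ne_one hp, h]

lemma neg_one_pow_eq_neg_one_iff (hp : 2 < p) (n : ℕ) : (-1 : ZMod p) ^ n = -1 ↔ Odd n := by
  rcases Nat.even_or_odd n with h | h
  · simp [h.neg_one_pow, h, (neg_one_zmod_ne_one hp).symm]
  · simp [h.neg_one_pow, h]

/-- The two cases for the action of the central involution. -/
theorem IsMinActIndec.parity [FiniteDimensional (ZMod p) V] (hp : 2 < p) (h : IsMinActIndec p ρ) :
    (AllCompositionFactorDims ρ Even ∧ ¬ AllCompositionFactorDims ρ Odd ∧ ρ.ker = ⊥ ∧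
      ∀ m : RepMod ρ, gr (-1 : SL(2, ZMod p)) • m = -m) ∨
    (AllCompositionFactorDims ρ Odd ∧ ¬ AllCompositionFactorDims ρ Even ∧
      ρ.ker = Subgroup.center SL(2, ZMod p) ∧
      ∀ m : RepMod ρ, gr (-1 : SL(2, ZMod p)) • m = m) := by
  have hM := h.indecomposable
  have : Nontrivial (RepMod ρ) := hM.1
  obtain ⟨m₀, hm₀⟩ := exists_ne (0 : RepMod ρ)
  obtain ⟨N, N', hN⟩ := exists_covBy (p := p) (M := RepMod ρ)
  obtain ⟨c, hc, hz⟩ := hM.central hp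
  simp only [allCompositionFactorDims_iff]
  rcases hc with rfl | rfl
  · right
    have hz' : ∀ m : RepMod ρ, gr (-1 : SL(2, ZMod p)) • m = m := by simpa using hz
    have hodd : ∀ N N' : Submodule (GroupAlg p) (RepMod ρ), N ⋖ N' →
        Odd (Module.finrank (ZMod p) (↥N' ⧸ N.submoduleOf N')) := fun N N' hN =>
      (neg_one_pow_eq_neg_one_iff hp _).1 (neg_one_pow_finrank_of_covBy hz hN)
    refine ⟨hodd, fun he => Nat.not_even_iff_odd.2 (hodd N N' hN) (he N N' hN), ?_, hz'⟩
    refine h.2.2.resolve_left fun hk => ?_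
    have h1 : (-1 : SL(2, ZMod p)) ∈ ρ.ker := RepMod.gr_smul_eq_iff.1 hz'
    rw [hk, Subgroup.mem_bot] at h1
    exact neg_one_ne_one hp h1
  · left
    have hz' : ∀ m : RepMod ρ, gr (-1 : SL(2, ZMod p)) • m = -m := by simpa using hz
    have heven : ∀ N N' : Submodule (GroupAlg p) (RepMod ρ), N ⋖ N' →
        Even (Module.finrank (ZMod p) (↥N' ⧸ N.submoduleOf N')) := fun N N' hN =>
      (neg_one_pow_eq_one_iff hp _).1 (by simpa using neg_one_pow_finrank_of_covBy hz hN)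
    refine ⟨heven, fun ho => Nat.not_even_iff_odd.2 (ho N N' hN) (heven N N' hN), ?_, hz'⟩
    refine h.2.2.resolve_right fun hk => ?_
    have h1 : (-1 : SL(2, ZMod p)) ∈ ρ.ker := hk ▸ neg_one_mem_center
    have h2 := RepMod.gr_smul_eq_iff.2 h1 m₀
    rw [hz', ← sub_eq_zero, ← neg_add', neg_eq_zero, ← two_smul (ZMod p)] at h2
    rcases smul_eq_zero.1 h2 with h3 | h3
    · exact neg_one_zmod_ne_one hp (by linear_combination -h3)
    · exact hm₀ h3

end Representations

/-! ### Existence and uniqueness of the nonsimple modules -/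

theorem existsUnique_add_eq_sub_one (hp : 5 ≤ p) {i j : ℕ} (hi : 1 ≤ i) (hj : 1 ≤ j)
    (hij : i + j = p - 1) : ∃ (W : Type u) (_ : AddCommGroup W) (_ : Module (ZMod p) W)
        (σ : Representation (ZMod p) SL(2, ZMod p) W),
        IsMinActIndec p σ ∧ Module.finrank (ZMod p) W = p - 1 ∧
        HasRadicalLayers p [j, i] σ.asModule ∧
        ∀ (V : Type u) [AddCommGroup V] [Module (ZMod p) V]
          (ρ : Representation (ZMod p) SL(2, ZMod p) V), HasRadicalLayers p [j, i] ρ.asModule →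
          Nonempty (ρ.asModule ≃ₗ[GroupAlg p] σ.asModule) := by
  obtain rfl : j = p - 1 - i := by omega
  have h := hasRadicalLayers_frobQuot hp hi (by omega)
  have hl : ∀ m ∈ [p - 1 - i, i], 1 ≤ m ∧ m ≤ p := by
    intro m hm
    simp only [List.mem_cons, List.not_mem_nil, or_false] at hm
    omega
  -- Since $p\ge5$, one of the two layers is not one-dimensional; it keeps the kernel of the action
  -- inside the center.
  obtain ⟨j, hj', hj2⟩ : ∃ j ∈ [p - 1 - i, i], 2 ≤ j := by
    rcases le_or_gt 2 i with h | h
    · exact ⟨i, by simp, h⟩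
    · exact ⟨p - 1 - i, by simp, by omega⟩
  have hfd := (h.finrank_eq hl).1
  obtain ⟨W, _, _, σ, h1, h2, h3, -⟩ := exists_isMinActIndec.{u} hl h hj' hj2
    (singleBlock_of_fixU (h.finrank_fixU_le hi hj hij))
  refine ⟨W, _, _, σ, h1, ?_, h3, fun V _ _ ρ hρ => ?_⟩
  · rw [h2]; simp; omega
  · obtain ⟨e⟩ := (hρ.congr (RepMod.asModuleEquiv ρ)).nonempty_equiv_of_add_eq hi hj hij
      (h3.congr (RepMod.asModuleEquiv σ))
    exact ⟨(RepMod.asModuleEquiv ρ).trans (e.trans (RepMod.asModuleEquiv σ).symm)⟩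

theorem existsUnique_projectiveCover (hp : 5 ≤ p) :
    ∃ (W : Type u) (_ : AddCommGroup W) (_ : Module (ZMod p) W)
        (σ : Representation (ZMod p) SL(2, ZMod p) W),
        IsMinActIndec p σ ∧ Module.finrank (ZMod p) W = p ∧
        HasRadicalLayers p [1, p - 2, 1] σ.asModule ∧
        Module.Projective (GroupAlg p) σ.asModule ∧
        ∀ (V : Type u) [AddCommGroup V] [Module (ZMod p) V]
          (ρ : Representation (ZMod p) SL(2, ZMod p) V),
          HasRadicalLayers p [1, p - 2, 1] ρ.asModule →
          Nonempty (ρ.asModule ≃ₗ[GroupAlg p] σ.asModule) := by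
  obtain ⟨P, hP, h, hU⟩ := exists_projectiveCover hp
  have hl : ∀ m ∈ [1, p - 2, 1], 1 ≤ m ∧ m ≤ p := by
    intro m hm
    simp only [List.mem_cons, List.not_mem_nil, or_false] at hm
    omega
  obtain ⟨W, _, _, σ, h1, h2, h3, ⟨e⟩⟩ := exists_isMinActIndec.{u} (j := p - 2) hl h (by simp)
    (by omega) (singleBlock_of_fixU hU)
  refine ⟨W, _, _, σ, h1, ?_, h3, Module.Projective.of_equiv' e.symm, fun V _ _ ρ hρ => ?_⟩
  · rw [h2]; simp; omega
  · obtain ⟨f⟩ := h.nonempty_equiv_of_projective hp (hρ.congr (RepMod.asModuleEquiv ρ))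
    exact ⟨(RepMod.asModuleEquiv ρ).trans (f.trans e.symm)⟩

theorem existsUnique_add_eq_add_one {i j : ℕ} (hi : 2 ≤ i) (hj : 2 ≤ j)
    (hij : i + j = p + 1) : ∃ (W : Type u) (_ : AddCommGroup W) (_ : Module (ZMod p) W)
        (σ : Representation (ZMod p) SL(2, ZMod p) W),
        IsMinActIndec p σ ∧ Module.finrank (ZMod p) W = p + 1 ∧
        HasRadicalLayers p [j, i] σ.asModule ∧
        ∀ (V : Type u) [AddCommGroup V] [Module (ZMod p) V]
          (ρ : Representation (ZMod p) SL(2, ZMod p) V), HasRadicalLayers p [j, i] ρ.asModule →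
          Nonempty (ρ.asModule ≃ₗ[GroupAlg p] σ.asModule) := by
  have h := hasRadicalLayers_homFun (p := p) (a := p - j) (by omega) (by omega)
  rw [show p - (p - j) = j by omega, show p - j + 1 = i by omega] at h
  obtain ⟨W, _, _, σ, h1, h2, h3, ⟨e⟩⟩ := exists_isMinActIndec.{u} (j := i) (by
    intro m hm
    simp only [List.mem_cons, List.not_mem_nil, or_false] at hm
    omega) h (by simp) hi (finrank_fixU_inf_range_homFun _)
  refine ⟨W, _, _, σ, h1, ?_, h3, fun V _ _ ρ hρ => ?_⟩
  · rw [h2]; simp; omega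
  · obtain ⟨f⟩ := (hρ.congr (RepMod.asModuleEquiv ρ)).nonempty_equiv_homFun hi hj hij
    exact ⟨(RepMod.asModuleEquiv ρ).trans (f.symm.trans e.symm)⟩

/-! ### `GL_2(p)` as an extension of `SL_2(p)` -/

open Matrix.SpecialLinearGroup (toGL toGL_injective)

/-- The diagonal matrix with entries `t`, `1`. -/
def diagGL (p : ℕ) [Fact p.Prime] : (ZMod p)ˣ →* GL (Fin 2) (ZMod p) where
  toFun t := ⟨!![(t : ZMod p), 0; 0, 1], !![((t⁻¹ : (ZMod p)ˣ) : ZMod p), 0; 0, 1],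
    by ext i j; fin_cases i <;> fin_cases j <;> simp [Matrix.mul_apply, Fin.sum_univ_two],
    by ext i j; fin_cases i <;> fin_cases j <;> simp [Matrix.mul_apply, Fin.sum_univ_two]⟩
  map_one' := by
    apply Units.ext
    ext i j; fin_cases i <;> fin_cases j <;> simp
  map_mul' s t := by
    apply Units.ext
    ext i j; fin_cases i <;> fin_cases j <;> simp [Matrix.mul_apply, Fin.sum_univ_two]

lemma diagGL_coe (t : (ZMod p)ˣ) : (diagGL p t).1 = !![(t : ZMod p), 0; 0, 1] := rfl

lemma det_diagGL (t : (ZMod p)ˣ) : Matrix.GeneralLinearGroup.det (diagGL p t) = t := by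
  apply Units.ext
  simp [Matrix.GeneralLinearGroup.val_det_apply, diagGL_coe, Matrix.det_fin_two]

lemma det_toGL (g : SL(2, ZMod p)) : Matrix.GeneralLinearGroup.det (toGL g) = 1 := by
  apply Units.ext
  simp [Matrix.GeneralLinearGroup.val_det_apply]

/-- A matrix of determinant one. -/
def slOfDet (g : GL (Fin 2) (ZMod p)) (h : Matrix.GeneralLinearGroup.det g = 1) : SL(2, ZMod p) :=
  ⟨g.1, by simpa [Matrix.GeneralLinearGroup.val_det_apply] using congrArg Units.val h⟩

lemma toGL_slOfDet (g : GL (Fin 2) (ZMod p)) (h) : toGL (slOfDet g h) = g := Units.ext rfl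

/-- Conjugation by `diag(t, 1)`. -/
def conjDiag (t : (ZMod p)ˣ) : SL(2, ZMod p) →* SL(2, ZMod p) where
  toFun g := slOfDet (diagGL p t * toGL g * (diagGL p t)⁻¹) (by simp [det_toGL])
  map_one' := by apply toGL_injective; rw [toGL_slOfDet]; simp
  map_mul' g h := by apply toGL_injective; rw [toGL_slOfDet, map_mul toGL (slOfDet _ _), toGL_slOfDet, toGL_slOfDet]; simp

lemma toGL_conjDiag (t : (ZMod p)ˣ) (g : SL(2, ZMod p)) :
    toGL (conjDiag t g) = diagGL p t * toGL g * (diagGL p t)⁻¹ :=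
  toGL_slOfDet _ (by simp [det_toGL])

lemma conjDiag_conjDiag (s t : (ZMod p)ˣ) (g : SL(2, ZMod p)) :
    conjDiag s (conjDiag t g) = conjDiag (s * t) g := by
  apply toGL_injective
  rw [toGL_conjDiag, toGL_conjDiag, toGL_conjDiag]; simp [mul_assoc]

lemma conjDiag_one (g : SL(2, ZMod p)) : conjDiag 1 g = g := by
  apply toGL_injective
  rw [toGL_conjDiag]; simp

lemma conjDiag_coe (t : (ZMod p)ˣ) (g : SL(2, ZMod p)) : (conjDiag t g).1 =
    !![g.1 0 0, (t : ZMod p) * g.1 0 1; ((t⁻¹ : (ZMod p)ˣ) : ZMod p) * g.1 1 0, g.1 1 1] := by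
  change (diagGL p t).1 * g.1 * (diagGL p t)⁻¹.1 = _
  rw [← map_inv, diagGL_coe, diagGL_coe]
  ext i j; fin_cases i <;> fin_cases j <;>
    simp [Matrix.mul_apply, Matrix.vecMul, dotProduct, Fin.sum_univ_two]
  · field_simp
  · exact mul_comm _ _

lemma conjDiag_upper (t : (ZMod p)ˣ) (c : ZMod p) : conjDiag t (upper c) = upper ((t : ZMod p) * c) := by
  apply sl_ext <;> simp [conjDiag_coe, upper_coe]

lemma conjDiag_torus (t s : (ZMod p)ˣ) : conjDiag t (torus s) = torus s := by
  apply sl_ext <;> simp [conjDiag_coe, torus_coe]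

/-- The factor in `SL_2(p)` of a matrix in `GL_2(p)`. -/
def slPart (g : GL (Fin 2) (ZMod p)) : SL(2, ZMod p) :=
  slOfDet (g * (diagGL p (Matrix.GeneralLinearGroup.det g))⁻¹) (by simp [det_diagGL])

lemma toGL_slPart (g : GL (Fin 2) (ZMod p)) :
    toGL (slPart g) = g * (diagGL p (Matrix.GeneralLinearGroup.det g))⁻¹ := toGL_slOfDet _ _

/-- This is the multiplication law of $\mathrm{GL}_2=\mathrm{SL}_2\rtimes\{\mathrm{diag}(t,1)\}$,
used to assemble `sigma` from `R` and `D`. -/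
lemma slPart_mul (g h : GL (Fin 2) (ZMod p)) :
    slPart (g * h) = slPart g * conjDiag (Matrix.GeneralLinearGroup.det g) (slPart h) := by
  apply toGL_injective
  rw [map_mul, toGL_conjDiag, toGL_slPart, toGL_slPart, toGL_slPart, map_mul, map_mul]
  rw [mul_inv_rev, mul_assoc, mul_assoc, mul_assoc, mul_assoc, inv_mul_cancel_left]

lemma slPart_toGL (g : SL(2, ZMod p)) : slPart (toGL g) = g := by
  apply toGL_injective
  rw [toGL_slPart, det_toGL]; simp

lemma slPart_diagGL (t : (ZMod p)ˣ) : slPart (diagGL p t) = 1 := by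
  apply toGL_injective
  rw [toGL_slPart, det_diagGL]; simp

lemma mem_center_GL {g : GL (Fin 2) (ZMod p)}
    (h : ∀ x : SL(2, ZMod p), g * toGL x = toGL x * g) :
    ∃ c : (ZMod p)ˣ, g = Matrix.GeneralLinearGroup.scalar (Fin 2) c := by
  have h1 : ∀ x : SL(2, ZMod p), g.1 * x.1 = x.1 * g.1 := fun x => congrArg Units.val (h x)
  have hu := h1 (upper 1)
  have hl := h1 (lower 1)
  simp only [upper_coe, lower_coe] at hu hl
  have e1 := congrFun (congrFun hu 0) 1
  have e2 := congrFun (congrFun hu 1) 1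
  have e3 := congrFun (congrFun hl 0) 0
  simp [Matrix.mul_apply, Fin.sum_univ_two] at e1 e2 e3
  have hd : g.1 0 0 ≠ 0 := by
    intro h0
    have := g.isUnit.map (Matrix.detMonoidHom)
    simp [Matrix.det_fin_two, e2, e3, h0] at this
  refine ⟨Units.mk0 _ hd, Units.ext ?_⟩
  ext i j
  fin_cases i <;> fin_cases j <;> simp [Matrix.scalar_apply, e2, e3]
  linear_combination -e1

lemma exists_conj_of_pow {x : SL(2, ZMod p)} (hx : x ^ p = 1) (hx1 : x ≠ 1) :
    ∃ (g : SL(2, ZMod p)) (c : (ZMod p)ˣ), x = g * upper (c : ZMod p) * g⁻¹ := by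
  obtain ⟨g, c, hc, h⟩ := exists_conj_upper (orderOf_eq_prime hx hx1)
  exact ⟨g, Units.mk0 c hc, h⟩

lemma trace_of_pow {x : SL(2, ZMod p)} (hx : x ^ p = 1) : x.1 0 0 + x.1 1 1 = 2 := by
  by_cases hx1 : x = 1
  · rw [hx1]; simp; norm_num
  · obtain ⟨g, c, rfl⟩ := exists_conj_of_pow hx hx1
    have h := Matrix.trace_mul_comm (g * upper (c : ZMod p)).1 g⁻¹.1
    rw [← sl_mul_coe, ← sl_mul_coe, inv_mul_cancel_left, Matrix.trace_fin_two,
      Matrix.trace_fin_two] at h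
    rw [h, upper_coe]
    simp; norm_num

/-! ### The normalizer of a group `SL_2(p)` or `PSL_2(p)` -/

/-- A homomorphism from `SL_2(p)` to a group, together with an action of the diagonal automorphisms
and a description of the centralizer of the image. -/
structure OvergroupData (p : ℕ) [Fact p.Prime] (Γ : Type u) [Group Γ] where
  /-- the homomorphism from `SL_2(p)` -/
  R : SL(2, ZMod p) →* Γ
  /-- the scalars -/
  Z : (ZMod p)ˣ →* Γ
  /-- the diagonal automorphisms -/
  D : (ZMod p)ˣ →* Γ
  /-- the unipotent part of the centralizer -/
  P : Subgroup Γ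
  ker_le : R.ker ≤ Subgroup.center SL(2, ZMod p)
  Z_injective : Function.Injective Z
  Z_comm : ∀ c γ, Z c * γ = γ * Z c
  D_mul : ∀ t g, D t * R g = R (conjDiag t g) * D t
  P_comm : ∀ x ∈ P, ∀ g, x * R g = R g * x
  P_pow : ∀ x ∈ P, x ^ p = 1
  centralizer : ∀ γ, (∀ g, γ * R g = R g * γ) → ∃ c, ∃ x ∈ P, γ = Z c * x

namespace OvergroupData

variable {Γ : Type u} [Group Γ] (d : OvergroupData p Γ)

/-- The extension of the homomorphism to `GL_2(p)`. -/
def sigma : GL (Fin 2) (ZMod p) →* Γ where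
  toFun g := d.R (slPart g) * d.D (Matrix.GeneralLinearGroup.det g)
  map_one' := by
    have : slPart (1 : GL (Fin 2) (ZMod p)) = 1 := by
      rw [← map_one toGL, slPart_toGL]
    rw [this]; simp
  map_mul' g h := by
    rw [slPart_mul, map_mul, map_mul, map_mul, mul_assoc, mul_assoc,
      ← mul_assoc (d.R (conjDiag _ _)), ← d.D_mul, mul_assoc]

lemma sigma_toGL (g : SL(2, ZMod p)) : d.sigma (toGL g) = d.R g := by
  change d.R _ * d.D _ = _
  rw [slPart_toGL, det_toGL]; simp

lemma sigma_diagGL (t : (ZMod p)ˣ) : d.sigma (diagGL p t) = d.D t := by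
  change d.R _ * d.D _ = _
  rw [slPart_diagGL, det_diagGL]; simp

lemma sigma_of_det {g : GL (Fin 2) (ZMod p)} (h : Matrix.GeneralLinearGroup.det g = 1) :
    d.sigma g ∈ d.R.range := by
  rw [← toGL_slOfDet g h, sigma_toGL]; exact ⟨_, rfl⟩

lemma eq_one_of_pow {x : Γ} (hx : x ∈ d.P) (h : x ^ (p - 1) = 1) : x = 1 := by
  have h1 := d.P_pow x hx
  rw [← Nat.sub_add_cancel (Fact.out : p.Prime).one_le, pow_succ, h, one_mul] at h1
  exact h1

lemma Z_pow (c : (ZMod p)ˣ) : d.Z c ^ (p - 1) = 1 := by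
  rw [← map_pow, ZMod.units_pow_card_sub_one_eq_one, map_one]

lemma eq_one_of_Z_mem {c : (ZMod p)ˣ} (h : d.Z c ∈ d.P) : c = 1 := by
  apply d.Z_injective
  rw [map_one]
  exact d.eq_one_of_pow h (d.Z_pow c)

/-- Elements acting by scalars. -/
lemma sigma_scalar (c : (ZMod p)ˣ) :
    ∃ e, d.sigma (Matrix.GeneralLinearGroup.scalar (Fin 2) c) = d.Z e := by
  obtain ⟨e, x, hx, h⟩ := d.centralizer (d.sigma (Matrix.GeneralLinearGroup.scalar (Fin 2) c))
    fun g => by rw [← sigma_toGL, ← map_mul, Matrix.GeneralLinearGroup.scalar_commute, map_mul]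
  refine ⟨e, ?_⟩
  -- The image centralizes, so it is a scalar times an element of $P$; exponent $p-1$ removes the
  -- part of exponent $p$.
  have h1 : (d.sigma (Matrix.GeneralLinearGroup.scalar (Fin 2) c)) ^ (p - 1) = 1 := by
    rw [← map_pow, ← map_pow, ZMod.units_pow_card_sub_one_eq_one, map_one, map_one]
  rw [h, Commute.mul_pow (d.Z_comm e x), d.Z_pow, one_mul] at h1
  rw [h, d.eq_one_of_pow hx h1, mul_one]

/-- An element of `GL_2(p)` whose image centralizes `SL_2(p)` is scalar. -/
lemma exists_eq_scalar (hp : 2 < p) {g : GL (Fin 2) (ZMod p)}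
    (h : ∀ x, d.sigma g * d.R x = d.R x * d.sigma g) :
    ∃ c, g = Matrix.GeneralLinearGroup.scalar (Fin 2) c := by
  refine mem_center_GL fun x => ?_
  let C : SL(2, ZMod p) → SL(2, ZMod p) := fun x => slOfDet (g * toGL x * g⁻¹) (by simp [det_toGL])
  have hC : ∀ x, toGL (C x) = g * toGL x * g⁻¹ := fun x => toGL_slOfDet _ (by simp [det_toGL])
  have hR : ∀ x, d.R (C x) = d.R x := fun x => by
    rw [← sigma_toGL, hC, map_mul, map_mul, sigma_toGL, h, map_inv, mul_inv_cancel_right]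
  -- Conjugation by $g$ changes $x$ by at most a sign. For $x^p=1$ both $x$ and its conjugate have
  -- trace $2$, which excludes the sign.
  have hcomm : ∀ x, x ^ p = 1 → g * toGL x = toGL x * g := by
    intro x hx
    have hCp : C x ^ p = 1 := by
      apply toGL_injective
      rw [map_pow, hC, conj_pow, ← map_pow, hx]; simp
    have h1 : C x * x⁻¹ ∈ d.R.ker := by rw [MonoidHom.mem_ker, map_mul, hR, map_inv, mul_inv_cancel]
    rcases mem_center_sl.1 (d.ker_le h1) with h2 | h2
    · rw [mul_inv_eq_one] at h2
      rw [← mul_inv_eq_iff_eq_mul, ← hC, h2]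
    · exfalso
      rw [mul_inv_eq_iff_eq_mul, neg_one_mul] at h2
      have t1 := trace_of_pow hx
      have t2 := trace_of_pow hCp
      rw [h2] at t2
      simp only [Matrix.SpecialLinearGroup.coe_neg, Matrix.neg_apply] at t2
      have t3 : ((4 : ℕ) : ZMod p) = 0 := by push_cast; linear_combination -t1 - t2
      rw [ZMod.natCast_eq_zero_iff] at t3
      have : p ∣ 2 := by
        have := (Fact.out : p.Prime).dvd_of_dvd_pow (show p ∣ 2 ^ 2 from t3)
        exact this
      exact absurd (Nat.le_of_dvd (by norm_num) this) (by omega)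
  refine sl_induction (P := fun x => g * toGL x = toGL x * g) (fun c => hcomm _ ?_)
    (fun c => hcomm _ ?_) (fun x y hx hy => ?_) x
  · rw [upper_pow]; simp [upper_zero]
  · rw [lower_pow]; simp [lower_zero]
  · rw [map_mul, ← mul_assoc, hx, mul_assoc, hy, mul_assoc]

/-- Elements of the image of `GL_2(p)` times scalars meet the unipotent centralizer trivially. -/
lemma eq_one_of_sigma_mul_mem (hp : 2 < p) {g : GL (Fin 2) (ZMod p)} {c : (ZMod p)ˣ}
    (h : d.sigma g * d.Z c ∈ d.P) : d.sigma g * d.Z c = 1 := by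
  -- Elements of $P$ centralize, hence $g$ is scalar; the product then lies in the intersection of
  -- the scalars with $P$, which is trivial.
  obtain ⟨e, rfl⟩ := d.exists_eq_scalar hp (g := g) fun x => by
    have h1 := d.P_comm _ h x
    rw [mul_assoc, d.Z_comm, ← mul_assoc, ← mul_assoc] at h1
    exact mul_right_cancel h1
  obtain ⟨e', he'⟩ := d.sigma_scalar e
  rw [he', ← map_mul] at h ⊢
  rw [d.eq_one_of_Z_mem h, map_one]

/-- The group generated by the image of `GL_2(p)` and the scalars. -/
def big : GL (Fin 2) (ZMod p) × (ZMod p)ˣ →* Γ :=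
  MonoidHom.noncommCoprod d.sigma d.Z fun _ _ => (d.Z_comm _ _).symm

lemma big_apply (g : GL (Fin 2) (ZMod p)) (c : (ZMod p)ˣ) : d.big (g, c) = d.sigma g * d.Z c := rfl

lemma range_le_range_big : d.R.range ≤ d.big.range := by
  rintro _ ⟨g, rfl⟩
  exact ⟨(toGL g, 1), by rw [big_apply, sigma_toGL, map_one, mul_one]⟩

lemma big_mul (g : GL (Fin 2) (ZMod p)) (c : (ZMod p)ˣ) (x : SL(2, ZMod p)) :
    ∃ y, d.big (g, c) * d.R x * (d.big (g, c))⁻¹ = d.R y := by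
  refine ⟨slOfDet (g * toGL x * g⁻¹) (by simp [det_toGL]), ?_⟩
  rw [← sigma_toGL, ← sigma_toGL, toGL_slOfDet _ (by simp [det_toGL]), big_apply, map_mul, map_mul,
    map_inv, mul_inv_rev, mul_assoc (d.sigma g), d.Z_comm]
  group

lemma le_normalizer {K : Subgroup Γ} (h : ∀ n ∈ K, ∀ x, ∃ y, n * d.R x * n⁻¹ = d.R y) :
    K ≤ Subgroup.normalizer (d.R.range : Set Γ) := by
  intro n hn
  refine Subgroup.mem_normalizer_iff.2 fun γ => ⟨?_, ?_⟩
  · rintro ⟨x, rfl⟩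
    obtain ⟨y, hy⟩ := h n hn x
    exact ⟨y, hy.symm⟩
  · rintro ⟨x, hx⟩
    obtain ⟨y, hy⟩ := h n⁻¹ (inv_mem hn) x
    refine ⟨y, ?_⟩
    rw [← hy, hx]; group

lemma range_big_le : d.big.range ≤ Subgroup.normalizer (d.R.range : Set Γ) := by
  refine d.le_normalizer ?_
  rintro _ ⟨⟨g, c⟩, rfl⟩
  exact d.big_mul g c

lemma P_le : d.P ≤ Subgroup.normalizer (d.R.range : Set Γ) :=
  d.le_normalizer fun n hn x => ⟨x, by rw [d.P_comm n hn, mul_inv_cancel_right]⟩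

/-- Elements of `SL_2(p)` with image of order dividing `p` can be chosen of order dividing `p`. -/
lemma exists_pow_eq_one (hp : 2 < p) {x : SL(2, ZMod p)} (hx : d.R x ^ p = 1) :
    ∃ y, y ^ p = 1 ∧ d.R y = d.R x := by
  have h1 : x ^ p ∈ d.R.ker := by rw [MonoidHom.mem_ker, map_pow, hx]
  -- The exponent is $1$ modulo $p$, so the image is unchanged, and even, so it removes the sign
  -- $x^p=\pm1$.
  refine ⟨x ^ (p + 1), ?_, by rw [map_pow, pow_succ, hx, one_mul]⟩
  rw [← pow_mul, mul_comm, pow_mul]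
  have hodd : Odd p := (Fact.out : p.Prime).odd_of_ne_two (by omega)
  rcases mem_center_sl.1 (d.ker_le h1) with h2 | h2
  · rw [h2, one_pow]
  · rw [h2, (hodd.add_odd odd_one).neg_one_pow]

lemma R_upper_one_ne_one : d.R (upper 1) ≠ 1 := by
  intro h
  rcases mem_center_sl.1 (d.ker_le (MonoidHom.mem_ker.2 h)) with h1 | h1
  · exact upper_ne_one one_ne_zero h1
  · have := congrArg (fun g : SL(2, ZMod p) => g.1 0 1) h1
    simp [upper_coe, Matrix.SpecialLinearGroup.coe_neg] at this

lemma R_eq {x y : SL(2, ZMod p)} (h : d.R x = d.R y) : x = y ∨ x = -y := by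
  have h1 : y⁻¹ * x ∈ d.R.ker := by rw [MonoidHom.mem_ker, map_mul, map_inv, h, inv_mul_cancel]
  rcases mem_center_sl.1 (d.ker_le h1) with h2 | h2
  · left; rw [← mul_inv_cancel_left y x, h2, mul_one]
  · right; rw [← mul_inv_cancel_left y x, h2, mul_neg_one]

lemma exists_conj_R (hp : 2 < p) {n : Γ} (hn : n ∈ Subgroup.normalizer (d.R.range : Set Γ))
    {x : SL(2, ZMod p)} (hx : x ^ p = 1) : ∃ y, y ^ p = 1 ∧ n * d.R x * n⁻¹ = d.R y := by
  obtain ⟨y, hy⟩ := (Subgroup.mem_normalizer_iff.1 hn (d.R x)).1 ⟨x, rfl⟩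
  obtain ⟨z, hz, hzy⟩ := d.exists_pow_eq_one hp (x := y) (by
    rw [hy, conj_pow, ← map_pow, hx]; simp)
  exact ⟨z, hz, by rw [hzy, hy]⟩

lemma upper_eq_pow (c : ZMod p) : upper c = upper 1 ^ c.val := by
  rw [upper_pow]; simp

lemma lower_eq_pow (c : ZMod p) : lower c = lower 1 ^ c.val := by
  rw [lower_pow]; simp

lemma eq_upper_of_trace {y : SL(2, ZMod p)} (h : y.1 0 0 + y.1 1 1 = 2) (h10 : y.1 1 0 = 0) :
    y = upper (y.1 0 1) := by
  have hd := sl_det y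
  rw [h10, mul_zero, sub_zero] at hd
  have h0 : (y.1 0 0 - 1) ^ 2 = 0 := by linear_combination y.1 0 0 * h - hd
  have h1 : y.1 0 0 = 1 := sub_eq_zero.1 (pow_eq_zero_iff two_ne_zero |>.1 h0)
  apply sl_ext
  · simp [upper_coe, h1]
  · simp [upper_coe]
  · simp [upper_coe, h10]
  · simp [upper_coe]; linear_combination h - h1

lemma exists_upper_conj_eq_lower {y : SL(2, ZMod p)} (h : y.1 0 0 + y.1 1 1 = 2)
    (h10 : y.1 1 0 ≠ 0) : ∃ e, upper e * y * (upper e)⁻¹ = lower (y.1 1 0) := by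
  have hd := sl_det y
  refine ⟨(1 - y.1 0 0) * (y.1 1 0)⁻¹, ?_⟩
  rw [mul_inv_eq_iff_eq_mul]
  apply sl_ext <;> rw [sl_mul_coe, sl_mul_coe] <;>
    simp [upper_coe, lower_coe, Matrix.mul_apply, Fin.sum_univ_two, Matrix.vecMul, dotProduct]
  · field_simp; ring
  · field_simp; linear_combination (-1) * hd + h
  · field_simp; linear_combination h

/-- An element which centralizes the upper unipotent elements and permutes the lower ones
centralizes the image. -/
lemma comm_of_conj (hp : 2 < p) {n : Γ} (hu : n * d.R (upper 1) * n⁻¹ = d.R (upper 1)) {c : ZMod p}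
    (hl : n * d.R (lower 1) * n⁻¹ = d.R (lower c)) (g : SL(2, ZMod p)) :
    n * d.R g = d.R g * n := by
  let φ : Γ →* Γ := (MulAut.conj n).toMonoidHom
  have hφ : ∀ γ, φ γ = n * γ * n⁻¹ := fun γ => rfl
  have hu' : φ (d.R (upper 1)) = d.R (upper 1) := hu
  have hl' : φ (d.R (lower 1)) = d.R (lower c) := hl
  have hc : c = 1 := by
    -- The Weyl element $u\ell^{-1}u$ conjugates $u$ to $\ell^{-1}$. Applying the automorphism to
    -- this relation determines $c$, with either sign.
    have h1 : (upper 1 * lower (-1) * upper 1) * upper 1 =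
        lower (-1) * (upper 1 * lower (-1) * upper (1 : ZMod p)) := by
      apply sl_ext <;> simp only [sl_mul_coe] <;>
        simp [upper_coe, lower_coe, Matrix.mul_apply, Fin.sum_univ_two]
    have h2 := congrArg (fun g => φ (d.R g)) h1
    simp only [← lower_inv, map_mul, map_inv, hu', hl'] at h2
    simp only [← map_mul, ← map_inv] at h2
    rcases d.R_eq h2 with h3 | h3
    · have := congrArg (fun g : SL(2, ZMod p) => g.1 0 1) h3
      simp only [lower_inv, sl_mul_coe] at this
      simp [upper_coe, lower_coe, Matrix.mul_apply, Fin.sum_univ_two] at this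
      linear_combination -this
    · have := congrArg (fun g : SL(2, ZMod p) => g.1 0 0) h3
      simp only [lower_inv, sl_mul_coe, Matrix.SpecialLinearGroup.coe_neg] at this
      simp [upper_coe, lower_coe, Matrix.mul_apply, Fin.sum_univ_two] at this
      have h4 : (2 : ZMod p) * (1 - c) = 0 := by linear_combination this
      have h5 : (2 : ZMod p) ≠ 0 := fun h => neg_one_zmod_ne_one hp (by linear_combination -h)
      exact (sub_eq_zero.1 ((mul_eq_zero.1 h4).resolve_left h5)).symm
  subst hc
  have key : ∀ g, φ (d.R g) = d.R g := by
    refine fun g => sl_induction (P := fun g => φ (d.R g) = d.R g) (fun c => ?_) (fun c => ?_)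
      (fun x y hx hy => ?_) g
    · rw [upper_eq_pow, map_pow, map_pow, hu']
    · rw [lower_eq_pow, map_pow, map_pow, hl']
    · rw [map_mul, map_mul, hx, hy]
  rw [← mul_inv_eq_iff_eq_mul, ← hφ, key]

/-- The normalizer of the image of `SL_2(p)`. -/
theorem exists_of_mem_normalizer (hp : 2 < p) {n : Γ}
    (hn : n ∈ Subgroup.normalizer (d.R.range : Set Γ)) :
    ∃ g ∈ d.big.range, ∃ x ∈ d.P, n = g * x := by
  have hpu : upper (1 : ZMod p) ^ p = 1 := by rw [upper_pow]; simp [upper_zero]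
  have hpl : lower (1 : ZMod p) ^ p = 1 := by rw [lower_pow]; simp [lower_zero]
  -- The image of $u$ is conjugate to some $u^c$; dividing $n$ by the corresponding element of the
  -- image of $\mathrm{GL}_2(p)$ leaves $n_1$ commuting with $u$.
  obtain ⟨x, hx, hnx⟩ := d.exists_conj_R hp hn hpu
  have hx1 : x ≠ 1 := by
    rintro rfl
    rw [map_one, conj_eq_one_iff] at hnx
    exact d.R_upper_one_ne_one hnx
  obtain ⟨h, c, rfl⟩ := exists_conj_of_pow hx hx1
  have hb : d.big (toGL h * diagGL p c, 1) = d.R h * d.D c := by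
    rw [big_apply, map_mul, sigma_toGL, sigma_diagGL, map_one, mul_one]
  obtain ⟨n₁, hn₁⟩ : ∃ n₁, n = d.big (toGL h * diagGL p c, 1) * n₁ := ⟨_, (mul_inv_cancel_left _ _).symm⟩
  have hn₁N : n₁ ∈ Subgroup.normalizer (d.R.range : Set Γ) := by
    rw [hn₁] at hn
    exact (Subgroup.mul_mem_cancel_left _ (d.range_big_le ⟨_, rfl⟩)).1 hn
  have hu₁ : n₁ * d.R (upper 1) * n₁⁻¹ = d.R (upper 1) := by
    have h1 : d.D c * (n₁ * d.R (upper 1) * n₁⁻¹) = d.D c * d.R (upper 1) := by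
      rw [d.D_mul, conjDiag_upper, mul_one]
      rw [hn₁, hb, map_mul, map_mul, map_inv] at hnx
      rw [← mul_inv_eq_iff_eq_mul]
      have := congrArg (fun γ => (d.R h)⁻¹ * γ * d.R h) hnx
      simp only [mul_inv_rev] at this
      calc _ = (d.R h)⁻¹ * (d.R h * d.D c * n₁ * d.R (upper 1) * (n₁⁻¹ * ((d.D c)⁻¹ * (d.R h)⁻¹))) *
          d.R h := by group
        _ = _ := by rw [this]; group
    exact mul_left_cancel h1
  obtain ⟨y, hy, hny⟩ := d.exists_conj_R hp hn₁N hpl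
  have ht := trace_of_pow hy
  -- Otherwise a lower unipotent element would be sent into the image of $U$, which $n_1$ already
  -- fixes elementwise.
  have hy10 : y.1 1 0 ≠ 0 := by
    intro h10
    rw [eq_upper_of_trace ht h10, upper_eq_pow, map_pow, ← hu₁, conj_pow, ← map_pow,
      ← upper_eq_pow] at hny
    have h1 := mul_left_cancel (mul_right_cancel hny)
    rcases d.R_eq h1 with h2 | h2
    · have := congrArg (fun g : SL(2, ZMod p) => g.1 1 0) h2
      simp [upper_coe, lower_coe] at this
    · have := congrArg (fun g : SL(2, ZMod p) => g.1 1 0) h2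
      simp [upper_coe, lower_coe, Matrix.SpecialLinearGroup.coe_neg] at this
  -- A further element of $U$ straightens the image to a lower unitriangular matrix without
  -- disturbing $u$; the corrected $n_1$ then centralizes everything.
  obtain ⟨e, he⟩ := exists_upper_conj_eq_lower ht hy10
  have hcomm := d.comm_of_conj hp (n := d.R (upper e) * n₁) (c := y.1 1 0) (by
      rw [mul_inv_rev, show d.R (upper e) * n₁ * d.R (upper 1) * (n₁⁻¹ * (d.R (upper e))⁻¹) =
        d.R (upper e) * (n₁ * d.R (upper 1) * n₁⁻¹) * (d.R (upper e))⁻¹ by group, hu₁, ← map_mul,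
        ← map_inv, ← map_mul, upper_mul, upper_inv, upper_mul]
      congr 2; ring) (by
      rw [mul_inv_rev, show d.R (upper e) * n₁ * d.R (lower 1) * (n₁⁻¹ * (d.R (upper e))⁻¹) =
        d.R (upper e) * (n₁ * d.R (lower 1) * n₁⁻¹) * (d.R (upper e))⁻¹ by group, hny, ← map_mul,
        ← map_inv, ← map_mul, he])
  obtain ⟨c', x, hx, hcx⟩ := d.centralizer _ hcomm
  refine ⟨_, mul_mem ⟨(toGL h * diagGL p c, 1), rfl⟩ ⟨((toGL (upper e))⁻¹, c'), rfl⟩, x, hx, ?_⟩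
  rw [hn₁, mul_assoc, mul_right_inj, big_apply, map_inv, sigma_toGL, mul_assoc, ← hcx,
    inv_mul_cancel_left]

end OvergroupData

/-! ### Maximal extensions of order prime to `p` -/

namespace OvergroupData

variable {Γ : Type u} [Group Γ] (d : OvergroupData p Γ)

/-- Scalars and determinants both have exponent dividing $p-1$; hence the quotient has no element of
order $p$. -/
lemma pow_mem_of_mem_range_big {γ : Γ} (hγ : γ ∈ d.big.range) : γ ^ (p - 1) ∈ d.R.range := by
  obtain ⟨⟨g, c⟩, rfl⟩ := hγ
  rw [← map_pow, Prod.pow_mk, big_apply, map_pow d.Z, d.Z_pow, mul_one]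
  exact d.sigma_of_det (by rw [map_pow, ZMod.units_pow_card_sub_one_eq_one])

lemma normal_subgroupOf {K : Subgroup Γ} (hK : K ≤ Subgroup.normalizer (d.R.range : Set Γ)) :
    (d.R.range.subgroupOf K).Normal :=
  ⟨fun n hn g => (Subgroup.mem_normalizer_iff.1 (hK g.2) n).1 hn⟩

lemma not_dvd_relIndex [Finite Γ] : ¬ p ∣ d.R.range.relIndex d.big.range := by
  intro h
  have := d.normal_subgroupOf d.range_big_le
  obtain ⟨q, hq⟩ := exists_prime_orderOf_dvd_card'
    (G := d.big.range ⧸ d.R.range.subgroupOf d.big.range) p h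
  induction q using QuotientGroup.induction_on with
  | H γ =>
    have h1 : (γ : d.big.range ⧸ d.R.range.subgroupOf d.big.range) ^ (p - 1) = 1 := by
      rw [← QuotientGroup.mk_pow, QuotientGroup.eq_one_iff]
      exact d.pow_mem_of_mem_range_big γ.2
    have h2 := Nat.le_of_dvd (Nat.sub_pos_of_lt (Fact.out : p.Prime).one_lt)
      (orderOf_dvd_of_pow_eq_one h1)
    have := (Fact.out : p.Prime).pos
    omega

/-- The normalizer preserves the centralizer, in which $P$ consists of the elements killed by $p$.
-/
lemma conj_mem_P {n : Γ} (hn : n ∈ Subgroup.normalizer (d.R.range : Set Γ)) {x : Γ} (hx : x ∈ d.P) :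
    n * x * n⁻¹ ∈ d.P := by
  obtain ⟨c, y, hy, h⟩ := d.centralizer (n * x * n⁻¹) fun g => by
    obtain ⟨g', hg'⟩ := (Subgroup.mem_normalizer_iff.1 (inv_mem hn) (d.R g)).1 ⟨g, rfl⟩
    have h1 : d.R g = n * d.R g' * n⁻¹ := by rw [hg']; group
    rw [h1, show n * x * n⁻¹ * (n * d.R g' * n⁻¹) = n * (x * d.R g') * n⁻¹ by group,
      d.P_comm x hx]
    group
  have h1 : (n * x * n⁻¹) ^ p = 1 := by rw [conj_pow, d.P_pow x hx]; simp
  rw [h, Commute.mul_pow (d.Z_comm c y), d.P_pow y hy, mul_one,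
    ← pow_sub_one_mul (Fact.out : p.Prime).ne_zero, d.Z_pow, one_mul] at h1
  have h2 : c = 1 := d.Z_injective (by rw [h1, map_one])
  rw [h, h2, map_one, one_mul]
  exact hy

/-- The index, prime to $p$, and the exponent $p$ of $x$ force $x$ into the image of
$\mathrm{SL}_2(p)$, which meets $P$ trivially. -/
lemma inf_P_eq_bot_of_not_dvd {H : Subgroup Γ} (hp : 2 < p)
    (hH : H ≤ Subgroup.normalizer (d.R.range : Set Γ)) (hd : ¬ p ∣ d.R.range.relIndex H) {x : Γ}
    (hxH : x ∈ H) (hxP : x ∈ d.P) : x = 1 := by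
  have := d.normal_subgroupOf hH
  have h1 : x ^ d.R.range.relIndex H ∈ d.R.range :=
    Subgroup.pow_index_mem (d.R.range.subgroupOf H) ⟨x, hxH⟩
  have h2 : x ∈ d.R.range := by
    have hc : Nat.Coprime (d.R.range.relIndex H) p :=
      (Nat.coprime_comm.1 ((Nat.Prime.coprime_iff_not_dvd Fact.out).2 hd))
    have h3 : x ^ ((Nat.gcd (d.R.range.relIndex H) p : ℕ) : ℤ) ∈ d.R.range := by
      rw [Nat.gcd_eq_gcd_ab, zpow_add, zpow_mul, zpow_mul, zpow_natCast, zpow_natCast,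
        d.P_pow x hxP, one_zpow, mul_one]
      exact zpow_mem h1 _
    rw [hc.gcd_eq_one] at h3
    simpa using h3
  obtain ⟨⟨g, c⟩, hg⟩ := d.range_le_range_big h2
  rw [big_apply] at hg
  rw [← hg]
  exact d.eq_one_of_sigma_mul_mem hp (hg ▸ hxP)

lemma isComplement' (hp : 2 < p) : Subgroup.IsComplement'
    (d.big.range.subgroupOf (Subgroup.normalizer (d.R.range : Set Γ)))
    (d.P.subgroupOf (Subgroup.normalizer (d.R.range : Set Γ))) := by
  refine Subgroup.isComplement'_of_disjoint_and_mul_eq_univ ?_ ?_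
  · rw [Subgroup.disjoint_def]
    rintro x ⟨⟨g, c⟩, hx1⟩ hx2
    apply Subtype.ext
    change _ = x.1 at hx1
    rw [← hx1]
    rw [big_apply] at hx1 ⊢
    exact d.eq_one_of_sigma_mul_mem hp (hx1 ▸ hx2)
  · refine Set.eq_univ_iff_forall.2 fun n => ?_
    obtain ⟨g, hg, x, hx, h⟩ := d.exists_of_mem_normalizer hp n.2
    exact ⟨⟨g, d.range_big_le hg⟩, hg, ⟨x, d.P_le hx⟩, hx, Subtype.ext h.symm⟩

instance : (d.P.subgroupOf (Subgroup.normalizer (d.R.range : Set Γ))).Normal :=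
  ⟨fun _ hn g => d.conj_mem_P g.2 hn⟩

/-- A maximal extension of order prime to `p` is a complement to the unipotent centralizer. -/
theorem relIndex_eq_and_isComplement' [Finite Γ] (hp : 2 < p)
    (hcard : Nat.card d.P = 1 ∨ Nat.card d.P = p) {H : Subgroup Γ}
    (hH : IsMaximalPrimeToExtension p d.R.range H) :
    H.relIndex (Subgroup.normalizer (d.R.range : Set Γ)) = Nat.card d.P ∧
      Subgroup.IsComplement' (H.subgroupOf (Subgroup.normalizer (d.R.range : Set Γ)))
        (d.P.subgroupOf (Subgroup.normalizer (d.R.range : Set Γ))) := by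
  obtain ⟨⟨h1, h2, h3⟩, h4⟩ := hH
  have hcompl := d.isComplement' hp
  have h5 := h4 _ d.range_le_range_big d.range_big_le d.not_dvd_relIndex
  have h6 : d.big.range.relIndex (Subgroup.normalizer (d.R.range : Set Γ)) = Nat.card d.P := by
    rw [Subgroup.relIndex, hcompl.symm.index_eq_card]
    exact Nat.card_congr (Subgroup.subgroupOfEquivOfLe d.P_le).toEquiv
  have h7 := (Subgroup.relIndex_mul_relIndex _ _ _ d.range_le_range_big d.range_big_le).trans
    (Subgroup.relIndex_mul_relIndex _ _ _ h1 h2).symm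
  have h8 : H.relIndex (Subgroup.normalizer (d.R.range : Set Γ)) = Nat.card d.P := by
    rw [h6] at h7
    have hpos : 0 < d.R.range.relIndex H := Nat.pos_of_ne_zero fun h => h3 (h ▸ dvd_zero p)
    have hpos' : 0 < d.R.range.relIndex d.big.range :=
      Nat.pos_of_ne_zero fun h => d.not_dvd_relIndex (h ▸ dvd_zero p)
    -- Both chains from $G_0$ to the normalizer give the same index, and $|P|$ is prime to
    -- $[H:G_0]$. So $[H:G_0]$ divides the index of the standard candidate, while maximality gives
    -- the reverse inequality.
    have hle : d.R.range.relIndex H ≤ d.R.range.relIndex d.big.range := by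
      refine Nat.le_of_dvd hpos' (Nat.Coprime.dvd_of_dvd_mul_right ?_ ⟨_, h7⟩)
      rcases hcard with h | h
      · rw [h]; exact Nat.coprime_one_right _
      · rw [h]; exact Nat.coprime_comm.1 ((Nat.Prime.coprime_iff_not_dvd Fact.out).2 h3)
    rw [le_antisymm hle h5] at h7
    exact (Nat.eq_of_mul_eq_mul_left hpos' h7).symm
  refine ⟨h8, Subgroup.isComplement'_of_card_mul_and_disjoint ?_ ?_⟩
  · rw [← Subgroup.card_mul_index (H.subgroupOf (Subgroup.normalizer (d.R.range : Set Γ)))]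
    congr 1
    rw [← Subgroup.relIndex, h8]
    exact Nat.card_congr (Subgroup.subgroupOfEquivOfLe d.P_le).toEquiv
  · rw [Subgroup.disjoint_def]
    intro x hx1 hx2
    exact Subtype.ext (d.inf_P_eq_bot_of_not_dvd hp h2 h3 hx1 hx2)

/-- Both groups are complements of the normal subgroup $P$ in the normalizer, hence isomorphic to
the quotient by $P$; conjugacy is not needed. -/
theorem nonempty_equiv_range_big [Finite Γ] (hp : 2 < p)
    (hcard : Nat.card d.P = 1 ∨ Nat.card d.P = p) {H : Subgroup Γ}
    (hH : IsMaximalPrimeToExtension p d.R.range H) :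
    Nonempty (H ≃* d.big.range) :=
  ⟨(Subgroup.subgroupOfEquivOfLe hH.1.2.1).symm.trans
    ((d.relIndex_eq_and_isComplement' hp hcard hH).2.QuotientMulEquiv.symm.trans
      ((d.isComplement' hp).QuotientMulEquiv.trans (Subgroup.subgroupOfEquivOfLe d.range_big_le)))⟩

lemma exists_eq_mul [Finite Γ] (hp : 2 < p)
    (hcard : Nat.card d.P = 1 ∨ Nat.card d.P = p) {H : Subgroup Γ}
    (hH : IsMaximalPrimeToExtension p d.R.range H) {n : Γ} (hn : n ∈ Subgroup.normalizer (d.R.range : Set Γ)) :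
    ∃ h ∈ H, ∃ x ∈ d.P, n = h * x := by
  obtain ⟨⟨h, x⟩, hx⟩ := (d.relIndex_eq_and_isComplement' hp hcard hH).2.surjective ⟨n, hn⟩
  exact ⟨_, h.2, _, x.2, (congrArg Subtype.val hx).symm⟩

/-- A scalar is $hx$ with $h\in H$ and $x\in P$; the $p$-th power of $h$ removes $x$ and returns the
scalar, because $c^p=c$. -/
lemma Z_mem [Finite Γ] (hp : 2 < p)
    (hcard : Nat.card d.P = 1 ∨ Nat.card d.P = p) {H : Subgroup Γ}
    (hH : IsMaximalPrimeToExtension p d.R.range H)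
    (c : (ZMod p)ˣ) : d.Z c ∈ H := by
  have hn : d.Z c ∈ Subgroup.normalizer (d.R.range : Set Γ) :=
    d.range_big_le ⟨(1, c), by rw [big_apply, map_one, one_mul]⟩
  obtain ⟨h, hh, x, hx, hc⟩ := d.exists_eq_mul hp hcard hH hn
  have h1 : h = d.Z c * x⁻¹ := by rw [hc, mul_inv_cancel_right]
  have h2 : h ^ p = d.Z c := by
    have hcomm : Commute (d.Z c) x⁻¹ := d.Z_comm c _
    rw [h1, hcomm.mul_pow, inv_pow, d.P_pow x hx, inv_one, mul_one,
      ← pow_sub_one_mul (Fact.out : p.Prime).ne_zero, d.Z_pow, one_mul]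
  rw [← h2]
  exact pow_mem hh p

/-- The scalars in `GL_2(p)` act by a power of the identity character. -/
lemma exists_sigma_scalar_eq : ∃ r : ℤ, ∀ c,
    d.sigma (Matrix.GeneralLinearGroup.scalar (Fin 2) c) = d.Z (c ^ r) := by
  obtain ⟨ζ, hζ⟩ := IsCyclic.exists_generator (α := (ZMod p)ˣ)
  obtain ⟨e, he⟩ := d.sigma_scalar ζ
  obtain ⟨r, rfl⟩ := hζ e
  refine ⟨r, fun c => ?_⟩
  obtain ⟨k, rfl⟩ := hζ c
  change d.sigma (Matrix.GeneralLinearGroup.scalar (Fin 2) (ζ ^ k)) = d.Z ((ζ ^ k) ^ r)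
  rw [map_zpow, map_zpow, he, ← map_zpow]
  congr 1
  exact zpow_comm ζ r k

lemma toGL_neg_one : (toGL (-1 : SL(2, ZMod p))) = Matrix.GeneralLinearGroup.scalar (Fin 2) (-1) := by
  apply Units.ext
  ext i j
  fin_cases i <;> fin_cases j <;> simp [Matrix.scalar_apply, Matrix.SpecialLinearGroup.coe_GL_coe_matrix]

/-- The extension to `GL_2(p)`, twisted by a power of the determinant. -/
def twist (s : ℤ) : GL (Fin 2) (ZMod p) →* Γ where
  toFun g := d.sigma g * d.Z (Matrix.GeneralLinearGroup.det g ^ s)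
  map_one' := by simp
  map_mul' g h := by
    rw [map_mul, map_mul, mul_zpow, map_mul, mul_assoc (d.sigma g) (d.sigma h),
      ← mul_assoc (d.sigma h), ← d.Z_comm _ (d.sigma h)]
    simp only [mul_assoc]

lemma twist_apply (s : ℤ) (g : GL (Fin 2) (ZMod p)) :
    d.twist s g = d.sigma g * d.Z (Matrix.GeneralLinearGroup.det g ^ s) := rfl

lemma sigma_eq_twist_mul (s : ℤ) (g : GL (Fin 2) (ZMod p)) (c : (ZMod p)ˣ) :
    d.sigma g * d.Z c = d.twist s g * d.Z (Matrix.GeneralLinearGroup.det g ^ (-s) * c) := by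
  rw [twist_apply, mul_assoc, ← map_mul, zpow_neg, mul_inv_cancel_left]

lemma twist_scalar {r : ℤ} (hr : ∀ c,
    d.sigma (Matrix.GeneralLinearGroup.scalar (Fin 2) c) = d.Z (c ^ r)) (s : ℤ) (c : (ZMod p)ˣ) :
    d.twist s (Matrix.GeneralLinearGroup.scalar (Fin 2) c) = d.Z (c ^ (r + 2 * s)) := by
  rw [twist_apply, hr, ← map_mul, Matrix.GeneralLinearGroup.det_scalar, zpow_add, zpow_mul]
  simp

lemma exists_eq_scalar_of_twist (hp : 2 < p) {s : ℤ} {g : GL (Fin 2) (ZMod p)} {c : (ZMod p)ˣ}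
    (h : d.twist s g * d.Z c = 1) : ∃ e, g = Matrix.GeneralLinearGroup.scalar (Fin 2) e := by
  refine d.exists_eq_scalar hp fun x => ?_
  rw [twist_apply, mul_assoc, ← map_mul] at h
  rw [eq_inv_of_mul_eq_one_left h, ← map_inv, d.Z_comm]

/-- If `-1` acts as the scalar `-1`, then the extension of `SL_2(p)` is `GL_2(p)`. -/
theorem nonempty_range_big_equiv_GL (hp : 2 < p) (h : d.R (-1) = d.Z (-1)) :
    Nonempty (d.big.range ≃* GL (Fin 2) (ZMod p)) := by
  obtain ⟨r, hr⟩ := d.exists_sigma_scalar_eq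
  -- The matrix $-1$ lies in $\mathrm{SL}_2(p)$ and is also the scalar $-1$, so $(-1)^r=-1$.
  have hodd : Odd r := by
    rw [← Int.not_even_iff_odd]
    intro he
    have h1 := hr (-1)
    rw [← toGL_neg_one, sigma_toGL, h, he.neg_one_zpow] at h1
    have h2 := congrArg Units.val (d.Z_injective h1)
    exact neg_one_zmod_ne_one hp (by simpa using h2)
  -- With $r=2s+1$, twisting by $\det^{-s}$ lets scalar matrices act as the same scalars. The twist
  -- is then faithful and its image contains all scalars.
  obtain ⟨s, hs⟩ := hodd
  have hsc : ∀ c, d.twist (-s) (Matrix.GeneralLinearGroup.scalar (Fin 2) c) = d.Z c := fun c => by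
    rw [d.twist_scalar hr, hs, show 2 * s + 1 + 2 * -s = 1 by ring, zpow_one]
  have hinj : Function.Injective (d.twist (-s)) := by
    rw [injective_iff_map_eq_one]
    intro g hg
    obtain ⟨e, rfl⟩ := d.exists_eq_scalar_of_twist hp (s := -s) (g := g) (c := 1) (by simpa using hg)
    rw [hsc] at hg
    rw [d.Z_injective (hg.trans (map_one d.Z).symm), map_one]
  have hrange : d.big.range = (d.twist (-s)).range := by
    apply le_antisymm
    · rintro _ ⟨⟨g, c⟩, rfl⟩
      rw [big_apply, d.sigma_eq_twist_mul (-s), ← hsc, ← map_mul]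
      exact ⟨_, rfl⟩
    · rintro _ ⟨g, rfl⟩
      exact ⟨(g, Matrix.GeneralLinearGroup.det g ^ (-s)), rfl⟩
  rw [hrange]
  exact ⟨(MonoidHom.ofInjective hinj).symm⟩

/-- If `-1` acts trivially, then the extension of `PSL_2(p)` is `PGL_2(p)` times the scalars. -/
theorem nonempty_range_big_equiv_PGL (hp : 2 < p) (h : d.R (-1) = 1) :
    Nonempty (d.big.range ≃* PGL(2, ZMod p) × Multiplicative (ZMod (p - 1))) := by
  obtain ⟨r, hr⟩ := d.exists_sigma_scalar_eq
  have heven : Even r := by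
    rw [← Int.not_odd_iff_even]
    intro ho
    have h1 := hr (-1)
    rw [← toGL_neg_one, sigma_toGL, h, ho.neg_one_zpow, ← map_one d.Z] at h1
    have h2 := congrArg Units.val (d.Z_injective h1)
    exact neg_one_zmod_ne_one hp (by simpa using h2.symm)
  -- With $r=2s$, twisting by $\det^{-s}$ kills scalar matrices, so it descends to
  -- $\mathrm{PGL}_2(p)$ and the scalars become a direct factor.
  obtain ⟨s, hs⟩ := heven.two_dvd
  have hsc : ∀ c, d.twist (-s) (Matrix.GeneralLinearGroup.scalar (Fin 2) c) = 1 := fun c => by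
    rw [d.twist_scalar hr, hs, show 2 * s + 2 * -s = 0 by ring, zpow_zero, map_one]
  let τ : PGL(2, ZMod p) →* Γ := QuotientGroup.lift _ (d.twist (-s)) (by
    intro g hg
    rw [Matrix.GeneralLinearGroup.center_eq_range_scalar] at hg
    obtain ⟨c, rfl⟩ := hg
    exact hsc c)
  have hτ : ∀ g, τ (Matrix.ProjGenLinGroup.mk g) = d.twist (-s) g := fun g => rfl
  let Φ : PGL(2, ZMod p) × (ZMod p)ˣ →* Γ :=
    MonoidHom.noncommCoprod τ d.Z fun _ _ => (d.Z_comm _ _).symm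
  have hΦ : ∀ g c, Φ (Matrix.ProjGenLinGroup.mk g, c) = d.twist (-s) g * d.Z c := fun g c => rfl
  have hinj : Function.Injective Φ := by
    rw [injective_iff_map_eq_one]
    rintro ⟨g, c⟩ hg
    induction g using Matrix.ProjGenLinGroup.induction_on with
    | mk g =>
      rw [hΦ] at hg
      obtain ⟨e, rfl⟩ := d.exists_eq_scalar_of_twist hp hg
      rw [hsc, one_mul] at hg
      rw [d.Z_injective (hg.trans (map_one d.Z).symm), Matrix.ProjGenLinGroup.mk_scalar]
      rfl
  have hrange : d.big.range = Φ.range := by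
    apply le_antisymm
    · rintro _ ⟨⟨g, c⟩, rfl⟩
      rw [big_apply, d.sigma_eq_twist_mul (-s)]
      exact ⟨(Matrix.ProjGenLinGroup.mk g, _), rfl⟩
    · rintro _ ⟨⟨g, c⟩, rfl⟩
      induction g using Matrix.ProjGenLinGroup.induction_on with
      | mk g =>
        refine ⟨(g, Matrix.GeneralLinearGroup.det g ^ (-s) * c), ?_⟩
        rw [hΦ, big_apply, map_mul, ← mul_assoc]; rfl
  have hcard : Nat.card (ZMod p)ˣ = p - 1 := by
    rw [Nat.card_eq_fintype_card, ZMod.card_units]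
  have e : Multiplicative (ZMod (p - 1)) ≃* (ZMod p)ˣ := hcard ▸ zmodCyclicMulEquiv (G := (ZMod p)ˣ) inferInstance
  rw [hrange]
  exact ⟨(MonoidHom.ofInjective hinj).symm.trans ((MulEquiv.refl _).prodCongr e.symm)⟩

end OvergroupData

/-! ### Endomorphisms -/

section Modules

variable {M : Type u} [AddCommGroup M] [Module (ZMod p) M] [Module (GroupAlg p) M]
  [IsScalarTower (ZMod p) (GroupAlg p) M]

lemma finrank_eq_of_equiv_vmod {N : Type v} [AddCommGroup N] [Module (ZMod p) N]
    [Module (GroupAlg p) N] [IsScalarTower (ZMod p) (GroupAlg p) N] {i : ℕ} (hi : 1 ≤ i)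
    (hi' : i ≤ p) (e : N ≃ₗ[GroupAlg p] VMod p i) : Module.finrank (ZMod p) N = i := by
  rw [((e.trans (vmodEquiv p i)).restrictScalars (ZMod p)).finrank_eq, finrank_symMod (by omega)]
  omega

lemma isSimpleModule_of_equiv_vmod {N : Type v} [AddCommGroup N] [Module (GroupAlg p) N] {i : ℕ}
    (hi : i - 1 < p) (e : N ≃ₗ[GroupAlg p] VMod p i) : IsSimpleModule (GroupAlg p) N := by
  have := isSimpleModule_symMod hi
  exact IsSimpleModule.congr (e.trans (vmodEquiv p i))

lemma HasRadicalLayers.subsingleton {i : ℕ} (h : HasRadicalLayers p [i] M) :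
    Subsingleton (Module.jacobson (GroupAlg p) M) := h.2

lemma HasRadicalLayers.nonempty_equiv_vmod {i : ℕ} (h : HasRadicalLayers p [i] M) :
    Nonempty (M ≃ₗ[GroupAlg p] VMod p i) := by
  obtain ⟨e⟩ := h.1
  have := h.subsingleton
  have hb : Module.jacobson (GroupAlg p) M = ⊥ := Submodule.subsingleton_iff_eq_bot.1 this
  exact ⟨(Submodule.quotEquivOfEqBot _ hb).symm.trans e⟩

lemma HasRadicalLayers.nonempty_equiv_top {i : ℕ} {l : List ℕ} (h : HasRadicalLayers p (i :: l) M) :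
    Nonempty ((M ⧸ Module.jacobson (GroupAlg p) M) ≃ₗ[GroupAlg p] VMod p i) := h.1

lemma HasRadicalLayers.tail {i : ℕ} {l : List ℕ} (h : HasRadicalLayers p (i :: l) M) :
    HasRadicalLayers p l (Module.jacobson (GroupAlg p) M) := h.2

/-- In a module of length two, the radical is the unique nontrivial submodule. -/
lemma HasRadicalLayers.jacobson_le [FiniteDimensional (ZMod p) M] {i j : ℕ} (hi : 1 ≤ i)
    (hi' : i ≤ p) (hj : j - 1 < p) (h : HasRadicalLayers p [j, i] M) :
    ∀ N : Submodule (GroupAlg p) M, N ≠ ⊥ → Module.jacobson (GroupAlg p) M ≤ N := by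
  intro N hN
  obtain ⟨e⟩ := h.tail.nonempty_equiv_vmod
  have : IsSimpleModule (GroupAlg p) (Module.jacobson (GroupAlg p) M) :=
    isSimpleModule_of_equiv_vmod (by omega) e
  by_cases hle : N ≤ Module.jacobson (GroupAlg p) M
  · exact le_of_inf_ne_bot (by rwa [inf_eq_right.2 hle])
  · rw [h.eq_top hj hle]; exact le_top

lemma eq_bot_of_range_eq_top [FiniteDimensional (ZMod p) M] {f : M →ₗ[GroupAlg p] M}
    (h : LinearMap.range f = ⊤) : LinearMap.ker f = ⊥ :=
  LinearMap.ker_eq_bot.2 ((LinearMap.injective_iff_surjective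
    (f := f.restrictScalars (ZMod p))).2 (LinearMap.range_eq_top (f := f).1 h))

/-- The endomorphisms of a module with simple top and simple essential socle, when every
endomorphism killing the socle factors through the top and has image in the socle. -/
lemma exists_endomorphism_generator [FiniteDimensional (ZMod p) M] {i j : ℕ} {l : List ℕ}
    (hi : i - 1 < p) (hj : j - 1 < p) (h : HasRadicalLayers p (j :: l) M)
    {S : Submodule (GroupAlg p) M} (eS : S ≃ₗ[GroupAlg p] VMod p i)
    (hess : ∀ N : Submodule (GroupAlg p) M, N ≠ ⊥ → S ≤ N)
    (hν : ∀ ν : M →ₗ[GroupAlg p] M, S ≤ LinearMap.ker ν →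
      Module.jacobson (GroupAlg p) M ≤ LinearMap.ker ν ∧ LinearMap.range ν ≤ S) :
    ∃ ν₀ : M →ₗ[GroupAlg p] M, (∀ m, ν₀ (ν₀ m) = 0) ∧
      (∀ φ : M →ₗ[GroupAlg p] M, ∃ c e : ZMod p, ∀ m, φ m = c • m + e • ν₀ m) ∧
      ((∃ m, ν₀ m ≠ 0) ↔ (S ≤ Module.jacobson (GroupAlg p) M ∧
        Nonempty ((M ⧸ Module.jacobson (GroupAlg p) M) ≃ₗ[GroupAlg p] S))) := by
  have hSs : IsSimpleModule (GroupAlg p) S := isSimpleModule_of_equiv_vmod hi eS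
  have hSbot : S ≠ ⊥ := by
    rintro rfl
    have := IsSimpleModule.nontrivial (GroupAlg p) (⊥ : Submodule (GroupAlg p) M)
    exact not_subsingleton (⊥ : Submodule (GroupAlg p) M) inferInstance
  have hJs : IsSimpleModule (GroupAlg p) (M ⧸ Module.jacobson (GroupAlg p) M) :=
    h.isSimpleModule_top hj
  have hfU : Module.finrank (ZMod p) (fixU p S) ≤ 1 := by
    let e := (eS.trans (vmodEquiv p i)).restrictScalars (ZMod p)
    have hle : fixU p S ≤ (fixU p (SymMod p (i - 1))).map e.symm.toLinearMap := fun x hx =>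
      ⟨e x, map_mem_fixU (eS.trans (vmodEquiv p i)).toLinearMap hx, e.symm_apply_apply x⟩
    exact (Submodule.finrank_mono hle).trans
      ((Submodule.finrank_map_le _ _).trans (finrank_fixU_symMod_le hi))
  have hspan : ∀ x y : M, x ∈ S → x ∈ fixU p M → x ≠ 0 → y ∈ S → y ∈ fixU p M →
      ∃ c : ZMod p, y = c • x := by
    intro x y hx hxU hx0 hy hyU
    obtain ⟨c, hc⟩ := mem_span_of_finrank_le_one hfU (x := ⟨x, hx⟩) (y := ⟨y, hy⟩)
      (coe_mem_fixU.1 hxU) (fun h => hx0 (congrArg Subtype.val h)) (coe_mem_fixU.1 hyU)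
    exact ⟨c, congrArg Subtype.val hc⟩
  obtain ⟨b, s, -, hsS, hs0, hsU, -⟩ := exists_mem_fixU_of_ne_bot hSbot
  -- subtraction of a scalar
  have hscal : ∀ φ : M →ₗ[GroupAlg p] M, ∃ (c : ZMod p) (ν : M →ₗ[GroupAlg p] M),
      S ≤ LinearMap.ker ν ∧ ∀ m, φ m = c • m + ν m := by
    intro φ
    -- The image of $S$ is zero, or it contains $S$ and has no larger dimension.
    have hφs : φ s ∈ S := by
      by_cases h0 : S.map φ = ⊥
      · have : φ s ∈ S.map φ := ⟨s, hsS, rfl⟩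
        rw [h0, Submodule.mem_bot] at this
        rw [this]; exact zero_mem _
      · have h1 := hess _ h0
        have h2 : S.map φ = S := (eq_of_le_of_finrank_submodule h1 (by
          have := finrank_map_add_finrank_inf_ker S φ
          omega)).symm
        rw [← h2]; exact ⟨s, hsS, rfl⟩
    obtain ⟨c, hc⟩ := hspan s (φ s) hsS hsU hs0 hφs (map_mem_fixU φ hsU)
    refine ⟨c, φ - c • LinearMap.id, ?_, fun m => by simp⟩
    refine hess _ fun h0 => hs0 ?_
    have : s ∈ LinearMap.ker (φ - c • LinearMap.id) := by simp [hc]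
    rwa [h0, Submodule.mem_bot] at this
  -- two endomorphisms killing the socle are proportional
  have hprop : ∀ ν₀ ν : M →ₗ[GroupAlg p] M, S ≤ LinearMap.ker ν₀ → S ≤ LinearMap.ker ν →
      ν₀ ≠ 0 → ∃ e : ZMod p, ∀ m, ν m = e • ν₀ m := by
    intro ν₀ ν h0 h1 hne
    have hk0 : LinearMap.ker ν₀ ≤ Module.jacobson (GroupAlg p) M := by
      by_contra hc
      exact hne (LinearMap.ker_eq_top.1 (h.eq_top hj hc))
    have : Nontrivial (M ⧸ Module.jacobson (GroupAlg p) M) := IsSimpleModule.nontrivial (GroupAlg p) _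
    obtain ⟨b, y, -, hy0, hyU, -⟩ := exists_fixU_isWt (p := p)
      (M := M ⧸ Module.jacobson (GroupAlg p) M)
    obtain ⟨v, rfl⟩ := Submodule.mkQ_surjective _ y
    have hvJ : v ∉ Module.jacobson (GroupAlg p) M := fun hv =>
      hy0 ((Submodule.Quotient.mk_eq_zero _).2 hv)
    have hnv : (nil : GroupAlg p) • v ∈ Module.jacobson (GroupAlg p) M := by
      rw [mem_fixU, ← map_smul] at hyU
      exact (Submodule.Quotient.mk_eq_zero _).1 hyU
    have hU : ∀ ν : M →ₗ[GroupAlg p] M, S ≤ LinearMap.ker ν → ν v ∈ S ∧ ν v ∈ fixU p M := by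
      intro ν h1
      refine ⟨(hν ν h1).2 ⟨v, rfl⟩, ?_⟩
      rw [mem_fixU, ← map_smul]
      exact (hν ν h1).1 hnv
    obtain ⟨e, he⟩ := hspan (ν₀ v) (ν v) (hU ν₀ h0).1 (hU ν₀ h0).2 (fun hv => hvJ (hk0 hv))
      (hU ν h1).1 (hU ν h1).2
    refine ⟨e, fun m => ?_⟩
    have hk : LinearMap.ker (ν - e • ν₀) = ⊤ := by
      refine h.eq_top hj fun hle => hvJ (hle ?_)
      simp [he]
    have : m ∈ LinearMap.ker (ν - e • ν₀) := hk ▸ trivial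
    simpa [sub_eq_zero] using this
  have hnil : ∀ ν : M →ₗ[GroupAlg p] M, S ≤ LinearMap.ker ν → ∀ m, ν (ν m) = 0 :=
    fun ν h1 m => h1 ((hν ν h1).2 ⟨m, rfl⟩)
  by_cases hex : ∃ ν₀ : M →ₗ[GroupAlg p] M, S ≤ LinearMap.ker ν₀ ∧ ν₀ ≠ 0
  · obtain ⟨ν₀, h0, hne⟩ := hex
    refine ⟨ν₀, hnil ν₀ h0, fun φ => ?_, fun _ => ?_, fun _ => ?_⟩
    · obtain ⟨c, ν, h1, h2⟩ := hscal φ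
      obtain ⟨e, he⟩ := hprop ν₀ ν h0 h1 hne
      exact ⟨c, e, fun m => by rw [h2, he]⟩
    · have hk0 : LinearMap.ker ν₀ ≤ Module.jacobson (GroupAlg p) M := by
        by_contra hc
        exact hne (LinearMap.ker_eq_top.1 (h.eq_top hj hc))
      refine ⟨h0.trans hk0, ⟨LinearEquiv.ofBijective ((Module.jacobson (GroupAlg p) M).liftQ
        (ν₀.codRestrict S fun m => (hν ν₀ h0).2 ⟨m, rfl⟩) ?_) ?_⟩⟩
      · intro m hm
        exact Subtype.ext ((hν ν₀ h0).1 hm)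
      · refine LinearMap.bijective_of_ne_zero fun hz => hne (LinearMap.ext fun m => ?_)
        exact congrArg Subtype.val (LinearMap.congr_fun hz (Submodule.Quotient.mk m))
    · by_contra hc
      push Not at hc
      exact hne (LinearMap.ext hc)
  · push Not at hex
    refine ⟨0, fun _ => rfl, fun φ => ?_, fun ⟨m, hm⟩ => absurd rfl hm, fun ⟨hSJ, ⟨f⟩⟩ => ?_⟩
    · obtain ⟨c, ν, h1, h2⟩ := hscal φ
      exact ⟨c, 0, fun m => by rw [h2, hex ν h1]; simp⟩
    · exfalso
      let κ : M →ₗ[GroupAlg p] M := S.subtype ∘ₗ f.toLinearMap ∘ₗ (Module.jacobson (GroupAlg p) M).mkQ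
      have h1 : κ = 0 := hex κ fun m hm => by
        have : (Module.jacobson (GroupAlg p) M).mkQ m = 0 := (Submodule.Quotient.mk_eq_zero _).2 (hSJ hm)
        rw [LinearMap.mem_ker, LinearMap.comp_apply, LinearMap.comp_apply, this, map_zero, map_zero]
      obtain ⟨y, hy⟩ := f.surjective ⟨s, hsS⟩
      obtain ⟨m, rfl⟩ := Submodule.mkQ_surjective _ y
      have h2 := LinearMap.congr_fun h1 m
      apply hs0
      have h3 : κ m = s := congrArg Subtype.val hy
      rw [← h3, h2]; rfl

end Modules

section Modules

variable {M : Type u} [AddCommGroup M] [Module (ZMod p) M] [Module (GroupAlg p) M]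
  [IsScalarTower (ZMod p) (GroupAlg p) M]

variable (p M) in
/-- The radical layers of the modules with nonscalar endomorphisms. -/
def HasNonscalarEndomorphism : Prop :=
  (∃ i : ℕ, (2 * i = p - 1 ∨ 2 * i = p + 1) ∧ HasRadicalLayers p [i, i] M) ∨
    HasRadicalLayers p [1, p - 2, 1] M

lemma HasRadicalLayers.finrank_jacobson [FiniteDimensional (ZMod p) M] {i : ℕ} {l : List ℕ}
    (hl : ∀ m ∈ i :: l, 1 ≤ m ∧ m ≤ p) (h : HasRadicalLayers p (i :: l) M) :
    Module.finrank (ZMod p) M = i + l.sum ∧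
      Module.finrank (ZMod p) (Module.jacobson (GroupAlg p) M) = l.sum :=
  ⟨by rw [(h.finrank_eq hl).2, List.sum_cons],
    (h.tail.finrank_eq fun m hm => hl m (List.mem_cons_of_mem _ hm)).2⟩

lemma forall_mem_pair {i j : ℕ} (hi : 1 ≤ i) (hi' : i ≤ p) (hj : 1 ≤ j) (hj' : j ≤ p) :
    ∀ m ∈ [j, i], 1 ≤ m ∧ m ≤ p := by
  intro m hm
  simp only [List.mem_cons, List.not_mem_nil, or_false] at hm
  omega

lemma forall_mem_triple (hp : 5 ≤ p) : ∀ m ∈ [1, p - 2, 1], 1 ≤ m ∧ m ≤ p := by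
  intro m hm
  simp only [List.mem_cons, List.not_mem_nil, or_false] at hm
  omega

/-- Numerical consequences of the radical layers of the modules with nonscalar endomorphisms. -/
lemma HasNonscalarEndomorphism.finrank [FiniteDimensional (ZMod p) M] (hp : 5 ≤ p)
    (h : HasNonscalarEndomorphism p M) :
    2 * Module.finrank (ZMod p) (Module.jacobson (GroupAlg p) M) = Module.finrank (ZMod p) M ∧
      1 ≤ Module.finrank (ZMod p) (Module.jacobson (GroupAlg p) M) ∨
    Module.finrank (ZMod p) M = p ∧
      Module.finrank (ZMod p) (Module.jacobson (GroupAlg p) M) = p - 1 := by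
  rcases h with ⟨i, hi, h⟩ | h
  · obtain ⟨h1, h2⟩ := h.finrank_jacobson
      (forall_mem_pair (p := p) (by omega) (by omega) (by omega) (by omega))
    simp at h1 h2
    omega
  · obtain ⟨h1, h2⟩ := h.finrank_jacobson (forall_mem_triple hp)
    simp at h1 h2
    omega

lemma exists_endomorphism_of_equiv_vmod [FiniteDimensional (ZMod p) M] (hp : 5 ≤ p) {i : ℕ}
    (hi : 1 ≤ i) (hi' : i ≤ p) (e : M ≃ₗ[GroupAlg p] VMod p i) :
    ∃ ν₀ : M →ₗ[GroupAlg p] M, (∀ m, ν₀ (ν₀ m) = 0) ∧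
      (∀ φ : M →ₗ[GroupAlg p] M, ∃ c e : ZMod p, ∀ m, φ m = c • m + e • ν₀ m) ∧
      ((∃ m, ν₀ m ≠ 0) ↔ HasNonscalarEndomorphism p M) := by
  have h : HasRadicalLayers p [i] M := HasRadicalLayers.of_isSimpleModule (by omega) e
  have hs := isSimpleModule_of_equiv_vmod (by omega) e
  have hfr : Module.finrank (ZMod p) (⊤ : Submodule (GroupAlg p) M) = Module.finrank (ZMod p) M :=
    finrank_top (ZMod p) M
  obtain ⟨h1, h2⟩ := h.finrank_jacobson (by simp; omega)
  simp at h1 h2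
  obtain ⟨ν₀, a1, a2, a3⟩ := exists_endomorphism_generator (S := ⊤) (by omega) (by omega) h
    (Submodule.topEquiv.trans e)
    (fun N hN => ((eq_bot_or_eq_top N).resolve_left hN).ge)
    (fun ν hν => ⟨le_top.trans hν, le_top⟩)
  refine ⟨ν₀, a1, a2, a3.trans ⟨fun ⟨h3, _⟩ => ?_, fun h3 => ?_⟩⟩
  · have := finrank_mono_submodule h3
    omega
  · have := h3.finrank hp
    omega

/-- An endomorphism killing the socle maps top to socle, so a nonzero one exists exactly when the
two layers are isomorphic, that is $i=j$. -/
lemma exists_endomorphism_of_pair [FiniteDimensional (ZMod p) M] (hp : 5 ≤ p) {i j : ℕ}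
    (hi : 1 ≤ i) (hi' : i ≤ p) (hj : 1 ≤ j) (hj' : j ≤ p) (hij : i + j = p - 1 ∨ i + j = p + 1)
    (h : HasRadicalLayers p [j, i] M) :
    ∃ ν₀ : M →ₗ[GroupAlg p] M, (∀ m, ν₀ (ν₀ m) = 0) ∧
      (∀ φ : M →ₗ[GroupAlg p] M, ∃ c e : ZMod p, ∀ m, φ m = c • m + e • ν₀ m) ∧
      ((∃ m, ν₀ m ≠ 0) ↔ HasNonscalarEndomorphism p M) := by
  obtain ⟨h1, h2⟩ := h.finrank_jacobson (forall_mem_pair hi hi' hj hj')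
  simp at h1 h2
  obtain ⟨e⟩ := h.tail.nonempty_equiv_vmod
  obtain ⟨f⟩ := h.nonempty_equiv_top
  have hess := h.jacobson_le hi hi' (by omega)
  obtain ⟨ν₀, a1, a2, a3⟩ := exists_endomorphism_generator (by omega) (by omega) h e hess
    (fun ν hν => ⟨hν, by
      by_contra hc
      have h3 := eq_bot_of_range_eq_top (h.eq_top (by omega) hc)
      rw [h3] at hν
      have := finrank_mono_submodule hν
      rw [coe_finrank_bot] at this
      omega⟩)
  refine ⟨ν₀, a1, a2, a3.trans ⟨fun ⟨_, ⟨g⟩⟩ => ?_, fun h3 => ⟨le_rfl, ?_⟩⟩⟩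
  · have h4 := finrank_eq_of_equiv_vmod hj hj' f
    rw [(g.restrictScalars (ZMod p)).finrank_eq, h2] at h4
    subst h4
    exact Or.inl ⟨i, by omega, h⟩
  · have h5 : i = j := by
      have := h3.finrank hp
      omega
    subst h5
    exact ⟨f.trans e.symm⟩

lemma exists_endomorphism_of_triple [FiniteDimensional (ZMod p) M] (hp : 5 ≤ p)
    (h : HasRadicalLayers p [1, p - 2, 1] M) :
    ∃ ν₀ : M →ₗ[GroupAlg p] M, (∀ m, ν₀ (ν₀ m) = 0) ∧
      (∀ φ : M →ₗ[GroupAlg p] M, ∃ c e : ZMod p, ∀ m, φ m = c • m + e • ν₀ m) ∧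
      ((∃ m, ν₀ m ≠ 0) ↔ HasNonscalarEndomorphism p M) := by
  obtain ⟨h1, h2⟩ := h.finrank_jacobson (forall_mem_triple hp)
  simp at h1 h2
  obtain ⟨h3, h4⟩ := h.tail.finrank_jacobson (forall_mem_pair (by omega) (by omega) (by omega) (by omega))
  simp at h3 h4
  set J := Module.jacobson (GroupAlg p) M with hJ
  let S₀ := Module.jacobson (GroupAlg p) J
  let S : Submodule (GroupAlg p) M := S₀.map J.subtype
  obtain ⟨e⟩ := h.tail.tail.nonempty_equiv_vmod
  let eS : S ≃ₗ[GroupAlg p] VMod p 1 :=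
    (S₀.equivMapOfInjective J.subtype J.injective_subtype).symm.trans e
  have hfS : Module.finrank (ZMod p) S = 1 := finrank_eq_of_equiv_vmod le_rfl (by omega) eS
  have hSJ : S ≤ J := Submodule.map_subtype_le J S₀
  -- submodules of `J`
  have hsub : ∀ N : Submodule (GroupAlg p) M, N ≤ J → N ≤ S ∨ N = J := by
    intro N hN
    by_cases hc : N.submoduleOf J ≤ S₀
    · left
      intro x hx
      exact ⟨⟨x, hN hx⟩, hc hx, rfl⟩
    · right
      have h5 := h.tail.eq_top (by omega) hc
      refine le_antisymm hN fun x hx => ?_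
      have : (⟨x, hx⟩ : J) ∈ N.submoduleOf J := h5 ▸ trivial
      exact this
  have hess : ∀ N : Submodule (GroupAlg p) M, N ≠ ⊥ → S ≤ N := by
    intro N hN
    by_cases hle : N ≤ J
    · have h5 : N.submoduleOf J ≠ ⊥ := by
        intro h0
        apply hN
        rw [eq_bot_iff]
        intro x hx
        have : (⟨x, hle hx⟩ : J) ∈ N.submoduleOf J := hx
        rw [h0, Submodule.mem_bot] at this
        exact congrArg Subtype.val this
      have h6 := h.tail.jacobson_le le_rfl (by omega) (by omega) _ h5
      rintro _ ⟨x, hx, rfl⟩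
      exact h6 hx
    · rw [h.eq_top (by omega) hle]; exact le_top
  obtain ⟨f⟩ := h.nonempty_equiv_top
  obtain ⟨ν₀, a1, a2, a3⟩ := exists_endomorphism_generator (S := S) (by omega) (by omega) h eS hess
    -- If $\nu$ did not kill the radical $J$, its kernel there would be the socle, and $\nu(J)\le J$
    -- would have dimension $p-2$. Submodules of $J$ have dimension at most one or exactly $p-1$.
    (fun ν hν => by
      have hnt : LinearMap.range ν ≠ ⊤ := fun hc => by
        rw [eq_bot_of_range_eq_top hc] at hν
        have := finrank_mono_submodule hν
        rw [coe_finrank_bot] at this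
        omega
      have hrJ : LinearMap.range ν ≤ J := by
        by_contra hc
        exact hnt (h.eq_top (by omega) hc)
      have hνJ : J.map ν ≤ J := (LinearMap.map_le_range).trans hrJ
      have h5 := finrank_map_add_finrank_inf_ker J ν
      have hJk : J ≤ LinearMap.ker ν := by
        rcases hsub (J ⊓ LinearMap.ker ν) inf_le_left with h6 | h6
        · exfalso
          have h7 := finrank_mono_submodule h6
          have h8 := finrank_mono_submodule (le_inf hSJ hν)
          rcases hsub _ hνJ with h9 | h9
          · have := finrank_mono_submodule h9
            omega
          · rw [h9] at h5
            omega
        · exact inf_eq_left.1 h6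
      refine ⟨hJk, ?_⟩
      by_cases h0 : LinearMap.range ν = ⊥
      · rw [h0]; exact bot_le
      · have h6 := hess _ h0
        refine (eq_of_le_of_finrank_submodule h6 ?_).ge
        have h7 := finrank_map_add_finrank_inf_ker ⊤ ν
        have h8 := finrank_mono_submodule hJk
        rw [Submodule.map_top, top_inf_eq] at h7
        have h9 : Module.finrank (ZMod p) (⊤ : Submodule (GroupAlg p) M) =
          Module.finrank (ZMod p) M := finrank_top (ZMod p) M
        omega)
  exact ⟨ν₀, a1, a2, a3.trans ⟨fun _ => Or.inr h, fun _ => ⟨hSJ, ⟨f.trans eS.symm⟩⟩⟩⟩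

end Modules

/-- The endomorphisms of an indecomposable minimally active module. -/
theorem IsMinActIndec.exists_endomorphism {V : Type u} [AddCommGroup V] [Module (ZMod p) V]
    [FiniteDimensional (ZMod p) V] {ρ : Representation (ZMod p) SL(2, ZMod p) V} (hp : 5 ≤ p)
    (h : IsMinActIndec p ρ) :
    ∃ ν₀ : RepMod ρ →ₗ[GroupAlg p] RepMod ρ, (∀ m, ν₀ (ν₀ m) = 0) ∧
      (∀ φ : RepMod ρ →ₗ[GroupAlg p] RepMod ρ, ∃ c e : ZMod p, ∀ m, φ m = c • m + e • ν₀ m) ∧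
      ((∃ m, ν₀ m ≠ 0) ↔ HasNonscalarEndomorphism p (RepMod ρ)) := by
  rcases h.classification hp with ⟨i, hi, hi', ⟨e⟩⟩ | ⟨i, j, hi, hj, hij, hl⟩ | hl |
    ⟨i, j, hi, hj, hij, hl⟩
  · exact exists_endomorphism_of_equiv_vmod hp (by omega) hi' e
  · exact exists_endomorphism_of_pair hp hi (by omega) hj (by omega) (Or.inl hij) hl
  · exact exists_endomorphism_of_triple hp hl
  · exact exists_endomorphism_of_pair hp (by omega) (by omega) (by omega) (by omega) (Or.inr hij) hl

/-! ### Twisting by diagonal automorphisms -/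

section Modules

variable {M : Type u} [AddCommGroup M] [Module (ZMod p) M] [Module (GroupAlg p) M]
  [IsScalarTower (ZMod p) (GroupAlg p) M]

variable (M) in
/-- The module is isomorphic to its twist by `diag(t, 1)`. -/
def IsTwistInvariant (t : (ZMod p)ˣ) : Prop :=
  ∃ T : M ≃ₗ[ZMod p] M, ∀ g m, T (gr g • m) = gr (conjDiag t g) • T m

lemma IsTwistInvariant.congr {N : Type v} [AddCommGroup N] [Module (ZMod p) N]
    [Module (GroupAlg p) N] [IsScalarTower (ZMod p) (GroupAlg p) N] {t : (ZMod p)ˣ}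
    (h : IsTwistInvariant M t) (e : M ≃ₗ[GroupAlg p] N) : IsTwistInvariant N t := by
  obtain ⟨T, hT⟩ := h
  let e' := e.restrictScalars (ZMod p)
  refine ⟨e'.symm ≪≫ₗ T ≪≫ₗ e', fun g m => ?_⟩
  change e (T (e.symm (gr g • m))) = gr (conjDiag t g) • e (T (e.symm m))
  rw [map_smul, hT, map_smul]

/-- Right translation by a matrix, on homogeneous functions. -/
def glTwistMap (a : ℕ) (h : GL (Fin 2) (ZMod p)) : homFun p a →ₗ[ZMod p] homFun p a where
  toFun f := ⟨mkFun (fun x => ev (Matrix.vecMul x h.1) (f : FunMod p)), mem_homFun.2 fun c x => by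
    rw [ev_mkFun, ev_mkFun, Matrix.smul_vecMul, mem_homFun.1 f.2]⟩
  map_add' f g := Subtype.ext (fun_ext fun x => map_add (ev (Matrix.vecMul x h.1)) (f : FunMod p) g)
  map_smul' c f := Subtype.ext (fun_ext fun x => map_smul (ev (Matrix.vecMul x h.1)) c (f : FunMod p))

lemma ev_glTwistMap {a : ℕ} (h : GL (Fin 2) (ZMod p)) (f : homFun p a) (x : Fin 2 → ZMod p) :
    ev x (glTwistMap a h f : FunMod p) = ev (Matrix.vecMul x h.1) (f : FunMod p) := rfl

lemma glTwistMap_inv_cancel {a : ℕ} (h : GL (Fin 2) (ZMod p)) (f : homFun p a) :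
    glTwistMap a h (glTwistMap a h⁻¹ f) = f := by
  refine Subtype.ext (fun_ext fun x => ?_)
  rw [ev_glTwistMap, ev_glTwistMap, Matrix.vecMul_vecMul, ← Units.val_mul, mul_inv_cancel,
    Units.val_one, Matrix.vecMul_one]

/-- Right translation by a matrix, as an equivalence. -/
def glTwist (a : ℕ) (h : GL (Fin 2) (ZMod p)) : homFun p a ≃ₗ[ZMod p] homFun p a :=
  LinearEquiv.ofLinearMap (glTwistMap a h) (glTwistMap a h⁻¹)
    (LinearMap.ext (glTwistMap_inv_cancel h))
    (LinearMap.ext fun f => by simpa using glTwistMap_inv_cancel h⁻¹ f)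

lemma ev_glTwist {a : ℕ} (h : GL (Fin 2) (ZMod p)) (f : homFun p a) (x : Fin 2 → ZMod p) :
    ev x (glTwist a h f : FunMod p) = ev (Matrix.vecMul x h.1) (f : FunMod p) := rfl

lemma glTwist_gr_smul {a : ℕ} {h : GL (Fin 2) (ZMod p)} {g g' : SL(2, ZMod p)}
    (hg : toGL g' = h * toGL g * h⁻¹) (f : homFun p a) :
    glTwist a h (gr g • f) = gr g' • glTwist a h f := by
  refine Subtype.ext (fun_ext fun x => ?_)
  rw [ev_glTwist, Submodule.coe_smul, Submodule.coe_smul, ev_gr_smul, ev_gr_smul, ev_glTwist,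
    Matrix.vecMul_vecMul, Matrix.vecMul_vecMul]
  rw [eq_mul_inv_iff_mul_eq] at hg
  exact congrArg (fun y => ev (Matrix.vecMul x y) (f : FunMod p)) (congrArg Units.val hg).symm

/-- Right translation by all of $\mathrm{GL}_2(p)$ preserves homogeneous functions, so the extension
is already at hand. -/
lemma isTwistInvariant_homFun (a : ℕ) (t : (ZMod p)ˣ) : IsTwistInvariant (homFun p a) t :=
  ⟨glTwist a (diagGL p t), fun g f => glTwist_gr_smul (toGL_conjDiag t g) f⟩

end Modules

lemma eq_zero_of_invariant_symMod {n : ℕ} (hn : 1 ≤ n) (hn' : n < p) {e : SymMod p n}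
    (he : ∀ g : SL(2, ZMod p), gr g • e = e) : e = 0 := by
  by_contra h0
  have := isSimpleModule_symMod hn'
  have h1 : invariantLine (p := p) (M := SymMod p n) he = ⊤ := by
    refine (eq_bot_or_eq_top _).resolve_left fun h => h0 ?_
    have : e ∈ invariantLine (p := p) (M := SymMod p n) he :=
      (mem_invariantLine (p := p) (M := SymMod p n) he).2 ⟨1, one_smul _ _⟩
    rwa [h] at this
  have h2 := finrank_invariantLine_le (p := p) (M := SymMod p n) he
  have h3 : Module.finrank (ZMod p) (⊤ : Submodule (GroupAlg p) (SymMod p n)) =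
    Module.finrank (ZMod p) (SymMod p n) := finrank_top (ZMod p) _
  rw [h1, h3, finrank_symMod hn'] at h2
  omega

section Representations

variable {V : Type u} [AddCommGroup V] [Module (ZMod p) V] [FiniteDimensional (ZMod p) V]
  {ρ : Representation (ZMod p) SL(2, ZMod p) V}

/-- The twist of a representation. -/
def twistRep (ρ : Representation (ZMod p) SL(2, ZMod p) V) (t : (ZMod p)ˣ) :
    Representation (ZMod p) SL(2, ZMod p) V := ρ.comp (conjDiag t)

instance (t : (ZMod p)ˣ) : FiniteDimensional (ZMod p) (RepMod (twistRep ρ t)) :=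
  inferInstanceAs (FiniteDimensional (ZMod p) V)

variable (ρ) in
/-- The identity, as a map to the twist. -/
def toTwist (t : (ZMod p)ˣ) : RepMod ρ ≃ₗ[ZMod p] RepMod (twistRep ρ t) :=
  (RepMod.equiv ρ).trans (RepMod.equiv (twistRep ρ t)).symm

lemma gr_smul_toTwist (t : (ZMod p)ˣ) (g : SL(2, ZMod p)) (m : RepMod ρ) :
    gr g • toTwist ρ t m = toTwist ρ t (gr (conjDiag t g) • m) := by
  rw [toTwist, LinearEquiv.trans_apply, LinearEquiv.trans_apply, RepMod.gr_smul_symm,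
    RepMod.equiv_gr_smul]
  rfl

lemma isTwistInvariant_of_equiv {t : (ZMod p)ˣ}
    (e : RepMod ρ ≃ₗ[GroupAlg p] RepMod (twistRep ρ t)) : IsTwistInvariant (RepMod ρ) t := by
  refine ⟨(e.restrictScalars (ZMod p)).trans (toTwist ρ t).symm, fun g m => ?_⟩
  change (toTwist ρ t).symm (e (gr g • m)) = gr (conjDiag t g) • (toTwist ρ t).symm (e m)
  apply (toTwist ρ t).injective
  rw [← gr_smul_toTwist, LinearEquiv.apply_symm_apply, LinearEquiv.apply_symm_apply, map_smul]

lemma toTwist_mem_fixU {t : (ZMod p)ˣ} {m : RepMod ρ} :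
    toTwist ρ t m ∈ fixU p (RepMod (twistRep ρ t)) ↔ m ∈ fixU p (RepMod ρ) := by
  rw [mem_fixU_iff, mem_fixU_iff]
  simp only [gr_smul_toTwist, conjDiag_upper, EmbeddingLike.apply_eq_iff_eq]
  refine ⟨fun h c => ?_, fun h c => h _⟩
  have := h ((t⁻¹ : (ZMod p)ˣ) * c)
  rwa [Units.mul_inv_cancel_left] at this

lemma finrank_fixU_twist (t : (ZMod p)ˣ) : Module.finrank (ZMod p) (fixU p (RepMod (twistRep ρ t))) ≤
    Module.finrank (ZMod p) (fixU p (RepMod ρ)) := by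
  have hle : fixU p (RepMod (twistRep ρ t)) ≤ (fixU p (RepMod ρ)).map (toTwist ρ t).toLinearMap := by
    intro x hx
    obtain ⟨m, rfl⟩ := (toTwist ρ t).surjective x
    exact ⟨m, toTwist_mem_fixU.1 hx, rfl⟩
  exact (Submodule.finrank_mono hle).trans (Submodule.finrank_map_le _ _)

lemma isWt_toTwist {t : (ZMod p)ˣ} {m : RepMod ρ} {b : ℤ} (h : IsWt p b m) :
    IsWt p b (toTwist ρ t m) := fun s => by
  rw [gr_smul_toTwist, conjDiag_torus, h s, map_smul]

lemma exists_toTwist_invariant {t : (ZMod p)ˣ} :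
    (∃ e : RepMod ρ, e ≠ 0 ∧ ∀ g : SL(2, ZMod p), gr g • e = e) ↔
      ∃ e : RepMod (twistRep ρ t), e ≠ 0 ∧ ∀ g : SL(2, ZMod p), gr g • e = e := by
  constructor
  · rintro ⟨e, h0, he⟩
    exact ⟨toTwist ρ t e, (toTwist ρ t).map_ne_zero_iff.2 h0, fun g => by rw [gr_smul_toTwist, he]⟩
  · rintro ⟨e, h0, he⟩
    obtain ⟨e, rfl⟩ := (toTwist ρ t).surjective e
    refine ⟨e, (toTwist ρ t).map_ne_zero_iff.1 h0, fun g => ?_⟩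
    have h1 := he (conjDiag t⁻¹ g)
    rw [gr_smul_toTwist, conjDiag_conjDiag, mul_inv_cancel, conjDiag_one] at h1
    exact (toTwist ρ t).injective h1

lemma finrank_twist (t : (ZMod p)ˣ) :
    Module.finrank (ZMod p) (RepMod (twistRep ρ t)) = Module.finrank (ZMod p) (RepMod ρ) :=
  (toTwist ρ t).finrank_eq.symm

/-- Conjugation by $\mathrm{diag}(t,1)$ normalizes $U$ and centralizes the torus. The twist has the
same dimension, fixed line and weight, which determine a Jordan block of size below $p$. -/
lemma isTwistInvariant_of_finrank_lt [Nontrivial (RepMod ρ)] (t : (ZMod p)ˣ)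
    (hU : Module.finrank (ZMod p) (fixU p (RepMod ρ)) ≤ 1)
    (hlt : Module.finrank (ZMod p) (RepMod ρ) < p) : IsTwistInvariant (RepMod ρ) t := by
  obtain ⟨b, s, -, hs0, hs, hw⟩ := exists_fixU_isWt (p := p) (M := RepMod ρ)
  obtain ⟨e⟩ := nonempty_equiv_of_fixU hU ((finrank_fixU_twist t).trans hU) (finrank_twist t).symm hlt
    hs hs0 hw (toTwist_mem_fixU.2 hs) ((toTwist ρ t).map_ne_zero_iff.2 hs0) (isWt_toTwist hw)
  exact isTwistInvariant_of_equiv e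

/-- The uniserial modules of dimension `p`. -/
lemma cases_of_finrank_eq [Nontrivial (RepMod ρ)] (hp : 5 ≤ p)
    (hU : Module.finrank (ZMod p) (fixU p (RepMod ρ)) ≤ 1)
    (hfr : Module.finrank (ZMod p) (RepMod ρ) = p) :
    (Nonempty (RepMod ρ ≃ₗ[GroupAlg p] SymMod p (p - 1)) ∧
      ¬ ∃ e : RepMod ρ, e ≠ 0 ∧ ∀ g : SL(2, ZMod p), gr g • e = e) ∨
    (HasRadicalLayers p [1, p - 2, 1] (RepMod ρ) ∧
      ∃ e : RepMod ρ, e ≠ 0 ∧ ∀ g : SL(2, ZMod p), gr g • e = e) := by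
  obtain ⟨b, s, -, hs0, hs, hw⟩ := exists_fixU_isWt (p := p) (M := RepMod ρ)
  rcases classification_of_fixU hp hU hs hs0 hw with ⟨n, hn, ⟨f⟩, -⟩ | ⟨i, hi1, hi, -, h2, -⟩ | ⟨hl, -⟩
  · have hn1 : n = p - 1 := by
      have := (f.restrictScalars (ZMod p)).finrank_eq
      rw [hfr, finrank_symMod hn] at this
      omega
    subst hn1
    refine Or.inl ⟨⟨f⟩, fun ⟨e, h0, he⟩ => h0 (f.map_eq_zero_iff.1 ?_)⟩
    exact eq_zero_of_invariant_symMod (by omega) hn fun g => by rw [← map_smul, he]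
  · omega
  · refine Or.inr ⟨hl, ?_⟩
    obtain ⟨h3, h4⟩ := hl.tail.tail.finrank_eq (by simp; omega)
    have : Nontrivial (Module.jacobson (GroupAlg p) (Module.jacobson (GroupAlg p) (RepMod ρ))) := by
      apply Module.nontrivial_of_finrank_pos (R := ZMod p)
      rw [h4]; simp
    obtain ⟨x, hx⟩ := exists_ne (0 : Module.jacobson (GroupAlg p) (Module.jacobson (GroupAlg p) (RepMod ρ)))
    refine ⟨x.1.1, fun h => hx (Subtype.ext (Subtype.ext h)), fun g => ?_⟩
    have h5 := gr_smul_of_finrank_le_one (by rw [h4]; simp) g x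
    exact congrArg (fun y => y.1.1) h5

/-- Twisting preserves the data separating the modules; in dimension $p$, the existence of an
invariant vector distinguishes $V_p$ from $V_1/V_{p-2}/V_1$. -/
theorem IsMinActIndec.isTwistInvariant (hp : 5 ≤ p) (h : IsMinActIndec p ρ) (t : (ZMod p)ˣ) :
    IsTwistInvariant (RepMod ρ) t := by
  have : Nontrivial (RepMod ρ) := h.indecomposable.1
  have hU1 : Module.finrank (ZMod p) (fixU p (RepMod ρ)) ≤ 1 →
      Module.finrank (ZMod p) (RepMod ρ) ≤ p → IsTwistInvariant (RepMod ρ) t := by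
    intro hU hle
    rcases hle.lt_or_eq with hlt | hfr
    · exact isTwistInvariant_of_finrank_lt t hU hlt
    · have : Nontrivial (RepMod (twistRep ρ t)) := (toTwist ρ t).injective.nontrivial
      rcases cases_of_finrank_eq hp hU hfr with ⟨⟨e⟩, h1⟩ | ⟨h1, h2⟩
      · rcases cases_of_finrank_eq hp ((finrank_fixU_twist t).trans hU)
          ((finrank_twist t).trans hfr) with ⟨⟨f⟩, -⟩ | ⟨-, h2⟩
        · exact isTwistInvariant_of_equiv (e.trans f.symm)
        · exact absurd (exists_toTwist_invariant.2 h2) h1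
      · rcases cases_of_finrank_eq hp ((finrank_fixU_twist t).trans hU)
          ((finrank_twist t).trans hfr) with ⟨-, h3⟩ | ⟨h3, -⟩
        · exact absurd (exists_toTwist_invariant.1 h2) h3
        · obtain ⟨P, hP, hl, -⟩ := exists_projectiveCover hp
          obtain ⟨e⟩ := hl.nonempty_equiv_of_projective hp h1
          obtain ⟨f⟩ := hl.nonempty_equiv_of_projective hp h3
          exact isTwistInvariant_of_equiv (e.trans f.symm)
  rcases h.classification hp with ⟨i, hi, hi', ⟨e⟩⟩ | ⟨i, j, hi, hj, hij, hl⟩ | hl |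
    ⟨i, j, hi, hj, hij, hl⟩
  · have e' := e.trans (vmodEquiv p i)
    have hfr := finrank_eq_of_equiv_vmod (by omega) hi' e
    refine hU1 ?_ (by omega)
    have hle : fixU p (RepMod ρ) ≤ (fixU p (SymMod p (i - 1))).map
        (e'.symm.restrictScalars (ZMod p)).toLinearMap := fun x hx =>
      ⟨e' x, map_mem_fixU e'.toLinearMap hx, e'.symm_apply_apply x⟩
    exact (Submodule.finrank_mono hle).trans
      ((Submodule.finrank_map_le _ _).trans (finrank_fixU_symMod_le (by omega)))
  · have := (hl.finrank_jacobson (forall_mem_pair (by omega) (by omega) (by omega) (by omega))).1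
    simp at this
    exact hU1 (hl.finrank_fixU_le hi hj hij) (by omega)
  · obtain ⟨P, hP, hl', hU⟩ := exists_projectiveCover hp
    obtain ⟨e⟩ := hl'.nonempty_equiv_of_projective hp hl
    have := (hl.finrank_jacobson (forall_mem_triple hp)).1
    simp at this
    refine hU1 ?_ (by omega)
    have hle : fixU p (RepMod ρ) ≤ (fixU p P).map
        (e.symm.restrictScalars (ZMod p)).toLinearMap := fun x hx =>
      ⟨e x, map_mem_fixU e.toLinearMap hx, e.symm_apply_apply x⟩
    exact (Submodule.finrank_mono hle).trans ((Submodule.finrank_map_le _ _).trans hU)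
  · obtain ⟨e⟩ := hl.nonempty_equiv_homFun hi hj hij
    exact (isTwistInvariant_homFun _ t).congr e

end Representations

/-! ### The normalizer of the image of an indecomposable minimally active representation -/

lemma units_pow_eq_self (t : (ZMod p)ˣ) : t ^ p = t := by
  have h := ZMod.units_pow_card_sub_one_eq_one p t
  rw [← pow_sub_one_mul (Fact.out : p.Prime).ne_zero, h, one_mul]

section Group

variable {Γ : Type u} [Group Γ] {R : SL(2, ZMod p) →* Γ}

lemma pow_mul_of_conjDiag {γ : Γ} {t : (ZMod p)ˣ} (h : ∀ g, γ * R g = R (conjDiag t g) * γ) (n : ℕ) :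
    ∀ g, γ ^ n * R g = R (conjDiag (t ^ n) g) * γ ^ n := by
  induction n with
  | zero => intro g; simp [conjDiag_one]
  | succ n ih =>
    intro g
    rw [pow_succ, mul_assoc, h, ← mul_assoc, ih, conjDiag_conjDiag, mul_assoc, pow_succ]

/-- The group of units is cyclic, so a twist for a generator, of order dividing $p-1$, yields a
homomorphic choice of all twists. -/
lemma exists_hom_of_conjDiag {γ : Γ} {ζ : (ZMod p)ˣ} (hζ : ∀ x, x ∈ Subgroup.zpowers ζ)
    (hγ : γ ^ (p - 1) = 1) (h : ∀ g, γ * R g = R (conjDiag ζ g) * γ) :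
    ∃ D : (ZMod p)ˣ →* Γ, ∀ t g, D t * R g = R (conjDiag t g) * D t := by
  have ho : orderOf γ ∣ orderOf ζ := by
    rw [orderOf_eq_card_of_forall_mem_zpowers hζ, Nat.card_eq_fintype_card, ZMod.card_units]
    exact orderOf_dvd_of_pow_eq_one hγ
  refine ⟨monoidHomOfForallMemZpowers hζ ho, fun t => ?_⟩
  obtain ⟨n, rfl⟩ := (mem_powers_iff_mem_zpowers.2 (hζ t) : t ∈ Submonoid.powers ζ)
  simp only [map_pow, monoidHomOfForallMemZpowers_apply_gen]
  exact pow_mul_of_conjDiag h n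

end Group

section Modules

variable {M : Type u} [AddCommGroup M] [Module (ZMod p) M] [Module (GroupAlg p) M]
  [IsScalarTower (ZMod p) (GroupAlg p) M]

lemma exists_mem_fixU_inf_range (h : ∃ m : M, (nil : GroupAlg p) • m ≠ 0) :
    ∃ s : M, s ≠ 0 ∧ s ∈ (fixU p M ⊓ LinearMap.range (act M (nil : GroupAlg p)) :
      Submodule (ZMod p) M) := by
  classical
  obtain ⟨m, hm⟩ := h
  have h0 : ∃ n, (nil : GroupAlg p) ^ (n + 1) • m = 0 :=
    ⟨p - 1, by rw [Nat.sub_add_cancel (Fact.out : p.Prime).one_le, nil_pow_p, zero_smul]⟩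
  have h1 := Nat.find_spec h0
  have h2 : Nat.find h0 ≠ 0 := fun h => by
    rw [h] at h1; exact hm (by simpa using h1)
  obtain ⟨n, hn⟩ := Nat.exists_eq_succ_of_ne_zero h2
  have h3 := Nat.find_min h0 (m := n) (by omega)
  refine ⟨_, h3, mem_fixU.2 ?_, (nil : GroupAlg p) ^ n • m, ?_⟩
  · rw [← mul_smul, ← pow_succ', ← Nat.succ_eq_add_one n, ← hn, h1]
  · change (nil : GroupAlg p) • (nil : GroupAlg p) ^ n • m = _
    rw [← mul_smul, ← pow_succ']

lemma twist_mem {t : (ZMod p)ˣ} {T : M →ₗ[ZMod p] M}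
    (hT : ∀ g m, T (gr g • m) = gr (conjDiag t g) • T m) {s : M}
    (hs : s ∈ (fixU p M ⊓ LinearMap.range (act M (nil : GroupAlg p)) : Submodule (ZMod p) M)) :
    T s ∈ (fixU p M ⊓ LinearMap.range (act M (nil : GroupAlg p)) : Submodule (ZMod p) M) := by
  obtain ⟨h1, m, rfl⟩ := hs
  refine ⟨mem_fixU_iff.2 fun c => ?_, ?_⟩
  · have h2 := mem_fixU_iff.1 h1 ((t⁻¹ : (ZMod p)ˣ) * c)
    conv_rhs => rw [← h2]
    rw [hT, conjDiag_upper, Units.mul_inv_cancel_left]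
  · refine range_act_upper_sub_one_le (t : ZMod p) ⟨T m, ?_⟩
    change (gr (upper (t : ZMod p)) - 1) • T m = T ((nil : GroupAlg p) • m)
    rw [nil_smul_eq, map_sub, hT, conjDiag_upper, mul_one, sub_smul, one_smul]

/-- A twist preserves the line of fixed commutators, so it can be rescaled to fix that line
pointwise; this normalization later forces a power of it to be unipotent. -/
lemma exists_twist_fixing (h1 : SingleBlock p M) [FiniteDimensional (ZMod p) M] {t : (ZMod p)ˣ}
    (hT : IsTwistInvariant M t) {s : M} (hs0 : s ≠ 0)
    (hs : s ∈ (fixU p M ⊓ LinearMap.range (act M (nil : GroupAlg p)) : Submodule (ZMod p) M)) :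
    ∃ T : M ≃ₗ[ZMod p] M, (∀ g m, T (gr g • m) = gr (conjDiag t g) • T m) ∧ T s = s := by
  obtain ⟨T, hT⟩ := hT
  obtain ⟨c, hc⟩ := (finrank_le_one_iff.1 h1)
  obtain ⟨a, ha⟩ := hc ⟨s, hs⟩
  obtain ⟨b, hb⟩ := hc ⟨T s, twist_mem (T := T.toLinearMap) hT hs⟩
  have ha' : a • (c : M) = s := congrArg Subtype.val ha
  have hb' : b • (c : M) = T s := congrArg Subtype.val hb
  have ha0 : a ≠ 0 := by rintro rfl; exact hs0 (by rw [← ha', zero_smul])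
  have hb0 : b ≠ 0 := by
    rintro rfl
    exact hs0 (T.map_eq_zero_iff.1 (by rw [← hb', zero_smul]))
  refine ⟨T.trans (LinearEquiv.smulOfNeZero (ZMod p) M (a * b⁻¹) (mul_ne_zero ha0 (inv_ne_zero hb0))),
    fun g m => ?_, ?_⟩
  · change (a * b⁻¹) • T (gr g • m) = gr (conjDiag t g) • ((a * b⁻¹) • T m)
    rw [hT, smul_comm]
  · change (a * b⁻¹) • T s = s
    rw [← hb', ← mul_smul, mul_assoc, inv_mul_cancel₀ hb0, mul_one, ha']

lemma eigenvalue_of_mem (h1 : SingleBlock p M) [FiniteDimensional (ZMod p) M]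
    (φ : M →ₗ[GroupAlg p] M) {s : M} (hs0 : s ≠ 0)
    (hs : s ∈ (fixU p M ⊓ LinearMap.range (act M (nil : GroupAlg p)) : Submodule (ZMod p) M)) :
    ∃ c : ZMod p, φ s = c • s := by
  have h2 : φ s ∈ (fixU p M ⊓ LinearMap.range (act M (nil : GroupAlg p)) : Submodule (ZMod p) M) := by
    obtain ⟨h3, m, rfl⟩ := hs
    exact ⟨map_mem_fixU φ h3, φ m, (map_smul φ (nil : GroupAlg p) m).symm⟩
  obtain ⟨c, hc⟩ := (finrank_le_one_iff.1 h1)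
  obtain ⟨a, ha⟩ := hc ⟨s, hs⟩
  obtain ⟨b, hb⟩ := hc ⟨φ s, h2⟩
  have ha' : a • (c : M) = s := congrArg Subtype.val ha
  have hb' : b • (c : M) = φ s := congrArg Subtype.val hb
  have ha0 : a ≠ 0 := by rintro rfl; exact hs0 (by rw [← ha', zero_smul])
  exact ⟨b * a⁻¹, by rw [← hb', ← ha', ← mul_smul, mul_assoc, inv_mul_cancel₀ ha0, mul_one]⟩

end Modules

section Unipotent

variable {V : Type u} [AddCommGroup V] [Module (ZMod p) V] {ν : Module.End (ZMod p) V}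

/-- The transvections `1 + e ν`. -/
def unipotentHom (ν : Module.End (ZMod p) V) (hν : ν * ν = 0) :
    Multiplicative (ZMod p) →* LinearMap.GeneralLinearGroup (ZMod p) V :=
  MonoidHom.toHomUnits
    { toFun := fun e => 1 + e.toAdd • ν
      map_one' := by simp
      map_mul' := fun e f => by
        rw [toAdd_mul, add_mul, mul_add, mul_add, one_mul, one_mul, mul_one, smul_mul_smul_comm, hν,
          smul_zero, add_zero, add_smul, add_assoc, add_comm (f.toAdd • ν)] }

lemma unipotentHom_apply (hν : ν * ν = 0) (e : Multiplicative (ZMod p)) :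
    ((unipotentHom ν hν e : LinearMap.GeneralLinearGroup (ZMod p) V) : V →ₗ[ZMod p] V) =
      (1 + e.toAdd • ν : Module.End (ZMod p) V) := rfl

lemma unipotentHom_pow (hν : ν * ν = 0) (e : Multiplicative (ZMod p)) : unipotentHom ν hν e ^ p = 1 := by
  rw [← map_pow]
  have : e ^ p = 1 := by
    apply Multiplicative.toAdd.injective
    rw [toAdd_pow, toAdd_one, nsmul_eq_mul, CharP.cast_eq_zero, zero_mul]
  rw [this, map_one]

lemma card_range_unipotentHom (hν : ν * ν = 0) (h : ν ≠ 0) :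
    Nat.card (unipotentHom ν hν).range = p := by
  have hinj : Function.Injective (unipotentHom ν hν) := by
    rw [injective_iff_map_eq_one]
    intro e he
    have h1 : (1 + e.toAdd • ν : Module.End (ZMod p) V) = 1 := congrArg Units.val he
    rw [add_eq_left, smul_eq_zero] at h1
    exact Multiplicative.toAdd.injective (h1.resolve_right h)
  rw [← Nat.card_congr (MonoidHom.ofInjective hinj).toEquiv]
  exact Nat.card_zmod p

lemma card_range_unipotentHom_zero (hν : ν * ν = 0) (h : ν = 0) :
    Nat.card (unipotentHom ν hν).range = 1 := by
  rw [Subgroup.card_eq_one, MonoidHom.range_eq_bot_iff]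
  refine MonoidHom.ext fun e => Units.ext ?_
  rw [unipotentHom_apply, h, smul_zero, add_zero]
  rfl

/-- The scalars in `GL(V)`. -/
def scalarHom (p : ℕ) [Fact p.Prime] (V : Type u) [AddCommGroup V] [Module (ZMod p) V] :
    (ZMod p)ˣ →* LinearMap.GeneralLinearGroup (ZMod p) V :=
  Units.map (algebraMap (ZMod p) (Module.End (ZMod p) V)).toMonoidHom

lemma scalarHom_apply (c : (ZMod p)ˣ) (v : V) :
    (scalarHom p V c : V →ₗ[ZMod p] V) v = (c : ZMod p) • v := rfl

end Unipotent

section Representations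

variable {V : Type u} [AddCommGroup V] [Module (ZMod p) V] [FiniteDimensional (ZMod p) V]
  {ρ : Representation (ZMod p) SL(2, ZMod p) V}

lemma asGroupHom_mul_eq_iff {g h : SL(2, ZMod p)} {γ : LinearMap.GeneralLinearGroup (ZMod p) V} :
    γ * ρ.asGroupHom g = ρ.asGroupHom h * γ ↔
      ∀ v : V, (γ : V →ₗ[ZMod p] V) (ρ g v) = ρ h ((γ : V →ₗ[ZMod p] V) v) := by
  rw [Units.ext_iff, LinearMap.ext_iff]
  rfl

lemma IsMinActIndec.exists_nilpotent (hp : 5 ≤ p) (h : IsMinActIndec p ρ) :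
    ∃ ν : Module.End (ZMod p) V, ν * ν = 0 ∧ (∀ g v, ν (ρ g v) = ρ g (ν v)) ∧
      (∀ φ : Module.End (ZMod p) V, (∀ g v, φ (ρ g v) = ρ g (φ v)) →
        ∃ c e : ZMod p, φ = c • (1 : Module.End (ZMod p) V) + e • ν) ∧
      (ν ≠ 0 ↔ HasNonscalarEndomorphism p (RepMod ρ)) := by
  obtain ⟨ν₀, h1, h2, h3⟩ := h.exists_endomorphism hp
  let E := RepMod.equiv ρ
  refine ⟨E.toLinearMap ∘ₗ (ν₀.restrictScalars (ZMod p)) ∘ₗ E.symm.toLinearMap, ?_, ?_, ?_, ?_⟩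
  · exact LinearMap.ext fun v => h1 (E.symm v)
  · intro g v
    change E (ν₀ (E.symm (ρ g v))) = ρ g (E (ν₀ (E.symm v)))
    rw [← RepMod.gr_smul_symm, map_smul, RepMod.equiv_gr_smul]
  · intro φ hφ
    obtain ⟨c, e, hce⟩ := h2 (equivariantMap (E.symm.toLinearMap ∘ₗ φ ∘ₗ E.toLinearMap) fun g m => by
      change E.symm (φ (E (gr g • m))) = gr g • E.symm (φ (E m))
      rw [RepMod.equiv_gr_smul, hφ, RepMod.gr_smul_symm])
    exact ⟨c, e, LinearMap.ext fun v => hce (E.symm v)⟩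
  · rw [← h3]
    constructor
    · intro h0
      by_contra! hh
      exact h0 (LinearMap.ext fun v => hh (E.symm v))
    · rintro ⟨m, hm⟩ h0
      exact hm (LinearMap.congr_fun h0 (E m))

lemma IsMinActIndec.exists_nil_smul_ne (h : IsMinActIndec p ρ) :
    ∃ m : RepMod ρ, (nil : GroupAlg p) • m ≠ 0 := by
  by_contra! h0
  have h1 : upper (1 : ZMod p) ∈ ρ.ker := by
    rw [← RepMod.gr_smul_eq_iff]
    intro m
    have := h0 m
    rwa [nil_smul_eq, sub_eq_zero] at this
  have h2 : upper (1 : ZMod p) ∈ Subgroup.center SL(2, ZMod p) := by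
    rcases h.2.2 with hk | hk
    · rw [hk, Subgroup.mem_bot] at h1; rw [h1]; exact one_mem _
    · rwa [hk] at h1
  have h3 := Subgroup.mem_center_iff.1 h2 (lower 1)
  have h4 := congrArg (fun g : SL(2, ZMod p) => g.1 0 0) h3
  simp [upper_coe, lower_coe, Matrix.mul_apply, Fin.sum_univ_two] at h4

/-- A twist of order prime to `p`. -/
lemma IsMinActIndec.exists_twist (hp : 5 ≤ p) (h : IsMinActIndec p ρ) (t : (ZMod p)ˣ) :
    ∃ γ : LinearMap.GeneralLinearGroup (ZMod p) V, γ ^ (p - 1) = 1 ∧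
      ∀ g, γ * ρ.asGroupHom g = ρ.asGroupHom (conjDiag t g) * γ := by
  obtain ⟨s, hs0, hs⟩ := exists_mem_fixU_inf_range h.exists_nil_smul_ne
  have hb := h.2.1.singleBlock
  obtain ⟨T, hT, hTs⟩ := exists_twist_fixing hb (h.isTwistInvariant hp t) hs0 hs
  obtain ⟨ν, hν, hνg, hφ, -⟩ := h.exists_nilpotent hp
  let E := RepMod.equiv ρ
  let T' : V ≃ₗ[ZMod p] V := E.symm.trans (T.trans E)
  let γ : LinearMap.GeneralLinearGroup (ZMod p) V :=
    (LinearMap.GeneralLinearGroup.generalLinearEquiv (ZMod p) V).symm T'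
  have hγ : ∀ g, γ * ρ.asGroupHom g = ρ.asGroupHom (conjDiag t g) * γ := fun g => by
    rw [asGroupHom_mul_eq_iff]
    intro v
    change E (T (E.symm (ρ g v))) = ρ _ (E (T (E.symm v)))
    rw [← RepMod.gr_smul_symm, hT, RepMod.equiv_gr_smul]
  have hγs : ∀ n : ℕ, ((γ ^ n : LinearMap.GeneralLinearGroup (ZMod p) V) : V →ₗ[ZMod p] V) (E s) = E s := by
    intro n
    induction n with
    | zero => rfl
    | succ n ih =>
      rw [pow_succ]
      change ((γ ^ n : LinearMap.GeneralLinearGroup (ZMod p) V) : V →ₗ[ZMod p] V)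
        (E (T (E.symm (E s)))) = _
      rw [LinearEquiv.symm_apply_apply, hTs, ih]
  -- This power is an endomorphism $c+e\nu$. Since it fixes $s$ and $\nu s=0$, $c=1$, so it has
  -- order dividing $p$.
  have hc : ∀ g, γ ^ (p - 1) * ρ.asGroupHom g = ρ.asGroupHom g * γ ^ (p - 1) := fun g => by
    rw [pow_mul_of_conjDiag hγ, ZMod.units_pow_card_sub_one_eq_one, conjDiag_one]
  obtain ⟨c, e, hce⟩ := hφ ((γ ^ (p - 1) : LinearMap.GeneralLinearGroup (ZMod p) V) : V →ₗ[ZMod p] V)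
    fun g => asGroupHom_mul_eq_iff.1 (hc g)
  have hνs : ν (E s) = 0 := by
    obtain ⟨c', hc'⟩ := eigenvalue_of_mem hb (equivariantMap (E.symm.toLinearMap ∘ₗ ν ∘ₗ E.toLinearMap)
      fun g m => by
        change E.symm (ν (E (gr g • m))) = gr g • E.symm (ν (E m))
        rw [RepMod.equiv_gr_smul, hνg, RepMod.gr_smul_symm]) hs0 hs
    have h1 : ν (E s) = c' • E s := hc'
    have h2 : c' • c' • E s = 0 := by
      rw [← h1, ← map_smul, ← h1]; exact LinearMap.congr_fun hν (E s)
    have h3 : E s ≠ 0 := E.map_ne_zero_iff.2 hs0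
    rw [smul_smul, smul_eq_zero, mul_self_eq_zero] at h2
    rw [h1, h2.resolve_right h3, zero_smul]
  have hc1 : c = 1 := by
    have h1 := LinearMap.congr_fun hce (E s)
    rw [hγs] at h1
    have h2 : E s = c • E s + e • ν (E s) := h1
    rw [hνs, smul_zero, add_zero] at h2
    have h3 : E s ≠ 0 := E.map_ne_zero_iff.2 hs0
    have h4 : (c - 1) • E s = 0 := by rw [sub_smul, one_smul, ← h2, sub_self]
    exact sub_eq_zero.1 ((smul_eq_zero.1 h4).resolve_right h3)
  have hu : γ ^ (p - 1) = unipotentHom ν hν (Multiplicative.ofAdd e) := by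
    apply Units.ext
    rw [hce, unipotentHom_apply, hc1, one_smul, toAdd_ofAdd]
  -- Passing to the $p$-th power removes the unipotent part and keeps the twist, because $t^p=t$.
  refine ⟨γ ^ p, ?_, fun g => ?_⟩
  · rw [← pow_mul, mul_comm, pow_mul, hu, unipotentHom_pow]
  · rw [pow_mul_of_conjDiag hγ, units_pow_eq_self]

/-- An invertible endomorphism $c+e\nu$ has $c\ne0$ and factors as the scalar $c$ times
$1+c^{-1}e\nu$, so the centralizer is the scalars times $P$. -/
theorem IsMinActIndec.exists_overgroupData (hp : 5 ≤ p) (h : IsMinActIndec p ρ) :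
    ∃ d : OvergroupData p (LinearMap.GeneralLinearGroup (ZMod p) V), d.R = ρ.asGroupHom ∧
      d.Z = scalarHom p V ∧ (HasNonscalarEndomorphism p (RepMod ρ) → Nat.card d.P = p) ∧
      (¬ HasNonscalarEndomorphism p (RepMod ρ) → Nat.card d.P = 1) := by
  obtain ⟨ν, hν, hνg, hφ, hne⟩ := h.exists_nilpotent hp
  obtain ⟨ζ, hζ⟩ := IsCyclic.exists_generator (α := (ZMod p)ˣ)
  obtain ⟨γ, hγ1, hγ⟩ := h.exists_twist hp ζ
  obtain ⟨D, hD⟩ := exists_hom_of_conjDiag hζ hγ1 hγ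
  have : Nontrivial V := h.indecomposable.1
  refine ⟨{ R := ρ.asGroupHom, Z := scalarHom p V, D := D, P := (unipotentHom ν hν).range
            ker_le := ?_, Z_injective := ?_, Z_comm := ?_, D_mul := hD, P_comm := ?_, P_pow := ?_
            centralizer := ?_ }, rfl, rfl, fun h1 => ?_, fun h1 => ?_⟩
  · have hk : ρ.asGroupHom.ker = ρ.ker := by
      ext g
      rw [MonoidHom.mem_ker, MonoidHom.mem_ker, Units.ext_iff, Representation.asGroupHom_apply]
      rfl
    rw [hk]
    rcases h.2.2 with hk | hk <;> rw [hk]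
    exact bot_le
  · intro c d hcd
    obtain ⟨v, hv⟩ := exists_ne (0 : V)
    have h1 : (c : ZMod p) • v = (d : ZMod p) • v :=
      LinearMap.congr_fun (congrArg Units.val hcd) v
    exact Units.ext (smul_left_injective _ hv h1)
  · intro c γ
    apply Units.ext
    refine LinearMap.ext fun v => ?_
    exact (map_smul (γ : V →ₗ[ZMod p] V) (c : ZMod p) v).symm
  · rintro _ ⟨e, rfl⟩ g
    rw [asGroupHom_mul_eq_iff]
    intro v
    rw [unipotentHom_apply]
    change ρ g v + e.toAdd • ν (ρ g v) = ρ g (v + e.toAdd • ν v)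
    rw [hνg, map_add, map_smul]
  · rintro _ ⟨e, rfl⟩
    exact unipotentHom_pow hν e
  · intro γ hγ
    obtain ⟨c, e, hce⟩ := hφ (γ : V →ₗ[ZMod p] V) fun g => asGroupHom_mul_eq_iff.1 (hγ g)
    have hc : c ≠ 0 := by
      rintro rfl
      rw [zero_smul, zero_add] at hce
      have h1 : IsUnit ((γ : V →ₗ[ZMod p] V) * (γ : V →ₗ[ZMod p] V)) := γ.isUnit.mul γ.isUnit
      rw [hce, smul_mul_smul_comm, hν, smul_zero] at h1
      have : Nontrivial (V →ₗ[ZMod p] V) := inferInstanceAs (Nontrivial (Module.End (ZMod p) V))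
      exact not_isUnit_zero h1
    refine ⟨Units.mk0 c hc, _, ⟨Multiplicative.ofAdd (c⁻¹ * e), rfl⟩, Units.ext ?_⟩
    rw [Units.val_mul, unipotentHom_apply, hce]
    refine LinearMap.ext fun v => ?_
    change c • v + e • ν v = c • (v + (c⁻¹ * e) • ν v)
    rw [smul_add, smul_smul, mul_inv_cancel_left₀ hc]
  · exact card_range_unipotentHom hν (hne.2 h1)
  · exact card_range_unipotentHom_zero hν (not_not.1 fun h2 => h1 (hne.1 h2))

end Representations

/-! ### The action of the normalizer of a Sylow subgroup on its fixed points -/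

/-- Conjugation of `SL_2(p)` by a matrix. -/
lemma exists_toGL_eq_conj (h : GL (Fin 2) (ZMod p)) (g : SL(2, ZMod p)) :
    ∃ g' : SL(2, ZMod p), toGL g' = h * toGL g * h⁻¹ :=
  ⟨slOfDet (h * toGL g * h⁻¹) (by simp [det_toGL]), toGL_slOfDet _ _⟩

section Modules

variable {M : Type u} [AddCommGroup M] [Module (ZMod p) M] [Module (GroupAlg p) M]
  [IsScalarTower (ZMod p) (GroupAlg p) M]

variable (p M) in
/-- The fixed vectors of the upper unitriangular group that are commutators. -/
def lineU : Submodule (ZMod p) M := fixU p M ⊓ LinearMap.range (act M (nil : GroupAlg p))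

lemma map_mem_lineU {N : Type v} [AddCommGroup N] [Module (ZMod p) N] [Module (GroupAlg p) N]
    [IsScalarTower (ZMod p) (GroupAlg p) N] (f : M →ₗ[GroupAlg p] N) {m : M} (h : m ∈ lineU p M) :
    f m ∈ lineU p N := by
  obtain ⟨h1, x, rfl⟩ := h
  exact ⟨map_mem_fixU f h1, f x, (map_smul f (nil : GroupAlg p) x).symm⟩

lemma eq_zero_of_mem_lineU (h1 : SingleBlock p M) [FiniteDimensional (ZMod p) M]
    {ν : M →ₗ[GroupAlg p] M} (hν : ∀ m, ν (ν m) = 0) {s : M} (hs : s ∈ lineU p M) : ν s = 0 := by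
  by_cases hs0 : s = 0
  · rw [hs0, map_zero]
  obtain ⟨c, hc⟩ := eigenvalue_of_mem h1 ν hs0 hs
  have h2 := hν s
  rw [hc, LinearMap.map_smul_of_tower, hc, smul_smul, smul_eq_zero, mul_self_eq_zero] at h2
  rw [hc, h2.resolve_right hs0, zero_smul]

lemma ev_eq_zero_of_mem_lineU {a : ℕ} {f : homFun p a} (hf : f ∈ lineU p (homFun p a)) :
    ev ![0, 1] (f : FunMod p) = 0 := by
  obtain ⟨-, z, rfl⟩ := hf
  have := congrArg (ev ![0, 1]) (nil_smul_eq (p := p) (z : FunMod p))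
  rw [map_sub, ev_upper_smul] at this
  refine this.trans ?_
  simp

lemma exists_nil_smul_homFun_ne {a : ℕ} (ha : 1 ≤ a) :
    ∃ f : homFun p a, (nil : GroupAlg p) • f ≠ 0 := by
  have hmem : mkFun (fun x => x 0 ^ (a - 1) * x 1) ∈ homFun p a := mem_homFun.2 fun c x => by
    rw [ev_mkFun, ev_mkFun, Pi.smul_apply, Pi.smul_apply, smul_eq_mul, smul_eq_mul, mul_pow,
      ← pow_sub_one_mul (show a ≠ 0 by omega) c]
    ring
  refine ⟨⟨_, hmem⟩, fun h => ?_⟩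
  have h1 := congrArg (fun f : homFun p a => ev ![1, 0] (f : FunMod p)) h
  simp only [Submodule.coe_smul, nil_smul_eq, map_sub, ev_upper_smul, Submodule.coe_zero,
    map_zero] at h1
  simp at h1

/-- Fixed functions vanishing at $(0,1)$ are multiples of $x_0^a$; since the space of fixed
commutators is nonzero, it is the line they span. -/
lemma mem_lineU_homFun {a : ℕ} (ha : 1 ≤ a) {f : homFun p a} :
    f ∈ lineU p (homFun p a) ↔ f ∈ fixU p (homFun p a) ∧ ev ![0, 1] (f : FunMod p) = 0 := by
  refine ⟨fun h => ⟨h.1, ev_eq_zero_of_mem_lineU h⟩, fun ⟨h1, h2⟩ => ?_⟩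
  obtain ⟨s, hs0, hs⟩ := exists_mem_fixU_inf_range (p := p) (M := homFun p a)
    (exists_nil_smul_homFun_ne ha)
  have h3 := eq_smul_evalMap s.2 (coe_mem_fixU.2 hs.1) (ev_eq_zero_of_mem_lineU hs)
  have h4 := eq_smul_evalMap f.2 (coe_mem_fixU.2 h1) h2
  have h5 : ev ![1, 0] (s : FunMod p) ≠ 0 := fun h => hs0 (Subtype.ext (by rw [h3, h, zero_smul]; rfl))
  have h6 : f = (ev ![1, 0] (f : FunMod p) * (ev ![1, 0] (s : FunMod p))⁻¹) • s := by
    apply Subtype.ext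
    refine h4.trans (Eq.trans ?_ (Submodule.coe_smul_of_tower _ _).symm)
    refine Eq.trans ?_ (congrArg (_ • ·) h3.symm)
    rw [smul_smul, inv_mul_cancel_right₀ h5]
  rw [h6]
  exact Submodule.smul_mem _ _ hs

lemma exists_mem_fixU_notMem_lineU {a : ℕ} (ha : 1 ≤ a) :
    ∃ t : homFun p a, t ∈ fixU p (homFun p a) ∧ ev ![0, 1] (t : FunMod p) = 1 := by
  refine ⟨⟨deltaFun p a, deltaFun_mem ha⟩, coe_mem_fixU.1 (mem_fixU_iff.2 fun c => fun_ext fun x => ?_), ?_⟩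
  · rw [ev_gr_smul]
    simp only [deltaFun, ev_mkFun, upper_coe, Matrix.vecMul, dotProduct, Fin.sum_univ_two]
    by_cases hx : x 0 = 0 <;> simp [hx]
  · simp [deltaFun]

/-- Nilpotent endomorphisms act trivially on the composition factors of the fixed points. -/
lemma ev_map_eq_zero_of_nilpotent {a : ℕ} (ha : 1 ≤ a) {ν : homFun p a →ₗ[GroupAlg p] homFun p a}
    [FiniteDimensional (ZMod p) (homFun p a)] (hν : ∀ m, ν (ν m) = 0) {f : homFun p a}
    (hf : f ∈ fixU p (homFun p a)) : ev ![0, 1] (ν f : FunMod p) = 0 := by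
  have hs : ∀ s ∈ lineU p (homFun p a), ν s = 0 := fun s hs =>
    eq_zero_of_mem_lineU (p := p) (M := homFun p a) (finrank_fixU_inf_range_homFun a) hν hs
  obtain ⟨t, ht, ht1⟩ := exists_mem_fixU_notMem_lineU (p := p) ha
  -- Since $\nu$ kills the line of fixed commutators, it factors through evaluation at $(0,1)$ on
  -- fixed points. Applied to $\nu t$, $\nu^2=0$ shows that $(\nu t)(0,1)$ squares to zero.
  have key : ∀ f ∈ fixU p (homFun p a), ν f = ev ![0, 1] (f : FunMod p) • ν t := by
    intro f hf
    have h1 : f - ev ![0, 1] (f : FunMod p) • t ∈ lineU p (homFun p a) := by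
      refine (mem_lineU_homFun ha).2 ⟨Submodule.sub_mem _ hf (Submodule.smul_mem _ _ ht), ?_⟩
      have : ((f - ev ![0, 1] (f : FunMod p) • t : homFun p a) : FunMod p) =
        (f : FunMod p) - ev ![0, 1] (f : FunMod p) • (t : FunMod p) := rfl
      rw [this, map_sub, map_smul, ht1, smul_eq_mul, mul_one, sub_self]
    have h2 := hs _ h1
    rwa [map_sub, LinearMap.map_smul_of_tower, sub_eq_zero] at h2
  have h3 := key (ν t) (map_mem_fixU ν ht)
  rw [hν] at h3
  have h4 := congrArg (fun f : homFun p a => ev ![0, 1] (f : FunMod p)) h3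
  have h5 : (0 : ZMod p) = ev ![0, 1] (ν t : FunMod p) * ev ![0, 1] (ν t : FunMod p) := by
    refine Eq.trans ?_ (h4.trans ?_)
    · exact (map_zero (ev ![0, 1])).symm
    · exact map_smul (ev ![0, 1]) _ (ν t : FunMod p)
  rw [key f hf]
  refine (map_smul (ev ![0, 1]) _ (ν t : FunMod p)).trans ?_
  rw [mul_self_eq_zero.1 h5.symm, smul_zero]

lemma diag_ne_zero {h : GL (Fin 2) (ZMod p)} (h10 : h.1 1 0 = 0) : h.1 0 0 ≠ 0 ∧ h.1 1 1 ≠ 0 := by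
  have h1 : h.1.det ≠ 0 := by
    rw [← Matrix.GeneralLinearGroup.val_det_apply]; exact Units.ne_zero _
  rw [Matrix.det_fin_two, h10, mul_zero, sub_zero] at h1
  exact ⟨left_ne_zero_of_mul h1, right_ne_zero_of_mul h1⟩

lemma conj_upper {h : GL (Fin 2) (ZMod p)} (h10 : h.1 1 0 = 0) (c : ZMod p) :
    toGL (upper (h.1 0 0 * (h.1 1 1)⁻¹ * c)) = h * toGL (upper c) * h⁻¹ := by
  obtain ⟨-, h11⟩ := diag_ne_zero h10
  rw [eq_mul_inv_iff_mul_eq]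
  apply Units.ext
  change (upper (h.1 0 0 * (h.1 1 1)⁻¹ * c)).1 * h.1 = h.1 * (upper c).1
  ext i j
  fin_cases i <;> fin_cases j <;>
    simp [upper_coe, Matrix.mul_apply, Fin.sum_univ_two, h10]
  field_simp
  ring

/-- $S$ and right translation by $h$ induce the same automorphism, so they differ by $c+e\nu$, and
$\nu$ is invisible on the factors of the fixed space. With diagonal entries $\alpha,\delta$ of $h$,
the scalars are $s=c\delta^a$ on the quotient, $c\alpha^a$ on the line, and $r=\alpha\delta^{-1}$ on
$U$; hence $c\alpha^a=sr^a$. -/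
lemma exists_scalars_homFun {a : ℕ} (hp : 5 ≤ p) (ha : 1 ≤ a) (ha' : a ≤ p - 2)
    {S : homFun p a ≃ₗ[ZMod p] homFun p a} {h : GL (Fin 2) (ZMod p)} (h10 : h.1 1 0 = 0)
    (hS : ∀ g g', toGL g' = h * toGL g * h⁻¹ → ∀ m, S (gr g • m) = gr g' • S m) :
    ∃ r s : (ZMod p)ˣ, (∀ c : ZMod p, toGL (upper ((r : ZMod p) * c)) = h * toGL (upper c) * h⁻¹) ∧
      (∀ z ∈ lineU p (homFun p a), S z = ((s * r ^ a : (ZMod p)ˣ) : ZMod p) • z) ∧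
      ∀ z ∈ fixU p (homFun p a), S z - (s : ZMod p) • z ∈ lineU p (homFun p a) := by
  have hfd : FiniteDimensional (ZMod p) (homFun p a) :=
    FiniteDimensional.of_finrank_pos (by rw [finrank_homFun ha]; omega)
  obtain ⟨h00, h11⟩ := diag_ne_zero h10
  obtain ⟨ν, hν, hφ, -⟩ := exists_endomorphism_of_pair (p := p) (M := homFun p a) (i := a + 1)
    (j := p - a) hp (by omega) (by omega) (by omega) (by omega) (by omega) (hasRadicalLayers_homFun ha ha')
  obtain ⟨c, e, hce⟩ := hφ (equivariantMap (S.trans (glTwist a h).symm).toLinearMap fun g m => by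
    obtain ⟨g', hg'⟩ := exists_toGL_eq_conj h g
    change (glTwist a h).symm (S (gr g • m)) = gr g • (glTwist a h).symm (S m)
    rw [LinearEquiv.symm_apply_eq, glTwist_gr_smul hg', LinearEquiv.apply_symm_apply, hS g g' hg'])
  have hSm : ∀ m, S m = c • glTwist a h m + e • glTwist a h (ν m) := by
    intro m
    have h1 : (glTwist a h).symm (S m) = c • m + e • ν m := hce m
    rw [LinearEquiv.symm_apply_eq, map_add, map_smul, map_smul] at h1
    exact h1
  have hc : c ≠ 0 := by
    rintro rfl
    obtain ⟨s, hs0, hs⟩ := exists_mem_fixU_inf_range (p := p) (M := homFun p a)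
      (exists_nil_smul_homFun_ne ha)
    have h1 := hSm s
    rw [eq_zero_of_mem_lineU (p := p) (M := homFun p a) (finrank_fixU_inf_range_homFun a) hν hs,
      map_zero, smul_zero, zero_smul, add_zero] at h1
    exact hs0 (S.map_eq_zero_iff.1 h1)
  have hS_fix : ∀ z ∈ fixU p (homFun p a), S z ∈ fixU p (homFun p a) := by
    intro z hz
    refine mem_fixU_iff.2 fun b => ?_
    have h1 := hS _ _ (conj_upper h10 (h.1 1 1 * (h.1 0 0)⁻¹ * b)) z
    rw [mem_fixU_iff.1 hz] at h1
    have h2 : h.1 0 0 * (h.1 1 1)⁻¹ * (h.1 1 1 * (h.1 0 0)⁻¹ * b) = b := by field_simp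
    rw [h2] at h1
    exact h1.symm
  have hevS : ∀ z x, ev x (S z : FunMod p) = c * ev (Matrix.vecMul x h.1) (z : FunMod p) +
      e * ev (Matrix.vecMul x h.1) (ν z : FunMod p) := fun z x => by rw [hSm]; rfl
  have hev : ∀ z ∈ fixU p (homFun p a), ev ![0, 1] (S z : FunMod p) =
      c * h.1 1 1 ^ a * ev ![0, 1] (z : FunMod p) := by
    intro z hz
    have h1 : Matrix.vecMul ![0, 1] h.1 = h.1 1 1 • ![0, 1] := by
      ext i; fin_cases i <;> simp [Matrix.vecMul, dotProduct, Fin.sum_univ_two, h10]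
    rw [hevS, h1, mem_homFun.1 z.2, mem_homFun.1 (ν z).2, ev_map_eq_zero_of_nilpotent ha hν hz]
    ring
  have hev' : ∀ z ∈ lineU p (homFun p a), ev ![1, 0] (S z : FunMod p) =
      c * h.1 0 0 ^ a * ev ![1, 0] (z : FunMod p) := by
    intro z hz
    have h1 : Matrix.vecMul ![1, 0] h.1 = ![h.1 0 0, h.1 0 1] := by
      ext i; fin_cases i <;> simp [Matrix.vecMul, dotProduct, Fin.sum_univ_two]
    have h2 : ev ![1, (h.1 0 0)⁻¹ * h.1 0 1] (z : FunMod p) = ev ![1, 0] (z : FunMod p) := by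
      have h3 := ev_upper_smul ((h.1 0 0)⁻¹ * h.1 0 1) (z : FunMod p) ![1, 0]
      rw [mem_fixU_iff.1 (coe_mem_fixU.2 hz.1)] at h3
      simpa using h3.symm
    have h4 : ν z = 0 :=
      eq_zero_of_mem_lineU (p := p) (M := homFun p a) (finrank_fixU_inf_range_homFun a) hν hz
    have h5 := ev_eq_pow_mul z.2 (x := ![h.1 0 0, h.1 0 1]) h00
    simp only [Matrix.cons_val_zero, Matrix.cons_val_one] at h5
    rw [hevS, h1, h4, Submodule.coe_zero, map_zero, mul_zero, add_zero, h5, h2, mul_assoc]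
  refine ⟨Units.mk0 _ h00 * (Units.mk0 _ h11)⁻¹, Units.mk0 c hc * Units.mk0 _ h11 ^ a, fun b => ?_,
    fun z hz => ?_, fun z hz => ?_⟩
  · rw [← conj_upper h10]
    simp
  · have h1 : S z ∈ lineU p (homFun p a) := (mem_lineU_homFun ha).2 ⟨hS_fix z hz.1, by
      rw [hev z hz.1, ev_eq_zero_of_mem_lineU hz, mul_zero]⟩
    have h2 := eq_smul_evalMap z.2 (coe_mem_fixU.2 hz.1) (ev_eq_zero_of_mem_lineU hz)
    have h3 := eq_smul_evalMap (S z).2 (coe_mem_fixU.2 h1.1) (ev_eq_zero_of_mem_lineU h1)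
    apply Subtype.ext
    refine h3.trans (Eq.trans ?_ (Submodule.coe_smul_of_tower _ _).symm)
    conv_rhs => rw [h2]
    rw [smul_smul, hev' z hz]
    congr 1
    simp only [Units.val_mul, Units.val_pow_eq_pow_val, Units.val_inv_eq_inv_val, Units.val_mk0,
      mul_pow, inv_pow]
    field_simp
  · refine (mem_lineU_homFun ha).2 ⟨Submodule.sub_mem _ (hS_fix z hz) (Submodule.smul_mem _ _ hz), ?_⟩
    have h1 : ∀ b : ZMod p, ((S z - b • z : homFun p a) : FunMod p) = (S z : FunMod p) - b • (z : FunMod p) :=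
      fun b => rfl
    rw [h1, map_sub, map_smul, hev z hz, smul_eq_mul, Units.val_mul, Units.val_pow_eq_pow_val,
      Units.val_mk0, Units.val_mk0, sub_self]

/-- Modules of type `V_j/V_i` of dimension `p + 1`: the action on the fixed points of a map
that induces the conjugation by an upper triangular matrix. -/
theorem HasRadicalLayers.exists_scalars (hp : 5 ≤ p) {i j : ℕ} (hi : 2 ≤ i) (hj : 2 ≤ j)
    (hij : i + j = p + 1) (hl : HasRadicalLayers p [j, i] M) {S : M ≃ₗ[ZMod p] M}
    {h : GL (Fin 2) (ZMod p)} (h10 : h.1 1 0 = 0)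
    (hS : ∀ g g', toGL g' = h * toGL g * h⁻¹ → ∀ m, S (gr g • m) = gr g' • S m) :
    ∃ r s : (ZMod p)ˣ, (∀ c : ZMod p, toGL (upper ((r : ZMod p) * c)) = h * toGL (upper c) * h⁻¹) ∧
      (∀ z ∈ lineU p M, S z = ((s * r ^ (i - 1) : (ZMod p)ˣ) : ZMod p) • z) ∧
      ∀ z ∈ fixU p M, S z - (s : ZMod p) • z ∈ lineU p M := by
  obtain ⟨e⟩ := hl.nonempty_equiv_homFun hi hj hij
  let e' := e.restrictScalars (ZMod p)
  obtain ⟨r, s, h1, h2, h3⟩ := exists_scalars_homFun hp (a := p - j) (by omega) (by omega)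
    (S := e'.trans (S.trans e'.symm)) h10 fun g g' hg m => by
      change e.symm (S (e (gr g • m))) = gr g' • e.symm (S (e m))
      rw [map_smul, hS g g' hg, map_smul]
  have hSe : ∀ m, S m = e ((e'.trans (S.trans e'.symm)) (e.symm m)) := fun m => by
    change _ = e (e.symm (S (e (e.symm m))))
    rw [e.apply_symm_apply, e.apply_symm_apply]
  refine ⟨r, s, h1, fun z hz => ?_, fun z hz => ?_⟩
  · have h4 := h2 (e.symm z) (map_mem_lineU e.symm.toLinearMap hz)
    rw [hSe, h4, show i - 1 = p - j by omega]
    exact (map_smul e' _ _).trans (congrArg _ (e.apply_symm_apply z))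
  · have h4 := map_mem_lineU e.toLinearMap (h3 (e.symm z) (map_mem_fixU e.symm.toLinearMap hz))
    have h5 : e ((e'.trans (S.trans e'.symm)) (e.symm z) - (s : ZMod p) • e.symm z) =
        S z - (s : ZMod p) • z := by
      rw [map_sub, ← hSe]
      congr 1
      exact (map_smul e' _ _).trans (congrArg _ (e.apply_symm_apply z))
    rw [← h5]
    exact h4

lemma HasRadicalLayers.exists_mem_fixU_notMem {i j : ℕ} (hi : 2 ≤ i) (hj : 2 ≤ j)
    (hij : i + j = p + 1) (hl : HasRadicalLayers p [j, i] M) :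
    ∃ z ∈ fixU p M, z ∉ lineU p M := by
  obtain ⟨e⟩ := hl.nonempty_equiv_homFun hi hj hij
  obtain ⟨t, ht, ht1⟩ := exists_mem_fixU_notMem_lineU (p := p) (a := p - j) (by omega)
  refine ⟨e t, map_mem_fixU e.toLinearMap ht, fun h => ?_⟩
  have h1 := map_mem_lineU e.symm.toLinearMap h
  have h2 := ev_eq_zero_of_mem_lineU h1
  rw [LinearEquiv.coe_coe, e.symm_apply_apply, ht1] at h2
  exact one_ne_zero h2

lemma finrank_lineU [FiniteDimensional (ZMod p) M] (h : SingleBlock p M)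
    (h0 : ∃ m : M, (nil : GroupAlg p) • m ≠ 0) : Module.finrank (ZMod p) (lineU p M) = 1 := by
  refine le_antisymm h ?_
  obtain ⟨s, hs0, hs⟩ := exists_mem_fixU_inf_range h0
  have : Nontrivial (lineU p M) := ⟨⟨s, hs⟩, 0, fun h => hs0 (congrArg Subtype.val h)⟩
  exact Module.finrank_pos

end Modules

/-! ### The homomorphism to the torus -/

namespace OvergroupData

variable {Γ : Type u} [Group Γ] (d : OvergroupData p Γ)

/-- Scalars and $P$ do not affect conjugation, so $n$ acts as some matrix $h$; preserving the image
of $U$ makes $h$ upper triangular. -/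
lemma exists_upperTriangular (hp : 2 < p) {n : Γ}
    (hn : n ∈ Subgroup.normalizer (d.R.range : Set Γ))
    (hU : ∃ c, n * d.R (upper 1) * n⁻¹ = d.R (upper c)) :
    ∃ h : GL (Fin 2) (ZMod p), h.1 1 0 = 0 ∧
      ∀ g g', toGL g' = h * toGL g * h⁻¹ → n * d.R g = d.R g' * n := by
  obtain ⟨_, ⟨⟨h, b⟩, rfl⟩, x, hx, rfl⟩ := d.exists_of_mem_normalizer hp hn
  have key : ∀ g g', toGL g' = h * toGL g * h⁻¹ →
      d.big (h, b) * x * d.R g = d.R g' * (d.big (h, b) * x) := by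
    intro g g' hg
    have h1 : d.sigma h * d.R g = d.R g' * d.sigma h := by
      rw [← sigma_toGL, ← sigma_toGL, hg, map_mul, map_mul, map_inv, inv_mul_cancel_right]
    rw [mul_assoc, d.P_comm x hx, ← mul_assoc, big_apply, mul_assoc (d.sigma h), d.Z_comm,
      ← mul_assoc, h1]
    simp only [mul_assoc]
  refine ⟨h, ?_, key⟩
  obtain ⟨c, hc⟩ := hU
  obtain ⟨g', hg'⟩ := exists_toGL_eq_conj h (upper 1)
  rw [key _ _ hg', mul_inv_cancel_right] at hc
  have h10 : g'.1 1 0 = 0 := by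
    rcases d.R_eq hc with h1 | h1 <;> rw [h1]
    · simp [upper_coe]
    · simp [upper_coe]
  rw [eq_mul_inv_iff_mul_eq] at hg'
  have h2 : g'.1 * h.1 = h.1 * (upper 1).1 := congrArg Units.val hg'
  have h3 := congrArg (fun y : Matrix (Fin 2) (Fin 2) (ZMod p) => y 1 0) h2
  have h4 := congrArg (fun y : Matrix (Fin 2) (Fin 2) (ZMod p) => y 1 1) h2
  simp [Matrix.mul_apply, Fin.sum_univ_two, upper_coe, h10] at h3 h4
  by_contra h5
  rw [mul_eq_right₀ h5] at h3
  rw [h3, one_mul] at h4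
  exact h5 (by simpa using h4)

end OvergroupData

section Representations

variable {V : Type u} [AddCommGroup V] [Module (ZMod p) V] [FiniteDimensional (ZMod p) V]
  {ρ : Representation (ZMod p) SL(2, ZMod p) V}
  {H : Subgroup (LinearMap.GeneralLinearGroup (ZMod p) V)} {U : Subgroup H}

lemma mem_fixedSubmodule_iff (hU : ∀ γ : H, γ ∈ U ↔ ∃ c, γ.1 = ρ.asGroupHom (upper c)) {v : V}
    (hρ : ρ.asGroupHom.range ≤ H) :
    v ∈ fixedSubmodule (tautRep H) U ↔ (RepMod.equiv ρ).symm v ∈ fixU p (RepMod ρ) := by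
  rw [mem_fixU_iff]
  constructor
  · intro h c
    have h1 := h ⟨⟨_, hρ ⟨upper c, rfl⟩⟩, (hU _).2 ⟨c, rfl⟩⟩
    rw [RepMod.gr_smul_symm]
    exact congrArg _ h1
  · rintro h ⟨w, hw⟩
    obtain ⟨c, hc⟩ := (hU w).1 hw
    have h1 := h c
    rw [RepMod.gr_smul_symm] at h1
    have h2 : ρ (upper c) v = v := (RepMod.equiv ρ).symm.injective h1
    change (w.1 : V →ₗ[ZMod p] V) v = v
    rw [hc]
    exact h2

lemma mem_zZero_iff (hU : ∀ γ : H, γ ∈ U ↔ ∃ c, γ.1 = ρ.asGroupHom (upper c)) {v : V}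
    (hρ : ρ.asGroupHom.range ≤ H) :
    v ∈ zZero (tautRep H) U ↔ (RepMod.equiv ρ).symm v ∈ lineU p (RepMod ρ) := by
  have hker : Representation.Coinvariants.ker ((tautRep H).comp U.subtype) =
      (LinearMap.range (act (RepMod ρ) (nil : GroupAlg p))).map (RepMod.equiv ρ).toLinearMap := by
    apply le_antisymm
    · refine Submodule.span_le.2 ?_
      rintro _ ⟨⟨⟨w, hw⟩, x⟩, rfl⟩
      obtain ⟨c, hc⟩ := (hU w).1 hw
      refine ⟨(gr (upper c) - 1) • (RepMod.equiv ρ).symm x,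
        range_act_upper_sub_one_le c ⟨_, rfl⟩, ?_⟩
      rw [sub_smul, one_smul, map_sub, RepMod.gr_smul_symm]
      change ρ (upper c) x - x = (w.1 : V →ₗ[ZMod p] V) x - x
      rw [hc]
      rfl
    · rintro _ ⟨_, ⟨m, rfl⟩, rfl⟩
      refine Representation.Coinvariants.mem_ker_of_eq (ρ := (tautRep H).comp U.subtype)
        ⟨⟨_, hρ ⟨upper 1, rfl⟩⟩, (hU _).2 ⟨1, rfl⟩⟩ (RepMod.equiv ρ m) _ ?_
      change ρ (upper 1) (RepMod.equiv ρ m) - RepMod.equiv ρ m = RepMod.equiv ρ ((nil : GroupAlg p) • m)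
      rw [nil_smul_eq, map_sub, RepMod.equiv_gr_smul]
  rw [zZero, Submodule.mem_inf, mem_fixedSubmodule_iff hU hρ, lineU, Submodule.mem_inf, hker,
    Submodule.mem_map]
  refine and_congr_right fun _ => ⟨?_, fun h => ⟨_, h, LinearEquiv.apply_symm_apply _ _⟩⟩
  rintro ⟨x, hx, rfl⟩
  exact hx

lemma finrank_zZero (hU : ∀ γ : H, γ ∈ U ↔ ∃ c, γ.1 = ρ.asGroupHom (upper c))
    (hρ : ρ.asGroupHom.range ≤ H) (h : IsMinActIndec p ρ) :
    Module.finrank (ZMod p) (zZero (tautRep H) U) = 1 := by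
  have h1 : zZero (tautRep H) U = (lineU p (RepMod ρ)).map (RepMod.equiv ρ).toLinearMap := by
    ext v
    rw [mem_zZero_iff hU hρ, Submodule.mem_map]
    exact ⟨fun h => ⟨_, h, LinearEquiv.apply_symm_apply _ _⟩, by rintro ⟨x, hx, rfl⟩; exact hx⟩
  rw [h1, LinearEquiv.finrank_map_eq, finrank_lineU h.2.1.singleBlock h.exists_nil_smul_ne]

/-- The action of the normalizer of the upper unitriangular group on the fixed points. -/
lemma exists_scalars (hp : 5 ≤ p)
    {d : OvergroupData p (LinearMap.GeneralLinearGroup (ZMod p) V)} (hd : d.R = ρ.asGroupHom)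
    (hU : ∀ γ : H, γ ∈ U ↔ ∃ c, γ.1 = ρ.asGroupHom (upper c))
    (hρ : ρ.asGroupHom.range ≤ H)
    (hH : H ≤ Subgroup.normalizer (ρ.asGroupHom.range : Set (LinearMap.GeneralLinearGroup (ZMod p) V)))
    {i j : ℕ} (hi : 2 ≤ i) (hj : 2 ≤ j) (hij : i + j = p + 1)
    (hl : HasRadicalLayers p [j, i] (RepMod ρ)) {γ : H} (hγ : γ ∈ Subgroup.normalizer (U : Set H)) :
    ∃ r s : (ZMod p)ˣ, (∀ c : ZMod p, γ.1 * ρ.asGroupHom (upper c) =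
        ρ.asGroupHom (upper ((r : ZMod p) * c)) * γ.1) ∧
      (∀ z ∈ zZero (tautRep H) U, tautRep H γ z = ((s * r ^ (i - 1) : (ZMod p)ˣ) : ZMod p) • z) ∧
      ∀ z ∈ fixedSubmodule (tautRep H) U, tautRep H γ z - (s : ZMod p) • z ∈ zZero (tautRep H) U := by
  have hex : ∃ c, γ.1 * d.R (upper 1) * γ.1⁻¹ = d.R (upper c) := by
    rw [hd]
    exact (hU _).1 ((Subgroup.mem_normalizer_iff.1 hγ ⟨_, hρ ⟨upper 1, rfl⟩⟩).1 ((hU _).2 ⟨1, rfl⟩))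
  obtain ⟨g, h10, hg⟩ := d.exists_upperTriangular (by omega) (hd ▸ hH γ.2) hex
  rw [hd] at hg
  let E := RepMod.equiv ρ
  let S : RepMod ρ ≃ₗ[ZMod p] RepMod ρ := E.trans
    ((LinearMap.GeneralLinearGroup.generalLinearEquiv (ZMod p) V γ.1).trans E.symm)
  obtain ⟨r, s, h1, h2, h3⟩ := hl.exists_scalars hp hi hj hij (S := S) h10 fun x x' hx m => by
    change E.symm ((γ.1 : V →ₗ[ZMod p] V) (E (gr x • m))) =
      gr x' • E.symm ((γ.1 : V →ₗ[ZMod p] V) (E m))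
    rw [RepMod.equiv_gr_smul, asGroupHom_mul_eq_iff.1 (hg x x' hx), RepMod.gr_smul_symm]
  refine ⟨r, s, fun c => hg _ _ (h1 c), fun z hz => ?_, fun z hz => ?_⟩
  · exact h2 (E.symm z) ((mem_zZero_iff hU hρ).1 hz)
  · exact (mem_zZero_iff hU hρ).2 (h3 (E.symm z) ((mem_fixedSubmodule_iff hU hρ).1 hz))

end Representations

lemma OvergroupData.R_upper_injective (hp : 2 < p) {Γ : Type u} [Group Γ] (d : OvergroupData p Γ) :
    Function.Injective fun c => d.R (upper c) := by
  intro b c h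
  rcases d.R_eq h with h1 | h1
  · exact upper_injective h1
  · have h2 := congrArg (fun g : SL(2, ZMod p) => g.1 0 0) h1
    simp [upper_coe] at h2
    exact absurd h2.symm (neg_one_zmod_ne_one hp)

section Representations

variable {V : Type u} [AddCommGroup V] [Module (ZMod p) V] [FiniteDimensional (ZMod p) V]
  {ρ : Representation (ZMod p) SL(2, ZMod p) V}
  {H : Subgroup (LinearMap.GeneralLinearGroup (ZMod p) V)} {U : Subgroup H}

/-- The existence and the image of the homomorphism to the torus, for the image of the upper
unitriangular group. -/
theorem exists_isMuMap (hp : 5 ≤ p) (h : IsMinActIndec p ρ)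
    {d : OvergroupData p (LinearMap.GeneralLinearGroup (ZMod p) V)} (hd : d.R = ρ.asGroupHom)
    (hdZ : d.Z = scalarHom p V) (hcard : Nat.card d.P = 1 ∨ Nat.card d.P = p)
    (hH : IsMaximalPrimeToExtension p ρ.asGroupHom.range H)
    (hU : ∀ γ : H, γ ∈ U ↔ ∃ c, γ.1 = ρ.asGroupHom (upper c))
    {i j : ℕ} (hi : 2 ≤ i) (hj : 2 ≤ j) (hij : i + j = p + 1)
    (hl : HasRadicalLayers p [j, i] (RepMod ρ)) :
    ∃ μ : gVee (tautRep H) U →* (ZMod p)ˣ × (ZMod p)ˣ,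
      IsMuMap (tautRep H) U μ ∧ μ.range = DeltaSubgroup p ((i : ℤ) - 1) := by
  have hfin : Finite V := Module.finite_of_finite (ZMod p)
  have hfin' : Finite (V →ₗ[ZMod p] V) := Module.finite_of_finite (ZMod p)
  have hinj : ∀ {b c : ZMod p}, ρ.asGroupHom (upper b) = ρ.asGroupHom (upper c) → b = c :=
    fun {b c} hbc => d.R_upper_injective (by omega) (by rw [hd]; exact hbc)
  have hscal := fun {γ : H} (hγ : γ ∈ Subgroup.normalizer (U : Set H)) =>
    exists_scalars hp hd hU hH.1.1 hH.1.2.1 hi hj hij hl hγ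
  obtain ⟨z₁, hz₁, hz₁'⟩ := hl.exists_mem_fixU_notMem hi hj hij
  replace hz₁ : RepMod.equiv ρ z₁ ∈ fixedSubmodule (tautRep H) U :=
    (mem_fixedSubmodule_iff hU hH.1.1).2 (by rwa [LinearEquiv.symm_apply_apply])
  replace hz₁' : RepMod.equiv ρ z₁ ∉ zZero (tautRep H) U := fun hc => hz₁' (by
    have := (mem_zZero_iff hU hH.1.1).1 hc
    rwa [LinearEquiv.symm_apply_apply] at this)
  have hex : ∀ γ : gVee (tautRep H) U, ∃ r : (ZMod p)ˣ,
      (∀ c : ZMod p, γ.1.1 * ρ.asGroupHom (upper c) =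
        ρ.asGroupHom (upper ((r : ZMod p) * c)) * γ.1.1) ∧
      ∀ z ∈ zZero (tautRep H) U, tautRep H γ z = ((r ^ (i - 1) : (ZMod p)ˣ) : ZMod p) • z := by
    intro γ
    obtain ⟨r, s, h1, h2, h3⟩ := hscal γ.2.1
    -- For a fixed $z\notin Z_0$, both $\gamma z-z$ and $\gamma z-sz$ lie in $Z_0$, hence so does
    -- $(s-1)z$.
    have hs : s = 1 := by
      by_contra hs
      have h4 := Submodule.sub_mem _ (γ.2.2 _ hz₁) (h3 _ hz₁)
      have h5 : (s : ZMod p) • RepMod.equiv ρ z₁ - RepMod.equiv ρ z₁ =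
        ((s : ZMod p) - 1) • RepMod.equiv ρ z₁ := by rw [sub_smul, one_smul]
      rw [sub_sub_sub_cancel_left, h5] at h4
      refine hz₁' ((Submodule.smul_mem_iff _ ?_).1 h4)
      exact sub_ne_zero.2 fun h => hs (Units.ext h)
    rw [hs] at h2
    exact ⟨r, h1, by simpa using h2⟩
  choose f hf1 hf2 using hex
  have hf : ∀ (γ : gVee (tautRep H) U) (r : ZMod p),
      γ.1.1 * ρ.asGroupHom (upper 1) = ρ.asGroupHom (upper r) * γ.1.1 → (f γ : ZMod p) = r := by
    intro γ r hr
    rw [hf1, mul_one] at hr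
    exact hinj (mul_right_cancel hr)
  let F : gVee (tautRep H) U →* (ZMod p)ˣ := MonoidHom.mk' f fun a b => by
    refine Units.ext (hf _ _ ?_)
    change a.1.1 * b.1.1 * _ = _ * (a.1.1 * b.1.1)
    rw [mul_assoc, hf1, ← mul_assoc, hf1, mul_one, mul_assoc, Units.val_mul]
  let ψ : (ZMod p)ˣ →* (ZMod p)ˣ × (ZMod p)ˣ :=
    (MonoidHom.id (ZMod p)ˣ).prod (zpowGroupHom ((i : ℤ) - 1))
  have hψ : ∀ r : (ZMod p)ˣ, ψ r = (r, r ^ (i - 1)) := fun r => by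
    refine Prod.ext rfl ?_
    change r ^ ((i : ℤ) - 1) = _
    rw [← zpow_natCast, Nat.cast_sub (by omega), Nat.cast_one]
  have hZ0 : ∃ z ∈ zZero (tautRep H) U, z ≠ 0 := by
    have : Nontrivial (zZero (tautRep H) U) := by
      apply Module.nontrivial_of_finrank_pos (R := ZMod p)
      rw [finrank_zZero hU hH.1.1 h]; exact one_pos
    obtain ⟨z, hz⟩ := exists_ne (0 : zZero (tautRep H) U)
    exact ⟨z, z.2, fun h => hz (Subtype.ext h)⟩
  refine ⟨ψ.comp F, fun γ r s => ?_, ?_⟩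
  · rw [MonoidHom.comp_apply, hψ, Prod.mk.injEq]
    change f γ = r ∧ f γ ^ (i - 1) = s ↔ _
    have hpow : ∀ c (r : (ZMod p)ˣ), ρ.asGroupHom (upper c) ^ (r : ZMod p).val =
        ρ.asGroupHom (upper ((r : ZMod p) * c)) := fun c r => by
      rw [← map_pow, upper_pow, ZMod.natCast_zmod_val]
    constructor
    · rintro ⟨rfl, rfl⟩
      refine ⟨fun w hw => ?_, hf2 γ⟩
      obtain ⟨c, hc⟩ := (hU w).1 hw
      apply Subtype.ext
      change γ.1.1 * w.1 * γ.1.1⁻¹ = w.1 ^ _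
      rw [hc, hpow, hf1, mul_inv_cancel_right]
    · rintro ⟨h1, h2⟩
      have h3 : f γ = r := by
        refine Units.ext (hf _ _ ?_)
        have h4 := congrArg Subtype.val (h1 ⟨_, hH.1.1 ⟨upper 1, rfl⟩⟩ ((hU _).2 ⟨1, rfl⟩))
        change γ.1.1 * ρ.asGroupHom (upper 1) * γ.1.1⁻¹ = ρ.asGroupHom (upper 1) ^ _ at h4
        rw [hpow, mul_one, mul_inv_eq_iff_eq_mul] at h4
        exact h4
      obtain ⟨z, hz, hz0⟩ := hZ0
      have h5 := (hf2 γ z hz).symm.trans (h2 z hz)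
      exact ⟨h3, Units.ext (smul_left_injective _ hz0 h5)⟩
  · rw [DeltaSubgroup, MonoidHom.range_comp, MonoidHom.range_eq_top.2, ← MonoidHom.range_eq_map]
    intro r
    have hH' : IsMaximalPrimeToExtension p d.R.range H := hd ▸ hH
    have hDn : d.D r ∈ Subgroup.normalizer (d.R.range : Set _) := by
      rw [← d.sigma_diagGL]
      exact d.range_big_le ⟨(diagGL p r, 1), by rw [d.big_apply, map_one, mul_one]⟩
    -- For surjectivity, the diagonal twist of parameter $r$ is moved into $\widehat G$ by dropping
    -- its $P$-component; a scalar factor $s^{-1}$ then makes it trivial on $Z/Z_0$.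
    obtain ⟨γ, hγ, x, hx, hDγ⟩ := d.exists_eq_mul (by omega) hcard hH' hDn
    have hγu : ∀ c, γ * ρ.asGroupHom (upper c) = ρ.asGroupHom (upper ((r : ZMod p) * c)) * γ := by
      intro c
      have h1 := d.D_mul r (upper c)
      rw [hDγ, mul_assoc, d.P_comm x hx, conjDiag_upper, ← mul_assoc, ← mul_assoc] at h1
      rw [← hd]
      exact mul_right_cancel h1
    have hγN : (⟨γ, hγ⟩ : H) ∈ Subgroup.normalizer (U : Set H) := by
      refine Subgroup.mem_normalizer_iff.2 fun w => ?_
      rw [hU, hU]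
      change (∃ c, w.1 = _) ↔ ∃ c, γ * w.1 * γ⁻¹ = _
      constructor
      · rintro ⟨c, hc⟩
        exact ⟨_, by rw [hc, hγu, mul_inv_cancel_right]⟩
      · rintro ⟨c, hc⟩
        refine ⟨(r⁻¹ : (ZMod p)ˣ) * c, mul_left_cancel (a := γ) ?_⟩
        rw [hγu, Units.mul_inv_cancel_left, ← hc, inv_mul_cancel_right]
    obtain ⟨r', s, -, -, h3⟩ := hscal hγN
    have hZ : d.Z s⁻¹ ∈ H := d.Z_mem (by omega) hcard hH' s⁻¹
    have hZN : (⟨d.Z s⁻¹, hZ⟩ : H) ∈ Subgroup.normalizer (U : Set H) := by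
      refine Subgroup.mem_normalizer_iff.2 fun w => ?_
      have : (⟨d.Z s⁻¹, hZ⟩ : H) * w * (⟨d.Z s⁻¹, hZ⟩ : H)⁻¹ = w := by
        apply Subtype.ext
        change d.Z s⁻¹ * w.1 * (d.Z s⁻¹)⁻¹ = w.1
        rw [d.Z_comm, mul_inv_cancel_right]
      rw [this]
    refine ⟨⟨⟨d.Z s⁻¹, hZ⟩ * ⟨γ, hγ⟩, mul_mem hZN hγN, fun z hz => ?_⟩, Units.ext (hf _ _ ?_)⟩
    · have h4 := Submodule.smul_mem _ ((s⁻¹ : (ZMod p)ˣ) : ZMod p) (h3 z hz)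
      rw [smul_sub, smul_smul, Units.inv_mul, one_smul] at h4
      have h5 : tautRep H (⟨d.Z s⁻¹, hZ⟩ * ⟨γ, hγ⟩) z =
          ((s⁻¹ : (ZMod p)ˣ) : ZMod p) • tautRep H ⟨γ, hγ⟩ z := by
        rw [map_mul, Module.End.mul_apply]
        change (d.Z s⁻¹ : V →ₗ[ZMod p] V) _ = _
        rw [hdZ, scalarHom_apply]
      rw [h5]
      exact h4
    · change d.Z s⁻¹ * γ * _ = _ * (d.Z s⁻¹ * γ)
      rw [mul_assoc, hγu, mul_one, d.Z_comm, d.Z_comm, mul_assoc]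

end Representations

/-! ### Sylow subgroups of the overgroup -/

lemma card_sl_dvd : Nat.card SL(2, ZMod p) ∣ p * ((p ^ 2 - 1) * (p - 1)) := by
  have h1 : Nat.card SL(2, ZMod p) ∣ Nat.card (GL (Fin 2) (ZMod p)) :=
    Subgroup.card_dvd_of_injective toGL toGL_injective
  rw [Matrix.card_GL_field, Fin.prod_univ_two] at h1
  simp only [Fin.val_zero, Fin.val_one, pow_zero, pow_one, ZMod.card] at h1
  have h2 : p ^ 2 - p = p * (p - 1) := by rw [Nat.mul_sub, mul_one, sq]
  rw [h2] at h1
  rwa [mul_left_comm] at h1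

/-- A group with a normal subgroup of index prime to `p` that is an image of `SL_2(p)`: the order
is not divisible by `p ^ 2`. -/
lemma not_sq_dvd_card {G : Type*} [Group G] {R : SL(2, ZMod p) →* G} {H : Subgroup G}
    (hR : R.range ≤ H) (hind : ¬ p ∣ R.range.relIndex H) : ¬ p ^ 2 ∣ Nat.card H := by
  have hp : p.Prime := Fact.out
  have hp1 := hp.two_le
  intro h
  rw [← Subgroup.card_mul_index (R.range.subgroupOf H),
    Nat.card_congr (Subgroup.subgroupOfEquivOfLe hR).toEquiv] at h
  have h1 : p ^ 2 ∣ Nat.card R.range :=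
    (Nat.Coprime.pow_left 2 ((Nat.Prime.coprime_iff_not_dvd hp).2 hind)).dvd_of_dvd_mul_right h
  have h2 := h1.trans ((Subgroup.card_range_dvd R).trans card_sl_dvd)
  rw [pow_two p, Nat.mul_dvd_mul_iff_left hp.pos, ← pow_two, hp.dvd_mul] at h2
  rcases h2 with h2 | h2
  · have h3 : p ∣ p ^ 2 - (p ^ 2 - 1) := Nat.dvd_sub (dvd_pow_self p two_ne_zero) h2
    rw [Nat.sub_sub_self (Nat.one_le_pow _ _ hp.pos)] at h3
    exact hp.one_lt.ne' (Nat.dvd_one.1 h3)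
  · exact absurd (Nat.le_of_dvd (by omega) h2) (by omega)

section Representations

variable {V : Type u} [AddCommGroup V] [Module (ZMod p) V] [FiniteDimensional (ZMod p) V]
  {ρ : Representation (ZMod p) SL(2, ZMod p) V}

lemma IsMinActIndec.congr {W : Type u} [AddCommGroup W] [Module (ZMod p) W]
    [FiniteDimensional (ZMod p) W] {σ : Representation (ZMod p) SL(2, ZMod p) W}
    (h : IsMinActIndec p ρ) (e : RepMod ρ ≃ₗ[GroupAlg p] RepMod σ) : IsMinActIndec p σ := by
  refine isMinActIndec_of_indecomposable (h.indecomposable.congr e) (h.2.1.singleBlock.congr e) ?_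
  have hk : σ.ker = ρ.ker := by
    ext g
    rw [← RepMod.gr_smul_eq_iff, ← RepMod.gr_smul_eq_iff]
    refine ⟨fun h m => e.injective (by rw [map_smul, h]), fun h m => ?_⟩
    obtain ⟨m, rfl⟩ := e.surjective m
    rw [← map_smul, h]
  rw [hk]
  rcases h.2.2 with hk | hk <;> rw [hk]
  exact bot_le

/-- The representation composed with an inner automorphism. -/
def conjRep (ρ : Representation (ZMod p) SL(2, ZMod p) V) (y : SL(2, ZMod p)) :
    Representation (ZMod p) SL(2, ZMod p) V := ρ.comp (MulAut.conj y).toMonoidHom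

lemma conjRep_asGroupHom (y g : SL(2, ZMod p)) :
    (conjRep ρ y).asGroupHom g = ρ.asGroupHom (y * g * y⁻¹) := Units.ext rfl

lemma range_conjRep (y : SL(2, ZMod p)) :
    (conjRep ρ y).asGroupHom.range = ρ.asGroupHom.range := by
  apply le_antisymm
  · rintro _ ⟨g, rfl⟩
    exact ⟨_, (conjRep_asGroupHom y g).symm⟩
  · rintro _ ⟨g, rfl⟩
    refine ⟨y⁻¹ * g * y, ?_⟩
    rw [conjRep_asGroupHom]
    congr 1
    group

lemma nonempty_equiv_conjRep (y : SL(2, ZMod p)) :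
    Nonempty (RepMod ρ ≃ₗ[GroupAlg p] RepMod (conjRep ρ y)) := by
  let E := RepMod.equiv ρ
  let E' := RepMod.equiv (conjRep ρ y)
  let T := E.trans ((LinearMap.GeneralLinearGroup.generalLinearEquiv (ZMod p) V
    (ρ.asGroupHom y)).trans E'.symm)
  have hT : ∀ (g : SL(2, ZMod p)) m, T (gr g • m) = gr g • T m := by
    intro g m
    change E'.symm (ρ y (E (gr g • m))) = gr g • E'.symm (ρ y (E m))
    rw [RepMod.equiv_gr_smul, RepMod.gr_smul_symm]
    change E'.symm (ρ y (ρ g (E m))) = E'.symm (ρ (y * g * y⁻¹) (ρ y (E m)))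
    rw [← Module.End.mul_apply, ← Module.End.mul_apply, ← map_mul, ← map_mul, inv_mul_cancel_right]
  exact ⟨LinearEquiv.ofBijective (equivariantMap T.toLinearMap hT) T.bijective⟩

/-- The Sylow subgroups of the overgroup are the conjugates of the image of the upper
unitriangular group. -/
lemma exists_mem_sylow_iff (hp : 5 ≤ p) {H : Subgroup (LinearMap.GeneralLinearGroup (ZMod p) V)}
    {d : OvergroupData p (LinearMap.GeneralLinearGroup (ZMod p) V)} (hd : d.R = ρ.asGroupHom)
    (hH : IsMaximalPrimeToExtension p ρ.asGroupHom.range H) (U : Sylow p H) :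
    ∃ y : SL(2, ZMod p), ∀ γ : H, γ ∈ (U : Subgroup H) ↔
      ∃ c, γ.1 = (conjRep ρ y).asGroupHom (upper c) := by
  have hfin : Finite V := Module.finite_of_finite (ZMod p)
  have hfin' : Finite (V →ₗ[ZMod p] V) := Module.finite_of_finite (ZMod p)
  let r : Multiplicative (ZMod p) →* H := MonoidHom.mk'
    (fun c => ⟨ρ.asGroupHom (upper c.toAdd), hH.1.1 ⟨_, rfl⟩⟩) fun a b => Subtype.ext (by
      change ρ.asGroupHom _ = ρ.asGroupHom _ * ρ.asGroupHom _
      rw [← map_mul, upper_mul, toAdd_mul])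
  have hr : Function.Injective r := fun a b hab => by
    have h1 := congrArg Subtype.val hab
    refine Multiplicative.toAdd.injective (d.R_upper_injective (by omega) ?_)
    simp only [hd]
    exact h1
  have hcard : Nat.card r.range = p := by
    rw [← Nat.card_congr (MonoidHom.ofInjective hr).toEquiv]
    exact Nat.card_zmod p
  -- The order of $\widehat G$ has exactly one factor $p$, so the image of $U$ is already a Sylow
  -- subgroup.
  have hfac : (Nat.card H).factorization p = 1 := by
    apply le_antisymm
    · by_contra! hc
      exact not_sq_dvd_card hH.1.1 hH.1.2.2
        (((Nat.Prime.pow_dvd_iff_le_factorization Fact.out Nat.card_pos.ne').2 hc))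
    · rw [← Nat.Prime.dvd_iff_one_le_factorization Fact.out Nat.card_pos.ne']
      exact hcard.symm.dvd.trans (Subgroup.card_subgroup_dvd_card r.range)
  let Q : Sylow p H := Sylow.ofCard r.range (by rw [hfac, pow_one, hcard])
  obtain ⟨n, hn⟩ := MulAction.exists_smul_eq H Q U
  -- In the conjugating element, scalars and $P$ act trivially and the diagonal factor only rescales
  -- the parameter of $U$, so an inner conjugation by $y\in\mathrm{SL}_2(p)$ remains.
  obtain ⟨_, ⟨⟨g, b⟩, rfl⟩, x, hx, hnx⟩ := d.exists_of_mem_normalizer (by omega) (hd ▸ hH.1.2.1 n.2)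
  obtain ⟨y, t, hy⟩ : ∃ y t, g = toGL y * diagGL p t :=
    ⟨slPart g, Matrix.GeneralLinearGroup.det g, by rw [toGL_slPart, inv_mul_cancel_right]⟩
  have hconj : ∀ c, n.1 * ρ.asGroupHom (upper c) * n.1⁻¹ =
      (conjRep ρ y).asGroupHom (upper ((t : ZMod p) * c)) := by
    intro c
    rw [mul_inv_eq_iff_eq_mul, conjRep_asGroupHom, ← hd, hnx, d.big_apply, hy, map_mul,
      d.sigma_toGL, d.sigma_diagGL, mul_assoc, d.P_comm x hx]
    simp only [mul_assoc]
    rw [← mul_assoc (d.Z b), d.Z_comm b, mul_assoc, ← mul_assoc (d.D t), d.D_mul, conjDiag_upper,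
      map_mul, map_mul, map_inv]
    simp only [mul_assoc, inv_mul_cancel_left]
  refine ⟨y, fun γ => ?_⟩
  rw [← hn]
  have h1 : γ ∈ ((n • Q : Sylow p H) : Subgroup H) ↔ n⁻¹ * γ * n ∈ r.range := by
    rw [Sylow.coe_subgroup_smul, Subgroup.mem_pointwise_smul_iff_inv_smul_mem]
    change (MulAut.conj n)⁻¹ γ ∈ r.range ↔ _
    rw [MulAut.conj_inv_apply]
  rw [h1]
  constructor
  · rintro ⟨c, hc⟩
    refine ⟨t * c.toAdd, ?_⟩
    rw [← hconj]
    have h2 : ρ.asGroupHom (upper c.toAdd) = n.1⁻¹ * γ.1 * n.1 := congrArg Subtype.val hc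
    rw [h2]
    group
  · rintro ⟨c, hc⟩
    refine ⟨Multiplicative.ofAdd ((t⁻¹ : (ZMod p)ˣ) * c), Subtype.ext ?_⟩
    change ρ.asGroupHom (upper ((t⁻¹ : (ZMod p)ˣ) * c)) = n.1⁻¹ * γ.1 * n.1
    rw [hc, ← Units.mul_inv_cancel_left t c, ← hconj, Units.mul_inv_cancel_left]
    group

/-- An arbitrary Sylow subgroup is the image of $U$ under $\rho$ composed with an inner
automorphism, which is isomorphic to $\rho$ and has the same image; so the standard position
suffices. -/
theorem finrank_zZero_and_exists_isMuMap (hp : 5 ≤ p) (h : IsMinActIndec p ρ)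
    {H : Subgroup (LinearMap.GeneralLinearGroup (ZMod p) V)}
    (hH : IsMaximalPrimeToExtension p ρ.asGroupHom.range H)
    {i j : ℕ} (hi : 2 ≤ i) (hj : 2 ≤ j) (hij : i + j = p + 1)
    (hl : HasRadicalLayers p [j, i] (RepMod ρ)) (U : Sylow p H) :
    Module.finrank (ZMod p) (zZero (tautRep H) (U : Subgroup H)) = 1 ∧
      ∃ μ : gVee (tautRep H) (U : Subgroup H) →* (ZMod p)ˣ × (ZMod p)ˣ,
        IsMuMap (tautRep H) (U : Subgroup H) μ ∧ μ.range = DeltaSubgroup p ((i : ℤ) - 1) := by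
  obtain ⟨d, hd, -, -⟩ := h.exists_overgroupData hp
  obtain ⟨y, hU⟩ := exists_mem_sylow_iff hp hd hH U
  obtain ⟨e⟩ := nonempty_equiv_conjRep (ρ := ρ) y
  have h' := h.congr e
  obtain ⟨d', hd', hdZ, h1, h2⟩ := h'.exists_overgroupData hp
  have hH' : IsMaximalPrimeToExtension p (conjRep ρ y).asGroupHom.range H := by
    rwa [range_conjRep]
  refine ⟨finrank_zZero hU hH'.1.1 h', exists_isMuMap hp h' hd' hdZ ?_ hH' hU hi hj hij (hl.congr e)⟩
  by_cases hc : HasNonscalarEndomorphism p (RepMod (conjRep ρ y))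
  · exact Or.inr (h1 hc)
  · exact Or.inl (h2 hc)

end Representations

/-! ### The structure of the overgroup -/

section Representations

variable {V : Type u} [AddCommGroup V] [Module (ZMod p) V] [FiniteDimensional (ZMod p) V]
  {ρ : Representation (ZMod p) SL(2, ZMod p) V}

theorem IsMinActIndec.classification_asModule (hp : 5 ≤ p) (h : IsMinActIndec p ρ) :
    (∃ i : ℕ, 2 ≤ i ∧ i ≤ p ∧ Nonempty (ρ.asModule ≃ₗ[GroupAlg p] VMod p i)) ∨
      (∃ i j : ℕ, 1 ≤ i ∧ 1 ≤ j ∧ i + j = p - 1 ∧ HasRadicalLayers p [j, i] ρ.asModule) ∨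
      HasRadicalLayers p [1, p - 2, 1] ρ.asModule ∨
      (∃ i j : ℕ, 2 ≤ i ∧ 2 ≤ j ∧ i + j = p + 1 ∧ HasRadicalLayers p [j, i] ρ.asModule) := by
  have e := RepMod.asModuleEquiv ρ
  rcases h.classification hp with ⟨i, hi, hi', ⟨f⟩⟩ | ⟨i, j, hi, hj, hij, hl⟩ | hl |
    ⟨i, j, hi, hj, hij, hl⟩
  · exact Or.inl ⟨i, hi, hi', ⟨e.trans f⟩⟩
  · exact Or.inr (Or.inl ⟨i, j, hi, hj, hij, hl.congr e.symm⟩)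
  · exact Or.inr (Or.inr (Or.inl (hl.congr e.symm)))
  · exact Or.inr (Or.inr (Or.inr ⟨i, j, hi, hj, hij, hl.congr e.symm⟩))

lemma HasNonscalarEndomorphism.congr {M : Type u} [AddCommGroup M] [Module (GroupAlg p) M]
    {N : Type v} [AddCommGroup N] [Module (GroupAlg p) N] (h : HasNonscalarEndomorphism p M)
    (e : M ≃ₗ[GroupAlg p] N) : HasNonscalarEndomorphism p N := by
  rcases h with ⟨i, hi, hl⟩ | hl
  · exact Or.inl ⟨i, hi, hl.congr e⟩
  · exact Or.inr (hl.congr e)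

variable {H : Subgroup (LinearMap.GeneralLinearGroup (ZMod p) V)}

lemma IsMinActIndec.exists_overgroupData_card (hp : 5 ≤ p) (h : IsMinActIndec p ρ) :
    ∃ d : OvergroupData p (LinearMap.GeneralLinearGroup (ZMod p) V), d.R = ρ.asGroupHom ∧
      d.Z = scalarHom p V ∧ (Nat.card d.P = 1 ∨ Nat.card d.P = p) ∧
      (HasNonscalarEndomorphism p ρ.asModule → Nat.card d.P = p) ∧
      (¬ HasNonscalarEndomorphism p ρ.asModule → Nat.card d.P = 1) := by
  obtain ⟨d, hd, hdZ, h1, h2⟩ := h.exists_overgroupData hp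
  have hiff : HasNonscalarEndomorphism p ρ.asModule ↔ HasNonscalarEndomorphism p (RepMod ρ) :=
    ⟨fun h => h.congr (RepMod.asModuleEquiv ρ), fun h => h.congr (RepMod.asModuleEquiv ρ).symm⟩
  rw [hiff]
  exact ⟨d, hd, hdZ, (em _).symm.imp h2 h1, h1, h2⟩

lemma finite_generalLinearGroup : Finite (LinearMap.GeneralLinearGroup (ZMod p) V) := by
  have : Finite V := Module.finite_of_finite (ZMod p)
  have : Finite (V →ₗ[ZMod p] V) := Module.finite_of_finite (ZMod p)
  exact inferInstanceAs (Finite (V →ₗ[ZMod p] V)ˣ)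

lemma IsMinActIndec.nonempty_overgroup_equiv_GL (hp : 5 ≤ p) (h : IsMinActIndec p ρ)
    (hH : IsMaximalPrimeToExtension p ρ.asGroupHom.range H) (hE : AllCompositionFactorDims ρ Even) :
    Nonempty (H ≃* GL (Fin 2) (ZMod p)) := by
  have := finite_generalLinearGroup (p := p) (V := V)
  obtain ⟨d, hd, hdZ, hc, -⟩ := h.exists_overgroupData_card hp
  obtain ⟨e⟩ := d.nonempty_equiv_range_big (by omega) hc (hd ▸ hH)
  obtain ⟨f⟩ := d.nonempty_range_big_equiv_GL (by omega) (by
    rw [hd, hdZ]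
    rcases h.parity (by omega) with ⟨-, -, -, h1⟩ | ⟨-, h1, -⟩
    · refine Units.ext (LinearMap.ext fun v => ?_)
      have h2 := h1 ((RepMod.equiv ρ).symm v)
      rw [RepMod.gr_smul_symm, ← map_neg] at h2
      rw [scalarHom_apply, Units.val_neg, Units.val_one, neg_one_smul]
      exact (RepMod.equiv ρ).symm.injective h2
    · exact absurd hE h1)
  exact ⟨e.trans f⟩

lemma IsMinActIndec.nonempty_overgroup_equiv_PGL (hp : 5 ≤ p) (h : IsMinActIndec p ρ)
    (hH : IsMaximalPrimeToExtension p ρ.asGroupHom.range H) (hO : AllCompositionFactorDims ρ Odd) :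
    Nonempty (H ≃* PGL(2, ZMod p) × Multiplicative (ZMod (p - 1))) := by
  have := finite_generalLinearGroup (p := p) (V := V)
  obtain ⟨d, hd, -, hc, -⟩ := h.exists_overgroupData_card hp
  obtain ⟨e⟩ := d.nonempty_equiv_range_big (by omega) hc (hd ▸ hH)
  obtain ⟨f⟩ := d.nonempty_range_big_equiv_PGL (by omega) (by
    rw [hd]
    rcases h.parity (by omega) with ⟨-, h1, -⟩ | ⟨-, -, h1, -⟩
    · exact absurd hO h1
    · have h2 : (-1 : SL(2, ZMod p)) ∈ ρ.ker := h1 ▸ neg_one_mem_center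
      exact Units.ext h2)
  exact ⟨e.trans f⟩

lemma IsMinActIndec.relIndex_overgroup (hp : 5 ≤ p) (h : IsMinActIndec p ρ)
    (hH : IsMaximalPrimeToExtension p ρ.asGroupHom.range H)
    (hn : HasNonscalarEndomorphism p ρ.asModule) : H.relIndex (Subgroup.normalizer
      (ρ.asGroupHom.range : Set (LinearMap.GeneralLinearGroup (ZMod p) V))) = p := by
  have := finite_generalLinearGroup (p := p) (V := V)
  obtain ⟨d, hd, -, hc, h1, -⟩ := h.exists_overgroupData_card hp
  rw [← hd] at hH ⊢
  exact (d.relIndex_eq_and_isComplement' (by omega) hc hH).1.trans (h1 hn)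

lemma IsMinActIndec.overgroup_eq_normalizer (hp : 5 ≤ p) (h : IsMinActIndec p ρ)
    (hH : IsMaximalPrimeToExtension p ρ.asGroupHom.range H)
    (hn : ¬ HasNonscalarEndomorphism p ρ.asModule) : H = Subgroup.normalizer
      (ρ.asGroupHom.range : Set (LinearMap.GeneralLinearGroup (ZMod p) V)) := by
  have := finite_generalLinearGroup (p := p) (V := V)
  obtain ⟨d, hd, -, hc, -, h1⟩ := h.exists_overgroupData_card hp
  rw [← hd] at hH ⊢
  exact le_antisymm hH.1.2.1 (Subgroup.relIndex_eq_one.1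
    ((d.relIndex_eq_and_isComplement' (by omega) hc hH).1.trans (h1 hn)))

end Representations

end

/-! ### The theorem. -/

theorem proposition4p2 (p : ℕ) [Fact p.Prime] (hp : 5 ≤ p) :
    -- (a) the simple modules
    (Nonempty (VMod p 1 ≃ₗ[GroupAlg p]
        (Representation.trivial (ZMod p) SL(2, ZMod p) (ZMod p)).asModule) ∧
      Nonempty (VMod p 2 ≃ₗ[GroupAlg p] (naturalRep (ZMod p)).asModule) ∧
      (∀ i : ℕ, 1 ≤ i → i ≤ p →
        IsSimpleModule (GroupAlg p) (VMod p i) ∧ Module.finrank (ZMod p) (VMod p i) = i) ∧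
      (∀ (V : Type u) [AddCommGroup V] [Module (ZMod p) V]
        (ρ : Representation (ZMod p) SL(2, ZMod p) V),
        IsSimpleModule (GroupAlg p) ρ.asModule →
          ∃ i : ℕ, 1 ≤ i ∧ i ≤ p ∧ Nonempty (ρ.asModule ≃ₗ[GroupAlg p] VMod p i)) ∧
      (∀ i : ℕ, 2 ≤ i → i ≤ p → IsMinActIndec p (symPowRep (ZMod p) (i - 1)))) ∧
    -- (b) the modules of type V_j/V_i of dimension p - 1
    (∀ i j : ℕ, 1 ≤ i → i ≤ p - 2 → 1 ≤ j → j ≤ p - 2 → i + j = p - 1 →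
      ∃ (W : Type u) (_ : AddCommGroup W) (_ : Module (ZMod p) W)
        (σ : Representation (ZMod p) SL(2, ZMod p) W),
        IsMinActIndec p σ ∧ Module.finrank (ZMod p) W = p - 1 ∧
        HasRadicalLayers p [j, i] σ.asModule ∧
        ∀ (V : Type u) [AddCommGroup V] [Module (ZMod p) V]
          (ρ : Representation (ZMod p) SL(2, ZMod p) V), HasRadicalLayers p [j, i] ρ.asModule →
          Nonempty (ρ.asModule ≃ₗ[GroupAlg p] σ.asModule)) ∧
    -- (c) the projective cover of the trivial module, of type V_1/V_{p-2}/V_1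
    (∃ (W : Type u) (_ : AddCommGroup W) (_ : Module (ZMod p) W)
        (σ : Representation (ZMod p) SL(2, ZMod p) W),
        IsMinActIndec p σ ∧ Module.finrank (ZMod p) W = p ∧
        HasRadicalLayers p [1, p - 2, 1] σ.asModule ∧
        Module.Projective (GroupAlg p) σ.asModule ∧
        ∀ (V : Type u) [AddCommGroup V] [Module (ZMod p) V]
          (ρ : Representation (ZMod p) SL(2, ZMod p) V),
          HasRadicalLayers p [1, p - 2, 1] ρ.asModule →
          Nonempty (ρ.asModule ≃ₗ[GroupAlg p] σ.asModule)) ∧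
    -- (d) the modules of type V_j/V_i of dimension p + 1
    (∀ i j : ℕ, 2 ≤ i → i ≤ p - 1 → 2 ≤ j → j ≤ p - 1 → i + j = p + 1 →
      ∃ (W : Type u) (_ : AddCommGroup W) (_ : Module (ZMod p) W)
        (σ : Representation (ZMod p) SL(2, ZMod p) W),
        IsMinActIndec p σ ∧ Module.finrank (ZMod p) W = p + 1 ∧
        HasRadicalLayers p [j, i] σ.asModule ∧
        ∀ (V : Type u) [AddCommGroup V] [Module (ZMod p) V]
          (ρ : Representation (ZMod p) SL(2, ZMod p) V), HasRadicalLayers p [j, i] ρ.asModule →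
          Nonempty (ρ.asModule ≃ₗ[GroupAlg p] σ.asModule)) ∧
    -- the statements about an arbitrary indecomposable minimally active module V
    (∀ (V : Type u) [AddCommGroup V] [Module (ZMod p) V] [FiniteDimensional (ZMod p) V]
      (ρ : Representation (ZMod p) SL(2, ZMod p) V), IsMinActIndec p ρ →
      -- V is one of the modules in (a), (b), (c), (d)
      ((∃ i : ℕ, 2 ≤ i ∧ i ≤ p ∧ Nonempty (ρ.asModule ≃ₗ[GroupAlg p] VMod p i)) ∨
        (∃ i j : ℕ, 1 ≤ i ∧ 1 ≤ j ∧ i + j = p - 1 ∧ HasRadicalLayers p [j, i] ρ.asModule) ∨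
        HasRadicalLayers p [1, p - 2, 1] ρ.asModule ∨
        (∃ i j : ℕ, 2 ≤ i ∧ 2 ≤ j ∧ i + j = p + 1 ∧ HasRadicalLayers p [j, i] ρ.asModule)) ∧
      -- the composition factors are all even dimensional or all odd dimensional, and this decides
      -- which group acts faithfully
      (AllCompositionFactorDims ρ Even ∨ AllCompositionFactorDims ρ Odd) ∧
      (AllCompositionFactorDims ρ Even → ρ.ker = ⊥) ∧
      (AllCompositionFactorDims ρ Odd → ρ.ker = Subgroup.center SL(2, ZMod p)) ∧
      -- the group Ĝ
      (∀ Ghat : Subgroup (LinearMap.GeneralLinearGroup (ZMod p) V),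
        IsMaximalPrimeToExtension p ρ.asGroupHom.range Ghat →
        (AllCompositionFactorDims ρ Even → Nonempty (Ghat ≃* GL (Fin 2) (ZMod p))) ∧
        (AllCompositionFactorDims ρ Odd →
          Nonempty (Ghat ≃* PGL(2, ZMod p) × Multiplicative (ZMod (p - 1)))) ∧
        (((∃ i : ℕ, (2 * i = p - 1 ∨ 2 * i = p + 1) ∧ HasRadicalLayers p [i, i] ρ.asModule) ∨
            HasRadicalLayers p [1, p - 2, 1] ρ.asModule) →
          Ghat.relIndex (Subgroup.normalizer
            (ρ.asGroupHom.range : Set (LinearMap.GeneralLinearGroup (ZMod p) V))) = p) ∧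
        (¬ ((∃ i : ℕ, (2 * i = p - 1 ∨ 2 * i = p + 1) ∧ HasRadicalLayers p [i, i] ρ.asModule) ∨
            HasRadicalLayers p [1, p - 2, 1] ρ.asModule) →
          Ghat = Subgroup.normalizer
            (ρ.asGroupHom.range : Set (LinearMap.GeneralLinearGroup (ZMod p) V))) ∧
        -- the image of μ_V when V is of type V_j/V_i of dimension p + 1
        (∀ i j : ℕ, 2 ≤ i → 2 ≤ j → i + j = p + 1 → HasRadicalLayers p [j, i] ρ.asModule →
          ∀ U : Sylow p Ghat,
            Module.finrank (ZMod p) (zZero (tautRep Ghat) (U : Subgroup Ghat)) = 1 ∧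
            ∃ μ : gVee (tautRep Ghat) (U : Subgroup Ghat) →* (ZMod p)ˣ × (ZMod p)ˣ,
              IsMuMap (tautRep Ghat) (U : Subgroup Ghat) μ ∧
              μ.range = DeltaSubgroup p ((i : ℤ) - 1)))) := by
  refine ⟨⟨nonempty_vmod_one_equiv, nonempty_vmod_two_equiv, fun i hi hi' =>
    ⟨isSimpleModule_vmod (by omega), finrank_vmod hi hi'⟩, fun V _ _ ρ h => exists_equiv_vmod h,
    fun i hi hi' => isMinActIndec_symPowRep hi hi'⟩,
    fun i j hi _ hj _ hij => existsUnique_add_eq_sub_one hp hi hj hij,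
    existsUnique_projectiveCover hp,
    fun i j hi _ hj _ hij => existsUnique_add_eq_add_one hi hj hij,
    fun V _ _ _ ρ h => ⟨h.classification_asModule hp, ?_⟩⟩
  -- The two parity conditions exclude each other because a composition factor exists, so the claims
  -- for the other parity are vacuous.
  rcases h.parity (by omega) with ⟨h1, h2, h3, -⟩ | ⟨h1, h2, h3, -⟩
  · exact ⟨Or.inl h1, fun _ => h3, fun h' => absurd h' h2, fun H hH => ⟨fun hE =>
      h.nonempty_overgroup_equiv_GL hp hH hE, fun h' => absurd h' h2,
      fun hn => h.relIndex_overgroup hp hH hn, fun hn => h.overgroup_eq_normalizer hp hH hn,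
      fun i j hi hj hij hl U => finrank_zZero_and_exists_isMuMap hp h hH hi hj hij
        (hl.congr (RepMod.asModuleEquiv ρ)) U⟩⟩
  · exact ⟨Or.inr h1, fun h' => absurd h' h2, fun _ => h3, fun H hH => ⟨fun h' => absurd h' h2,
      fun hO => h.nonempty_overgroup_equiv_PGL hp hH hO,
      fun hn => h.relIndex_overgroup hp hH hn, fun hn => h.overgroup_eq_normalizer hp hH hn,
      fun i j hi hj hij hl U => finrank_zZero_and_exists_isMuMap hp h hH hi hj hij
        (hl.congr (RepMod.asModuleEquiv ρ)) U⟩⟩
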